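/- **Setting.** Let $\Gamma=\mathbb R^2/(L_1\mathbb Z\times L_2\mathbb Z)$, $L_1,L_2>0$, be a flat two-dimensional torus, and let $\gamma>3$, $\mu>0$, $\lambda\ge 0$. Put $\mathbb S(\nabla u)=\mu(\nabla u+\nabla^{\tau}u-\tfrac23(\nabla\cdot u)\mathbb I)+\lambda(\nabla\cdot u)\mathbb I$. For $h:\Gamma\to[0,\infty)$ let $\Omega^{h}=\{(x,y,z):(x,y)\in\Gamma,\ 0<z<h(x,y)\}$; for $\eta=\eta(t,x,y)$ put $\Omega^\eta(t)=\Omega^{\eta(t)}$, $Q_t^\eta=\bigcup_{s\in(0,t)}\{s\}\times\Omega^\eta(s)$, $G_t=(0,t)\times\Gamma$. Functions in $H^2(\Gamma)$ are identified with their continuous representatives, and $\eta$ with its representative continuous on $[0,T]\times\Gamma$. For continuous $h\in H^2(\Gamma)$ with $h>0$ a.e., $H^1_{0z}(\Omega^{h})$ is the set of $f\in H^1(\Omega^{h})$ whose trace on $O\times\{0\}$ vanishes for every closed $O\subset\{h>0\}$; the Lagrangian trace $\gamma_{|\Gamma^h}f$ of such an $f$ is the trace on the graph of $h$ of its extension by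 zero to $\{-1<z<h\}$, that is, the continuous extension of $g\mapsto g(\cdot,h(\cdot))$ from $C^1$ functions. **Initial data** $(\eta_0,v_0,\rho_0,(\rho u)_0)$ are admissible if $\eta_0\in H^2(\Gamma)$, $\eta_0>0$ a.e., $\ln\eta_0\in L^1(\Gamma)$, $v_0\in L^2(\Gamma)$, $0\le\rho_0\in L^\gamma(\Omega^{\eta_0})$, $(\rho u)_0\in L^{2\gamma/(\gamma+1)}(\Omega^{\eta_0})$, $|(\rho u)_0|^2/\rho_0\in L^1(\Omega^{\eta_0})$, $\rho_0>0$ wherever $(\rho u)_0\neq0$, and $m:=\int_{\Omega^{\eta_0}}\rho_0>0$. **Weak solutions.** Given $T>0$ and an outer force $F$ on $G_T$, a weak solution on $(0,T)$ is a triple $(\rho,u,\eta)$, $\rho\ge0$, with $\eta(0)=\eta_0$, such that: 1. for all $t\in[0,T]$, $\int_{\Omega^\eta(t)}\rho(t)=m$ and $\eta(t)>0$ a.e. on $\Gamma$; moreover $\rho\in L^\infty(0,T;L^\gamma(\Omega^\eta(t)))$, $u\in L^2(0,T;H^1_{0z}(\Omega^\eta(t)))$, $\rho|u|^2\in L^\infty(0,T;L^1(\Omega^\eta(t)))$,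 $\rho^\gamma/\eta,\ \rho|u_3|^2/\eta\in L^1(Q^\eta_T)$, $\eta\in W^{1,\infty}(0,T;L^2(\Gamma))\cap L^\infty(0,T;H^2(\Gamma))$, $\ln\eta\in C([0,T];L^1(\Gamma))$; 2. $\gamma_{|\Gamma^\eta}u=\partial_t\eta\,e_z$ a.e. on $G_T$; 3. $\int_{Q_T^\eta}\rho B(\rho)(\partial_t\varphi+u\cdot\nabla\varphi)=\int_{Q_T^\eta}b(\rho)(\nabla\cdot u)\varphi-\int_{\Omega^{\eta_0}}\rho_0B(\rho_0)\varphi(0)$ for all $\varphi\in C_c^\infty([0,T)\times\Gamma\times\mathbb R)$, all bounded $b\in C[0,\infty)$ with $b(0)=0$, and every primitive $B$ of $b(\rho)/\rho^2$ on $(0,\infty)$; 4. for all $\varphi\in C_c^\infty([0,T)\times\Gamma\times\mathbb R;\mathbb R^3)$ and $\psi\in C_c^\infty([0,T)\times\Gamma)$ with $\varphi(t,x,y,\eta(t,x,y))=\psi(t,x,y)e_z$ on $G_T$ and $\varphi=0$ on $\{z=0\}$, $$\int_{Q_T^\eta}\rho u\cdot\partial_t\varphi+\int_{Q_T^\eta}\rho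 u\otimes u:\nabla\varphi+\int_{Q_T^\eta}\rho^\gamma\nabla\cdot\varphi-\int_{Q_T^\eta}\mathbb S(\nabla u):\nabla\varphi+\int_{G_T}\partial_t\eta\,\partial_t\psi-\int_{G_T}\Delta\eta\,\Delta\psi+\int_{G_T}F\psi=-\int_{\Omega^{\eta_0}}(\rho u)_0\cdot\varphi(0)-\int_\Gamma v_0\psi(0);$$ 5. (contact inequality) for a.a. $t\in(0,T)$ $$\int_{G_t}F+\int_{Q_t^\eta}\frac{\rho^\gamma}{\eta}+\int_{Q_t^\eta}\frac{\rho|u_3|^2}{\eta}-\Big(\frac{4\mu}3+\lambda\Big)\int_\Gamma\ln\eta(t)\le\int_{Q_t^\eta}\rho u_3z\frac{\partial_t\eta}{\eta^2}+\int_{Q_t^\eta}\rho u_1u_3\frac{z\partial_x\eta}{\eta^2}+\int_{Q_t^\eta}\rho u_2u_3\frac{z\partial_y\eta}{\eta^2}$$ $$-\mu\int_{Q_t^\eta}(\partial_zu_1+\partial_xu_3)\frac{z\partial_x\eta}{\eta^2}-\mu\int_{Q_t^\eta}(\partial_zu_2+\partial_yu_3)\frac{z\partial_y\eta}{\eta^2}+\Big(\lambda-\frac{2\mu}3\Big)\int_{Q_t^\eta}\Big(u_1\frac{\partial_x\eta}{\eta^2}+u_2\frac{\partial_y\eta}{\eta^2}\Big)$$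 $$-\Big(\frac{4\mu}3+\lambda\Big)\int_\Gamma\ln\eta_0+\int_{\Omega^\eta(t)}\rho(t)u_3(t)\frac{z}{\eta(t)}-\int_{\Omega^{\eta_0}}(\rho u_3)_0\frac{z}{\eta_0}+\int_\Gamma\partial_t\eta(t)-\int_\Gamma v_0;$$ 6. (energy inequality) for a.a. $t\in(0,T)$ $$\int_{\Omega^\eta(t)}\Big(\frac12\rho|u|^2+\frac{\rho^\gamma}{\gamma-1}\Big)(t)+\int_\Gamma\Big(\frac12|\partial_t\eta|^2+\frac12|\Delta\eta|^2\Big)(t)+\int_{Q_t^\eta}\mathbb S(\nabla u):\nabla u\le\int_{\Omega^{\eta_0}}\Big(\frac{|(\rho u)_0|^2}{2\rho_0}+\frac{\rho_0^\gamma}{\gamma-1}\Big)+\int_\Gamma\Big(\frac12|v_0|^2+\frac12|\Delta\eta_0|^2\Big)+\int_{G_t}F\,\partial_t\eta.$$ **Theorem 3.** Let admissible initial data satisfy $\eta_0(x_0,y_0)=0$ for some $(x_0,y_0)\in\Gamma$. Then for every $T>0$ and every $r>0$ there is a bounded time-independent force $F\in L^1(\Gamma)$, $F\ge0$, vanishing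 outside the ball of radius $r$ around $(x_0,y_0)$, such that every weak solution $(\rho,u,\eta)$ on $(0,T)$ with these initial data and force $F$ satisfies $\eta(t,x_0,y_0)>0$ for some $t\in(0,T)$. -/

import Mathlib

open MeasureTheory Set Filter Topology
open scoped ContDiff

noncomputable section

namespace FluidPlate

/-! ### The torus and differentiation -/

/-- The flat two-dimensional torus `Γ` with periods `L₁, L₂`. -/
abbrev Torus (L₁ L₂ : ℝ) : Type := AddCircle L₁ × AddCircle L₂

/-- The space `Γ × ℝ` containing all fluid domains; a point is `((x, y), z)`. -/
abbrev Space (L₁ L₂ : ℝ) : Type := Torus L₁ L₂ × ℝ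

variable {L₁ L₂ : ℝ}

/-- Translation of the torus by `s` in the `i`-th coordinate direction. -/
def shiftT (i : Fin 2) (s : ℝ) (p : Torus L₁ L₂) : Torus L₁ L₂ :=
  match i with
  | 0 => (p.1 + (s : AddCircle L₁), p.2)
  | 1 => (p.1, p.2 + (s : AddCircle L₂))

/-- Translation of `Γ × ℝ` by `s` in the `i`-th coordinate direction. -/
def shiftX (i : Fin 3) (s : ℝ) (q : Space L₁ L₂) : Space L₁ L₂ :=
  match i with
  | 0 => (shiftT 0 s q.1, q.2)
  | 1 => (shiftT 1 s q.1, q.2)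
  | 2 => (q.1, q.2 + s)

/-- Classical partial derivative `∂_i f` on the torus. -/
def pdT (i : Fin 2) (f : Torus L₁ L₂ → ℝ) (p : Torus L₁ L₂) : ℝ :=
  deriv (fun s : ℝ => f (shiftT i s p)) 0

/-- Classical partial derivative `∂_i f` on `Γ × ℝ`. -/
def pdX (i : Fin 3) (f : Space L₁ L₂ → ℝ) (q : Space L₁ L₂) : ℝ :=
  deriv (fun s : ℝ => f (shiftX i s q)) 0

/-- Classical Laplacian on the torus. -/
def lapT (f : Torus L₁ L₂ → ℝ) (p : Torus L₁ L₂) : ℝ :=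
  ∑ i : Fin 2, pdT i (pdT i f) p

/-- `f` is of class `C^k` on the torus, i.e. its periodic lift to `ℝ²` is. -/
def IsCkT (k : WithTop ℕ∞) (f : Torus L₁ L₂ → ℝ) : Prop :=
  ContDiff ℝ k fun a : ℝ × ℝ => f ((a.1 : AddCircle L₁), (a.2 : AddCircle L₂))

/-- `f` is of class `C^k` on `Γ × ℝ`. -/
def IsCkX (k : WithTop ℕ∞) (f : Space L₁ L₂ → ℝ) : Prop :=
  ContDiff ℝ k fun a : ℝ × ℝ × ℝ =>
    f (((a.1 : AddCircle L₁), (a.2.1 : AddCircle L₂)), a.2.2)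

/-- Test functions `ψ ∈ C_c^∞(I × Γ)`, `I` a set of times: smooth functions on `ℝ × Γ` with
compact support contained in `I × Γ`.  For `I = (-∞, T)` the restrictions of these functions to
`[0, T) × Γ` are exactly the elements of `C_c^∞([0, T) × Γ)`. -/
def IsTestT (I : Set ℝ) (ψ : ℝ → Torus L₁ L₂ → ℝ) : Prop :=
  ContDiff ℝ ∞ (fun a : ℝ × ℝ × ℝ =>
    ψ a.1 ((a.2.1 : AddCircle L₁), (a.2.2 : AddCircle L₂))) ∧
  HasCompactSupport (Function.uncurry ψ) ∧
  tsupport (Function.uncurry ψ) ⊆ I ×ˢ univ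

/-- Test functions `φ ∈ C_c^∞(I × Γ × ℝ)`, with the same convention. -/
def IsTestX (I : Set ℝ) (φ : ℝ → Space L₁ L₂ → ℝ) : Prop :=
  ContDiff ℝ ∞ (fun a : ℝ × ℝ × ℝ × ℝ =>
    φ a.1 (((a.2.1 : AddCircle L₁), (a.2.2.1 : AddCircle L₂)), a.2.2.2)) ∧
  HasCompactSupport (Function.uncurry φ) ∧
  tsupport (Function.uncurry φ) ⊆ I ×ˢ univ

/-! ### Fluid domains -/

/-- `Ω^h = {(x, y, z) : 0 < z < h(x, y)}`. -/
def dom (h : Torus L₁ L₂ → ℝ) : Set (Space L₁ L₂) :=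
  {q | 0 < q.2 ∧ q.2 < h q.1}

/-- The domain `{(x, y, z) : -1 < z < h(x, y)}`, i.e. `Ω^h` extended downwards. -/
def domExt (h : Torus L₁ L₂ → ℝ) : Set (Space L₁ L₂) :=
  {q | -1 < q.2 ∧ q.2 < h q.1}

/-- The space-time cylinder `⋃_{s ∈ (0, t)} {s} × Ω^{η(s)}`. -/
def cyl (t : ℝ) (η : ℝ → Torus L₁ L₂ → ℝ) : Set (ℝ × Space L₁ L₂) :=
  {a | (0 < a.1 ∧ a.1 < t) ∧ a.2 ∈ dom (η a.1)}

/-- `(0, t) × Γ`. -/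
def cylT (t : ℝ) : Set (ℝ × Torus L₁ L₂) := Ioo 0 t ×ˢ univ

/-! ### Algebra of the model -/

/-- `|v|²`. -/
def normSq (v : Fin 3 → ℝ) : ℝ := ∑ i, v i ^ 2

/-- The viscous stress `𝕊(A)` where `A i j = ∂_j u_i`. -/
def stress (μ lam : ℝ) (A : Fin 3 → Fin 3 → ℝ) (i j : Fin 3) : ℝ :=
  μ * (A i j + A j i - 2 / 3 * (∑ k, A k k) * (if i = j then 1 else 0))
    + lam * (∑ k, A k k) * (if i = j then 1 else 0)

/-- The product `A : B`. -/
def frob (A B : Fin 3 → Fin 3 → ℝ) : ℝ := ∑ i, ∑ j, A i j * B i j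

section Analysis

variable [Fact (0 < L₁)] [Fact (0 < L₂)]

/-! ### Weak derivatives, Sobolev classes and traces -/

/-- `g` is the weak partial derivative `∂_i f` on the torus. -/
def HasWeakPdT (i : Fin 2) (f g : Torus L₁ L₂ → ℝ) : Prop :=
  ∀ ψ : Torus L₁ L₂ → ℝ, IsCkT ∞ ψ → ∫ p, f p * pdT i ψ p = -∫ p, g p * ψ p

/-- `f ∈ H²(Γ)` with weak gradient `Df` and weak Hessian `D2f`. -/
def IsH2 (f : Torus L₁ L₂ → ℝ) (Df : Torus L₁ L₂ → Fin 2 → ℝ)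
    (D2f : Torus L₁ L₂ → Fin 2 → Fin 2 → ℝ) : Prop :=
  MemLp f 2 ∧ (∀ i, MemLp (fun p => Df p i) 2) ∧ (∀ i j, MemLp (fun p => D2f p i j) 2) ∧
  (∀ i, HasWeakPdT i f (fun p => Df p i)) ∧
  (∀ i j, HasWeakPdT j (fun p => Df p i) (fun p => D2f p i j))

/-- `f ∈ H¹(U)` with weak gradient `Df`, for an open set `U ⊆ Γ × ℝ`. -/
def IsH1On (U : Set (Space L₁ L₂)) (f : Space L₁ L₂ → ℝ) (Df : Space L₁ L₂ → Fin 3 → ℝ) : Prop :=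
  MemLp f 2 (volume.restrict U) ∧ (∀ i, MemLp (fun q => Df q i) 2 (volume.restrict U)) ∧
  ∀ (i : Fin 3) (φ : Space L₁ L₂ → ℝ), IsCkX ∞ φ → HasCompactSupport φ → tsupport φ ⊆ U →
    ∫ q in U, f q * pdX i φ q = -∫ q in U, Df q i * φ q

/-- `g` is the trace over `O ⊆ Γ` of `f ∈ H¹(U)` (weak gradient `Df`) on the graph of `h`: the
restriction operator `G ↦ G(·, h(·))` on `C¹` functions, extended by continuity from the norm of
`H¹(U)` to that of `L²(O)`. -/
def HasTraceOn (U : Set (Space L₁ L₂)) (f : Space L₁ L₂ → ℝ) (Df : Space L₁ L₂ → Fin 3 → ℝ)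
    (O : Set (Torus L₁ L₂)) (h g : Torus L₁ L₂ → ℝ) : Prop :=
  ∃ G : ℕ → Space L₁ L₂ → ℝ, (∀ n, IsCkX 1 (G n)) ∧
    Tendsto (fun n => eLpNorm (fun q => G n q - f q) 2 (volume.restrict U)) atTop (𝓝 0) ∧
    (∀ i, Tendsto (fun n => eLpNorm (fun q => pdX i (G n) q - Df q i) 2 (volume.restrict U))
      atTop (𝓝 0)) ∧
    Tendsto (fun n => eLpNorm (fun p => G n (p, h p) - g p) 2 (volume.restrict O)) atTop (𝓝 0)

/-- `f ∈ H¹_{0z}(Ω^h)`: `f ∈ H¹(Ω^h)` and, for every closed `O ⊆ {h > 0}`, the trace of `f` on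
`O × {0}` vanishes (the trace being taken from a cylinder `V × (0, c) ⊆ Ω^h` over a
neighbourhood `V` of `O`). -/
def IsH10z (h : Torus L₁ L₂ → ℝ) (f : Space L₁ L₂ → ℝ) (Df : Space L₁ L₂ → Fin 3 → ℝ) : Prop :=
  IsH1On (dom h) f Df ∧
  ∀ O : Set (Torus L₁ L₂), IsClosed O → O ⊆ {p | 0 < h p} →
    ∃ (V : Set (Torus L₁ L₂)) (c : ℝ), IsOpen V ∧ O ⊆ V ∧ 0 < c ∧ V ×ˢ Ioo 0 c ⊆ dom h ∧
      HasTraceOn (V ×ˢ Ioo 0 c) f Df O (fun _ => 0) (fun _ => 0)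

/-- The Lagrangian trace of `f ∈ H¹_{0z}(Ω^h)` on the graph of `h`: extend `f` by zero to
`Γ × (-1, 0]` and take the trace on the graph of `h` from the extended domain. -/
def HasLagrangianTrace (h : Torus L₁ L₂ → ℝ) (f : Space L₁ L₂ → ℝ)
    (Df : Space L₁ L₂ → Fin 3 → ℝ) (g : Torus L₁ L₂ → ℝ) : Prop :=
  HasTraceOn (domExt h) ((dom h).indicator f)
    (fun q i => (dom h).indicator (fun q' => Df q' i) q) univ h g

/-- `f ∈ L^∞(0, T; L^r(Γ))`. -/
def MemLinftyT (T : ℝ) (r : ENNReal) (f : ℝ → Torus L₁ L₂ → ℝ) : Prop :=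
  AEStronglyMeasurable (Function.uncurry f) (volume.restrict (cylT T)) ∧
  ∃ C : NNReal, ∀ᵐ t ∂volume.restrict (Ioo 0 T), eLpNorm (f t) r ≤ C

/-- `f ∈ L^∞(0, T; L^r(Ω^{η(t)}))`. -/
def MemLinftyX (T : ℝ) (η : ℝ → Torus L₁ L₂ → ℝ) (r : ENNReal) (f : ℝ → Space L₁ L₂ → ℝ) : Prop :=
  AEStronglyMeasurable (Function.uncurry f) (volume.restrict (cyl T η)) ∧
  ∃ C : NNReal, ∀ᵐ t ∂volume.restrict (Ioo 0 T),
    eLpNorm (f t) r (volume.restrict (dom (η t))) ≤ C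

/-! ### Initial data -/

/-- Initial displacement, plate velocity, density and momentum `(ρu)₀`. -/
structure InitialData (L₁ L₂ : ℝ) where
  η₀ : Torus L₁ L₂ → ℝ
  v₀ : Torus L₁ L₂ → ℝ
  ρ₀ : Space L₁ L₂ → ℝ
  q₀ : Space L₁ L₂ → Fin 3 → ℝ

/-- Regularity and compatibility of the initial data.  The displacement, being in `H²(Γ)`, is
taken to be its continuous representative. -/
structure InitialData.Admissible (d : InitialData L₁ L₂) (γ : ℝ) : Prop where
  η₀_continuous : Continuous d.η₀
  η₀_pos : ∀ᵐ p, 0 < d.η₀ p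
  η₀_H2 : ∃ Dη D2η, IsH2 d.η₀ Dη D2η
  log_η₀ : Integrable fun p => Real.log (d.η₀ p)
  v₀_L2 : MemLp d.v₀ 2
  ρ₀_Lγ : MemLp d.ρ₀ (ENNReal.ofReal γ) (volume.restrict (dom d.η₀))
  q₀_Lp : ∀ i, MemLp (fun q => d.q₀ q i) (ENNReal.ofReal (2 * γ / (γ + 1)))
    (volume.restrict (dom d.η₀))
  kinetic : IntegrableOn (fun q => normSq (d.q₀ q) / d.ρ₀ q) (dom d.η₀)
  ρ₀_pos : ∀ᵐ q ∂volume.restrict (dom d.η₀), d.q₀ q ≠ 0 → 0 < d.ρ₀ q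
  ρ₀_nonneg : ∀ᵐ q ∂volume.restrict (dom d.η₀), 0 ≤ d.ρ₀ q
  mass_pos : 0 < ∫ q in dom d.η₀, d.ρ₀ q

/-! ### Weak solutions -/

/-- `(ρ, u, η)` is a weak solution on `(0, T)` with initial data `d` and outer force `F`, where
`Du t q i j = ∂_j u_i`, `dη = ∂_t η`, `Dη = ∇η`, `D2η = ∇²η` and `D2η₀ = ∇²η₀` are the weak
derivatives of the solution and of the initial displacement.  `η` is the continuous
representative. -/
structure IsWeakSolutionWith (γ μ lam T : ℝ) (d : InitialData L₁ L₂) (F : ℝ → Torus L₁ L₂ → ℝ)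
    (ρ : ℝ → Space L₁ L₂ → ℝ) (u : ℝ → Space L₁ L₂ → Fin 3 → ℝ) (η : ℝ → Torus L₁ L₂ → ℝ)
    (Du : ℝ → Space L₁ L₂ → Fin 3 → Fin 3 → ℝ) (dη : ℝ → Torus L₁ L₂ → ℝ)
    (Dη : ℝ → Torus L₁ L₂ → Fin 2 → ℝ) (D2η : ℝ → Torus L₁ L₂ → Fin 2 → Fin 2 → ℝ)
    (Dη₀ : Torus L₁ L₂ → Fin 2 → ℝ) (D2η₀ : Torus L₁ L₂ → Fin 2 → Fin 2 → ℝ) : Prop where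
  -- mass, positivity of the displacement, initial position
  mass : ∀ t ∈ Icc 0 T, ∫ q in dom (η t), ρ t q = ∫ q in dom d.η₀, d.ρ₀ q
  η_pos : ∀ t ∈ Icc 0 T, ∀ᵐ p, 0 < η t p
  η_initial : η 0 = d.η₀
  -- regularity of the fluid
  ρ_nonneg : ∀ᵐ a ∂volume.restrict (cyl T η), 0 ≤ ρ a.1 a.2
  ρ_Lγ : MemLinftyX T η (ENNReal.ofReal γ) ρ
  u_L2 : ∀ i, MemLp (fun a : ℝ × Space L₁ L₂ => u a.1 a.2 i) 2 (volume.restrict (cyl T η))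
  Du_L2 : ∀ i j, MemLp (fun a : ℝ × Space L₁ L₂ => Du a.1 a.2 i j) 2 (volume.restrict (cyl T η))
  u_H10z : ∀ᵐ t ∂volume.restrict (Ioo 0 T), ∀ i,
    IsH10z (η t) (fun q => u t q i) (fun q => Du t q i)
  kinetic : MemLinftyX T η 1 (fun t q => ρ t q * normSq (u t q))
  pressure_over_η : IntegrableOn (fun a : ℝ × Space L₁ L₂ => ρ a.1 a.2 ^ γ / η a.1 a.2.1) (cyl T η)
  kinetic_over_η : IntegrableOn
    (fun a : ℝ × Space L₁ L₂ => ρ a.1 a.2 * u a.1 a.2 2 ^ 2 / η a.1 a.2.1) (cyl T η)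
  -- regularity of the plate
  η_continuous : ContinuousOn (Function.uncurry η) (Icc 0 T ×ˢ univ)
  η_L2 : MemLinftyT T 2 η
  dη_L2 : MemLinftyT T 2 dη
  dη_weak : ∀ ψ : ℝ → Torus L₁ L₂ → ℝ, IsTestT (Ioo 0 T) ψ →
    ∫ a in cylT T, η a.1 a.2 * deriv (fun s => ψ s a.2) a.1 = -∫ a in cylT T, dη a.1 a.2 * ψ a.1 a.2
  Dη_L2 : ∀ i, MemLinftyT T 2 (fun t p => Dη t p i)
  D2η_L2 : ∀ i j, MemLinftyT T 2 (fun t p => D2η t p i j)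
  η_H2 : ∀ᵐ t ∂volume.restrict (Ioo 0 T), IsH2 (η t) (Dη t) (D2η t)
  η₀_H2 : IsH2 d.η₀ Dη₀ D2η₀
  log_η : ∀ t ∈ Icc 0 T, Integrable fun p => Real.log (η t p)
  log_η_continuous : ∀ t₀ ∈ Icc 0 T,
    Tendsto (fun t => ∫ p, |Real.log (η t p) - Real.log (η t₀ p)|) (𝓝[Icc 0 T] t₀) (𝓝 0)
  -- kinematic coupling
  coupling : ∀ᵐ t ∂volume.restrict (Ioo 0 T), ∀ i : Fin 3,
    HasLagrangianTrace (η t) (fun q => u t q i) (fun q => Du t q i)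
      (fun p => if i = 2 then dη t p else 0)
  -- renormalized continuity equation
  continuity : ∀ (φ : ℝ → Space L₁ L₂ → ℝ) (b B : ℝ → ℝ), IsTestX (Iio T) φ →
    ContinuousOn b (Ici 0) → (∃ C, ∀ r ∈ Ici (0 : ℝ), |b r| ≤ C) → b 0 = 0 →
    (∀ r > 0, HasDerivAt B (b r / r ^ 2) r) →
    ∫ a in cyl T η, ρ a.1 a.2 * B (ρ a.1 a.2) *
        (deriv (fun s => φ s a.2) a.1 + ∑ i, u a.1 a.2 i * pdX i (φ a.1) a.2)
      = (∫ a in cyl T η, b (ρ a.1 a.2) * (∑ i, Du a.1 a.2 i i) * φ a.1 a.2)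
        - ∫ q in dom d.η₀, d.ρ₀ q * B (d.ρ₀ q) * φ 0 q
  -- coupled momentum equation
  momentum : ∀ (φ : Fin 3 → ℝ → Space L₁ L₂ → ℝ) (ψ : ℝ → Torus L₁ L₂ → ℝ),
    (∀ i, IsTestX (Iio T) (φ i)) → IsTestT (Iio T) ψ →
    (∀ t ∈ Ioo 0 T, ∀ p, ∀ i, φ i t (p, η t p) = if i = 2 then ψ t p else 0) →
    (∀ t ∈ Ico 0 T, ∀ p, ∀ i, φ i t (p, 0) = 0) →
    (∫ a in cyl T η, ρ a.1 a.2 * ∑ i, u a.1 a.2 i * deriv (fun s => φ i s a.2) a.1)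
      + (∫ a in cyl T η, frob (fun i j => ρ a.1 a.2 * u a.1 a.2 i * u a.1 a.2 j)
          (fun i j => pdX j (φ i a.1) a.2))
      + (∫ a in cyl T η, ρ a.1 a.2 ^ γ * ∑ i, pdX i (φ i a.1) a.2)
      - (∫ a in cyl T η, frob (stress μ lam (Du a.1 a.2)) (fun i j => pdX j (φ i a.1) a.2))
      + (∫ a in cylT T, dη a.1 a.2 * deriv (fun s => ψ s a.2) a.1)
      - (∫ a in cylT T, (∑ i, D2η a.1 a.2 i i) * lapT (ψ a.1) a.2)
      + (∫ a in cylT T, F a.1 a.2 * ψ a.1 a.2)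
      = -(∫ q in dom d.η₀, ∑ i, d.q₀ q i * φ i 0 q) - ∫ p, d.v₀ p * ψ 0 p
  -- contact inequality
  contact : ∀ᵐ t ∂volume.restrict (Ioo 0 T),
    (∫ a in cylT t, F a.1 a.2)
      + (∫ a in cyl t η, ρ a.1 a.2 ^ γ / η a.1 a.2.1)
      + (∫ a in cyl t η, ρ a.1 a.2 * u a.1 a.2 2 ^ 2 / η a.1 a.2.1)
      - (4 * μ / 3 + lam) * (∫ p, Real.log (η t p))
    ≤ (∫ a in cyl t η, ρ a.1 a.2 * u a.1 a.2 2 * a.2.2 * dη a.1 a.2.1 / η a.1 a.2.1 ^ 2)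
      + (∫ a in cyl t η, ρ a.1 a.2 * u a.1 a.2 0 * u a.1 a.2 2 *
          (a.2.2 * Dη a.1 a.2.1 0 / η a.1 a.2.1 ^ 2))
      + (∫ a in cyl t η, ρ a.1 a.2 * u a.1 a.2 1 * u a.1 a.2 2 *
          (a.2.2 * Dη a.1 a.2.1 1 / η a.1 a.2.1 ^ 2))
      - μ * (∫ a in cyl t η, (Du a.1 a.2 0 2 + Du a.1 a.2 2 0) *
          (a.2.2 * Dη a.1 a.2.1 0 / η a.1 a.2.1 ^ 2))
      - μ * (∫ a in cyl t η, (Du a.1 a.2 1 2 + Du a.1 a.2 2 1) *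
          (a.2.2 * Dη a.1 a.2.1 1 / η a.1 a.2.1 ^ 2))
      + (lam - 2 * μ / 3) * (∫ a in cyl t η,
          (u a.1 a.2 0 * (Dη a.1 a.2.1 0 / η a.1 a.2.1 ^ 2)
            + u a.1 a.2 1 * (Dη a.1 a.2.1 1 / η a.1 a.2.1 ^ 2)))
      - (4 * μ / 3 + lam) * (∫ p, Real.log (d.η₀ p))
      + (∫ q in dom (η t), ρ t q * u t q 2 * (q.2 / η t q.1))
      - (∫ q in dom d.η₀, d.q₀ q 2 * (q.2 / d.η₀ q.1))
      + (∫ p, dη t p) - ∫ p, d.v₀ p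
  -- energy inequality
  energy : ∀ᵐ t ∂volume.restrict (Ioo 0 T),
    (∫ q in dom (η t), (1 / 2 * ρ t q * normSq (u t q) + ρ t q ^ γ / (γ - 1)))
      + (∫ p, (1 / 2 * dη t p ^ 2 + 1 / 2 * (∑ i, D2η t p i i) ^ 2))
      + (∫ a in cyl t η, frob (stress μ lam (Du a.1 a.2)) (Du a.1 a.2))
    ≤ (∫ q in dom d.η₀, (1 / (2 * d.ρ₀ q) * normSq (d.q₀ q) + d.ρ₀ q ^ γ / (γ - 1)))
      + (∫ p, (1 / 2 * d.v₀ p ^ 2 + 1 / 2 * (∑ i, D2η₀ p i i) ^ 2))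
      + ∫ a in cylT t, F a.1 a.2 * dη a.1 a.2

/-- `(ρ, u, η)` is a weak solution on `(0, T)` with initial data `d` and outer force `F`. -/
def IsWeakSolution (γ μ lam T : ℝ) (d : InitialData L₁ L₂) (F : ℝ → Torus L₁ L₂ → ℝ)
    (ρ : ℝ → Space L₁ L₂ → ℝ) (u : ℝ → Space L₁ L₂ → Fin 3 → ℝ)
    (η : ℝ → Torus L₁ L₂ → ℝ) : Prop :=
  ∃ Du dη Dη D2η Dη₀ D2η₀,
    IsWeakSolutionWith γ μ lam T d F ρ u η Du dη Dη D2η Dη₀ D2η₀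

end Analysis

end FluidPlate

end

/-! The force is a smooth bump of total mass K concentrated in a square of half-width ε around the
contact point p₀. Suppose that some solution keeps η(t, p₀) = 0 for all t in (0, T). For large K,
two facts then collide.

The force does almost no work. As F does not depend on time, its work up to time t is ∫ F η(t) − ∫ F
η₀ ≤ ∫ F η(t) (`integral_force_mul_velocity`). On a two-dimensional torus an H² function is Hölder
continuous with exponent 1/2, with a constant controlled by the L² norm of its Laplacian
(`IsH2.sq_sub_shiftT_le`). Since η(t) vanishes at p₀, the work is at most of order K √ε ‖Δη(t)‖. If
K² ε is small, the bending energy absorbs it, and all energy bounds become independent of K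
(`ae_isPlateSlice`).

The contact inequality, however, has the whole impulse t K on its left side. Its right side is
bounded independently of K, up to 3/4 of the integral of ρ|u₃|²/η and 1/3 of that of ρ^γ/η, which
the left side absorbs. At a time t > T/2 this bounds K by a constant that depends only on the data
and T (`exists_force_bound`), so a larger K is contradictory.

The bounds of the fluxes (`exists_lintegral_fluxes_le`) have to cope with η degenerating at contact
points and with a graph that need not be Lipschitz. They rest on four facts. (1) Korn's inequality
with the constant μ, whatever the domain (`korn`): the 2×2 minors of ∇u are null Lagrangians, each
containing a horizontal component of u, whose trace on the graph vanishes. (2) (∂_j η)²/η is bounded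
in L² by the Laplacian (`IsH2.lintegral_pow_four_div_le`). (3) On almost every vertical segment,
|u|² ≤ 2 N D, where N and D are the L² norms of u and ∂_z u on that segment
(`HasLagrangianTrace.ae_vert_bounds`). (4) N lies in every L^q over the torus, with norm bounded by
the Dirichlet norm of u (`HasLagrangianTrace.lintegral_vert_pow_le`). Combining them by Hölder's
inequality gives bounds linear in the Dirichlet energy, hence integrable in time; the exponents fit
exactly because γ > 3. Facts (1), (2) and (4) are obtained for mollified plates and passed to the
limit. -/

namespace FluidPlate

set_option linter.unusedSectionVars false

/-! ### Calculus along the coordinate lines of the torus -/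

section TorusCalculus

variable {L₁ L₂ : ℝ}

/-- The translation vector of `shiftT`. -/
def vecT (i : Fin 2) (s : ℝ) : Torus L₁ L₂ :=
  match i with
  | 0 => ((s : AddCircle L₁), 0)
  | 1 => (0, (s : AddCircle L₂))

lemma shiftT_eq (i : Fin 2) (s : ℝ) (p : Torus L₁ L₂) : shiftT i s p = p + vecT i s := by
  fin_cases i <;> simp [shiftT, vecT, Prod.ext_iff]

lemma vecT_add (i : Fin 2) (s t : ℝ) : (vecT i (s + t) : Torus L₁ L₂) = vecT i s + vecT i t := by
  fin_cases i <;> simp [vecT]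

lemma vecT_zero (i : Fin 2) : (vecT i 0 : Torus L₁ L₂) = 0 := by
  fin_cases i <;> simp [vecT]

lemma shiftT_zero (i : Fin 2) (p : Torus L₁ L₂) : shiftT i 0 p = p := by
  simp [shiftT_eq, vecT_zero]

lemma shiftT_shiftT (i : Fin 2) (s t : ℝ) (p : Torus L₁ L₂) :
    shiftT i s (shiftT i t p) = shiftT i (t + s) p := by
  simp [shiftT_eq, vecT_add, add_assoc]

lemma continuous_vecT (i : Fin 2) : Continuous (vecT i : ℝ → Torus L₁ L₂) := by
  have h1 := AddCircle.continuous_mk' L₁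
  have h2 := AddCircle.continuous_mk' L₂
  fin_cases i
  · exact h1.prodMk continuous_const
  · exact continuous_const.prodMk h2

lemma continuous_shiftT (i : Fin 2) :
    Continuous (fun a : ℝ × Torus L₁ L₂ => shiftT i a.1 a.2) := by
  simp only [shiftT_eq]
  exact continuous_snd.add ((continuous_vecT i).comp continuous_fst)

lemma continuous_shiftT_left (i : Fin 2) (p : Torus L₁ L₂) :
    Continuous (fun s => shiftT i s p) :=
  (continuous_shiftT i).comp (continuous_id.prodMk continuous_const)

lemma continuous_shiftT_right (i : Fin 2) (s : ℝ) :
    Continuous (shiftT i s : Torus L₁ L₂ → Torus L₁ L₂) :=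
  (continuous_shiftT i).comp (continuous_const.prodMk continuous_id)

/-- `g` is the classical partial derivative `∂_i f` on the torus. -/
def HasPdT (i : Fin 2) (f g : Torus L₁ L₂ → ℝ) : Prop :=
  ∀ p, HasDerivAt (fun s : ℝ => f (shiftT i s p)) (g p) 0

namespace HasPdT

variable {i : Fin 2} {f g f' g' : Torus L₁ L₂ → ℝ}

/-- Shifts in one direction form a one-parameter group, so derivatives at parameter 0 at all points
give the derivative at every parameter. -/
lemma hasDerivAt (h : HasPdT i f g) (p : Torus L₁ L₂) (s : ℝ) :
    HasDerivAt (fun s : ℝ => f (shiftT i s p)) (g (shiftT i s p)) s := by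
  have h0 := h (shiftT i s p)
  simp only [shiftT_shiftT] at h0
  have := HasDerivAt.scomp s (h := fun t => t - s) (h' := 1)
    (g₁ := fun t => f (shiftT i (s + t) p)) (g₁' := g (shiftT i s p)) (by simpa using h0)
    ((hasDerivAt_id s).sub_const s)
  simpa [Function.comp_def] using this

lemma pdT_eq (h : HasPdT i f g) : pdT i f = g := funext fun p => (h p).deriv

lemma add_const (h : HasPdT i f g) (c : ℝ) : HasPdT i (fun p => f p + c) g :=
  fun p => (h p).add_const c

lemma mul (h : HasPdT i f g) (h' : HasPdT i f' g') :
    HasPdT i (fun p => f p * f' p) (fun p => g p * f' p + f p * g' p) := fun p => by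
  have := (h p).mul (h' p)
  simp only [shiftT_zero] at this
  exact this

lemma comp_deriv {φ φ' : ℝ → ℝ} (h : HasPdT i f g) (hφ : ∀ p, HasDerivAt φ (φ' (f p)) (f p)) :
    HasPdT i (fun p => φ (f p)) (fun p => φ' (f p) * g p) := fun p => by
  have h0 := hφ p
  exact HasDerivAt.comp (h₂ := φ) (h := fun s => f (shiftT i s p)) (0 : ℝ)
    (by simpa [shiftT_zero] using h0) (h p)

lemma pow (h : HasPdT i f g) (n : ℕ) :
    HasPdT i (fun p => f p ^ n) (fun p => (n * f p ^ (n - 1)) * g p) :=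
  h.comp_deriv (φ := fun x => x ^ n) (φ' := fun x => n * x ^ (n - 1)) fun p => hasDerivAt_pow n (f p)

lemma integral_line (h : HasPdT i f g) (hg : Continuous g) (p : Torus L₁ L₂) (a b : ℝ) :
    ∫ s in a..b, g (shiftT i s p) = f (shiftT i b p) - f (shiftT i a p) :=
  intervalIntegral.integral_eq_sub_of_hasDerivAt (fun s _ => h.hasDerivAt p s)
    ((hg.comp (continuous_shiftT_left i p)).intervalIntegrable _ _)

end HasPdT

variable [Fact (0 < L₁)] [Fact (0 < L₂)]

instance : (volume : Measure (Torus L₁ L₂)).IsAddHaarMeasure :=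
  inferInstanceAs ((volume : Measure (AddCircle L₁)).prod
    (volume : Measure (AddCircle L₂))).IsAddHaarMeasure

lemma integral_shiftT (i : Fin 2) (s : ℝ) (f : Torus L₁ L₂ → ℝ) :
    ∫ p, f (shiftT i s p) = ∫ p, f p := by
  simp only [shiftT_eq]
  exact integral_add_right_eq_self f _

lemma Torus.integrable {f : Torus L₁ L₂ → ℝ} (hf : Continuous f) : Integrable f :=
  hf.integrable_of_hasCompactSupport (HasCompactSupport.of_compactSpace f)

lemma Torus.memLp {f : Torus L₁ L₂ → ℝ} (hf : Continuous f) (p : ENNReal) : MemLp f p :=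
  hf.memLp_of_hasCompactSupport (HasCompactSupport.of_compactSpace f)

/-- The integral of a classical partial derivative over the torus vanishes. -/
lemma HasPdT.integral_eq_zero {i : Fin 2} {f g : Torus L₁ L₂ → ℝ} (h : HasPdT i f g)
    (hf : Continuous f) (hg : Continuous g) : ∫ p, g p = 0 := by
  have h1 : ∫ p, ∫ s in (0:ℝ)..1, g (shiftT i s p) = 0 := by
    simp only [h.integral_line hg]
    rw [integral_sub, integral_shiftT, integral_shiftT, sub_self]
    · exact Torus.integrable (hf.comp (continuous_shiftT_right i 1))
    · exact Torus.integrable (hf.comp (continuous_shiftT_right i 0))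
  have h2 : ∫ p, ∫ s in (0:ℝ)..1, g (shiftT i s p) = ∫ p, g p := by
    simp only [intervalIntegral.integral_of_le zero_le_one]
    rw [integral_integral_swap]
    · simp [integral_shiftT]
    · have hc : Continuous (fun a : Torus L₁ L₂ × ℝ => g (shiftT i a.2 a.1)) :=
        hg.comp ((continuous_shiftT i).comp (continuous_snd.prodMk continuous_fst))
      have : IntegrableOn (fun a : Torus L₁ L₂ × ℝ => g (shiftT i a.2 a.1))
          (univ ×ˢ Icc 0 1) (volume.prod volume) :=
        hc.continuousOn.integrableOn_compact (isCompact_univ.prod isCompact_Icc)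
      rw [IntegrableOn, ← Measure.prod_restrict, Measure.restrict_univ] at this
      exact this.mono_measure (Measure.prod_mono le_rfl
        (Measure.restrict_mono Ioc_subset_Icc_self le_rfl))
  rw [← h2, h1]

/-- Integration by parts on the torus. -/
lemma HasPdT.integral_mul_eq_neg {i : Fin 2} {f g f' g' : Torus L₁ L₂ → ℝ} (h : HasPdT i f f')
    (h' : HasPdT i g g') (hf : Continuous f) (hf' : Continuous f') (hg : Continuous g)
    (hg' : Continuous g') : ∫ p, f p * g' p = -∫ p, f' p * g p := by
  have := (h.mul h').integral_eq_zero (hf.mul hg) ((hf'.mul hg).add (hf.mul hg'))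
  have e := integral_add (Torus.integrable (hf'.mul hg)) (Torus.integrable (hf.mul hg'))
  simp only [Pi.mul_apply] at e
  linarith

/-- The period in the `i`-th direction. -/
def period (L₁ L₂ : ℝ) (i : Fin 2) : ℝ := if i = 0 then L₁ else L₂

lemma period_pos (i : Fin 2) : 0 < period L₁ L₂ i := by
  have h1 : 0 < L₁ := Fact.out
  have h2 : 0 < L₂ := Fact.out
  fin_cases i <;> simpa [period]

lemma shiftT_period (i : Fin 2) (p : Torus L₁ L₂) : shiftT i (period L₁ L₂ i) p = p := by
  fin_cases i
  · simp [shiftT, period, AddCircle.coe_period]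
  · simp [shiftT, period, AddCircle.coe_period]

/-- The integral of `f` over the closed line through `p` in direction `i`. -/
noncomputable def lineInt (i : Fin 2) (f : Torus L₁ L₂ → ℝ) (p : Torus L₁ L₂) : ℝ :=
  ∫ s in (0:ℝ)..period L₁ L₂ i, f (shiftT i s p)

lemma lineInt_zero_eq (f : Torus L₁ L₂ → ℝ) (p : Torus L₁ L₂) :
    lineInt 0 f p = ∫ x : AddCircle L₁, f (x, p.2) := by
  have := AddCircle.intervalIntegral_preimage L₁ 0 (fun x => f (x + p.1, p.2))
  rw [integral_add_right_eq_self (fun x => f (x, p.2))] at this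
  rw [← this]
  simp [lineInt, shiftT, period, add_comm]

lemma lineInt_one_eq (f : Torus L₁ L₂ → ℝ) (p : Torus L₁ L₂) :
    lineInt 1 f p = ∫ y : AddCircle L₂, f (p.1, y) := by
  have := AddCircle.intervalIntegral_preimage L₂ 0 (fun y => f (p.1, y + p.2))
  rw [integral_add_right_eq_self (fun y => f (p.1, y))] at this
  rw [← this]
  simp [lineInt, shiftT, period, add_comm]

lemma continuous_lineInt (i : Fin 2) {f : Torus L₁ L₂ → ℝ} (hf : Continuous f) :
    Continuous (lineInt i f) := by
  unfold lineInt
  refine intervalIntegral.continuous_parametric_intervalIntegral_of_continuous' ?_ _ _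
  exact hf.comp ((continuous_shiftT i).comp (continuous_snd.prodMk continuous_fst))

lemma integral_lineInt (i : Fin 2) {f : Torus L₁ L₂ → ℝ} (hf : Continuous f) :
    ∫ p, lineInt i f p = period L₁ L₂ i * ∫ p, f p := by
  unfold lineInt
  simp only [intervalIntegral.integral_of_le (period_pos (L₁ := L₁) (L₂ := L₂) i).le]
  rw [integral_integral_swap]
  · simp [integral_shiftT, (period_pos (L₁ := L₁) (L₂ := L₂) i).le]
  · have hc : Continuous (fun a : Torus L₁ L₂ × ℝ => f (shiftT i a.2 a.1)) :=
      hf.comp ((continuous_shiftT i).comp (continuous_snd.prodMk continuous_fst))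
    have : IntegrableOn (fun a : Torus L₁ L₂ × ℝ => f (shiftT i a.2 a.1))
        (univ ×ˢ Icc 0 (period L₁ L₂ i)) (volume.prod volume) :=
      hc.continuousOn.integrableOn_compact (isCompact_univ.prod isCompact_Icc)
    rw [IntegrableOn, ← Measure.prod_restrict, Measure.restrict_univ] at this
    exact this.mono_measure (Measure.prod_mono le_rfl
      (Measure.restrict_mono Ioc_subset_Icc_self le_rfl))

/-- Fundamental theorem of calculus along the line. The segment is enlarged to the whole closed
line, so that the bound no longer depends on s. -/
lemma abs_sub_shiftT_le {i : Fin 2} {f g : Torus L₁ L₂ → ℝ} (h : HasPdT i f g)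
    (hg : Continuous g) (p : Torus L₁ L₂) {s : ℝ} (hs : s ∈ Icc 0 (period L₁ L₂ i)) :
    |f (shiftT i s p) - f p| ≤ lineInt i (fun p => |g p|) p := by
  have h1 := h.integral_line hg p 0 s
  rw [shiftT_zero] at h1
  rw [← h1]
  have hc : Continuous (fun s => |g (shiftT i s p)|) :=
    (hg.comp (continuous_shiftT_left i p)).abs
  calc |∫ s in (0:ℝ)..s, g (shiftT i s p)|
      ≤ ∫ s in (0:ℝ)..s, |g (shiftT i s p)| :=
        intervalIntegral.abs_integral_le_integral_abs hs.1
    _ ≤ _ := by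
        unfold lineInt
        refine intervalIntegral.integral_mono_interval le_rfl hs.1 hs.2 ?_
          (hc.intervalIntegrable _ _)
        exact Eventually.of_forall fun _ => abs_nonneg _

/-- A function is bounded on each line by its mean and the variation along the line. -/
lemma abs_le_lineInt {i : Fin 2} {f g : Torus L₁ L₂ → ℝ} (h : HasPdT i f g)
    (hf : Continuous f) (hg : Continuous g) (p : Torus L₁ L₂) :
    |f p| ≤ lineInt i (fun p => |f p|) p / period L₁ L₂ i + lineInt i (fun p => |g p|) p := by
  have hL := period_pos (L₁ := L₁) (L₂ := L₂) i
  -- Compare f p with its value at every point of the line and average over one period.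
  have key : ∫ s in (0:ℝ)..period L₁ L₂ i, |f p| ≤
      ∫ s in (0:ℝ)..period L₁ L₂ i,
        (|f (shiftT i s p)| + lineInt i (fun p => |g p|) p) := by
    have hc : Continuous (fun s => |f (shiftT i s p)|) :=
      (hf.comp (continuous_shiftT_left i p)).abs
    refine intervalIntegral.integral_mono_on hL.le (by simp)
      ((hc.add continuous_const).intervalIntegrable _ _) fun s hs => ?_
    have := abs_sub_shiftT_le h hg p hs
    have h2 := abs_sub_abs_le_abs_sub (f p) (f (shiftT i s p))
    rw [abs_sub_comm] at h2
    linarith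
  rw [intervalIntegral.integral_add, intervalIntegral.integral_const,
    intervalIntegral.integral_const] at key
  · simp only [sub_zero, smul_eq_mul] at key
    have e : lineInt i (fun p => |f p|) p = ∫ s in (0:ℝ)..period L₁ L₂ i, |f (shiftT i s p)| := rfl
    rw [← e] at key
    rw [div_add' _ _ _ hL.ne', le_div_iff₀ hL]
    linarith
  · exact ((hf.comp (continuous_shiftT_left i p)).abs).intervalIntegrable _ _
  · simp

/-- A function with vanishing mean on lines is bounded by its variation along the line. -/
lemma abs_le_lineInt_of_lineInt_eq_zero {i : Fin 2} {f g : Torus L₁ L₂ → ℝ} (h : HasPdT i f g)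
    (hf : Continuous f) (hg : Continuous g) (p : Torus L₁ L₂) (h0 : lineInt i f p = 0) :
    |f p| ≤ lineInt i (fun p => |g p|) p := by
  have hL := period_pos (L₁ := L₁) (L₂ := L₂) i
  -- With zero mean, −f p is the average over the line of the differences from f p, each of which is
  -- bounded by the variation.
  have e : ∫ s in (0:ℝ)..period L₁ L₂ i, (f (shiftT i s p) - f p) =
      -(period L₁ L₂ i * f p) := by
    rw [intervalIntegral.integral_sub, intervalIntegral.integral_const]
    · have : ∫ s in (0:ℝ)..period L₁ L₂ i, f (shiftT i s p) = 0 := h0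
      rw [this]; simp
    · exact (hf.comp (continuous_shiftT_left i p)).intervalIntegrable _ _
    · simp
  have b : ‖∫ s in (0:ℝ)..period L₁ L₂ i, (f (shiftT i s p) - f p)‖ ≤
      lineInt i (fun p => |g p|) p * |period L₁ L₂ i - 0| := by
    refine intervalIntegral.norm_integral_le_of_norm_le_const fun s hs => ?_
    rw [uIoc_of_le hL.le] at hs
    exact abs_sub_shiftT_le h hg p ⟨hs.1.le, hs.2⟩
  rw [e, norm_neg, norm_mul, sub_zero, Real.norm_eq_abs, Real.norm_eq_abs, abs_of_pos hL,
    mul_comm] at b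
  exact le_of_mul_le_mul_right b hL

/-- The two-dimensional Gagliardo-Nirenberg inequality `W^{1,1} ⊆ L²` on the torus. -/
lemma integral_sq_le_mul {f f₀ f₁ : Torus L₁ L₂ → ℝ} (h₀ : HasPdT 0 f f₀) (h₁ : HasPdT 1 f f₁)
    (hf : Continuous f) (hf₀ : Continuous f₀) (hf₁ : Continuous f₁) :
    ∫ p, f p ^ 2 ≤ ((∫ p, |f p|) / L₁ + ∫ p, |f₀ p|) * ((∫ p, |f p|) / L₂ + ∫ p, |f₁ p|) := by
  -- The bound of |f| along horizontal lines depends on y only, the one along vertical lines on x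
  -- only. Hence f² ≤ A(y) B(x), and Fubini factorizes the integral.
  set A : AddCircle L₂ → ℝ := fun y =>
    (∫ x : AddCircle L₁, |f (x, y)|) / L₁ + ∫ x : AddCircle L₁, |f₀ (x, y)|
  set B : AddCircle L₁ → ℝ := fun x =>
    (∫ y : AddCircle L₂, |f (x, y)|) / L₂ + ∫ y : AddCircle L₂, |f₁ (x, y)|
  have hA : ∀ p, |f p| ≤ A p.2 := fun p => by
    have := abs_le_lineInt h₀ hf hf₀ p
    rw [lineInt_zero_eq, lineInt_zero_eq] at this
    simpa [period] using this
  have hB : ∀ p, |f p| ≤ B p.1 := fun p => by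
    have := abs_le_lineInt h₁ hf hf₁ p
    rw [lineInt_one_eq, lineInt_one_eq] at this
    simpa [period] using this
  have iA : Integrable A := by
    refine Integrable.add (Integrable.div_const ?_ _) ?_
    · exact (Torus.integrable hf.abs).integral_prod_right
    · exact (Torus.integrable hf₀.abs).integral_prod_right
  have iB : Integrable B := by
    refine Integrable.add (Integrable.div_const ?_ _) ?_
    · exact (Torus.integrable hf.abs).integral_prod_left
    · exact (Torus.integrable hf₁.abs).integral_prod_left
  have eA : ∫ y, A y = (∫ p, |f p|) / L₁ + ∫ p, |f₀ p| := by
    rw [integral_add, integral_div]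
    · exact congrArg₂ (· / L₁ + ·) (integral_prod_symm _ (Torus.integrable hf.abs)).symm
        (integral_prod_symm _ (Torus.integrable hf₀.abs)).symm
    · exact (Torus.integrable hf.abs).integral_prod_right.div_const _
    · exact (Torus.integrable hf₀.abs).integral_prod_right
  have eB : ∫ x, B x = (∫ p, |f p|) / L₂ + ∫ p, |f₁ p| := by
    rw [integral_add, integral_div]
    · exact congrArg₂ (· / L₂ + ·) (integral_prod _ (Torus.integrable hf.abs)).symm
        (integral_prod _ (Torus.integrable hf₁.abs)).symm
    · exact (Torus.integrable hf.abs).integral_prod_left.div_const _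
    · exact (Torus.integrable hf₁.abs).integral_prod_left
  rw [← eA, ← eB, mul_comm, ← integral_prod_mul]
  refine integral_mono (Torus.integrable (hf.pow 2)) (iB.mul_prod iA) fun p => ?_
  have := mul_le_mul (hB p) (hA p) (abs_nonneg _) ((abs_nonneg _).trans (hB p))
  simpa [← abs_mul, ← sq] using this

end TorusCalculus

/-! ### Cauchy–Schwarz and Hölder without roots -/

section Inequalities

variable {α : Type*} [MeasurableSpace α] {ν : Measure α}

/-- The Cauchy-Schwarz inequality. -/
lemma sq_integral_mul_le {f g : α → ℝ} (hf : MemLp f 2 ν) (hg : MemLp g 2 ν) :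
    (∫ x, f x * g x ∂ν) ^ 2 ≤ (∫ x, f x ^ 2 ∂ν) * ∫ x, g x ^ 2 ∂ν := by
  have if2 : Integrable (fun x => f x ^ 2) ν := hf.integrable_sq
  have ig2 : Integrable (fun x => g x ^ 2) ν := hg.integrable_sq
  have ifg : Integrable (fun x => f x * g x) ν := hf.integrable_mul hg
  -- The quadratic polynomial t ↦ ∫ (f + t g)² is nonnegative, so its discriminant is not positive.
  have key : ∀ t : ℝ, 0 ≤ (∫ x, g x ^ 2 ∂ν) * (t * t) + (2 * ∫ x, f x * g x ∂ν) * t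
      + ∫ x, f x ^ 2 ∂ν := fun t => by
    have h0 : 0 ≤ ∫ x, (f x + t * g x) ^ 2 ∂ν := integral_nonneg fun x => sq_nonneg _
    have e : ∫ x, (f x + t * g x) ^ 2 ∂ν
        = ∫ x, ((f x ^ 2 + (2 * t) * (f x * g x)) + t ^ 2 * g x ^ 2) ∂ν := by
      congr 1; ext x; ring
    have i1 : Integrable (fun x => f x ^ 2 + (2 * t) * (f x * g x)) ν := if2.add (ifg.const_mul _)
    rw [e, integral_add i1 (ig2.const_mul _),
      integral_add if2 (ifg.const_mul _), integral_const_mul, integral_const_mul] at h0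
    linarith
  have := discrim_le_zero key
  unfold discrim at this
  linarith

lemma integral_mul_le_sqrt_mul_sqrt {f g : α → ℝ} (hf : MemLp f 2 ν) (hg : MemLp g 2 ν) :
    ∫ x, f x * g x ∂ν ≤ √(∫ x, f x ^ 2 ∂ν) * √(∫ x, g x ^ 2 ∂ν) := by
  rw [← Real.sqrt_mul (integral_nonneg fun x => sq_nonneg _)]
  exact Real.le_sqrt_of_sq_le (sq_integral_mul_le hf hg)

lemma sq_integral_le [IsFiniteMeasure ν] {f : α → ℝ} (hf : MemLp f 2 ν) :
    (∫ x, f x ∂ν) ^ 2 ≤ ν.real univ * ∫ x, f x ^ 2 ∂ν := by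
  have := sq_integral_mul_le hf (memLp_const (1 : ℝ))
  simpa [mul_comm] using this

/-- Hölder's inequality with exponents `n / (n - 1)` and `n`, without roots. -/
lemma integral_pow_mul_pow_le {f g : α → ℝ} {n : ℕ} (hn : 1 ≤ n) (hf0 : ∀ x, 0 ≤ f x)
    (hg0 : ∀ x, 0 ≤ g x)
    (hf : MemLp (fun x => f x ^ n) (ENNReal.ofReal ((n + 1 : ℝ) / n)) ν)
    (hg : MemLp g (ENNReal.ofReal (n + 1)) ν) :
    (∫ x, f x ^ n * g x ∂ν) ^ (n + 1) ≤
      (∫ x, f x ^ (n + 1) ∂ν) ^ n * ∫ x, g x ^ (n + 1) ∂ν := by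
  have hn' : (0 : ℝ) < n := by exact_mod_cast hn
  have hpq : ((n + 1 : ℝ) / n).HolderConjugate (n + 1 : ℝ) := by
    rw [Real.holderConjugate_iff]
    constructor
    · rw [lt_div_iff₀ hn']; linarith
    · field_simp
  have := integral_mul_le_Lp_mul_Lq_of_nonneg hpq
    (Eventually.of_forall fun x => pow_nonneg (hf0 x) n) (Eventually.of_forall hg0) hf hg
  have e1 : ∀ x, (f x ^ n) ^ ((n + 1 : ℝ) / n) = f x ^ (n + 1) := fun x => by
    rw [← Real.rpow_natCast, ← Real.rpow_mul (hf0 x), mul_div_cancel₀ _ hn'.ne']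
    exact_mod_cast Real.rpow_natCast (f x) (n + 1)
  have e2 : ∀ x, (g x) ^ ((n + 1 : ℝ)) = g x ^ (n + 1) := fun x => by
    exact_mod_cast Real.rpow_natCast (g x) (n + 1)
  simp only [e1, e2] at this
  have h0 : 0 ≤ ∫ x, f x ^ n * g x ∂ν :=
    integral_nonneg fun x => mul_nonneg (pow_nonneg (hf0 x) _) (hg0 x)
  have hA : 0 ≤ ∫ x, f x ^ (n + 1) ∂ν := integral_nonneg fun x => pow_nonneg (hf0 x) _
  have hB : 0 ≤ ∫ x, g x ^ (n + 1) ∂ν := integral_nonneg fun x => pow_nonneg (hg0 x) _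
  -- Raising Hölder's inequality to the power n + 1 turns the exponents n/(n+1) and 1/(n+1) into n
  -- and 1.
  refine (pow_le_pow_left₀ h0 this (n + 1)).trans_eq ?_
  rw [mul_pow, ← Real.rpow_natCast, ← Real.rpow_natCast, ← Real.rpow_mul hA, ← Real.rpow_mul hB]
  push_cast
  have a1 : 1 / ((n + 1 : ℝ) / n) * (n + 1) = n := by field_simp
  have a2 : 1 / (n + 1 : ℝ) * (n + 1) = 1 := by field_simp
  rw [a1, a2, Real.rpow_natCast, Real.rpow_one]

end Inequalities

/-! ### Estimates for smooth plates in terms of the Laplacian -/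

section SmoothPlate

variable {L₁ L₂ : ℝ} [Fact (0 < L₁)] [Fact (0 < L₂)]

/-- The constant of `integral_pow_le`. -/
noncomputable def gnConst (L₁ L₂ : ℝ) (k : ℕ) : ℝ := (1 / L₁ + 2 * k) * (1 / L₂ + 2 * k)

omit [Fact (0 < L₁)] [Fact (0 < L₂)] in
lemma gnConst_nonneg (h₁ : 0 < L₁) (h₂ : 0 < L₂) (k : ℕ) : 0 ≤ gnConst L₁ L₂ k := by
  unfold gnConst; positivity

/-- Gagliardo-Nirenberg estimate for all powers of a nonnegative function `W` on the torus with
`|∇W| ≤ 2 √W g m`. -/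
lemma integral_pow_le {W g m : Torus L₁ L₂ → ℝ} {W' : Fin 2 → Torus L₁ L₂ → ℝ}
    (hW : ∀ i, HasPdT i W (W' i)) (cW : Continuous W) (cW' : ∀ i, Continuous (W' i))
    (cg : Continuous g) (cm : Continuous m) (W0 : ∀ p, 0 ≤ W p)
    (m1 : ∀ p, 1 ≤ m p) (hb : ∀ i p, |W' i p| ≤ 2 * √(W p) * (g p * m p)) {k : ℕ} (hk : 1 ≤ k) :
    ∫ p, W p ^ (2 * k) ≤
      (gnConst L₁ L₂ k * ((∫ p, W p) + ∫ p, g p ^ 2)) ^ (2 * k) * ∫ p, m p ^ (4 * k) := by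
  have hL₁ : 0 < L₁ := Fact.out
  have hL₂ : 0 < L₂ := Fact.out
  set A := ∫ p, W p ^ (2 * k) with hA
  -- The W^{1,1} ⊆ L² inequality is applied to W^k. Its gradient is at most 2k W^{k−1/2} g m, so
  -- Cauchy–Schwarz separates the L² norm of g from the square root of P.
  set P := ∫ p, W p ^ (2 * k - 1) * m p ^ 2 with hP
  set N := ∫ p, m p ^ (4 * k) with hN
  set X := (∫ p, W p) + ∫ p, g p ^ 2 with hX
  have A0 : 0 ≤ A := integral_nonneg fun p => pow_nonneg (W0 p) _
  have P0 : 0 ≤ P := integral_nonneg fun p => mul_nonneg (pow_nonneg (W0 p) _) (sq_nonneg _)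
  have N0 : 0 ≤ N := integral_nonneg fun p => by have := m1 p; positivity
  have IW0 : 0 ≤ ∫ p, W p := integral_nonneg W0
  have Ig0 : 0 ≤ ∫ p, g p ^ 2 := integral_nonneg fun p => sq_nonneg _
  have X0 : 0 ≤ X := add_nonneg IW0 Ig0
  have c0 := gnConst_nonneg hL₁ hL₂ k
  have csW : Continuous fun p => √(W p) := cW.sqrt
  have esq : ∀ p, √(W p) ^ 2 = W p := fun p => Real.sq_sqrt (W0 p)
  have hPle : ∫ p, (√(W p) * W p ^ (k - 1) * m p) ^ 2 = P := by
    rw [hP]; congr 1; ext p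
    rw [mul_pow, mul_pow, esq, ← pow_mul, ← pow_succ']
    congr 2; lia
  have ck : Continuous fun p => √(W p) * W p ^ (k - 1) * m p :=
    (csW.mul (cW.pow _)).mul cm
  have b1 : ∫ p, |W p ^ k| ≤ √(∫ p, W p) * √P := by
    rw [← hPle]
    have := integral_mul_le_sqrt_mul_sqrt (Torus.memLp csW 2) (Torus.memLp ck 2)
    simp only [esq] at this
    refine le_trans (integral_mono (Torus.integrable (cW.pow _).abs)
      (Torus.integrable (csW.mul ck)) fun p => ?_) this
    show |W p ^ k| ≤ √(W p) * (√(W p) * W p ^ (k - 1) * m p)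
    rw [abs_of_nonneg (pow_nonneg (W0 p) _)]
    have e : √(W p) * (√(W p) * W p ^ (k - 1) * m p) = W p ^ k * m p := by
      have : √(W p) * (√(W p) * W p ^ (k - 1) * m p) = (√(W p) ^ 2 * W p ^ (k - 1)) * m p := by
        ring
      rw [this, esq, ← pow_succ']
      congr 2; lia
    rw [e]
    exact le_mul_of_one_le_right (pow_nonneg (W0 p) _) (m1 p)
  have b2 : ∀ i, ∫ p, |k * W p ^ (k - 1) * W' i p| ≤ 2 * k * (√(∫ p, g p ^ 2) * √P) := fun i => by
    rw [← hPle]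
    have := integral_mul_le_sqrt_mul_sqrt (Torus.memLp cg 2) (Torus.memLp ck 2)
    refine le_trans (b := ∫ p, (2 * k : ℝ) * (g p * (√(W p) * W p ^ (k - 1) * m p)))
      (integral_mono
      (Torus.integrable ((continuous_const.mul (cW.pow _)).mul (cW' i)).abs)
      (Torus.integrable (continuous_const.mul (cg.mul ck))) fun p => ?_) ?_
    · show |k * W p ^ (k - 1) * W' i p| ≤ (2 * k : ℝ) * (g p * (√(W p) * W p ^ (k - 1) * m p))
      rw [abs_mul, abs_of_nonneg (mul_nonneg (Nat.cast_nonneg k) (pow_nonneg (W0 p) _))]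
      have := mul_le_mul_of_nonneg_left (hb i p)
        (mul_nonneg (Nat.cast_nonneg (α := ℝ) k) (pow_nonneg (W0 p) (k - 1)))
      refine this.trans_eq (by ring)
    · rw [integral_const_mul]
      exact mul_le_mul_of_nonneg_left this (by positivity)
  -- Both factors of the W^{1,1} ⊆ L² inequality carry √X √P. The zeroth-order term also fits
  -- because m ≥ 1.
  have main : A ≤ gnConst L₁ L₂ k * X * P := by
    have h := integral_sq_le_mul ((hW 0).pow k) ((hW 1).pow k) (cW.pow k)
      ((continuous_const.mul (cW.pow _)).mul (cW' 0)) ((continuous_const.mul (cW.pow _)).mul (cW' 1))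
    have e : ∫ p, (W p ^ k) ^ 2 = A := by
      rw [hA]; congr 1; ext p; rw [← pow_mul, mul_comm]
    rw [e] at h
    set a := √(∫ p, W p)
    set b := √(∫ p, g p ^ 2)
    have ha : a ^ 2 = ∫ p, W p := Real.sq_sqrt IW0
    have hbb : b ^ 2 = ∫ p, g p ^ 2 := Real.sq_sqrt Ig0
    have hp : √P ^ 2 = P := Real.sq_sqrt P0
    have a0 : 0 ≤ a := Real.sqrt_nonneg _
    have b0 : 0 ≤ b := Real.sqrt_nonneg _
    have ha' : a ≤ √X := Real.sqrt_le_sqrt (by linarith)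
    have hb' : b ≤ √X := Real.sqrt_le_sqrt (by linarith)
    have f1 : ∀ L > 0, ∀ i, (∫ p, |W p ^ k|) / L + ∫ p, |k * W p ^ (k - 1) * W' i p| ≤
        (1 / L + 2 * k) * √X * √P := fun L hL i => by
      have t1 : (∫ p, |W p ^ k|) / L ≤ (√X * √P) / L := by
        gcongr
        exact b1.trans (by gcongr)
      have t2 : 2 * k * (b * √P) ≤ 2 * k * (√X * √P) := by gcongr
      have t3 := b2 i
      have : (1 / L + 2 * k) * √X * √P = (√X * √P) / L + 2 * k * (√X * √P) := by ring
      linarith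
    have hx : √X ^ 2 = X := Real.sq_sqrt X0
    calc A ≤ _ := h
      _ ≤ ((1 / L₁ + 2 * k) * √X * √P) * ((1 / L₂ + 2 * k) * √X * √P) := by
          refine mul_le_mul (f1 L₁ hL₁ 0) (f1 L₂ hL₂ 1) ?_ (by positivity)
          have : 0 ≤ ∫ p, |W p ^ k| := integral_nonneg fun _ => abs_nonneg _
          have : 0 ≤ ∫ p, |k * W p ^ (k - 1) * W' 1 p| := integral_nonneg fun _ => abs_nonneg _
          positivity
      _ = (1 / L₁ + 2 * k) * (1 / L₂ + 2 * k) * √X ^ 2 * √P ^ 2 := by ring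
      _ = _ := by rw [hx, hp]; rfl
  have hold : P ^ (2 * k) ≤ A ^ (2 * k - 1) * N := by
    have h := integral_pow_mul_pow_le (ν := (volume : Measure (Torus L₁ L₂))) (f := W)
      (g := fun p => m p ^ 2) (n := 2 * k - 1) (by lia) W0 (fun p => sq_nonneg _)
      (Torus.memLp (cW.pow _) _) (Torus.memLp (cm.pow _) _)
    have e : 2 * k - 1 + 1 = 2 * k := by lia
    rw [e] at h
    have e2 : ∀ p, (m p ^ 2) ^ (2 * k) = m p ^ (4 * k) := fun p => by
      rw [← pow_mul]; congr 1; lia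
    simp only [e2] at h
    exact h
  -- Hölder bounds P by a power of A below one. Inserted into the bound of A, this leaves a surplus
  -- factor A, so A^(2k−1) can be cancelled.
  rcases A0.eq_or_lt with h | h
  · rw [← h]; positivity
  have h1 : A ^ (2 * k) ≤ (gnConst L₁ L₂ k * X) ^ (2 * k) * (A ^ (2 * k - 1) * N) := by
    refine (pow_le_pow_left₀ A0 main _).trans ?_
    rw [mul_pow]
    gcongr
  have e : A ^ (2 * k) = A ^ (2 * k - 1) * A := by
    rw [← pow_succ]; congr 1; lia
  rw [e] at h1
  have hpos : 0 < A ^ (2 * k - 1) := by positivity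
  refine le_of_mul_le_mul_left (h1.trans_eq ?_) hpos
  ring

/-- `h` has continuous classical derivatives up to order three, the derivatives commuting. -/
structure IsSmoothPlate (h : Torus L₁ L₂ → ℝ) (D1 : Fin 2 → Torus L₁ L₂ → ℝ)
    (D2 : Fin 2 → Fin 2 → Torus L₁ L₂ → ℝ) (D3 : Fin 2 → Fin 2 → Fin 2 → Torus L₁ L₂ → ℝ) :
    Prop where
  c0 : Continuous h
  c1 : ∀ i, Continuous (D1 i)
  c2 : ∀ i j, Continuous (D2 i j)
  c3 : ∀ i j l, Continuous (D3 i j l)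
  d1 : ∀ i, HasPdT i h (D1 i)
  d2 : ∀ i j, HasPdT j (D1 i) (D2 i j)
  d3 : ∀ i j l, HasPdT l (D2 i j) (D3 i j l)
  symm : ∀ i j, D2 i j = D2 j i
  symm' : ∀ i j l, D3 i j l = D3 i l j

lemma lineInt_lineInt {i j : Fin 2} (hij : i ≠ j) {f : Torus L₁ L₂ → ℝ} (hf : Continuous f)
    (p : Torus L₁ L₂) : lineInt i (lineInt j f) p = ∫ q, f q := by
  have h1 : lineInt 0 (lineInt 1 f) p = ∫ q, f q := by
    rw [lineInt_zero_eq]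
    simp only [lineInt_one_eq]
    exact (integral_prod _ (Torus.integrable hf)).symm
  have h2 : lineInt 1 (lineInt 0 f) p = ∫ q, f q := by
    rw [lineInt_one_eq]
    simp only [lineInt_zero_eq]
    exact (integral_prod_symm _ (Torus.integrable hf)).symm
  fin_cases i <;> fin_cases j <;> simp_all

lemma lineInt_mono {i : Fin 2} {f g : Torus L₁ L₂ → ℝ} (hf : Continuous f) (hg : Continuous g)
    (h : ∀ p, f p ≤ g p) (p : Torus L₁ L₂) : lineInt i f p ≤ lineInt i g p := by
  refine intervalIntegral.integral_mono_on (period_pos i).le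
    ((hf.comp (continuous_shiftT_left i p)).intervalIntegrable _ _)
    ((hg.comp (continuous_shiftT_left i p)).intervalIntegrable _ _) fun s _ => h _

/-- Continuous functions on the torus are bounded on lines in mean square by their norm in the
space `W^{1,1}` in the other direction. -/
lemma lineInt_le_integral {i j : Fin 2} (hij : i ≠ j) {f g : Torus L₁ L₂ → ℝ} (h : HasPdT j f g)
    (hf : Continuous f) (hg : Continuous g) (f0 : ∀ p, 0 ≤ f p) (p : Torus L₁ L₂) :
    lineInt i f p ≤ (∫ q, f q) / period L₁ L₂ j + ∫ q, |g q| := by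
  have hb : ∀ q, f q ≤ lineInt j f q / period L₁ L₂ j + lineInt j (fun p => |g p|) q := fun q => by
    have := abs_le_lineInt h hf hg q
    simpa only [abs_of_nonneg (f0 _)] using this
  have c1 := continuous_lineInt j hf
  have c2 := continuous_lineInt j hg.abs
  refine (lineInt_mono hf ((c1.div_const _).add c2) hb p).trans_eq ?_
  rw [← lineInt_lineInt hij hf p, ← lineInt_lineInt hij hg.abs p]
  unfold lineInt
  rw [← intervalIntegral.integral_div, ← intervalIntegral.integral_add]
  · rfl
  · exact ((c1.div_const _).comp (continuous_shiftT_left i p)).intervalIntegrable _ _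
  · exact (c2.comp (continuous_shiftT_left i p)).intervalIntegrable _ _

lemma sq_lineInt_le {i : Fin 2} {f : Torus L₁ L₂ → ℝ} (hf : Continuous f) (p : Torus L₁ L₂) :
    lineInt i f p ^ 2 ≤ period L₁ L₂ i * lineInt i (fun q => f q ^ 2) p := by
  have hL := (period_pos (L₁ := L₁) (L₂ := L₂) i).le
  unfold lineInt
  simp only [intervalIntegral.integral_of_le hL]
  have hc : Continuous fun s => f (shiftT i s p) := hf.comp (continuous_shiftT_left i p)
  have := sq_integral_le (ν := volume.restrict (Ioc 0 (period L₁ L₂ i)))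
    (f := fun s => f (shiftT i s p)) ?_
  · simpa [hL] using this
  · rw [memLp_two_iff_integrable_sq hc.aestronglyMeasurable]
    exact ((hc.pow 2).integrableOn_Icc (a := 0) (b := period L₁ L₂ i)).mono_set Ioc_subset_Icc_self

/-- The Hölder constant of `IsSmoothPlate.abs_sub_le`. -/
noncomputable def holderConst (L₁ L₂ : ℝ) : ℝ :=
  (L₁ ^ 2 / L₂ + L₁ ^ 2 + 1) + (L₂ ^ 2 / L₁ + L₂ ^ 2 + 1)

lemma holderConst_pos : 0 < holderConst L₁ L₂ := by
  have hL₁ : 0 < L₁ := Fact.out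
  have hL₂ : 0 < L₂ := Fact.out
  unfold holderConst; positivity

namespace IsSmoothPlate

variable {h : Torus L₁ L₂ → ℝ} {D1 : Fin 2 → Torus L₁ L₂ → ℝ}
  {D2 : Fin 2 → Fin 2 → Torus L₁ L₂ → ℝ} {D3 : Fin 2 → Fin 2 → Fin 2 → Torus L₁ L₂ → ℝ}

/-- All second derivatives are controlled by the Laplacian. -/
lemma integral_sq_le (H : IsSmoothPlate h D1 D2 D3) (i j : Fin 2) :
    ∫ p, D2 i j p ^ 2 ≤ ∫ p, (∑ i, D2 i i p) ^ 2 := by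
  -- Integrating by parts twice gives ∫ h_xx h_yy = ∫ h_xy². The square of the Laplacian therefore
  -- integrates to the sum of the squares of all second derivatives.
  have e1 := (H.d2 0 0).integral_mul_eq_neg (H.d3 1 1 0) (H.c1 0) (H.c2 0 0) (H.c2 1 1) (H.c3 1 1 0)
  have e2 := (H.d2 0 1).integral_mul_eq_neg (H.d3 0 1 1) (H.c1 0) (H.c2 0 1) (H.c2 0 1) (H.c3 0 1 1)
  have e3 : D3 1 1 0 = D3 0 1 1 := by
    rw [H.symm' 1 1 0]
    rw [← (H.d3 1 0 1).pdT_eq, ← (H.d3 0 1 1).pdT_eq, H.symm 0 1]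
  rw [e3] at e1
  have e4 : ∫ p, D2 0 0 p * D2 1 1 p = ∫ p, D2 0 1 p ^ 2 := by
    simp only [sq]; linarith
  have I : ∀ i j, Integrable fun p => D2 i j p ^ 2 := fun i j => Torus.integrable ((H.c2 i j).pow 2)
  have I2 : Integrable fun p => D2 0 0 p * D2 1 1 p :=
    Torus.integrable ((H.c2 0 0).mul (H.c2 1 1))
  have e5 : ∫ p, (∑ i, D2 i i p) ^ 2 =
      (∫ p, D2 0 0 p ^ 2) + 2 * (∫ p, D2 0 1 p ^ 2) + ∫ p, D2 1 1 p ^ 2 := by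
    have i1 : Integrable fun p => D2 0 0 p ^ 2 + 2 * (D2 0 0 p * D2 1 1 p) :=
      (I 0 0).add (I2.const_mul _)
    rw [← e4, ← integral_const_mul, ← integral_add (I 0 0) (I2.const_mul _),
      ← integral_add i1 (I 1 1)]
    congr 1; ext p; rw [Fin.sum_univ_two]; ring
  have n : ∀ i j, 0 ≤ ∫ p, D2 i j p ^ 2 := fun i j => integral_nonneg fun _ => sq_nonneg _
  have s : ∫ p, D2 1 0 p ^ 2 = ∫ p, D2 0 1 p ^ 2 := by rw [H.symm]
  have := n 0 0
  have := n 0 1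
  have := n 1 1
  fin_cases i <;> fin_cases j <;> simp only [Fin.zero_eta, Fin.mk_one] <;> linarith

/-- The endpoints of a closed line coincide. This is what makes Poincaré's inequality available for
first derivatives. -/
lemma lineInt_eq_zero (H : IsSmoothPlate h D1 D2 D3) (i : Fin 2) (p : Torus L₁ L₂) :
    lineInt i (D1 i) p = 0 := by
  unfold lineInt
  rw [(H.d1 i).integral_line (H.c1 i), shiftT_period, shiftT_zero, sub_self]

/-- Poincaré's inequality for first derivatives. -/
lemma integral_sq_D1_le (H : IsSmoothPlate h D1 D2 D3) (i : Fin 2) :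
    ∫ p, D1 i p ^ 2 ≤ period L₁ L₂ i ^ 2 * ∫ p, (∑ i, D2 i i p) ^ 2 := by
  have hL := (period_pos (L₁ := L₁) (L₂ := L₂) i).le
  have c := (H.c2 i i).abs
  have hb : ∀ p, D1 i p ^ 2 ≤ period L₁ L₂ i * lineInt i (fun q => |D2 i i q| ^ 2) p := fun p => by
    have := abs_le_lineInt_of_lineInt_eq_zero (H.d2 i i) (H.c1 i) (H.c2 i i) p (H.lineInt_eq_zero i p)
    rw [← sq_abs]
    exact (pow_le_pow_left₀ (abs_nonneg _) this 2).trans (sq_lineInt_le c p)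
  calc ∫ p, D1 i p ^ 2 ≤ ∫ p, period L₁ L₂ i * lineInt i (fun q => |D2 i i q| ^ 2) p :=
        integral_mono (Torus.integrable ((H.c1 i).pow 2))
          (Torus.integrable (continuous_const.mul (continuous_lineInt i (c.pow 2)))) hb
    _ = period L₁ L₂ i ^ 2 * ∫ p, D2 i i p ^ 2 := by
        rw [integral_const_mul, integral_lineInt i (f := fun q => |D2 i i q| ^ 2) (c.pow 2)]
        simp only [sq_abs]; ring
    _ ≤ _ := mul_le_mul_of_nonneg_left (H.integral_sq_le i i) (sq_nonneg _)

/-- A trace estimate on lines: (∂_i h)² belongs to W^{1,1}, so its integral over a line in direction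
i is controlled by its integral and that of its derivative in the other direction. Young's and
Poincaré's inequalities reduce both to the Laplacian. -/
lemma lineInt_sq_le (H : IsSmoothPlate h D1 D2 D3) (i : Fin 2) (p : Torus L₁ L₂) :
    lineInt i (fun q => D1 i q ^ 2) p ≤ holderConst L₁ L₂ * ∫ p, (∑ i, D2 i i p) ^ 2 := by
  set S := ∫ p, (∑ i, D2 i i p) ^ 2
  have S0 : 0 ≤ S := integral_nonneg fun _ => sq_nonneg _
  have hL₁ : 0 < L₁ := Fact.out
  have hL₂ : 0 < L₂ := Fact.out
  have key : ∀ j, i ≠ j → lineInt i (fun q => D1 i q ^ 2) p ≤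
      (period L₁ L₂ i ^ 2 / period L₁ L₂ j + period L₁ L₂ i ^ 2 + 1) * S := fun j hij => by
    have hj := period_pos (L₁ := L₁) (L₂ := L₂) j
    have h1 := lineInt_le_integral hij ((H.d2 i j).pow 2) ((H.c1 i).pow 2)
      ((continuous_const.mul ((H.c1 i).pow _)).mul (H.c2 i j)) (fun _ => sq_nonneg _) p
    have h2 : ∫ q, |(2 : ℕ) * D1 i q ^ (2 - 1) * D2 i j q| ≤
        (∫ q, D1 i q ^ 2) + ∫ q, D2 i j q ^ 2 := by
      rw [← integral_add (f := fun q => D1 i q ^ 2) (g := fun q => D2 i j q ^ 2)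
        (Torus.integrable ((H.c1 i).pow 2)) (Torus.integrable ((H.c2 i j).pow 2))]
      refine integral_mono (Torus.integrable
        ((continuous_const.mul ((H.c1 i).pow _)).mul (H.c2 i j)).abs)
        (Torus.integrable (((H.c1 i).pow 2).add ((H.c2 i j).pow 2))) fun q => ?_
      simp only [Nat.add_one_sub_one, pow_one, Nat.cast_ofNat, abs_mul, abs_two]
      have := sq_nonneg (|D1 i q| - |D2 i j q|)
      rw [sub_sq, sq_abs, sq_abs] at this
      linarith
    have h3 := H.integral_sq_D1_le i
    have h4 := H.integral_sq_le i j
    have h5 : (∫ q, D1 i q ^ 2) / period L₁ L₂ j ≤ period L₁ L₂ i ^ 2 * S / period L₁ L₂ j := by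
      gcongr
    calc _ ≤ _ := h1
      _ ≤ period L₁ L₂ i ^ 2 * S / period L₁ L₂ j + (period L₁ L₂ i ^ 2 * S + S) := by
          gcongr; linarith
      _ = _ := by ring
  have hp1 : 0 ≤ L₁ ^ 2 / L₂ + L₁ ^ 2 + 1 := by positivity
  have hp2 : 0 ≤ L₂ ^ 2 / L₁ + L₂ ^ 2 + 1 := by positivity
  have q1 := mul_nonneg hp1 S0
  have q2 := mul_nonneg hp2 S0
  unfold holderConst
  fin_cases i
  · have := key 1 (by simp)
    simp only [period, Fin.zero_eta, if_true, one_ne_zero, if_false] at this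
    simp only [Fin.zero_eta]
    linarith
  · have := key 0 (by simp)
    simp only [period, Fin.mk_one, if_true, one_ne_zero, if_false] at this
    simp only [Fin.mk_one]
    linarith

/-- Cauchy–Schwarz on a segment of length |s| gives the factor |s|; the integral of (∂_i h)² over
the segment is at most that over the closed line. The restriction to one period keeps the segment
from covering the line more than once. -/
lemma sq_sub_shiftT_le (H : IsSmoothPlate h D1 D2 D3) (i : Fin 2) (p : Torus L₁ L₂) {s : ℝ}
    (hs : |s| ≤ period L₁ L₂ i) :
    (h (shiftT i s p) - h p) ^ 2 ≤ |s| * (holderConst L₁ L₂ * ∫ p, (∑ i, D2 i i p) ^ 2) := by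
  have pos : ∀ (p : Torus L₁ L₂) (s : ℝ), 0 ≤ s → s ≤ period L₁ L₂ i →
      (h (shiftT i s p) - h p) ^ 2 ≤ s * (holderConst L₁ L₂ * ∫ p, (∑ i, D2 i i p) ^ 2) := by
    intro p s hs hs'
    have e := (H.d1 i).integral_line (H.c1 i) p 0 s
    rw [shiftT_zero] at e
    rw [← e, intervalIntegral.integral_of_le hs]
    have hc : Continuous fun s => D1 i (shiftT i s p) :=
      (H.c1 i).comp (continuous_shiftT_left i p)
    have := sq_integral_le (ν := volume.restrict (Ioc 0 s)) (f := fun s => D1 i (shiftT i s p)) ?_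
    · simp only [measureReal_restrict_apply_univ, Real.volume_real_Ioc, sub_zero, max_eq_left hs]
        at this
      refine this.trans (mul_le_mul_of_nonneg_left ?_ hs)
      refine le_trans ?_ (H.lineInt_sq_le i p)
      rw [← intervalIntegral.integral_of_le hs]
      exact intervalIntegral.integral_mono_interval le_rfl hs hs'
        (Eventually.of_forall fun _ => sq_nonneg _) ((hc.pow 2).intervalIntegrable _ _)
    · rw [memLp_two_iff_integrable_sq hc.aestronglyMeasurable]
      exact ((hc.pow 2).integrableOn_Icc (a := 0) (b := s)).mono_set Ioc_subset_Icc_self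
  rcases le_total 0 s with h0 | h0
  · rw [abs_of_nonneg h0] at hs ⊢
    exact pos p s h0 hs
  · rw [abs_of_nonpos h0] at hs ⊢
    have := pos (shiftT i s p) (-s) (by linarith) hs
    rw [shiftT_shiftT, add_neg_cancel, shiftT_zero] at this
    rw [← neg_sub, neg_sq]
    exact this

/-- Bounds of the first derivatives in all Lebesgue spaces. -/
lemma integral_D1_pow_le (H : IsSmoothPlate h D1 D2 D3) (i : Fin 2) {k : ℕ} (hk : 1 ≤ k) :
    ∫ p, D1 i p ^ (4 * k) ≤
      (gnConst L₁ L₂ k * ((period L₁ L₂ i ^ 2 + 2) * ∫ p, (∑ i, D2 i i p) ^ 2)) ^ (2 * k)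
        * (volume : Measure (Torus L₁ L₂)).real univ := by
  have c := (H.c1 i)
  have cs : Continuous fun p => D2 i 0 p ^ 2 + D2 i 1 p ^ 2 :=
    ((H.c2 i 0).pow 2).add ((H.c2 i 1).pow 2)
  -- Apply the power estimate to W = (∂_i h)² with weight m = 1 and g the norm of the gradient of
  -- ∂_i h.
  have key := integral_pow_le (fun j => (H.d2 i j).pow 2) (c.pow 2)
    (fun j => (continuous_const.mul (c.pow _)).mul (H.c2 i j)) cs.sqrt
    (continuous_const (y := (1 : ℝ))) (fun p => sq_nonneg _)
    (fun _ => le_rfl) (fun j p => ?_) hk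
  · have e1 : ∀ p, (D1 i p ^ 2) ^ (2 * k) = D1 i p ^ (4 * k) := fun p => by
      rw [← pow_mul]; congr 1; lia
    have e2 : ∀ p, √(D2 i 0 p ^ 2 + D2 i 1 p ^ 2) ^ 2 = D2 i 0 p ^ 2 + D2 i 1 p ^ 2 := fun p =>
      Real.sq_sqrt (by positivity)
    simp only [e1, e2, one_pow, integral_const, smul_eq_mul, mul_one] at key
    refine key.trans ?_
    have g0 : 0 ≤ gnConst L₁ L₂ k := gnConst_nonneg Fact.out Fact.out k
    have n1 : 0 ≤ ∫ p, D1 i p ^ 2 := integral_nonneg fun _ => sq_nonneg _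
    have n2 : 0 ≤ ∫ p, (D2 i 0 p ^ 2 + D2 i 1 p ^ 2) := integral_nonneg fun _ => by positivity
    gcongr
    rw [integral_add (f := fun q => D2 i 0 q ^ 2) (g := fun q => D2 i 1 q ^ 2)
      (Torus.integrable ((H.c2 i 0).pow 2)) (Torus.integrable ((H.c2 i 1).pow 2))]
    have := H.integral_sq_D1_le i
    have := H.integral_sq_le i 0
    have := H.integral_sq_le i 1
    linarith
  · simp only [Nat.add_one_sub_one, pow_one, Nat.cast_ofNat, abs_mul, abs_two, mul_one,
      Real.sqrt_sq_eq_abs]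
    gcongr
    rw [← Real.sqrt_sq_eq_abs]
    apply Real.sqrt_le_sqrt
    fin_cases j <;> simp <;> positivity

/-- `|∂_i h|² / h` is bounded in `L²` by the second derivatives, for nonnegative `h`. -/
lemma integral_D1_pow_four_div_le (H : IsSmoothPlate h D1 D2 D3) (h0 : ∀ p, 0 ≤ h p) {δ : ℝ}
    (hδ : 0 < δ) (i : Fin 2) :
    ∫ p, D1 i p ^ 4 / (h p + δ) ^ 2 ≤ 9 * ∫ p, (∑ i, D2 i i p) ^ 2 := by
  have hp : ∀ p, 0 < h p + δ := fun p => by have := h0 p; linarith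
  have cu : Continuous fun p => (h p + δ)⁻¹ :=
    (H.c0.add continuous_const).inv₀ fun p => (hp p).ne'
  have du : HasPdT i (fun p => (h p + δ)⁻¹) (fun p => -((h p + δ) ^ 2)⁻¹ * D1 i p) :=
    ((H.d1 i).add_const δ).comp_deriv (φ := fun x => x⁻¹) (φ' := fun x => -(x ^ 2)⁻¹) fun p =>
      hasDerivAt_inv (hp p).ne'
  have cv := H.c1 i
  have cv' := H.c2 i i
  have cu2 : Continuous fun p => ((h p + δ) ^ 2)⁻¹ :=
    ((H.c0.add continuous_const).pow 2).inv₀ fun p => (pow_pos (hp p) 2).ne'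
  -- Write (∂h)⁴/(h+δ)² as −(∂h)³ ∂(1/(h+δ)) and integrate by parts: A = 3 ∫ (∂h)²/(h+δ) ∂²h. By
  -- Cauchy–Schwarz A² ≤ 9 A ∫ (∂²h)², and one factor A cancels. The shift δ keeps 1/(h+δ) regular
  -- and does not enter the bound.
  have e := ((H.d2 i i).pow 3).integral_mul_eq_neg du (cv.pow 3)
    ((continuous_const.mul (cv.pow _)).mul cv') cu (cu2.neg.mul cv)
  set A := ∫ p, D1 i p ^ 4 / (h p + δ) ^ 2 with hA
  have cw : Continuous fun p => D1 i p ^ 2 * (h p + δ)⁻¹ := (cv.pow 2).mul cu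
  have e1 : A = 3 * ∫ p, (D1 i p ^ 2 * (h p + δ)⁻¹) * D2 i i p := by
    rw [← integral_const_mul]
    have : A = -∫ p, D1 i p ^ 3 * (-((h p + δ) ^ 2)⁻¹ * D1 i p) := by
      rw [← integral_neg, hA]
      congr 1; ext p; rw [div_eq_mul_inv]; ring
    rw [this, e, neg_neg]
    congr 1; ext p; push_cast; ring
  have e2 : A = ∫ p, (D1 i p ^ 2 * (h p + δ)⁻¹) ^ 2 := by
    rw [hA]; congr 1; ext p; rw [div_eq_mul_inv, mul_pow, inv_pow, ← pow_mul]
  have A0 : 0 ≤ A := by rw [e2]; exact integral_nonneg fun _ => sq_nonneg _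
  have cs := sq_integral_mul_le (Torus.memLp cw 2) (Torus.memLp cv' 2)
  rw [← e2] at cs
  have b := H.integral_sq_le i i
  have n : 0 ≤ ∫ p, D2 i i p ^ 2 := integral_nonneg fun _ => sq_nonneg _
  rcases A0.eq_or_lt with hA0 | hA0
  · rw [← hA0]; linarith
  · have : A * A ≤ A * (9 * ∫ p, D2 i i p ^ 2) := by
      have : A ^ 2 = 9 * (∫ p, (D1 i p ^ 2 * (h p + δ)⁻¹) * D2 i i p) ^ 2 := by
        nth_rw 1 [e1]; ring
      nlinarith
    have := le_of_mul_le_mul_left this hA0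
    linarith

end IsSmoothPlate

end SmoothPlate

/-! ### Almost everywhere convergent subsequences -/

section Extraction

variable {α : Type*} [MeasurableSpace α] {ν : Measure α}

/-- Choose indices whose integrals are at most 2⁻ⁿ. The series of functions then has a finite
integral, hence converges almost everywhere, and its terms tend to zero. -/
lemma exists_subseq_ae_tendsto_zero {f : ℕ → α → ENNReal} (hf : ∀ n, AEMeasurable (f n) ν)
    (h : Tendsto (fun n => ∫⁻ x, f n x ∂ν) atTop (𝓝 0)) :
    ∃ ns : ℕ → ℕ, StrictMono ns ∧ ∀ᵐ x ∂ν, Tendsto (fun n => f (ns n) x) atTop (𝓝 0) := by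
  obtain ⟨ns, hns, hle⟩ := extraction_forall_of_eventually' (P := fun n k =>
    ∫⁻ x, f k x ∂ν ≤ (2⁻¹ : ENNReal) ^ n) fun n => by
      have : (0 : ENNReal) < (2⁻¹ : ENNReal) ^ n := ENNReal.pow_pos (by simp) n
      obtain ⟨N, hN⟩ := eventually_atTop.1 (h.eventually (ge_mem_nhds this))
      exact ⟨N, hN⟩
  refine ⟨ns, hns, ?_⟩
  have hsum : ∫⁻ x, ∑' n, f (ns n) x ∂ν ≠ ⊤ := by
    rw [lintegral_tsum fun n => hf _]
    refine ne_top_of_le_ne_top ?_ (ENNReal.tsum_le_tsum hle)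
    rw [ENNReal.tsum_geometric]
    simp
  filter_upwards [ae_lt_top' (AEMeasurable.tsum fun n => hf _) hsum] with x hx
  exact ENNReal.tendsto_atTop_zero_of_tsum_ne_top hx.ne

end Extraction

/-! ### Smooth functions on the torus through their periodic lifts -/

section SmoothTest

variable {L₁ L₂ : ℝ}

/-- The covering of the torus by the plane. -/
def projT (a : ℝ × ℝ) : Torus L₁ L₂ := ((a.1 : AddCircle L₁), (a.2 : AddCircle L₂))

lemma isOpenQuotientMap_projT : IsOpenQuotientMap (projT : ℝ × ℝ → Torus L₁ L₂) :=
  IsOpenQuotientMap.prodMap QuotientAddGroup.isOpenQuotientMap_mk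
    QuotientAddGroup.isOpenQuotientMap_mk

/-- The coordinate direction in the plane. -/
def dirT (i : Fin 2) : ℝ × ℝ := if i = 0 then (1, 0) else (0, 1)

lemma shiftT_projT (i : Fin 2) (s : ℝ) (a : ℝ × ℝ) :
    shiftT i s (projT a : Torus L₁ L₂) = projT (a + s • dirT i) := by
  fin_cases i <;> simp [shiftT, projT, dirT]

lemma exists_projT (p : Torus L₁ L₂) : ∃ a, projT a = p := isOpenQuotientMap_projT.surjective p

lemma projT_sub (a b : ℝ × ℝ) : (projT (a - b) : Torus L₁ L₂) = projT a - projT b := by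
  simp [projT]

lemma isCkT_iff {k : WithTop ℕ∞} {f : Torus L₁ L₂ → ℝ} :
    IsCkT k f ↔ ContDiff ℝ k fun a => f (projT a) := Iff.rfl

lemma IsCkT.continuous {k : WithTop ℕ∞} {f : Torus L₁ L₂ → ℝ} (h : IsCkT k f) : Continuous f :=
  isOpenQuotientMap_projT.continuous_comp_iff.1 (ContDiff.continuous (isCkT_iff.1 h))

lemma IsCkT.hasDerivAt {k : WithTop ℕ∞} {f : Torus L₁ L₂ → ℝ} (h : IsCkT k f) (hk : k ≠ 0)
    (i : Fin 2) (a : ℝ × ℝ) : HasDerivAt (fun s => f (shiftT i s (projT a)))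
      (fderiv ℝ (fun a => f (projT a)) a (dirT i)) 0 := by
  simp only [shiftT_projT]
  have h1 : HasFDerivAt (fun a => f (projT a)) (fderiv ℝ (fun a => f (projT a)) a)
      (a + (0 : ℝ) • dirT i) := by
    simpa using ((isCkT_iff.1 h).differentiable hk a).hasFDerivAt
  have h2 : HasDerivAt (fun s : ℝ => a + s • dirT i) (dirT i) 0 := by
    simpa using ((hasDerivAt_id (0 : ℝ)).smul_const (dirT i)).const_add a
  exact h1.comp_hasDerivAt (0 : ℝ) h2

lemma IsCkT.pdT_projT {k : WithTop ℕ∞} {f : Torus L₁ L₂ → ℝ} (h : IsCkT k f) (hk : k ≠ 0)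
    (i : Fin 2) (a : ℝ × ℝ) :
    pdT i f (projT a) = fderiv ℝ (fun a => f (projT a)) a (dirT i) :=
  (h.hasDerivAt hk i a).deriv

lemma IsCkT.hasPdT {k : WithTop ℕ∞} {f : Torus L₁ L₂ → ℝ} (h : IsCkT k f) (hk : k ≠ 0)
    (i : Fin 2) : HasPdT i f (pdT i f) := fun p => by
  obtain ⟨a, rfl⟩ := exists_projT p
  rw [h.pdT_projT hk]
  exact h.hasDerivAt hk i a

lemma IsCkT.pdT {f : Torus L₁ L₂ → ℝ} (h : IsCkT ∞ f) (i : Fin 2) : IsCkT ∞ (pdT i f) := by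
  rw [isCkT_iff]
  have : (fun a => FluidPlate.pdT i f (projT a)) =
      fun a => fderiv ℝ (fun a => f (projT a)) a (dirT i) :=
    funext fun a => h.pdT_projT (by simp) i a
  rw [this]
  exact ((isCkT_iff.1 h).fderiv_right (m := ∞) (by simp)).clm_apply contDiff_const

lemma IsCkT.pdT_comm {f : Torus L₁ L₂ → ℝ} (h : IsCkT ∞ f) (i j : Fin 2) :
    FluidPlate.pdT i (FluidPlate.pdT j f) = FluidPlate.pdT j (FluidPlate.pdT i f) := by
  have key : ∀ i j : Fin 2, ∀ a, FluidPlate.pdT i (FluidPlate.pdT j f) (projT a) =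
      fderiv ℝ (fderiv ℝ fun a => f (projT a)) a (dirT i) (dirT j) := fun i j a => by
    rw [(h.pdT j).pdT_projT (by simp)]
    have : (fun a => FluidPlate.pdT j f (projT a)) =
        fun a => fderiv ℝ (fun a => f (projT a)) a (dirT j) :=
      funext fun a => h.pdT_projT (by simp) j a
    rw [this]
    have hd : DifferentiableAt ℝ (fderiv ℝ fun a => f (projT a)) a :=
      ((isCkT_iff.1 h).fderiv_right (m := 1) (by norm_cast)).differentiable (by simp) a
    rw [fderiv_clm_apply hd (differentiableAt_const _)]
    simp
  funext p
  obtain ⟨a, rfl⟩ := exists_projT p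
  rw [key, key]
  exact ((isCkT_iff.1 h).contDiffAt.isSymmSndFDerivAt
    (by simpa using WithTop.coe_le_coe.2 (le_top (a := (2 : ℕ∞))))).eq _ _

lemma IsCkT.comp_sub_left {f : Torus L₁ L₂ → ℝ} (h : IsCkT ∞ f) (p : Torus L₁ L₂) :
    IsCkT ∞ fun q => f (p - q) := by
  obtain ⟨b, rfl⟩ := exists_projT p
  rw [isCkT_iff] at *
  simp only [← projT_sub]
  exact h.comp (contDiff_const.sub contDiff_id)

lemma shiftT_sub (i : Fin 2) (s : ℝ) (p q : Torus L₁ L₂) :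
    shiftT i s p - q = shiftT i s (p - q) := by
  simp only [shiftT_eq]; abel

lemma sub_shiftT (i : Fin 2) (s : ℝ) (p q : Torus L₁ L₂) :
    p - shiftT i s q = shiftT i (-s) (p - q) := by
  have : (vecT i (-s) : Torus L₁ L₂) = -vecT i s := by
    rw [eq_neg_iff_add_eq_zero, ← vecT_add, neg_add_cancel, vecT_zero]
  simp only [shiftT_eq, this]; abel

lemma HasPdT.comp_sub_left {i : Fin 2} {f g : Torus L₁ L₂ → ℝ} (h : HasPdT i f g)
    (p : Torus L₁ L₂) : HasPdT i (fun q => f (p - q)) (fun q => -g (p - q)) := fun q => by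
  simp only [sub_shiftT]
  have h0 : HasDerivAt (fun s => f (shiftT i s (p - q))) (g (p - q)) (-0) := by
    rw [neg_zero]; exact h (p - q)
  have := HasDerivAt.scomp (0 : ℝ) (h := fun s : ℝ => -s) (h' := -1) h0 (hasDerivAt_neg 0)
  simpa [Function.comp_def] using this

end SmoothTest

/-! ### Mollification on the torus -/

section Convolution

variable {L₁ L₂ : ℝ} [Fact (0 < L₁)] [Fact (0 < L₂)]

/-- Convolution on the torus. -/
noncomputable def convT (g k : Torus L₁ L₂ → ℝ) (p : Torus L₁ L₂) : ℝ := ∫ q, g q * k (p - q)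

lemma exists_bound {k : Torus L₁ L₂ → ℝ} (hk : Continuous k) : ∃ C, ∀ p, |k p| ≤ C := by
  obtain ⟨C, hC⟩ := isCompact_univ.exists_bound_of_continuousOn hk.continuousOn
  exact ⟨C, fun p => hC p (mem_univ p)⟩

lemma integrable_convT {g k : Torus L₁ L₂ → ℝ} (hg : Integrable g) (hk : Continuous k)
    (p : Torus L₁ L₂) : Integrable fun q => g q * k (p - q) := by
  obtain ⟨C, hC⟩ := exists_bound hk
  exact hg.mul_bdd (hk.comp (continuous_const.sub continuous_id)).aestronglyMeasurable
    (Eventually.of_forall fun q => hC (p - q))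

lemma continuous_convT {g k : Torus L₁ L₂ → ℝ} (hg : Integrable g) (hk : Continuous k) :
    Continuous (convT g k) := by
  obtain ⟨C, hC⟩ := exists_bound hk
  refine continuous_of_dominated (bound := fun q => |g q| * C)
    (fun p => (integrable_convT hg hk p).aestronglyMeasurable)
    (fun p => Eventually.of_forall fun q => ?_) (hg.abs.mul_const C)
    (Eventually.of_forall fun q => ?_)
  · rw [norm_mul]
    exact mul_le_mul_of_nonneg_left (hC _) (abs_nonneg _)
  · exact continuous_const.mul (hk.comp (continuous_id.sub continuous_const))

lemma hasPdT_convT {i : Fin 2} {g k k' : Torus L₁ L₂ → ℝ} (hg : Integrable g) (hk : Continuous k)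
    (hk' : Continuous k') (h : HasPdT i k k') : HasPdT i (convT g k) (convT g k') := fun p => by
  obtain ⟨C, hC⟩ := exists_bound hk'
  have := hasDerivAt_integral_of_dominated_loc_of_deriv_le (μ := (volume : Measure (Torus L₁ L₂)))
    (F := fun s q => g q * k (shiftT i s p - q)) (F' := fun s q => g q * k' (shiftT i s p - q))
    (x₀ := (0 : ℝ)) (s := univ) (bound := fun q => |g q| * C) univ_mem
    (Eventually.of_forall fun s => (integrable_convT hg hk _).aestronglyMeasurable)
    (integrable_convT hg hk _) (integrable_convT hg hk' _).aestronglyMeasurable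
    (Eventually.of_forall fun q s _ => by
      rw [norm_mul]
      exact mul_le_mul_of_nonneg_left (hC _) (abs_nonneg _)) (hg.abs.mul_const C)
    (Eventually.of_forall fun q s _ => by
      simp only [shiftT_sub]
      exact (h.hasDerivAt (p - q) s).const_mul _)
  have h2 := this.2
  simp only [shiftT_zero] at h2
  exact h2

/-- The reflected kernel q ↦ k (p − q) is an admissible test function. The sign from the reflection
and the sign from the weak formulation cancel. -/
lemma HasWeakPdT.convT_eq {i : Fin 2} {f g k : Torus L₁ L₂ → ℝ} (h : HasWeakPdT i f g)
    (hk : IsCkT ∞ k) : convT f (pdT i k) = convT g k := funext fun p => by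
  have h1 := h _ (hk.comp_sub_left p)
  rw [((hk.hasPdT (by simp) i).comp_sub_left p).pdT_eq] at h1
  simp only [mul_neg, integral_neg, neg_inj] at h1
  exact h1

/-- The mollification of an integrable function is smooth. -/
lemma isSmoothPlate_convT {g k : Torus L₁ L₂ → ℝ} (hg : Integrable g) (hk : IsCkT ∞ k) :
    IsSmoothPlate (convT g k) (fun i => convT g (pdT i k)) (fun i j => convT g (pdT j (pdT i k)))
      (fun i j l => convT g (pdT l (pdT j (pdT i k)))) where
  c0 := continuous_convT hg hk.continuous
  c1 i := continuous_convT hg (hk.pdT i).continuous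
  c2 i j := continuous_convT hg ((hk.pdT i).pdT j).continuous
  c3 i j l := continuous_convT hg (((hk.pdT i).pdT j).pdT l).continuous
  d1 i := hasPdT_convT hg hk.continuous (hk.pdT i).continuous (hk.hasPdT (by simp) i)
  d2 i j := hasPdT_convT hg (hk.pdT i).continuous ((hk.pdT i).pdT j).continuous
    ((hk.pdT i).hasPdT (by simp) j)
  d3 i j l := hasPdT_convT hg ((hk.pdT i).pdT j).continuous (((hk.pdT i).pdT j).pdT l).continuous
    (((hk.pdT i).pdT j).hasPdT (by simp) l)
  symm i j := by rw [hk.pdT_comm]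
  symm' i j l := by rw [(hk.pdT i).pdT_comm]

instance : (volume : Measure (Torus L₁ L₂)).IsNegInvariant :=
  Measure.IsAddHaarMeasure.isNegInvariant_of_regular _

lemma integral_sub_left (f : Torus L₁ L₂ → ℝ) (p : Torus L₁ L₂) :
    ∫ q, f (p - q) = ∫ q, f q := integral_sub_left_eq_self f volume p

/-- Mollification is a contraction of `L²`. -/
lemma integral_sq_convT_le {g k : Torus L₁ L₂ → ℝ} (hg : MemLp g 2) (hk : Continuous k)
    (k0 : ∀ p, 0 ≤ k p) (k1 : ∫ p, k p = 1) : ∫ p, convT g k p ^ 2 ≤ ∫ p, g p ^ 2 := by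
  have ig := hg.integrable one_le_two
  have ig2 : Integrable fun q => g q ^ 2 := hg.integrable_sq
  obtain ⟨C, hC⟩ := exists_bound hk
  -- Jensen's inequality for the probability density k, as Cauchy–Schwarz after splitting k = √k √k.
  have b : ∀ p, convT g k p ^ 2 ≤ ∫ q, g q ^ 2 * k (p - q) := fun p => by
    have cs : Continuous fun q => √(k (p - q)) :=
      (hk.comp (continuous_const.sub continuous_id)).sqrt
    have sq : ∀ q, √(k (p - q)) ^ 2 = k (p - q) := fun q => Real.sq_sqrt (k0 _)
    have m : MemLp (fun q => g q * √(k (p - q))) 2 := by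
      refine (memLp_two_iff_integrable_sq (f := fun q => g q * √(k (p - q)))
        (hg.aestronglyMeasurable.mul cs.aestronglyMeasurable)).2 ?_
      simp only [mul_pow, sq]
      exact integrable_convT ig2 hk p
    have := sq_integral_mul_le m (Torus.memLp cs 2)
    simp only [mul_pow, sq, integral_sub_left, k1, mul_one] at this
    refine le_trans (le_of_eq ?_) this
    rw [convT]; congr 2; ext q
    rw [mul_assoc, ← pow_two, sq]
  have iprod : Integrable (fun a : Torus L₁ L₂ × Torus L₁ L₂ => g a.2 ^ 2 * k (a.1 - a.2))
      (volume.prod volume) := by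
    refine Integrable.mul_bdd (c := C) (ig2.comp_snd volume)
      (hk.comp (continuous_fst.sub continuous_snd)).aestronglyMeasurable
      (Eventually.of_forall fun a => hC _)
  calc ∫ p, convT g k p ^ 2 ≤ ∫ p, ∫ q, g q ^ 2 * k (p - q) :=
        integral_mono (Torus.integrable ((continuous_convT ig hk).pow 2))
          iprod.integral_prod_left b
    _ = ∫ q, ∫ p, g q ^ 2 * k (p - q) := integral_integral_swap iprod
    _ = ∫ q, g q ^ 2 := by
        simp only [integral_const_mul]
        congr 1; ext q
        rw [integral_sub_right_eq_self k q, k1, mul_one]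

lemma convT_nonneg {g k : Torus L₁ L₂ → ℝ} (hg : ∀ p, 0 ≤ g p) (k0 : ∀ p, 0 ≤ k p)
    (p : Torus L₁ L₂) : 0 ≤ convT g k p := integral_nonneg fun q => mul_nonneg (hg q) (k0 _)

/-- A smooth mollifier with support in a coordinate square of half-width `ε`. -/
structure IsMollifier (ε : ℝ) (k : Torus L₁ L₂ → ℝ) : Prop where
  smooth : IsCkT ∞ k
  nonneg : ∀ p, 0 ≤ k p
  integral_eq : ∫ p, k p = 1
  supp : ∀ p, k p ≠ 0 → ∃ a : ℝ × ℝ, |a.1| < ε ∧ |a.2| < ε ∧ p = projT a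

lemma norm_projT_lt {ε : ℝ} {a : ℝ × ℝ} (h1 : |a.1| < ε) (h2 : |a.2| < ε) :
    ‖(projT a : Torus L₁ L₂)‖ < ε := by
  have e1 : ‖(a.1 : AddCircle L₁)‖ ≤ |a.1| := QuotientAddGroup.norm_mk_le_norm (m := a.1)
  have e2 : ‖(a.2 : AddCircle L₂)‖ ≤ |a.2| := QuotientAddGroup.norm_mk_le_norm (m := a.2)
  exact max_lt (e1.trans_lt h1) (e2.trans_lt h2)

/-- A smooth periodic bump on the line. -/
noncomputable def perBump (L ε : ℝ) (s : ℝ) : ℝ :=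
  Real.smoothTransition (Real.cos (2 * Real.pi / L * s) - (1 - 8 * ε ^ 2 / L ^ 2))

lemma perBump_periodic {L : ℝ} (hL : 0 < L) (ε : ℝ) : Function.Periodic (perBump L ε) L := by
  intro s
  unfold perBump
  have : 2 * Real.pi / L * (s + L) = 2 * Real.pi / L * s + 2 * Real.pi := by
    field_simp
  rw [this, Real.cos_add_two_pi]

/-- The threshold in `perBump` comes from cos x ≤ 1 − 2x²/π² on [−π, π]. At x = 2πt/L the right side
is 1 − 8t²/L², which exceeds 1 − 8ε²/L² only if |t| < ε. -/
lemma exists_of_perBump_ne_zero {L ε : ℝ} (hL : 0 < L) (hε : 0 < ε) (s : ℝ)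
    (h : perBump L ε s ≠ 0) : ∃ t, |t| < ε ∧ (s : AddCircle L) = t := by
  have : Fact (0 < L) := ⟨hL⟩
  obtain ⟨t, ht, hst⟩ : ∃ t ∈ Ico (-(L / 2)) (-(L / 2) + L), (t : AddCircle L) = s := by
    have := (AddCircle.coe_image_Ico_eq L (-(L / 2))).ge (mem_univ (s : AddCircle L))
    exact this
  refine ⟨t, ?_, hst.symm⟩
  have hper : perBump L ε s = perBump L ε t := by
    rw [← (perBump_periodic hL ε).lift_coe s, ← (perBump_periodic hL ε).lift_coe t]
    exact congrArg _ hst.symm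
  rw [hper] at h
  have h1 : 1 - 8 * ε ^ 2 / L ^ 2 < Real.cos (2 * Real.pi / L * t) := by
    by_contra hc
    exact h (Real.smoothTransition.zero_of_nonpos (by linarith))
  have h2 : |t| ≤ L / 2 := abs_le.2 ⟨ht.1, by linarith [ht.2]⟩
  have hb : |2 * Real.pi / L * t| ≤ Real.pi := by
    rw [abs_mul, abs_of_pos (by positivity)]
    calc 2 * Real.pi / L * |t| ≤ 2 * Real.pi / L * (L / 2) := by gcongr
      _ = Real.pi := by field_simp
  have h3 := Real.cos_le_one_sub_mul_cos_sq hb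
  have h4 : 2 / Real.pi ^ 2 * (2 * Real.pi / L * t) ^ 2 = 8 * t ^ 2 / L ^ 2 := by
    field_simp; ring
  rw [h4] at h3
  have h5 : 8 * t ^ 2 / L ^ 2 < 8 * ε ^ 2 / L ^ 2 := by linarith
  rw [div_lt_div_iff_of_pos_right (by positivity)] at h5
  exact abs_lt_of_sq_lt_sq (by linarith) hε.le

lemma exists_isMollifier {ε : ℝ} (hε : 0 < ε) : ∃ k : Torus L₁ L₂ → ℝ, IsMollifier ε k := by
  have hL₁ : 0 < L₁ := Fact.out
  have hL₂ : 0 < L₂ := Fact.out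
  set b : Torus L₁ L₂ → ℝ := fun p =>
    (perBump_periodic hL₁ ε).lift p.1 * (perBump_periodic hL₂ ε).lift p.2
  have hb : ∀ a, b (projT a) = perBump L₁ ε a.1 * perBump L₂ ε a.2 := fun a => rfl
  have cd : ∀ L : ℝ, ContDiff ℝ ∞ (perBump L ε) := fun L =>
    Real.smoothTransition.contDiff.comp
      ((Real.contDiff_cos.comp (contDiff_const.mul contDiff_id)).sub contDiff_const)
  have sb : IsCkT ∞ b := by
    rw [isCkT_iff]
    simp only [hb]
    exact ((cd L₁).comp contDiff_fst).mul ((cd L₂).comp contDiff_snd)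
  have b0 : ∀ p, 0 ≤ b p := fun p => by
    obtain ⟨a, rfl⟩ := exists_projT p
    rw [hb]
    exact mul_nonneg (Real.smoothTransition.nonneg _) (Real.smoothTransition.nonneg _)
  have p0 : ∀ L : ℝ, 0 < L → 0 < perBump L ε 0 := fun L hL => by
    refine Real.smoothTransition.pos_of_pos ?_
    simp only [mul_zero, Real.cos_zero, sub_sub_cancel]
    positivity
  have hpos : 0 < ∫ p, b p := by
    refine sb.continuous.integral_pos_of_hasCompactSupport_nonneg_nonzero
      (HasCompactSupport.of_compactSpace b) b0 (x := projT 0) ?_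
    rw [hb]
    exact (mul_pos (p0 L₁ hL₁) (p0 L₂ hL₂)).ne'
  refine ⟨fun p => b p / ∫ p, b p, ?_, fun p => div_nonneg (b0 p) hpos.le, ?_, fun p hp => ?_⟩
  · exact (isCkT_iff.1 sb).div_const _
  · rw [integral_div, div_self hpos.ne']
  · obtain ⟨a, rfl⟩ := exists_projT p
    have hp' : b (projT a) ≠ 0 := fun h => hp (by simp only [h, zero_div])
    rw [hb] at hp'
    obtain ⟨t₁, h1, e1⟩ := exists_of_perBump_ne_zero hL₁ hε a.1 (left_ne_zero_of_mul hp')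
    obtain ⟨t₂, h2, e2⟩ := exists_of_perBump_ne_zero hL₂ hε a.2 (right_ne_zero_of_mul hp')
    exact ⟨(t₁, t₂), h1, h2, Prod.ext e1 e2⟩

lemma IsMollifier.abs_convT_sub_le {ε c : ℝ} {g k : Torus L₁ L₂ → ℝ} (hk : IsMollifier ε k)
    (hg : Continuous g) (hc : ∀ p q, dist p q < ε → |g p - g q| ≤ c) (p : Torus L₁ L₂) :
    |convT g k p - g p| ≤ c := by
  have ig := Torus.integrable hg
  have ik : Integrable fun q => k (p - q) :=
    Torus.integrable (hk.smooth.continuous.comp (continuous_const.sub continuous_id))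
  have e : convT g k p - g p = ∫ q, (g q - g p) * k (p - q) := by
    simp only [sub_mul]
    rw [integral_sub (integrable_convT ig hk.smooth.continuous p) (ik.const_mul _),
      integral_const_mul, integral_sub_left, hk.integral_eq, mul_one, convT]
  have b : ‖∫ q, (g q - g p) * k (p - q)‖ ≤ ∫ q, c * k (p - q) := by
    refine norm_integral_le_of_norm_le (ik.const_mul c) (Eventually.of_forall fun q => ?_)
    rw [norm_mul, Real.norm_of_nonneg (hk.nonneg _)]
    by_cases h : k (p - q) = 0
    · simp [h]
    · obtain ⟨a, h1, h2, h3⟩ := hk.supp _ h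
      refine mul_le_mul_of_nonneg_right (hc q p ?_) (hk.nonneg _)
      rw [dist_comm, dist_eq_norm, h3]
      exact norm_projT_lt h1 h2
  rw [integral_const_mul, integral_sub_left, hk.integral_eq, mul_one] at b
  rw [e]; exact b

/-- Uniform convergence of mollifications of continuous functions. -/
lemma tendstoUniformly_convT {g : Torus L₁ L₂ → ℝ} {k : ℕ → Torus L₁ L₂ → ℝ} (hg : Continuous g)
    (hk : ∀ n : ℕ, IsMollifier (1 / (n + 1 : ℝ)) (k n)) :
    TendstoUniformly (fun n => convT g (k n)) g atTop := by
  rw [Metric.tendstoUniformly_iff]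
  intro c hc
  obtain ⟨δ, hδ, h⟩ := Metric.uniformContinuous_iff.1
    (CompactSpace.uniformContinuous_of_continuous hg) (c / 2) (half_pos hc)
  have : ∀ᶠ n : ℕ in atTop, 1 / (n + 1 : ℝ) < δ :=
    tendsto_one_div_add_atTop_nhds_zero_nat.eventually_lt_const hδ
  filter_upwards [this] with n hn p
  rw [dist_comm, Real.dist_eq]
  refine ((hk n).abs_convT_sub_le hg (c := c / 2) (fun p q hpq => ?_) p).trans_lt (half_lt_self hc)
  rw [← Real.dist_eq]
  exact (h (hpq.trans hn)).le

/-- `L²` convergence of mollifications. -/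
lemma tendsto_integral_sq_convT_sub {g : Torus L₁ L₂ → ℝ} {k : ℕ → Torus L₁ L₂ → ℝ}
    (hg : MemLp g 2) (hk : ∀ n : ℕ, IsMollifier (1 / (n + 1 : ℝ)) (k n)) :
    Tendsto (fun n => ∫ p, (convT g (k n) p - g p) ^ 2) atTop (𝓝 0) := by
  have ig := hg.integrable one_le_two
  rw [Metric.tendsto_atTop]
  intro c hc
  set V := (volume : Measure (Torus L₁ L₂)).real univ
  have V0 : 0 ≤ V := measureReal_nonneg
  -- Density of continuous functions. The error splits into three parts, whose squares enter with a
  -- factor 3 and are at most c/12 each, which leaves 3c/4 < c.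
  obtain ⟨f, -, hf, cf, -⟩ := MemLp.exists_hasCompactSupport_integral_rpow_sub_le (p := 2)
    two_pos (f := g) (μ := volume) (by simpa using hg) (ε := c / 12) (by positivity)
  have hf' : ∫ p, (g p - f p) ^ 2 ≤ c / 12 := by
    have e : ∀ p, ‖g p - f p‖ ^ (2 : ℝ) = (g p - f p) ^ 2 := fun p => by
      rw [Real.rpow_two, Real.norm_eq_abs, sq_abs]
    simpa only [e] using hf
  have mf : MemLp f 2 := Torus.memLp cf 2
  have jf := mf.integrable one_le_two
  -- A uniform error e contributes V e² ≤ c/12 to the squared L² error. The summand 1 avoids having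
  -- to know that V is positive.
  set e := √(c / (12 * (V + 1)))
  have he : 0 < e := Real.sqrt_pos.2 (by positivity)
  have u := Metric.tendstoUniformly_iff.1 (tendstoUniformly_convT cf hk) e he
  obtain ⟨N, hN⟩ := eventually_atTop.1 u
  refine ⟨N, fun n hn => ?_⟩
  have hu := hN n hn
  have kn := hk n
  have kc := kn.smooth.continuous
  have lin : ∀ p, convT g (k n) p - g p =
      convT (fun q => g q - f q) (k n) p + (convT f (k n) p - f p) + (f p - g p) := fun p => by
    have : convT (fun q => g q - f q) (k n) p = convT g (k n) p - convT f (k n) p := by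
      simp only [convT, sub_mul]
      exact integral_sub (integrable_convT ig kc p) (integrable_convT jf kc p)
    rw [this]; ring
  have md : MemLp (fun q => g q - f q) 2 := hg.sub mf
  have c1 : Continuous (convT (fun q => g q - f q) (k n)) :=
    continuous_convT (md.integrable one_le_two) kc
  have c2 : Continuous fun p => convT f (k n) p - f p := (continuous_convT jf kc).sub cf
  have i1 : Integrable fun p => 3 * convT (fun q => g q - f q) (k n) p ^ 2 :=
    Torus.integrable (continuous_const.mul (c1.pow 2))
  have i2 : Integrable fun p => 3 * (convT f (k n) p - f p) ^ 2 :=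
    Torus.integrable (continuous_const.mul (c2.pow 2))
  have i3 : Integrable fun p => 3 * (g p - f p) ^ 2 := md.integrable_sq.const_mul 3
  have i12 : Integrable fun p =>
      3 * convT (fun q => g q - f q) (k n) p ^ 2 + 3 * (convT f (k n) p - f p) ^ 2 := i1.add i2
  have i4 : Integrable fun p => (convT g (k n) p - g p) ^ 2 :=
    ((Torus.memLp (continuous_convT ig kc) 2).sub hg).integrable_sq
  have i123 : Integrable fun p => (3 * convT (fun q => g q - f q) (k n) p ^ 2
        + 3 * (convT f (k n) p - f p) ^ 2) + 3 * (g p - f p) ^ 2 := i12.add i3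
  have b : ∫ p, (convT g (k n) p - g p) ^ 2 ≤ ∫ p, ((3 * convT (fun q => g q - f q) (k n) p ^ 2
        + 3 * (convT f (k n) p - f p) ^ 2) + 3 * (g p - f p) ^ 2) := by
    refine integral_mono i4 i123 fun p => ?_
    simp only [lin p]
    set a := convT (fun q => g q - f q) (k n) p
    set b := convT f (k n) p - f p
    set c := g p - f p
    have : f p - g p = -c := by simp [c]
    rw [this]
    nlinarith [sq_nonneg (a - b), sq_nonneg (a + c), sq_nonneg (b + c)]
  rw [integral_add i12 i3, integral_add i1 i2, integral_const_mul, integral_const_mul,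
    integral_const_mul] at b
  have b1 := integral_sq_convT_le md kc kn.nonneg kn.integral_eq
  have b2 : ∫ p, (convT f (k n) p - f p) ^ 2 ≤ c / 12 := by
    have : ∫ p, (convT f (k n) p - f p) ^ 2 ≤ ∫ p : Torus L₁ L₂, e ^ 2 := by
      refine integral_mono (Torus.integrable (c2.pow 2)) (integrable_const _) fun p => ?_
      have := hu p
      rw [dist_comm, Real.dist_eq] at this
      show (convT f (k n) p - f p) ^ 2 ≤ e ^ 2
      rw [← sq_abs]
      exact pow_le_pow_left₀ (abs_nonneg _) this.le 2
    refine this.trans ?_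
    rw [integral_const, smul_eq_mul, Real.sq_sqrt (by positivity)]
    show V * (c / (12 * (V + 1))) ≤ c / 12
    rw [mul_div_assoc', div_le_div_iff₀ (by positivity) (by norm_num)]
    nlinarith
  rw [Real.dist_eq, sub_zero, abs_of_nonneg (integral_nonneg fun _ => sq_nonneg _)]
  linarith

/-- Weak derivatives are unique. -/
lemma HasWeakPdT.ae_eq {i : Fin 2} {f g g' : Torus L₁ L₂ → ℝ} (h : HasWeakPdT i f g)
    (h' : HasWeakPdT i f g') (hg : MemLp g 2) (hg' : MemLp g' 2) : g =ᵐ[volume] g' := by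
  choose k hk using fun n : ℕ => exists_isMollifier (L₁ := L₁) (L₂ := L₂)
    (ε := 1 / (n + 1 : ℝ)) Nat.one_div_pos_of_nat
  have t1 := tendsto_integral_sq_convT_sub hg hk
  have t2 := tendsto_integral_sq_convT_sub hg' hk
  -- Both mollifications equal f convolved with the derivative of the kernel, so g and g' share
  -- their L² limit.
  have e : ∀ n, convT g (k n) = convT g' (k n) := fun n => by
    rw [← h.convT_eq (hk n).smooth, h'.convT_eq (hk n).smooth]
  have m := (hg.sub hg').integrable_sq
  have b : ∀ n, ∫ p, (g p - g' p) ^ 2 ≤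
      2 * (∫ p, (convT g (k n) p - g p) ^ 2) + 2 * ∫ p, (convT g' (k n) p - g' p) ^ 2 := fun n => by
    have i1 : Integrable fun p => (convT g (k n) p - g p) ^ 2 := ((Torus.memLp
      (continuous_convT (hg.integrable one_le_two) (hk n).smooth.continuous) 2).sub hg).integrable_sq
    have i2 : Integrable fun p => (convT g' (k n) p - g' p) ^ 2 := ((Torus.memLp
      (continuous_convT (hg'.integrable one_le_two) (hk n).smooth.continuous) 2).sub
        hg').integrable_sq
    rw [← integral_const_mul, ← integral_const_mul,
      ← integral_add (i1.const_mul 2) (i2.const_mul 2)]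
    refine integral_mono m ((i1.const_mul 2).add (i2.const_mul 2)) fun p => ?_
    show (g p - g' p) ^ 2 ≤ 2 * (convT g (k n) p - g p) ^ 2 + 2 * (convT g' (k n) p - g' p) ^ 2
    rw [e n]
    nlinarith [sq_nonneg ((convT g' (k n) p - g p) + (convT g' (k n) p - g' p))]
  have lim : ∫ p, (g p - g' p) ^ 2 ≤ 0 := by
    refine ge_of_tendsto' (f := fun n => 2 * (∫ p, (convT g (k n) p - g p) ^ 2)
      + 2 * ∫ p, (convT g' (k n) p - g' p) ^ 2) (x := atTop) ?_ b
    simpa using (t1.const_mul 2).add (t2.const_mul 2)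
  have z := (integral_eq_zero_iff_of_nonneg (fun p => sq_nonneg _) m).1
    (le_antisymm lim (integral_nonneg fun p => sq_nonneg _))
  filter_upwards [z] with p hp
  have : (g p - g' p) ^ 2 = 0 := hp
  nlinarith [pow_eq_zero_iff (two_ne_zero) |>.1 this]

end Convolution

/-! ### Estimates for plates of class H² -/

section WeakPlate

variable {L₁ L₂ : ℝ} [Fact (0 < L₁)] [Fact (0 < L₂)]

/-- Bound for the `L^{4k}` norm of `1 + |∂_x h| + |∂_y h|`, where `S = ∫ |Δh|²`. -/
noncomputable def plateConst (L₁ L₂ : ℝ) [Fact (0 < L₁)] [Fact (0 < L₂)] (k : ℕ) (S : ℝ) : ℝ :=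
  3 ^ (4 * k) * ((volume : Measure (Torus L₁ L₂)).real univ +
    ∑ i : Fin 2, (gnConst L₁ L₂ k * ((period L₁ L₂ i ^ 2 + 2) * S)) ^ (2 * k)
        * (volume : Measure (Torus L₁ L₂)).real univ)

lemma plateConst_mono (k : ℕ) {S S' : ℝ} (hS : 0 ≤ S) (h : S ≤ S') :
    plateConst L₁ L₂ k S ≤ plateConst L₁ L₂ k S' := by
  have g0 : 0 ≤ gnConst L₁ L₂ k := gnConst_nonneg Fact.out Fact.out k
  have V0 : 0 ≤ (volume : Measure (Torus L₁ L₂)).real univ := measureReal_nonneg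
  unfold plateConst
  gcongr

lemma one_add_add_pow_le {a b : ℝ} (ha : 0 ≤ a) (hb : 0 ≤ b) (n : ℕ) :
    (1 + a + b) ^ n ≤ 3 ^ n * (1 + a ^ n + b ^ n) := by
  set M := max 1 (max a b)
  have h1 : 1 ≤ M := le_max_left _ _
  have h2 : a ≤ M := (le_max_left _ _).trans (le_max_right _ _)
  have h3 : b ≤ M := (le_max_right _ _).trans (le_max_right _ _)
  have hM : M ^ n ≤ 1 + a ^ n + b ^ n := by
    have pa := pow_nonneg ha n
    have pb := pow_nonneg hb n
    rcases max_choice 1 (max a b) with e | e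
    · show (max 1 (max a b)) ^ n ≤ _
      rw [e, one_pow]; linarith
    · show (max 1 (max a b)) ^ n ≤ _
      rw [e]
      rcases max_choice a b with e | e <;> rw [e] <;> linarith
  calc (1 + a + b) ^ n ≤ (3 * M) ^ n := pow_le_pow_left₀ (by positivity) (by linarith) n
    _ = 3 ^ n * M ^ n := mul_pow _ _ _
    _ ≤ _ := by gcongr

/-- This weight dominates every component of the non-normalized normal of the graph. Its moments
replace the Lipschitz bound that H² does not provide in two dimensions. -/
lemma IsSmoothPlate.integral_slope_pow_le {h : Torus L₁ L₂ → ℝ} {D1 : Fin 2 → Torus L₁ L₂ → ℝ}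
    {D2 : Fin 2 → Fin 2 → Torus L₁ L₂ → ℝ} {D3 : Fin 2 → Fin 2 → Fin 2 → Torus L₁ L₂ → ℝ}
    (H : IsSmoothPlate h D1 D2 D3) {k : ℕ} (hk : 1 ≤ k) :
    ∫ p, (1 + |D1 0 p| + |D1 1 p|) ^ (4 * k) ≤
      plateConst L₁ L₂ k (∫ p, (∑ i, D2 i i p) ^ 2) := by
  have c0 := H.c1 0
  have c1 := H.c1 1
  have ev : Even (4 * k) := ⟨2 * k, by ring⟩
  have e : ∀ x : ℝ, |x| ^ (4 * k) = x ^ (4 * k) := fun x => ev.pow_abs x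
  have i0 : Integrable fun p => D1 0 p ^ (4 * k) := Torus.integrable (c0.pow _)
  have i1 : Integrable fun p => D1 1 p ^ (4 * k) := Torus.integrable (c1.pow _)
  have j0 : Integrable fun p => 1 + D1 0 p ^ (4 * k) := (integrable_const 1).add i0
  have j1 : Integrable fun p => 1 + D1 0 p ^ (4 * k) + D1 1 p ^ (4 * k) := j0.add i1
  calc ∫ p, (1 + |D1 0 p| + |D1 1 p|) ^ (4 * k)
      ≤ ∫ p, 3 ^ (4 * k) * (1 + D1 0 p ^ (4 * k) + D1 1 p ^ (4 * k)) := by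
        refine integral_mono (Torus.integrable
          (((continuous_const.add c0.abs).add c1.abs).pow _)) (j1.const_mul _) fun p => ?_
        have := one_add_add_pow_le (abs_nonneg (D1 0 p)) (abs_nonneg (D1 1 p)) (4 * k)
        simpa only [e] using this
    _ ≤ _ := by
        rw [integral_const_mul, integral_add j0 i1, integral_add (integrable_const 1) i0]
        unfold plateConst
        rw [Fin.sum_univ_two]
        have := H.integral_D1_pow_le 0 hk
        have := H.integral_D1_pow_le 1 hk
        simp only [integral_const, smul_eq_mul, mul_one]
        exact mul_le_mul_of_nonneg_left (by linarith) (by positivity)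

/-- Approximation of a plate of class `H²` by smooth plates. -/
lemma exists_smoothPlate_seq {h : Torus L₁ L₂ → ℝ} {Dh : Torus L₁ L₂ → Fin 2 → ℝ}
    {D2h : Torus L₁ L₂ → Fin 2 → Fin 2 → ℝ} (hc : Continuous h) (h0 : ∀ p, 0 ≤ h p)
    (H : IsH2 h Dh D2h) :
    ∃ (hn : ℕ → Torus L₁ L₂ → ℝ) (D1 : ℕ → Fin 2 → Torus L₁ L₂ → ℝ)
      (D2 : ℕ → Fin 2 → Fin 2 → Torus L₁ L₂ → ℝ)
      (D3 : ℕ → Fin 2 → Fin 2 → Fin 2 → Torus L₁ L₂ → ℝ),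
      (∀ n, IsSmoothPlate (hn n) (D1 n) (D2 n) (D3 n)) ∧ (∀ n p, 0 ≤ hn n p) ∧
      TendstoUniformly hn h atTop ∧
      (∀ n, ∫ p, (∑ i, D2 n i i p) ^ 2 ≤ ∫ p, (∑ i, D2h p i i) ^ 2) ∧
      ∀ᵐ p, ∀ i, Tendsto (fun n => D1 n i p) atTop (𝓝 (Dh p i)) := by
  obtain ⟨m0, m1, m2, w1, w2⟩ := H
  choose k hk using fun n : ℕ => exists_isMollifier (L₁ := L₁) (L₂ := L₂)
    (ε := 1 / (n + 1 : ℝ)) Nat.one_div_pos_of_nat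
  have ih := Torus.integrable hc
  have e1 : ∀ n i, convT h (pdT i (k n)) = convT (fun p => Dh p i) (k n) := fun n i =>
    (w1 i).convT_eq (hk n).smooth
  have e2 : ∀ n i j, convT h (pdT j (pdT i (k n))) = convT (fun p => D2h p i j) (k n) :=
    fun n i j => by
      rw [(hk n).smooth.pdT_comm, (w1 i).convT_eq ((hk n).smooth.pdT j),
        (w2 i j).convT_eq (hk n).smooth]
  have t : ∀ i, Tendsto (fun n => ∫⁻ p,
      ENNReal.ofReal ((convT (fun p => Dh p i) (k n) p - Dh p i) ^ 2)) atTop (𝓝 0) := fun i => by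
    have := ENNReal.tendsto_ofReal (tendsto_integral_sq_convT_sub (m1 i) hk)
    rw [ENNReal.ofReal_zero] at this
    refine this.congr fun n => ?_
    rw [ofReal_integral_eq_lintegral_ofReal _ (Eventually.of_forall fun p => sq_nonneg _)]
    exact ((Torus.memLp (continuous_convT ((m1 i).integrable one_le_two)
      (hk n).smooth.continuous) 2).sub (m1 i)).integrable_sq
  have am : ∀ n i, AEMeasurable fun p =>
      ENNReal.ofReal ((convT (fun p => Dh p i) (k n) p - Dh p i) ^ 2) := fun n i =>
    (((continuous_convT ((m1 i).integrable one_le_two) (hk n).smooth.continuous).aemeasurable.sub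
      (m1 i).aestronglyMeasurable.aemeasurable).pow_const 2).ennreal_ofReal
  -- Only the almost everywhere convergence of the gradients needs a subsequence; adding the two
  -- squared errors makes one subsequence serve both components.
  obtain ⟨ns, hns, hae⟩ := exists_subseq_ae_tendsto_zero
    (f := fun n p => ENNReal.ofReal ((convT (fun p => Dh p 0) (k n) p - Dh p 0) ^ 2)
      + ENNReal.ofReal ((convT (fun p => Dh p 1) (k n) p - Dh p 1) ^ 2))
    (fun n => (am n 0).add (am n 1)) (by
      have := (t 0).add (t 1)
      rw [add_zero] at this
      refine this.congr fun n => ?_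
      rw [lintegral_add_left' (am n 0)])
  refine ⟨fun n => convT h (k (ns n)), fun n i => convT h (pdT i (k (ns n))),
    fun n i j => convT h (pdT j (pdT i (k (ns n)))), _,
    fun n => isSmoothPlate_convT ih (hk _).smooth, fun n => convT_nonneg h0 (hk _).nonneg,
    ?_, fun n => ?_, ?_⟩
  · intro u hu
    exact hns.tendsto_atTop.eventually (tendstoUniformly_convT hc hk u hu)
  -- The Laplacian of the mollified plate is the mollified Laplacian, so its L² norm does not
  -- increase.
  · have ms : MemLp (fun p => ∑ i, D2h p i i) 2 := memLp_finsetSum _ fun i _ => m2 i i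
    have e : ∀ p, ∑ i, convT h (pdT i (pdT i (k (ns n)))) p =
        convT (fun p => ∑ i, D2h p i i) (k (ns n)) p := fun p => by
      simp only [e2]
      simp only [convT, Finset.sum_mul]
      rw [integral_finsetSum]
      exact fun i _ => integrable_convT ((m2 i i).integrable one_le_two)
        (hk _).smooth.continuous p
    simp only [e]
    exact integral_sq_convT_le ms (hk _).smooth.continuous (hk _).nonneg (hk _).integral_eq
  · filter_upwards [hae] with p hp i
    rw [← tendsto_sub_nhds_zero_iff]
    have key : Tendsto (fun n => ENNReal.ofReal
        ((convT (fun p => Dh p i) (k (ns n)) p - Dh p i) ^ 2)) atTop (𝓝 0) := by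
      refine tendsto_of_tendsto_of_tendsto_of_le_of_le tendsto_const_nhds hp (fun _ => zero_le)
        fun n => ?_
      fin_cases i
      · exact le_self_add
      · exact le_add_self
    have k2 := (ENNReal.tendsto_toReal ENNReal.zero_ne_top).comp key
    simp only [Function.comp_def, ENNReal.toReal_ofReal (sq_nonneg _), ENNReal.toReal_zero] at k2
    have k3 := k2.sqrt
    simp only [Real.sqrt_sq_eq_abs, Real.sqrt_zero] at k3
    simp only [e1]
    exact (tendsto_zero_iff_abs_tendsto_zero _).2 k3

variable {h : Torus L₁ L₂ → ℝ} {Dh : Torus L₁ L₂ → Fin 2 → ℝ}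
    {D2h : Torus L₁ L₂ → Fin 2 → Fin 2 → ℝ}

/-- Hölder continuity of a plate of class `H²`. -/
lemma IsH2.sq_sub_shiftT_le (H : IsH2 h Dh D2h) (hc : Continuous h) (h0 : ∀ p, 0 ≤ h p)
    (i : Fin 2) (p : Torus L₁ L₂) {s : ℝ} (hs : |s| ≤ period L₁ L₂ i) :
    (h (shiftT i s p) - h p) ^ 2 ≤
      |s| * (holderConst L₁ L₂ * ∫ p, (∑ i, D2h p i i) ^ 2) := by
  obtain ⟨hn, D1, D2, D3, hsm, hn0, hu, hS, -⟩ := exists_smoothPlate_seq hc h0 H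
  have t1 := hu.tendsto_at p
  have t2 := hu.tendsto_at (shiftT i s p)
  refine le_of_tendsto' ((t2.sub t1).pow 2) fun n => ?_
  refine ((hsm n).sq_sub_shiftT_le i p hs).trans ?_
  have := holderConst_pos (L₁ := L₁) (L₂ := L₂)
  have := hS n
  gcongr

/-- Two coordinate moves, each with the Hölder bound, account for the factor 2. This bounds a plate
near a contact point. -/
lemma IsH2.le_add_sqrt (H : IsH2 h Dh D2h) (hc : Continuous h) (h0 : ∀ p, 0 ≤ h p)
    (p : Torus L₁ L₂) {ε : ℝ} {a : ℝ × ℝ} (h1 : |a.1| ≤ ε) (h2 : |a.2| ≤ ε)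
    (h1' : |a.1| ≤ L₁) (h2' : |a.2| ≤ L₂) :
    h (p + projT a) ≤ h p + 2 * √(ε * (holderConst L₁ L₂ * ∫ p, (∑ i, D2h p i i) ^ 2)) := by
  set B := holderConst L₁ L₂ * ∫ p, (∑ i, D2h p i i) ^ 2
  have B0 : 0 ≤ B := mul_nonneg holderConst_pos.le (integral_nonneg fun _ => sq_nonneg _)
  have e : p + projT a = shiftT 1 a.2 (shiftT 0 a.1 p) := by
    simp [shiftT, projT, Prod.ext_iff]
  have k1 := H.sq_sub_shiftT_le hc h0 0 p (s := a.1) (by simpa [period] using h1')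
  have k2 := H.sq_sub_shiftT_le hc h0 1 (shiftT 0 a.1 p) (s := a.2) (by simpa [period] using h2')
  have l1 := Real.abs_le_sqrt (k1.trans (mul_le_mul_of_nonneg_right h1 B0))
  have l2 := Real.abs_le_sqrt (k2.trans (mul_le_mul_of_nonneg_right h2 B0))
  rw [e]
  have := le_abs_self (h (shiftT 1 a.2 (shiftT 0 a.1 p)) - h (shiftT 0 a.1 p))
  have := le_abs_self (h (shiftT 0 a.1 p) - h p)
  linarith

/-- A plate of class `H²` is bounded by its value at a point and its Laplacian. -/
lemma IsH2.le_add_sqrt_max (H : IsH2 h Dh D2h) (hc : Continuous h) (h0 : ∀ p, 0 ≤ h p)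
    (p q : Torus L₁ L₂) :
    h q ≤ h p + 2 * √(max L₁ L₂ * (holderConst L₁ L₂ * ∫ p, (∑ i, D2h p i i) ^ 2)) := by
  have hL₁ : 0 < L₁ := Fact.out
  have hL₂ : 0 < L₂ := Fact.out
  obtain ⟨s, hs, es⟩ := (AddCircle.coe_image_Ico_eq L₁ 0).ge (mem_univ (q - p).1)
  obtain ⟨t, ht, et⟩ := (AddCircle.coe_image_Ico_eq L₂ 0).ge (mem_univ (q - p).2)
  have e : q = p + projT (s, t) := by
    have : (projT (s, t) : Torus L₁ L₂) = q - p := Prod.ext es et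
    rw [this]; abel
  have a1 : |s| ≤ L₁ := by rw [abs_of_nonneg hs.1]; linarith [hs.2]
  have a2 : |t| ≤ L₂ := by rw [abs_of_nonneg ht.1]; linarith [ht.2]
  rw [e]
  exact H.le_add_sqrt hc h0 p (a1.trans (le_max_left _ _)) (a2.trans (le_max_right _ _)) a1 a2

/-- Fatou's lemma for the smooth plates regularized by δ = 1/(n+1): their bound is uniform in δ, and
the quotients converge almost everywhere on {h > 0}. -/
lemma IsH2.lintegral_pow_four_div_le (H : IsH2 h Dh D2h) (hc : Continuous h) (h0 : ∀ p, 0 ≤ h p)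
    (i : Fin 2) :
    ∫⁻ p, ENNReal.ofReal (Dh p i ^ 4 / h p ^ 2) ≤
      ENNReal.ofReal (9 * ∫ p, (∑ i, D2h p i i) ^ 2) := by
  obtain ⟨hn, D1, D2, D3, hsm, hn0, hu, hS, hae⟩ := exists_smoothPlate_seq hc h0 H
  have pos : ∀ (n : ℕ) p, 0 < hn n p + 1 / (n + 1 : ℝ) := fun n p =>
    add_pos_of_nonneg_of_pos (hn0 n p) Nat.one_div_pos_of_nat
  have hcont : ∀ n : ℕ, Continuous fun p => D1 n i p ^ 4 / (hn n p + 1 / (n + 1 : ℝ)) ^ 2 :=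
    fun n => (((hsm n).c1 i).pow 4).div (((hsm n).c0.add continuous_const).pow 2)
      fun p => (pow_pos (pos n p) 2).ne'
  have e : ∀ᵐ p, ENNReal.ofReal (Dh p i ^ 4 / h p ^ 2) ≤
      liminf (fun n : ℕ => ENNReal.ofReal (D1 n i p ^ 4 / (hn n p + 1 / (n + 1 : ℝ)) ^ 2))
        atTop := by
    filter_upwards [hae] with p hp
    rcases (h0 p).eq_or_lt with hz | hz
    -- At a zero of h the quotient is 0 by the convention x / 0 = 0.
    · simp [← hz]
    · refine (Tendsto.liminf_eq (ENNReal.tendsto_ofReal (((hp i).pow 4).div ?_ ?_))).ge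
      · simpa using ((hu.tendsto_at p).add tendsto_one_div_add_atTop_nhds_zero_nat).pow 2
      · positivity
  refine (lintegral_mono_ae e).trans ((lintegral_liminf_le fun n =>
    (hcont n).measurable.ennreal_ofReal).trans ?_)
  refine liminf_le_of_frequently_le' (Frequently.of_forall fun n => ?_)
  rw [← ofReal_integral_eq_lintegral_ofReal (Torus.integrable (hcont n))
    (Eventually.of_forall fun p => by positivity)]
  refine ENNReal.ofReal_le_ofReal (((hsm n).integral_D1_pow_four_div_le (hn0 n)
    Nat.one_div_pos_of_nat i).trans ?_)
  have := hS n
  gcongr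

end WeakPlate

/-! ### Calculus in Γ × ℝ and the divergence theorem below a graph -/

section SpaceCalculus

variable {L₁ L₂ : ℝ}

/-- The covering of `Γ × ℝ` by the Euclidean space. -/
def projX (a : ℝ × ℝ × ℝ) : Space L₁ L₂ :=
  (((a.1 : AddCircle L₁), (a.2.1 : AddCircle L₂)), a.2.2)

lemma isOpenQuotientMap_projX : IsOpenQuotientMap (projX : ℝ × ℝ × ℝ → Space L₁ L₂) := by
  have h : IsOpenQuotientMap (fun a : (ℝ × ℝ) × ℝ => ((projT a.1, a.2) : Space L₁ L₂)) :=
    IsOpenQuotientMap.prodMap isOpenQuotientMap_projT .id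
  exact h.comp (Homeomorph.prodAssoc ℝ ℝ ℝ).symm.isOpenQuotientMap

/-- The coordinate directions of the Euclidean space. -/
def dirX (i : Fin 3) : ℝ × ℝ × ℝ :=
  match i with
  | 0 => (1, 0, 0)
  | 1 => (0, 1, 0)
  | 2 => (0, 0, 1)

lemma shiftX_projX (i : Fin 3) (s : ℝ) (a : ℝ × ℝ × ℝ) :
    shiftX i s (projX a : Space L₁ L₂) = projX (a + s • dirX i) := by
  fin_cases i <;> simp [shiftX, shiftT, projX, dirX]

lemma exists_projX (q : Space L₁ L₂) : ∃ a, projX a = q := isOpenQuotientMap_projX.surjective q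

lemma isCkX_iff {k : WithTop ℕ∞} {f : Space L₁ L₂ → ℝ} :
    IsCkX k f ↔ ContDiff ℝ k fun a => f (projX a) := Iff.rfl

lemma IsCkX.continuous {k : WithTop ℕ∞} {f : Space L₁ L₂ → ℝ} (h : IsCkX k f) : Continuous f :=
  isOpenQuotientMap_projX.continuous_comp_iff.1 (ContDiff.continuous (isCkX_iff.1 h))

/-- `g` is the classical partial derivative `∂_i f` on `Γ × ℝ`. -/
def HasPdX (i : Fin 3) (f g : Space L₁ L₂ → ℝ) : Prop :=
  ∀ q, HasDerivAt (fun s : ℝ => f (shiftX i s q)) (g q) 0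

lemma HasPdX.pdX_eq {i : Fin 3} {f g : Space L₁ L₂ → ℝ} (h : HasPdX i f g) : pdX i f = g :=
  funext fun q => (h q).deriv

lemma IsCkX.hasDerivAt {f : Space L₁ L₂ → ℝ} (h : IsCkX 1 f)
    (i : Fin 3) (a : ℝ × ℝ × ℝ) : HasDerivAt (fun s => f (shiftX i s (projX a)))
      (fderiv ℝ (fun a => f (projX a)) a (dirX i)) 0 := by
  simp only [shiftX_projX]
  have h1 : HasFDerivAt (fun a => f (projX a)) (fderiv ℝ (fun a => f (projX a)) a)
      (a + (0 : ℝ) • dirX i) := by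
    simpa using ((isCkX_iff.1 h).differentiable (by simp) a).hasFDerivAt
  have h2 : HasDerivAt (fun s : ℝ => a + s • dirX i) (dirX i) 0 := by
    simpa using ((hasDerivAt_id (0 : ℝ)).smul_const (dirX i)).const_add a
  exact h1.comp_hasDerivAt (0 : ℝ) h2

lemma IsCkX.pdX_projX {f : Space L₁ L₂ → ℝ} (h : IsCkX 1 f) (i : Fin 3) (a : ℝ × ℝ × ℝ) :
    pdX i f (projX a) = fderiv ℝ (fun a => f (projX a)) a (dirX i) :=
  (h.hasDerivAt i a).deriv

lemma IsCkX.hasPdX {f : Space L₁ L₂ → ℝ} (h : IsCkX 1 f) (i : Fin 3) :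
    HasPdX i f (pdX i f) := fun q => by
  obtain ⟨a, rfl⟩ := exists_projX q
  rw [h.pdX_projX]
  exact h.hasDerivAt i a

lemma IsCkX.continuous_pdX {f : Space L₁ L₂ → ℝ} (h : IsCkX 1 f) (i : Fin 3) :
    Continuous (pdX i f) := by
  refine isOpenQuotientMap_projX.continuous_comp_iff.1 ?_
  have : pdX i f ∘ projX = fun a => fderiv ℝ (fun a => f (projX a)) a (dirX i) :=
    funext fun a => h.pdX_projX i a
  rw [this]
  exact ((isCkX_iff.1 h).continuous_fderiv (by simp)).clm_apply continuous_const

lemma shiftX_castSucc (i : Fin 2) (s : ℝ) (q : Space L₁ L₂) :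
    shiftX i.castSucc s q = (shiftT i s q.1, q.2) := by
  fin_cases i <;> rfl

lemma shiftX_two (s : ℝ) (q : Space L₁ L₂) : shiftX 2 s q = (q.1, q.2 + s) := rfl

lemma continuous_shiftX (i : Fin 3) :
    Continuous (fun a : ℝ × Space L₁ L₂ => shiftX i a.1 a.2) := by
  have c : ∀ i : Fin 2, Continuous (fun a : ℝ × Space L₁ L₂ => shiftX i.castSucc a.1 a.2) :=
    fun i => by
      simp only [shiftX_castSucc]
      exact ((continuous_shiftT i).comp (continuous_fst.prodMk
        (continuous_fst.comp continuous_snd))).prodMk (continuous_snd.comp continuous_snd)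
  fin_cases i
  · exact c 0
  · exact c 1
  · exact (continuous_fst.comp continuous_snd).prodMk
      ((continuous_snd.comp continuous_snd).add continuous_fst)

namespace HasPdX

variable {i : Fin 3} {f g f' g' : Space L₁ L₂ → ℝ}

lemma shiftX_zero (q : Space L₁ L₂) : shiftX i 0 q = q := by
  fin_cases i <;> simp [shiftX, shiftT]

lemma mul (h : HasPdX i f g) (h' : HasPdX i f' g') :
    HasPdX i (fun p => f p * f' p) (fun p => g p * f' p + f p * g' p) := fun q => by
  have := (h q).mul (h' q)
  simp only [shiftX_zero] at this
  exact this

lemma hasDerivAt_castSucc {i : Fin 2} (h : HasPdX i.castSucc f g) (p : Torus L₁ L₂) (z s : ℝ) :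
    HasDerivAt (fun s => f (shiftT i s p, z)) (g (shiftT i s p, z)) s := by
  have h0 := h (shiftT i s p, z)
  simp only [shiftX_castSucc, shiftT_shiftT] at h0
  have := HasDerivAt.scomp s (h := fun t => t - s) (h' := 1)
    (g₁ := fun t => f (shiftT i (s + t) p, z)) (g₁' := g (shiftT i s p, z)) (by simpa using h0)
    ((hasDerivAt_id s).sub_const s)
  simpa [Function.comp_def] using this

lemma hasDerivAt_two (h : HasPdX 2 f g) (p : Torus L₁ L₂) (z : ℝ) :
    HasDerivAt (fun z => f (p, z)) (g (p, z)) z := by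
  have h0 := h (p, z)
  simp only [shiftX_two] at h0
  have := HasDerivAt.scomp z (h := fun t => t - z) (h' := 1)
    (g₁ := fun t => f (p, z + t)) (g₁' := g (p, z)) (by simpa using h0)
    ((hasDerivAt_id z).sub_const z)
  simpa [Function.comp_def] using this

end HasPdX

/-- The primitive in the vertical direction, starting from `z = -1`. -/
noncomputable def prim (f : Space L₁ L₂ → ℝ) (q : Space L₁ L₂) : ℝ :=
  ∫ z in (-1 : ℝ)..q.2, f (q.1, z)

lemma continuous_slice {f : Space L₁ L₂ → ℝ} (hf : Continuous f) (p : Torus L₁ L₂) :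
    Continuous fun z => f (p, z) := hf.comp (continuous_const.prodMk continuous_id)

lemma continuous_prim {f : Space L₁ L₂ → ℝ} (hf : Continuous f) : Continuous (prim f) :=
  intervalIntegral.continuous_parametric_primitive_of_continuous (f := fun p z => f (p, z)) hf

lemma prim_pdX_two {f g : Space L₁ L₂ → ℝ} (h : HasPdX 2 f g) (hg : Continuous g)
    (q : Space L₁ L₂) : prim g q = f q - f (q.1, -1) :=
  intervalIntegral.integral_eq_sub_of_hasDerivAt (fun z _ => h.hasDerivAt_two q.1 z)
    ((continuous_slice hg q.1).intervalIntegrable _ _)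

lemma prim_add {f g : Space L₁ L₂ → ℝ} (hf : Continuous f) (hg : Continuous g) (q : Space L₁ L₂) :
    prim (fun q => f q + g q) q = prim f q + prim g q :=
  intervalIntegral.integral_add ((continuous_slice hf q.1).intervalIntegrable _ _)
    ((continuous_slice hg q.1).intervalIntegrable _ _)

lemma prim_sub {f g : Space L₁ L₂ → ℝ} (hf : Continuous f) (hg : Continuous g) (q : Space L₁ L₂) :
    prim (fun q => f q - g q) q = prim f q - prim g q :=
  intervalIntegral.integral_sub ((continuous_slice hf q.1).intervalIntegrable _ _)
    ((continuous_slice hg q.1).intervalIntegrable _ _)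

lemma prim_mono {f g : Space L₁ L₂ → ℝ} (hf : Continuous f) (hg : Continuous g)
    (h : ∀ q, f q ≤ g q) {q : Space L₁ L₂} (hq : -1 ≤ q.2) : prim f q ≤ prim g q :=
  intervalIntegral.integral_mono_on hq ((continuous_slice hf q.1).intervalIntegrable _ _)
    ((continuous_slice hg q.1).intervalIntegrable _ _) fun _ _ => h _

lemma prim_nonneg {f : Space L₁ L₂ → ℝ} (h : ∀ q, 0 ≤ f q) {q : Space L₁ L₂} (hq : -1 ≤ q.2) :
    0 ≤ prim f q := intervalIntegral.integral_nonneg hq fun _ _ => h _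

lemma prim_mono_right {f : Space L₁ L₂ → ℝ} (hf : Continuous f) (h : ∀ q, 0 ≤ f q)
    (p : Torus L₁ L₂) {z w : ℝ} (hz : -1 ≤ z) (hzw : z ≤ w) : prim f (p, z) ≤ prim f (p, w) :=
  intervalIntegral.integral_mono_interval le_rfl hz hzw (Eventually.of_forall fun _ => h _)
    ((continuous_slice hf p).intervalIntegrable _ _)

lemma sq_prim_mul_le {f g : Space L₁ L₂ → ℝ} (hf : Continuous f) (hg : Continuous g)
    {q : Space L₁ L₂} (hq : -1 ≤ q.2) :
    prim (fun q => f q * g q) q ^ 2 ≤ prim (fun q => f q ^ 2) q * prim (fun q => g q ^ 2) q := by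
  unfold prim
  simp only [intervalIntegral.integral_of_le hq]
  have m : ∀ f : Space L₁ L₂ → ℝ, Continuous f →
      MemLp (fun z => f (q.1, z)) 2 (volume.restrict (Ioc (-1) q.2)) := fun f hf => by
    rw [memLp_two_iff_integrable_sq (continuous_slice hf q.1).aestronglyMeasurable]
    exact (((continuous_slice hf q.1).pow 2).integrableOn_Icc (a := -1) (b := q.2)).mono_set
      Ioc_subset_Icc_self
  exact sq_integral_mul_le (m f hf) (m g hg)

lemma abs_prim_mul_le {f g : Space L₁ L₂ → ℝ} (hf : Continuous f) (hg : Continuous g)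
    {q : Space L₁ L₂} (hq : -1 ≤ q.2) :
    |prim (fun q => f q * g q) q| ≤ √(prim (fun q => f q ^ 2) q) * √(prim (fun q => g q ^ 2) q) := by
  rw [← Real.sqrt_mul (prim_nonneg (fun _ => sq_nonneg _) hq)]
  exact Real.abs_le_sqrt (sq_prim_mul_le hf hg hq)

/-- The derivative of an integral over the region below a graph. -/
lemma hasPdT_prim {i : Fin 2} {f g : Space L₁ L₂ → ℝ} {h h' : Torus L₁ L₂ → ℝ}
    (hfg : HasPdX i.castSucc f g) (hf : Continuous f) (hg : Continuous g) (hh : HasPdT i h h') :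
    HasPdT i (fun p => prim f (p, h p)) (fun p => prim g (p, h p) + f (p, h p) * h' p) := fun p => by
  have cf : Continuous fun a : ℝ × ℝ => f (shiftT i a.1 p, a.2) :=
    hf.comp (((continuous_shiftT_left i p).comp continuous_fst).prodMk continuous_snd)
  have cg : Continuous fun a : ℝ × ℝ => g (shiftT i a.1 p, a.2) :=
    hg.comp (((continuous_shiftT_left i p).comp continuous_fst).prodMk continuous_snd)
  have cpg : Continuous fun a : ℝ × ℝ => prim g (shiftT i a.1 p, a.2) :=
    (continuous_prim hg).comp (((continuous_shiftT_left i p).comp continuous_fst).prodMk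
      continuous_snd)
  have d1 : ∀ s t : ℝ, HasDerivAt (fun s => prim f (shiftT i s p, t)) (prim g (shiftT i s p, t)) s :=
    fun s t => by
      obtain ⟨C, hC⟩ := ((isCompact_Icc (a := s - 1) (b := s + 1)).prod
        (isCompact_uIcc (a := (-1 : ℝ)) (b := t))).exists_bound_of_continuousOn cg.continuousOn
      refine (intervalIntegral.hasDerivAt_integral_of_dominated_loc_of_deriv_le
        (F := fun s z => f (shiftT i s p, z)) (F' := fun s z => g (shiftT i s p, z))
        (bound := fun _ => C) (Icc_mem_nhds (sub_one_lt s) (lt_add_one s))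
        (Eventually.of_forall fun s => (continuous_slice hf _).aestronglyMeasurable)
        ((continuous_slice hf _).intervalIntegrable _ _)
        (continuous_slice hg _).aestronglyMeasurable
        (Eventually.of_forall fun z hz x hx => hC (x, z) ⟨hx, uIoc_subset_uIcc hz⟩)
        intervalIntegrable_const
        (Eventually.of_forall fun z _ x _ => hfg.hasDerivAt_castSucc p z x)).2
  have d2 : ∀ s t : ℝ, HasDerivAt (fun t => prim f (shiftT i s p, t)) (f (shiftT i s p, t)) t :=
    fun s t => intervalIntegral.integral_hasDerivAt_right
      ((continuous_slice hf _).intervalIntegrable _ _)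
      ((continuous_slice hf _).stronglyMeasurableAtFilter _ _) (continuous_slice hf _).continuousAt
  -- The primitive is regarded as a function of the horizontal parameter s and of the upper limit t
  -- separately. Continuous partial derivatives make it differentiable, and the chain rule along t =
  -- h(shifted p) produces the boundary term.
  have key := hasStrictFDerivAt_uncurry_coprod (u := ((0 : ℝ), h p))
    (f := fun s t => prim f (shiftT i s p, t))
    (f₁ := fun s t => ContinuousLinearMap.toSpanSingleton ℝ (prim g (shiftT i s p, t)))
    (f₂ := fun s t => ContinuousLinearMap.toSpanSingleton ℝ (f (shiftT i s p, t)))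
    (Eventually.of_forall fun v => (d1 v.1 v.2).hasFDerivAt)
    (Eventually.of_forall fun v => (d2 v.1 v.2).hasFDerivAt)
    ((ContinuousLinearMap.toSpanSingletonCLE (𝕜 := ℝ) (E := ℝ)).continuous.comp cpg).continuousAt
    ((ContinuousLinearMap.toSpanSingletonCLE (𝕜 := ℝ) (E := ℝ)).continuous.comp cf).continuousAt
  have inner : HasDerivAt (fun s => (s, h (shiftT i s p))) ((1 : ℝ), h' p) 0 :=
    (hasDerivAt_id (0 : ℝ)).prodMk (hh p)
  have key' := key.hasFDerivAt
  have e0 : ((0 : ℝ), h p) = (fun s => (s, h (shiftT i s p))) 0 := by simp [shiftT_zero]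
  rw [e0] at key'
  have := key'.comp_hasDerivAt (0 : ℝ) inner
  simpa [Function.comp_def, Function.HasUncurry.uncurry, shiftT_zero, mul_comm] using this

variable [Fact (0 < L₁)] [Fact (0 < L₂)]

lemma continuous_graph {h : Torus L₁ L₂ → ℝ} (hh : Continuous h) :
    Continuous fun p : Torus L₁ L₂ => ((p, h p) : Space L₁ L₂) := continuous_id.prodMk hh

/-- Passage to the limit in integrals over graphs. -/
lemma tendsto_integral_graph {f : Space L₁ L₂ → ℝ} (hf : Continuous f) {h : Torus L₁ L₂ → ℝ}
    {hn : ℕ → Torus L₁ L₂ → ℝ} (hh : Continuous h) (hhn : ∀ n, Continuous (hn n))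
    (hu : TendstoUniformly hn h atTop) :
    Tendsto (fun n => ∫ p, f (p, hn n p)) atTop (𝓝 (∫ p, f (p, h p))) := by
  obtain ⟨H, hH⟩ := exists_bound hh
  obtain ⟨C, hC⟩ := ((isCompact_univ (X := Torus L₁ L₂)).prod
    (isCompact_Icc (a := -(H + 1)) (b := H + 1))).exists_bound_of_continuousOn hf.continuousOn
  refine tendsto_integral_filter_of_dominated_convergence (fun _ => C)
    (Eventually.of_forall fun n => (hf.comp (continuous_graph (hhn n))).aestronglyMeasurable) ?_
    (integrable_const C) (Eventually.of_forall fun p => ?_)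
  · filter_upwards [Metric.tendstoUniformly_iff.1 hu 1 one_pos] with n hn'
    refine Eventually.of_forall fun p => hC (p, hn n p) ⟨mem_univ _, ?_⟩
    have h1 := hn' p
    have h2 := hH p
    rw [Real.dist_eq] at h1
    rw [abs_le] at h2
    rw [abs_lt] at h1
    exact ⟨by linarith [h1.2, h2.1], by linarith [h1.1, h2.2]⟩
  · exact (hf.tendsto (p, h p)).comp (tendsto_const_nhds.prodMk_nhds (hu.tendsto_at p))

/-- The region `a < z < h`. -/
def region (a : ℝ) (h : Torus L₁ L₂ → ℝ) : Set (Space L₁ L₂) := {q | a < q.2 ∧ q.2 < h q.1}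

lemma isOpen_region (a : ℝ) {h : Torus L₁ L₂ → ℝ} (hh : Continuous h) : IsOpen (region a h) :=
  (isOpen_lt continuous_const continuous_snd).inter
    (isOpen_lt continuous_snd (hh.comp continuous_fst))

lemma lintegral_region (a : ℝ) {h : Torus L₁ L₂ → ℝ} (hh : Continuous h)
    {f : Space L₁ L₂ → ENNReal} (hf : AEMeasurable f (volume.restrict (region a h))) :
    ∫⁻ q in region a h, f q = ∫⁻ p, ∫⁻ z in Ioo a (h p), f (p, z) := by
  have m := (isOpen_region a hh).measurableSet
  rw [← lintegral_indicator m]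
  have h1 := lintegral_prod (μ := (volume : Measure (Torus L₁ L₂))) (ν := (volume : Measure ℝ))
    ((region a h).indicator f) ((aemeasurable_indicator_iff m).2 hf)
  refine h1.trans (lintegral_congr fun p => ?_)
  rw [← lintegral_indicator measurableSet_Ioo]
  rfl

lemma integral_region (a : ℝ) {h : Torus L₁ L₂ → ℝ} (hh : Continuous h)
    {f : Space L₁ L₂ → ℝ} (hf : IntegrableOn f (region a h)) :
    ∫ q in region a h, f q = ∫ p, ∫ z in Ioo a (h p), f (p, z) := by
  have m := (isOpen_region a hh).measurableSet
  rw [← integral_indicator m]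
  have h1 := integral_prod (μ := (volume : Measure (Torus L₁ L₂))) (ν := (volume : Measure ℝ))
    ((region a h).indicator f) ((integrable_indicator_iff m).2 hf)
  refine h1.trans (integral_congr_ae (Eventually.of_forall fun p => ?_))
  show ∫ z, (region a h).indicator f (p, z) = ∫ z in Ioo a (h p), f (p, z)
  rw [← integral_indicator measurableSet_Ioo]
  rfl

lemma integrableOn_region (a : ℝ) {h : Torus L₁ L₂ → ℝ} (hh : Continuous h) {f : Space L₁ L₂ → ℝ}
    (hf : Continuous f) : IntegrableOn f (region a h) := by
  obtain ⟨H, hH⟩ := exists_bound hh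
  have : IntegrableOn f (univ ×ˢ Icc a H) :=
    hf.continuousOn.integrableOn_compact (isCompact_univ.prod isCompact_Icc)
  exact this.mono_set fun q hq =>
    ⟨mem_univ _, hq.1.le, hq.2.le.trans ((le_abs_self _).trans (hH _))⟩

lemma memLp_region (a : ℝ) {h : Torus L₁ L₂ → ℝ} (hh : Continuous h) {f : Space L₁ L₂ → ℝ}
    (hf : Continuous f) : MemLp f 2 (volume.restrict (region a h)) :=
  (memLp_two_iff_integrable_sq hf.aestronglyMeasurable).2 (integrableOn_region a hh (hf.pow 2))

lemma integral_region_eq_prim {h : Torus L₁ L₂ → ℝ} (hh : Continuous h) (h0 : ∀ p, 0 ≤ h p)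
    {f : Space L₁ L₂ → ℝ} (hf : Continuous f) :
    ∫ q in region (-1) h, f q = ∫ p, prim f (p, h p) := by
  rw [integral_region _ hh (integrableOn_region _ hh hf)]
  congr 1; ext p
  rw [prim, intervalIntegral.integral_of_le (by linarith [h0 p] : (-1 : ℝ) ≤ h p),
    integral_Ioc_eq_integral_Ioo]

/-- The components of the (non-normalized) outer normal of the graph. -/
def normalX (D1 : Fin 2 → Torus L₁ L₂ → ℝ) (i : Fin 3) (p : Torus L₁ L₂) : ℝ :=
  match i with
  | 0 => -D1 0 p
  | 1 => -D1 1 p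
  | 2 => 1

/-- The divergence theorem below a graph. -/
lemma integral_prim_eq {h : Torus L₁ L₂ → ℝ} {D1 : Fin 2 → Torus L₁ L₂ → ℝ} (hh : Continuous h)
    (hD : ∀ i, HasPdT i h (D1 i)) (cD : ∀ i, Continuous (D1 i)) (i : Fin 3)
    {f g : Space L₁ L₂ → ℝ} (hfg : HasPdX i f g) (hf : Continuous f) (hg : Continuous g)
    (hf0 : ∀ p, f (p, -1) = 0) :
    ∫ p, prim g (p, h p) = ∫ p, f (p, h p) * normalX D1 i p := by
  -- In horizontal directions, the total derivative of p ↦ ∫ f dz over −1 < z < h(p) integrates to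
  -- zero over the torus, which leaves the boundary term with −∂_i h.
  have hor : ∀ i : Fin 2, HasPdX i.castSucc f g →
      ∫ p, prim g (p, h p) = ∫ p, f (p, h p) * -D1 i p := fun i hfg => by
    have c1 : Continuous fun p => prim g (p, h p) := (continuous_prim hg).comp (continuous_graph hh)
    have c2 : Continuous fun p => f (p, h p) * D1 i p := (hf.comp (continuous_graph hh)).mul (cD i)
    have := (hasPdT_prim hfg hf hg (hD i)).integral_eq_zero
      ((continuous_prim hf).comp (continuous_graph hh)) (c1.add c2)
    rw [integral_add (Torus.integrable c1) (Torus.integrable c2)] at this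
    simp only [mul_neg, integral_neg]
    linarith
  fin_cases i
  · exact hor 0 hfg
  · exact hor 1 hfg
  -- In the vertical direction this is the fundamental theorem of calculus, with no contribution
  -- from the bottom.
  · have : ∀ p, prim g (p, h p) = f (p, h p) * normalX D1 2 p := fun p => by
      rw [prim_pdX_two hfg hg, hf0, sub_zero, normalX, mul_one]
    exact integral_congr_ae (Eventually.of_forall this)

end SpaceCalculus

/-! ### Steklov averages and difference quotients -/

section Steklov

variable {L₁ L₂ : ℝ}

/-- The Steklov average in the horizontal direction `i`. -/
noncomputable def steklov (i : Fin 2) (s : ℝ) (f : Space L₁ L₂ → ℝ) (q : Space L₁ L₂) : ℝ :=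
  s⁻¹ * ∫ σ in (0 : ℝ)..s, f (shiftT i σ q.1, q.2)

/-- The difference quotient in the horizontal direction `i`. -/
noncomputable def diffQuot (i : Fin 2) (s : ℝ) (f : Space L₁ L₂ → ℝ) (q : Space L₁ L₂) : ℝ :=
  s⁻¹ * (f (shiftT i s q.1, q.2) - f q)

lemma continuous_horShift (i : Fin 2) :
    Continuous fun a : Space L₁ L₂ × ℝ => ((shiftT i a.2 a.1.1, a.1.2) : Space L₁ L₂) :=
  ((continuous_shiftT i).comp (continuous_snd.prodMk (continuous_fst.comp continuous_fst))).prodMk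
    (continuous_snd.comp continuous_fst)

lemma continuous_line {f : Space L₁ L₂ → ℝ} (hf : Continuous f) (i : Fin 2) (q : Space L₁ L₂) :
    Continuous fun σ => f (shiftT i σ q.1, q.2) :=
  hf.comp ((continuous_horShift i).comp (continuous_const.prodMk continuous_id))

lemma continuous_steklov {f : Space L₁ L₂ → ℝ} (hf : Continuous f) (i : Fin 2) (s : ℝ) :
    Continuous (steklov i s f) :=
  continuous_const.mul (intervalIntegral.continuous_parametric_intervalIntegral_of_continuous'
    (f := fun (q : Space L₁ L₂) σ => f (shiftT i σ q.1, q.2)) (hf.comp (continuous_horShift i)) 0 s)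

lemma continuous_diffQuot {f : Space L₁ L₂ → ℝ} (hf : Continuous f) (i : Fin 2) (s : ℝ) :
    Continuous (diffQuot i s f) :=
  continuous_const.mul ((hf.comp ((continuous_horShift i).comp
    (continuous_id.prodMk continuous_const))).sub hf)

/-- Averaging in direction i makes a merely continuous function differentiable in that direction.
With `hasPdX_diffQuot` it replaces the symmetry of second derivatives for a g that is only C¹: the
∂_i derivative of the average of ∂_j g and the ∂_j derivative of the difference quotient of g are
both the difference quotient of ∂_j g. -/
lemma hasPdX_steklov {f : Space L₁ L₂ → ℝ} (hf : Continuous f) (i : Fin 2) (s : ℝ) :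
    HasPdX i.castSucc (steklov i s f) (diffQuot i s f) := fun q => by
  have c := continuous_line hf i q
  have e : ∀ t, steklov i s f (shiftX i.castSucc t q) = s⁻¹ *
      ((∫ σ in (0 : ℝ)..(t + s), f (shiftT i σ q.1, q.2)) -
        ∫ σ in (0 : ℝ)..t, f (shiftT i σ q.1, q.2)) := fun t => by
    rw [intervalIntegral.integral_interval_sub_left (c.intervalIntegrable _ _)
      (c.intervalIntegrable _ _), steklov, shiftX_castSucc]
    simp only [shiftT_shiftT]
    rw [intervalIntegral.integral_comp_add_left (fun σ => f (shiftT i σ q.1, q.2)) t, add_zero]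
  simp only [e]
  have d : ∀ t, HasDerivAt (fun t => ∫ σ in (0 : ℝ)..t, f (shiftT i σ q.1, q.2))
      (f (shiftT i t q.1, q.2)) t := fun t => intervalIntegral.integral_hasDerivAt_right
    (c.intervalIntegrable _ _) (c.stronglyMeasurableAtFilter _ _) c.continuousAt
  have d1 : HasDerivAt (fun t => ∫ σ in (0 : ℝ)..(t + s), f (shiftT i σ q.1, q.2))
      (f (shiftT i s q.1, q.2)) 0 := by
    have := HasDerivAt.scomp (0 : ℝ) (h := fun t => t + s) (h' := 1) (by simpa using d s)
      ((hasDerivAt_id (0 : ℝ)).add_const s)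
    simpa [Function.comp_def] using this
  have d0 := d 0
  rw [shiftT_zero] at d0
  exact (d1.sub d0).const_mul _

/-- A horizontal shift commutes with the shift in every direction j, including j = i. -/
lemma hasPdX_diffQuot {j : Fin 3} {f g : Space L₁ L₂ → ℝ} (h : HasPdX j f g) (i : Fin 2) (s : ℝ) :
    HasPdX j (diffQuot i s f) (diffQuot i s g) := fun q => by
  have comm : ∀ t, ((shiftT i s (shiftX j t q).1, (shiftX j t q).2) : Space L₁ L₂) =
      shiftX j t (shiftT i s q.1, q.2) := fun t => by
    fin_cases i <;> fin_cases j <;> simp [shiftX, shiftT] <;> abel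
  unfold diffQuot
  simp only [comm]
  exact ((h _).sub (h q)).const_mul _

lemma steklov_eq_diffQuot {f g : Space L₁ L₂ → ℝ} {i : Fin 2} (h : HasPdX i.castSucc f g)
    (hg : Continuous g) (s : ℝ) : steklov i s g = diffQuot i s f := funext fun q => by
  rw [steklov, diffQuot, intervalIntegral.integral_eq_sub_of_hasDerivAt
    (fun σ _ => h.hasDerivAt_castSucc q.1 q.2 σ)
    ((continuous_line hg i q).intervalIntegrable _ _), shiftT_zero]

lemma abs_steklov_le {f : Space L₁ L₂ → ℝ} (i : Fin 2) {s : ℝ} (hs : 0 < s) {B : ℝ}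
    {q : Space L₁ L₂} (hB : ∀ p, |f (p, q.2)| ≤ B) : |steklov i s f q| ≤ B := by
  have := intervalIntegral.norm_integral_le_of_norm_le_const (a := 0) (b := s) (C := B)
    (f := fun σ => f (shiftT i σ q.1, q.2)) fun σ _ => hB _
  rw [sub_zero, Real.norm_eq_abs, abs_of_pos hs] at this
  rw [steklov, abs_mul, abs_of_pos (inv_pos.2 hs), inv_mul_le_iff₀ hs]
  linarith

lemma tendsto_steklov {f : Space L₁ L₂ → ℝ} (hf : Continuous f) (i : Fin 2) (q : Space L₁ L₂) :
    Tendsto (fun n : ℕ => steklov i (1 / (n + 1 : ℝ)) f q) atTop (𝓝 (f q)) := by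
  have c := continuous_line hf i q
  have d : HasDerivAt (fun t => ∫ σ in (0 : ℝ)..t, f (shiftT i σ q.1, q.2))
      (f (shiftT i 0 q.1, q.2)) 0 := intervalIntegral.integral_hasDerivAt_right
    (c.intervalIntegrable _ _) (c.stronglyMeasurableAtFilter _ _) c.continuousAt
  rw [shiftT_zero] at d
  have t := hasDerivAt_iff_tendsto_slope_zero.1 d
  have u : Tendsto (fun n : ℕ => (1 / (n + 1 : ℝ))) atTop (𝓝[≠] 0) :=
    tendsto_nhdsWithin_iff.2 ⟨tendsto_one_div_add_atTop_nhds_zero_nat,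
      Eventually.of_forall fun n => (Nat.one_div_pos_of_nat).ne'⟩
  have := t.comp u
  simpa [Function.comp_def, steklov] using this

end Steklov

/-! ### The null Lagrangian of two functions below a graph -/

section NullLagrangian

variable {L₁ L₂ : ℝ} [Fact (0 < L₁)] [Fact (0 < L₂)]

lemma exists_bound_slab {f : Space L₁ L₂ → ℝ} (hf : Continuous f) (a b : ℝ) :
    ∃ C, ∀ p, ∀ z ∈ Icc a b, |f (p, z)| ≤ C := by
  obtain ⟨C, hC⟩ := ((isCompact_univ (X := Torus L₁ L₂)).prod
    (isCompact_Icc (a := a) (b := b))).exists_bound_of_continuousOn hf.continuousOn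
  exact ⟨C, fun p z hz => hC (p, z) ⟨mem_univ _, hz⟩⟩

instance (a : ℝ) (h : Torus L₁ L₂ → ℝ) [hh : Fact (Continuous h)] :
    IsFiniteMeasure ((volume : Measure (Space L₁ L₂)).restrict (region a h)) := by
  have := integrableOn_region a hh.out (f := fun _ => (1 : ℝ)) continuous_const
  rw [IntegrableOn, integrable_const_iff] at this
  exact this.resolve_left one_ne_zero

lemma abs_normalX_le (D1 : Fin 2 → Torus L₁ L₂ → ℝ) (i : Fin 3) (p : Torus L₁ L₂) :
    |normalX D1 i p| ≤ 1 + |D1 0 p| + |D1 1 p| := by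
  have h0 := abs_nonneg (D1 0 p)
  have h1 := abs_nonneg (D1 1 p)
  fin_cases i
  · show |-D1 0 p| ≤ _
    rw [abs_neg]; linarith
  · show |-D1 1 p| ≤ _
    rw [abs_neg]; linarith
  · show |(1 : ℝ)| ≤ _
    rw [abs_one]; linarith

/-- The null Lagrangian `∂_i f ∂_j g - ∂_j f ∂_i g` of classical functions below a smooth graph is
controlled by the values of `f` on the graph. -/
lemma abs_integral_bracket_le {h : Torus L₁ L₂ → ℝ} {D1 : Fin 2 → Torus L₁ L₂ → ℝ}
    (hh : Continuous h) (hD : ∀ i, HasPdT i h (D1 i)) (cD : ∀ i, Continuous (D1 i))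
    (h0 : ∀ p, 0 ≤ h p) (i : Fin 2) (j : Fin 3) {f g : Space L₁ L₂ → ℝ} (hf : IsCkX 1 f)
    (hg : IsCkX 1 g) (hf0 : ∀ p, f (p, -1) = 0) {H B : ℝ} (hH : ∀ p, h p ≤ H)
    (hBi : ∀ p, ∀ z ∈ Icc (-1) H, |pdX i.castSucc g (p, z)| ≤ B)
    (hBj : ∀ p, ∀ z ∈ Icc (-1) H, |pdX j g (p, z)| ≤ B) :
    |∫ q in region (-1) h, (pdX i.castSucc f q * pdX j g q - pdX j f q * pdX i.castSucc g q)| ≤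
      2 * B * ∫ p, |f (p, h p)| * (1 + |D1 0 p| + |D1 1 p|) := by
  have cf := hf.continuous
  have cfi := hf.continuous_pdX i.castSucc
  have cfj := hf.continuous_pdX j
  have cgi := hg.continuous_pdX i.castSucc
  have cgj := hg.continuous_pdX j
  have cm : Continuous fun p => |f (p, h p)| * (1 + |D1 0 p| + |D1 1 p|) :=
    (cf.comp (continuous_graph hh)).abs.mul ((continuous_const.add (cD 0).abs).add (cD 1).abs)
  set s : ℕ → ℝ := fun n => 1 / (n + 1 : ℝ)
  have spos : ∀ n, 0 < s n := fun n => Nat.one_div_pos_of_nat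
  -- A and A' are substitutes for ∂_j g and ∂_i g with ∂_i A = ∂_j A'. They inherit the bound B and
  -- converge to the originals pointwise.
  set A : ℕ → Space L₁ L₂ → ℝ := fun n => steklov i (s n) (pdX j g)
  set A' : ℕ → Space L₁ L₂ → ℝ := fun n => diffQuot i (s n) g
  have cA : ∀ n, Continuous (A n) := fun n => continuous_steklov cgj i (s n)
  have cA' : ∀ n, Continuous (A' n) := fun n => continuous_diffQuot hg.continuous i (s n)
  have eA' : ∀ n, A' n = steklov i (s n) (pdX i.castSucc g) := fun n =>
    (steklov_eq_diffQuot (hg.hasPdX _) cgi (s n)).symm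
  have bA : ∀ n p, ∀ z ∈ Icc (-1) H, |A n (p, z)| ≤ B := fun n p z hz =>
    abs_steklov_le i (spos n) fun p => hBj p z hz
  have bA' : ∀ n p, ∀ z ∈ Icc (-1) H, |A' n (p, z)| ≤ B := fun n p z hz => by
    rw [eA']
    exact abs_steklov_le i (spos n) fun p => hBi p z hz
  have step : ∀ n, |∫ q in region (-1) h,
      (pdX i.castSucc f q * A n q - pdX j f q * A' n q)| ≤
      2 * B * ∫ p, |f (p, h p)| * (1 + |D1 0 p| + |D1 1 p|) := fun n => by
    have d1 := (hf.hasPdX i.castSucc).mul (hasPdX_steklov cgj i (s n))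
    have d2 := (hf.hasPdX j).mul (hasPdX_diffQuot (hg.hasPdX j) i (s n))
    have cK : Continuous (diffQuot i (s n) (pdX j g)) := continuous_diffQuot cgj i (s n)
    have c1 : Continuous fun q => pdX i.castSucc f q * A n q + f q * diffQuot i (s n) (pdX j g) q :=
      (cfi.mul (cA n)).add (cf.mul cK)
    have c2 : Continuous fun q => pdX j f q * A' n q + f q * diffQuot i (s n) (pdX j g) q :=
      (cfj.mul (cA' n)).add (cf.mul cK)
    have e1 := integral_prim_eq hh hD cD i.castSucc d1 (cf.mul (cA n)) c1
      (fun p => by rw [hf0, zero_mul])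
    have e2 := integral_prim_eq hh hD cD j d2 (cf.mul (cA' n)) c2
      (fun p => by rw [hf0, zero_mul])
    rw [integral_region_eq_prim (f := fun q => pdX i.castSucc f q * A n q - pdX j f q * A' n q)
      hh h0 ((cfi.mul (cA n)).sub (cfj.mul (cA' n)))]
    -- By the compatibility of A and A' the bracket is ∂_i (f A) − ∂_j (f A'): the two terms in
    -- which f is not differentiated cancel, and only boundary terms remain.
    have eq1 : ∀ p, prim (fun q => pdX i.castSucc f q * A n q - pdX j f q * A' n q) (p, h p) =
        prim (fun q => pdX i.castSucc f q * A n q + f q * diffQuot i (s n) (pdX j g) q) (p, h p) -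
        prim (fun q => pdX j f q * A' n q + f q * diffQuot i (s n) (pdX j g) q) (p, h p) :=
      fun p => by
        rw [← prim_sub c1 c2]
        congr 1; ext q; ring
    have i1 : Integrable fun p =>
        prim (fun q => pdX i.castSucc f q * A n q + f q * diffQuot i (s n) (pdX j g) q) (p, h p) :=
      Torus.integrable ((continuous_prim c1).comp (continuous_graph hh))
    have i2 : Integrable fun p =>
        prim (fun q => pdX j f q * A' n q + f q * diffQuot i (s n) (pdX j g) q) (p, h p) :=
      Torus.integrable ((continuous_prim c2).comp (continuous_graph hh))
    have cN : ∀ l : Fin 3, Continuous (normalX D1 l) := fun l => by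
      fin_cases l
      · exact (cD 0).neg
      · exact (cD 1).neg
      · exact continuous_const
    have i3 : Integrable fun p => f (p, h p) * A n (p, h p) * normalX D1 i.castSucc p :=
      Torus.integrable (((cf.mul (cA n)).comp (continuous_graph hh)).mul (cN _))
    have i4 : Integrable fun p => f (p, h p) * A' n (p, h p) * normalX D1 j p :=
      Torus.integrable (((cf.mul (cA' n)).comp (continuous_graph hh)).mul (cN _))
    rw [integral_congr_ae (μ := volume) (Eventually.of_forall eq1), integral_sub i1 i2]
    have E1 : (∫ p, prim (fun q => pdX i.castSucc f q * A n q +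
        f q * diffQuot i (s n) (pdX j g) q) (p, h p)) =
        ∫ p, f (p, h p) * A n (p, h p) * normalX D1 i.castSucc p := e1
    have E2 : (∫ p, prim (fun q => pdX j f q * A' n q +
        f q * diffQuot i (s n) (pdX j g) q) (p, h p)) =
        ∫ p, f (p, h p) * A' n (p, h p) * normalX D1 j p := e2
    rw [E1, E2, ← integral_sub i3 i4, ← integral_const_mul]
    rw [← Real.norm_eq_abs]
    refine norm_integral_le_of_norm_le (Torus.integrable (f := fun p => 2 * B *
      (|f (p, h p)| * (1 + |D1 0 p| + |D1 1 p|))) (continuous_const.mul cm))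
      (Eventually.of_forall fun p => ?_)
    rw [Real.norm_eq_abs]
    have hz : h p ∈ Icc (-1) H := ⟨by linarith [h0 p], hH p⟩
    have a1 := bA n p (h p) hz
    have a2 := bA' n p (h p) hz
    have n1 := abs_normalX_le D1 i.castSucc p
    have n2 := abs_normalX_le D1 j p
    have m0 : 0 ≤ 1 + |D1 0 p| + |D1 1 p| := by positivity
    have B0 : 0 ≤ B := (abs_nonneg _).trans a1
    have t1 : |f (p, h p) * A n (p, h p) * normalX D1 i.castSucc p| ≤
        |f (p, h p)| * B * (1 + |D1 0 p| + |D1 1 p|) := by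
      rw [abs_mul, abs_mul]; gcongr
    have t2 : |f (p, h p) * A' n (p, h p) * normalX D1 j p| ≤
        |f (p, h p)| * B * (1 + |D1 0 p| + |D1 1 p|) := by
      rw [abs_mul, abs_mul]; gcongr
    refine (abs_sub _ _).trans ?_
    linarith
  have lim : Tendsto (fun n => ∫ q in region (-1) h,
      (pdX i.castSucc f q * A n q - pdX j f q * A' n q)) atTop
      (𝓝 (∫ q in region (-1) h,
        (pdX i.castSucc f q * pdX j g q - pdX j f q * pdX i.castSucc g q))) := by
    obtain ⟨C₁, hC₁⟩ := exists_bound_slab cfi (-1) H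
    obtain ⟨C₂, hC₂⟩ := exists_bound_slab cfj (-1) H
    have : Fact (Continuous h) := ⟨hh⟩
    refine tendsto_integral_of_dominated_convergence (fun _ => C₁ * B + C₂ * B)
      (fun n => ((cfi.mul (cA n)).sub (cfj.mul (cA' n))).aestronglyMeasurable)
      (integrable_const _) (fun n => ?_) (Eventually.of_forall fun q => ?_)
    · refine (ae_restrict_iff' (isOpen_region _ hh).measurableSet).2
        (Eventually.of_forall fun q hq => ?_)
      have hz : q.2 ∈ Icc (-1) H := ⟨hq.1.le, hq.2.le.trans (hH _)⟩
      have b1 := hC₁ q.1 q.2 hz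
      have b2 := hC₂ q.1 q.2 hz
      have b3 := bA n q.1 q.2 hz
      have b4 := bA' n q.1 q.2 hz
      rw [Real.norm_eq_abs]
      refine (abs_sub _ _).trans ?_
      rw [abs_mul, abs_mul]
      have := (abs_nonneg _).trans b1
      have := (abs_nonneg _).trans b2
      gcongr
    · refine (tendsto_const_nhds.mul (tendsto_steklov cgj i q)).sub (tendsto_const_nhds.mul ?_)
      simp only [eA']
      exact tendsto_steklov cgi i q
  exact le_of_tendsto lim.abs (Eventually.of_forall step)

/-- The null Lagrangian below the graph of a plate of class `H²`. -/
lemma exists_abs_integral_bracket_le {h : Torus L₁ L₂ → ℝ} {Dh : Torus L₁ L₂ → Fin 2 → ℝ}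
    {D2h : Torus L₁ L₂ → Fin 2 → Fin 2 → ℝ} (H2 : IsH2 h Dh D2h) (hc : Continuous h)
    (h0 : ∀ p, 0 ≤ h p) (i : Fin 2) (j : Fin 3) {g : Space L₁ L₂ → ℝ} (hg : IsCkX 1 g) :
    ∃ C : ℝ, ∀ f : Space L₁ L₂ → ℝ, IsCkX 1 f → (∀ p, f (p, -1) = 0) →
      |∫ q in region (-1) h, (pdX i.castSucc f q * pdX j g q - pdX j f q * pdX i.castSucc g q)| ≤
        C * √(∫ p, f (p, h p) ^ 2) := by
  obtain ⟨hn, D1, D2, D3, hsm, hn0, hu, hS, -⟩ := exists_smoothPlate_seq hc h0 H2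
  set S := ∫ p, (∑ i, D2h p i i) ^ 2
  obtain ⟨H, hH⟩ := exists_bound hc
  obtain ⟨B₁, hB₁⟩ := exists_bound_slab (hg.continuous_pdX i.castSucc) (-1) (H + 1)
  obtain ⟨B₂, hB₂⟩ := exists_bound_slab (hg.continuous_pdX j) (-1) (H + 1)
  set B := max B₁ B₂
  have hB0 : 0 ≤ B := by
    have h1 : (0 : ℝ) ∈ Icc (-1) (H + 1) :=
      ⟨by norm_num, by have := (abs_nonneg _).trans (hH 0); linarith⟩
    exact ((abs_nonneg _).trans (hB₁ 0 0 h1)).trans (le_max_left _ _)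
  -- The constant depends on g and on the plate but not on f, so f may be sent to a limit while g is
  -- fixed. The bound B is taken up to height H + 1 because the approximating plates may exceed H
  -- slightly.
  refine ⟨2 * B * √(plateConst L₁ L₂ 1 S), fun f hf hf0 => ?_⟩
  have cf := hf.continuous
  have cbr : Continuous fun q => pdX i.castSucc f q * pdX j g q - pdX j f q * pdX i.castSucc g q :=
    ((hf.continuous_pdX _).mul (hg.continuous_pdX _)).sub
      ((hf.continuous_pdX _).mul (hg.continuous_pdX _))
  have lim1 := tendsto_integral_graph (continuous_prim cbr) hc (fun n => (hsm n).c0) hu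
  have lim2 := tendsto_integral_graph (cf.pow 2) hc (fun n => (hsm n).c0) hu
  rw [← integral_region_eq_prim hc h0 cbr] at lim1
  refine le_of_tendsto_of_tendsto lim1.abs (lim2.sqrt.const_mul _) ?_
  filter_upwards [Metric.tendstoUniformly_iff.1 hu 1 one_pos] with n hn'
  have hle : ∀ p, hn n p ≤ H + 1 := fun p => by
    have h1 := hn' p
    have h2 := (le_abs_self _).trans (hH p)
    rw [Real.dist_eq, abs_lt] at h1
    linarith [h1.1]
  have key := abs_integral_bracket_le (hsm n).c0 (hsm n).d1 (hsm n).c1 (hn0 n) i j hf hg hf0 hle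
    (fun p z hz => (hB₁ p z hz).trans (le_max_left _ _))
    (fun p z hz => (hB₂ p z hz).trans (le_max_right _ _))
  rw [integral_region_eq_prim (hsm n).c0 (hn0 n) cbr] at key
  refine key.trans ?_
  have cm : Continuous fun p => 1 + |D1 n 0 p| + |D1 n 1 p| :=
    (continuous_const.add ((hsm n).c1 0).abs).add ((hsm n).c1 1).abs
  have cfh : Continuous fun p => f (p, hn n p) := cf.comp (continuous_graph (hsm n).c0)
  have hol := integral_mul_le_sqrt_mul_sqrt (Torus.memLp cfh.abs 2) (Torus.memLp cm 2)
  simp only [sq_abs] at hol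
  -- The weight is at least 1, so its square is at most its fourth power, which is the case k = 1 of
  -- the slope bound.
  have m4 : ∫ p, (1 + |D1 n 0 p| + |D1 n 1 p|) ^ 2 ≤ plateConst L₁ L₂ 1 S := by
    refine le_trans (integral_mono (Torus.integrable (cm.pow 2)) (Torus.integrable (cm.pow 4))
      fun p => ?_) (((hsm n).integral_slope_pow_le le_rfl).trans
        (plateConst_mono 1 (integral_nonneg fun _ => sq_nonneg _) (hS n)))
    have : 1 ≤ 1 + |D1 n 0 p| + |D1 n 1 p| := by
      have := abs_nonneg (D1 n 0 p)
      have := abs_nonneg (D1 n 1 p)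
      linarith
    exact pow_le_pow_right₀ this (by norm_num)
  calc _ ≤ 2 * B * (√(∫ p, f (p, hn n p) ^ 2) * √(∫ p, (1 + |D1 n 0 p| + |D1 n 1 p|) ^ 2)) := by
        gcongr
    _ ≤ 2 * B * (√(∫ p, f (p, hn n p) ^ 2) * √(plateConst L₁ L₂ 1 S)) := by
        gcongr
    _ = _ := by simp only [Pi.pow_apply]; ring

end NullLagrangian

/-! ### The vertical L² mass of a function below a graph -/

section VerticalMass

variable {L₁ L₂ : ℝ}

/-- As f vanishes at the bottom, f² is the vertical integral of 2 f ∂_z f; then Cauchy–Schwarz.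
Unlike `sq_le_mul_prim`, the bound keeps a factor of the norm of f itself. -/
lemma sq_le_prim {f g : Space L₁ L₂ → ℝ} (h : HasPdX 2 f g) (hf : Continuous f) (hg : Continuous g)
    (hf0 : ∀ p, f (p, -1) = 0) {q : Space L₁ L₂} (hq : -1 ≤ q.2) :
    f q ^ 2 ≤ 2 * (√(prim (fun q => f q ^ 2) q) * √(prim (fun q => g q ^ 2) q)) := by
  have d := h.mul h
  have e := prim_pdX_two d ((hg.mul hf).add (hf.mul hg)) q
  rw [hf0, zero_mul, sub_zero] at e
  have e2 : prim (fun q => g q * f q + f q * g q) q = 2 * prim (fun q => f q * g q) q := by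
    rw [prim_add (f := fun q => g q * f q) (g := fun q => f q * g q) (hg.mul hf) (hf.mul hg)]
    simp only [mul_comm (g _)]
    ring
  have := le_abs_self (prim (fun q => f q * g q) q)
  have := abs_prim_mul_le hf hg hq
  rw [sq, ← e, e2]
  linarith

lemma sq_le_mul_prim {f g : Space L₁ L₂ → ℝ} (h : HasPdX 2 f g) (hg : Continuous g)
    (hf0 : ∀ p, f (p, -1) = 0) {q : Space L₁ L₂} (hq : -1 ≤ q.2) :
    f q ^ 2 ≤ (q.2 + 1) * prim (fun q => g q ^ 2) q := by
  have e := prim_pdX_two h hg q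
  rw [hf0, sub_zero] at e
  have := sq_prim_mul_le (continuous_const (y := (1 : ℝ))) hg hq
  simp only [one_mul, one_pow] at this
  rw [e] at this
  have e1 : prim (fun _ => (1 : ℝ)) q = q.2 + 1 := by simp [prim]
  rwa [e1] at this

variable [Fact (0 < L₁)] [Fact (0 < L₂)]

/-- Integrability of all powers of the vertical `L²` mass of a classical function below a smooth
graph. -/
lemma IsSmoothPlate.integral_prim_sq_pow_le {h : Torus L₁ L₂ → ℝ} {D1 : Fin 2 → Torus L₁ L₂ → ℝ}
    {D2 : Fin 2 → Fin 2 → Torus L₁ L₂ → ℝ} {D3 : Fin 2 → Fin 2 → Fin 2 → Torus L₁ L₂ → ℝ}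
    (hsm : IsSmoothPlate h D1 D2 D3) (h0 : ∀ p, 0 ≤ h p) {H : ℝ} (hH : ∀ p, h p ≤ H)
    {f : Space L₁ L₂ → ℝ} (hf : IsCkX 1 f) (hf0 : ∀ p, f (p, -1) = 0) {k : ℕ} (hk : 1 ≤ k) :
    ∫ p, prim (fun q => f q ^ 2) (p, h p) ^ (2 * k) ≤
      (gnConst L₁ L₂ k * (((1 + H) ^ 2 + 1) * ∫ p, prim (fun q => ∑ j, pdX j f q ^ 2) (p, h p)))
        ^ (2 * k) * plateConst L₁ L₂ k (∫ p, (∑ i, D2 i i p) ^ 2) := by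
  have cf := hf.continuous
  have cd := hf.continuous_pdX
  have cg := continuous_graph hsm.c0
  have csum : Continuous fun q => ∑ j, pdX j f q ^ 2 :=
    continuous_finsetSum _ fun j _ => (cd j).pow 2
  set g2 : Torus L₁ L₂ → ℝ := fun p => prim (fun q => ∑ j, pdX j f q ^ 2) (p, h p)
  have cg2 : Continuous g2 := (continuous_prim csum).comp cg
  have hq : ∀ p, (-1 : ℝ) ≤ ((p, h p) : Space L₁ L₂).2 := fun p => by
    show -1 ≤ h p
    linarith [h0 p]
  have jle : ∀ j p, prim (fun q => pdX j f q ^ 2) (p, h p) ≤ g2 p := fun j p =>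
    prim_mono ((cd j).pow 2) csum (fun q => Finset.single_le_sum
      (f := fun j => pdX j f q ^ 2) (fun _ _ => sq_nonneg _) (Finset.mem_univ j)) (hq p)
  have g20 : ∀ p, 0 ≤ g2 p := fun p => (prim_nonneg (fun _ => sq_nonneg _) (hq p)).trans (jle 0 p)
  set W : Torus L₁ L₂ → ℝ := fun p => prim (fun q => f q ^ 2) (p, h p)
  have cW : Continuous W := (continuous_prim (cf.pow 2)).comp cg
  have W0 : ∀ p, 0 ≤ W p := fun p => prim_nonneg (fun _ => sq_nonneg _) (hq p)
  have dsq : ∀ i, HasPdX i (fun q => f q ^ 2) (fun q => 2 * (f q * pdX i f q)) := fun i => by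
    have := (hf.hasPdX i).mul (hf.hasPdX i)
    have e1 : (fun q => f q * f q) = fun q => f q ^ 2 := by ext q; ring
    have e2 : (fun q => pdX i f q * f q + f q * pdX i f q) = fun q => 2 * (f q * pdX i f q) := by
      ext q; ring
    rwa [e1, e2] at this
  -- The derivative of the vertical mass has an interior part and a boundary part, the latter
  -- multiplied by the slope of the plate.
  set W' : Fin 2 → Torus L₁ L₂ → ℝ := fun i p =>
    prim (fun q => 2 * (f q * pdX i.castSucc f q)) (p, h p) + f (p, h p) ^ 2 * D1 i p
  have cdd : ∀ i, Continuous fun q => 2 * (f q * pdX i f q) := fun i =>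
    continuous_const.mul (cf.mul (cd i))
  have hW : ∀ i, HasPdT i W (W' i) := fun i =>
    hasPdT_prim (dsq i.castSucc) (cf.pow 2) (cdd _) (hsm.d1 i)
  have cW' : ∀ i, Continuous (W' i) := fun i =>
    ((continuous_prim (cdd _)).comp cg).add (((cf.pow 2).comp cg).mul (hsm.c1 i))
  have cm : Continuous fun p => 1 + |D1 0 p| + |D1 1 p| :=
    (continuous_const.add (hsm.c1 0).abs).add (hsm.c1 1).abs
  have key := integral_pow_le hW cW cW' cg2.sqrt cm W0 (fun p => by
      have := abs_nonneg (D1 0 p)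
      have := abs_nonneg (D1 1 p)
      linarith) (fun i p => ?_) hk
  · simp only [fun p => Real.sq_sqrt (g20 p)] at key
    -- Poincaré's inequality on vertical lines of length at most 1 + H, so that the lowest-order
    -- term is also controlled by the Dirichlet integral.
    have IW : ∫ p, W p ≤ (1 + H) ^ 2 * ∫ p, g2 p := by
      rw [← integral_const_mul]
      refine integral_mono (Torus.integrable cW) (Torus.integrable (continuous_const.mul cg2))
        fun p => ?_
      have hb : ∀ z ∈ Icc (-1) (h p), f (p, z) ^ 2 ≤ (1 + H) * g2 p := fun z hz => by
        refine (sq_le_mul_prim (hf.hasPdX 2) (cd 2) hf0 (q := (p, z)) hz.1).trans ?_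
        have a1 := prim_mono_right ((cd 2).pow 2) (fun _ => sq_nonneg _) p hz.1 hz.2
        have a2 : (0 : ℝ) ≤ z + 1 := by linarith [hz.1]
        have a3 : z + 1 ≤ 1 + H := by linarith [hz.2, hH p]
        exact mul_le_mul a3 (a1.trans (jle 2 p))
          (prim_nonneg (fun _ => sq_nonneg _) hz.1) (a2.trans a3)
      have : W p ≤ ∫ z in (-1 : ℝ)..h p, (1 + H) * g2 p :=
        intervalIntegral.integral_mono_on (hq p)
          ((continuous_slice (cf.pow 2) p).intervalIntegrable _ _) intervalIntegrable_const hb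
      rw [intervalIntegral.integral_const, smul_eq_mul] at this
      have h1 : h p - -1 ≤ 1 + H := by linarith [hH p]
      have h2 : 0 ≤ (1 + H) * g2 p := by
        have : 0 ≤ H := (h0 p).trans (hH p)
        have := g20 p
        positivity
      show W p ≤ (1 + H) ^ 2 * g2 p
      nlinarith
    have n1 : 0 ≤ ∫ p, W p := integral_nonneg W0
    have n2 : 0 ≤ ∫ p, g2 p := integral_nonneg g20
    have g0 : 0 ≤ gnConst L₁ L₂ k := gnConst_nonneg Fact.out Fact.out k
    have N0 : 0 ≤ ∫ p, (1 + |D1 0 p| + |D1 1 p|) ^ (4 * k) :=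
      integral_nonneg fun p => by positivity
    refine key.trans ?_
    have hN := hsm.integral_slope_pow_le hk
    gcongr
    linarith
  · have b1 : |prim (fun q => 2 * (f q * pdX i.castSucc f q)) (p, h p)| ≤
        2 * (√(W p) * √(g2 p)) := by
      have e : prim (fun q => 2 * (f q * pdX i.castSucc f q)) (p, h p) =
          2 * prim (fun q => f q * pdX i.castSucc f q) (p, h p) :=
        intervalIntegral.integral_const_mul _ _
      rw [e, abs_mul, abs_two]
      have := abs_prim_mul_le cf (cd i.castSucc) (hq p)
      have := Real.sqrt_le_sqrt (jle i.castSucc p)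
      have : √(W p) * √(prim (fun q => pdX i.castSucc f q ^ 2) (p, h p)) ≤ √(W p) * √(g2 p) := by
        gcongr
      show 2 * |prim (fun q => f q * pdX i.castSucc f q) (p, h p)| ≤ 2 * (√(W p) * √(g2 p))
      linarith
    -- The boundary value obeys the same bound √W √g₂ as the interior part. This brings the gradient
    -- of W into the form 2 √W g m required by the power estimate, with the slope weight as m.
    have b2 : f (p, h p) ^ 2 ≤ 2 * (√(W p) * √(g2 p)) := by
      refine (sq_le_prim (hf.hasPdX 2) cf (cd 2) hf0 (hq p)).trans ?_
      have := Real.sqrt_le_sqrt (jle 2 p)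
      gcongr
    have hd : |D1 i p| ≤ |D1 0 p| + |D1 1 p| := by
      have := abs_nonneg (D1 0 p)
      have := abs_nonneg (D1 1 p)
      fin_cases i
      · show |D1 0 p| ≤ _
        linarith
      · show |D1 1 p| ≤ _
        linarith
    calc |W' i p| ≤ |prim (fun q => 2 * (f q * pdX i.castSucc f q)) (p, h p)|
          + |f (p, h p) ^ 2 * D1 i p| := abs_add_le _ _
      _ ≤ 2 * (√(W p) * √(g2 p)) + 2 * (√(W p) * √(g2 p)) * (|D1 0 p| + |D1 1 p|) := by
          rw [abs_mul, abs_of_nonneg (sq_nonneg (f (p, h p)))]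
          gcongr
      _ = _ := by ring

/-- Integrability of all powers of the vertical `L²` mass below the graph of a plate of class
`H²`. -/
lemma IsH2.integral_prim_sq_pow_le {h : Torus L₁ L₂ → ℝ} {Dh : Torus L₁ L₂ → Fin 2 → ℝ}
    {D2h : Torus L₁ L₂ → Fin 2 → Fin 2 → ℝ} (H2 : IsH2 h Dh D2h) (hc : Continuous h)
    (h0 : ∀ p, 0 ≤ h p) {H : ℝ} (hH : ∀ p, h p ≤ H)
    {f : Space L₁ L₂ → ℝ} (hf : IsCkX 1 f) (hf0 : ∀ p, f (p, -1) = 0) {k : ℕ} (hk : 1 ≤ k) :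
    ∫ p, prim (fun q => f q ^ 2) (p, h p) ^ (2 * k) ≤
      (gnConst L₁ L₂ k * (((2 + H) ^ 2 + 1) * ∫ p, prim (fun q => ∑ j, pdX j f q ^ 2) (p, h p)))
        ^ (2 * k) * plateConst L₁ L₂ k (∫ p, (∑ i, D2h p i i) ^ 2) := by
  obtain ⟨hn, D1, D2, D3, hsm, hn0, hu, hS, -⟩ := exists_smoothPlate_seq hc h0 H2
  have csum : Continuous fun q => ∑ j, pdX j f q ^ 2 :=
    continuous_finsetSum _ fun j _ => (hf.continuous_pdX j).pow 2
  have lim1 := tendsto_integral_graph ((continuous_prim (hf.continuous.pow 2)).pow (2 * k)) hc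
    (fun n => (hsm n).c0) hu
  have lim2 := tendsto_integral_graph (continuous_prim csum) hc (fun n => (hsm n).c0) hu
  refine le_of_tendsto_of_tendsto lim1 ((((lim2.const_mul ((2 + H) ^ 2 + 1)).const_mul
    (gnConst L₁ L₂ k)).pow (2 * k)).mul_const
      (plateConst L₁ L₂ k (∫ p, (∑ i, D2h p i i) ^ 2))) ?_
  filter_upwards [Metric.tendstoUniformly_iff.1 hu 1 one_pos] with n hn'
  have hle : ∀ p, hn n p ≤ H + 1 := fun p => by
    have h1 := hn' p
    have h2 := hH p
    rw [Real.dist_eq, abs_lt] at h1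
    linarith [h1.1]
  have key := (hsm n).integral_prim_sq_pow_le (hn0 n) hle hf hf0 hk
  rw [show 1 + (H + 1) = 2 + H by ring] at key
  refine key.trans (mul_le_mul_of_nonneg_left
    (plateConst_mono k (integral_nonneg fun _ => sq_nonneg _) (hS n)) ?_)
  exact (even_two_mul k).pow_nonneg _

end VerticalMass

/-! ### Limits of norms and products in L² -/

section L2Limits

variable {α : Type*} [MeasurableSpace α] {ν : Measure α}

lemma tendsto_eLpNorm_of_sub {a : ℕ → α → ℝ} {b : α → ℝ} (ha : ∀ n, AEStronglyMeasurable (a n) ν)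
    (hb : AEStronglyMeasurable b ν)
    (h : Tendsto (fun n => eLpNorm (fun x => a n x - b x) 2 ν) atTop (𝓝 0)) :
    Tendsto (fun n => eLpNorm (a n) 2 ν) atTop (𝓝 (eLpNorm b 2 ν)) := by
  have up : ∀ n, eLpNorm (a n) 2 ν ≤ eLpNorm b 2 ν + eLpNorm (fun x => a n x - b x) 2 ν :=
    fun n => by
      have := eLpNorm_add_le hb ((ha n).sub hb) (p := 2) one_le_two
      rwa [add_sub_cancel] at this
  have lo : ∀ n, eLpNorm b 2 ν - eLpNorm (fun x => a n x - b x) 2 ν ≤ eLpNorm (a n) 2 ν :=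
    fun n => by
      have := eLpNorm_sub_le (ha n) ((ha n).sub hb) (p := 2) one_le_two
      rw [sub_sub_cancel] at this
      exact tsub_le_iff_right.2 this
  refine tendsto_of_tendsto_of_tendsto_of_le_of_le ?_ ?_ lo up
  · have := ENNReal.Tendsto.sub (tendsto_const_nhds (x := eLpNorm b 2 ν)) h (.inr ENNReal.zero_ne_top)
    rwa [tsub_zero] at this
  · have := tendsto_const_nhds (x := eLpNorm b 2 ν) |>.add h
    rwa [add_zero] at this

lemma tendsto_integral_mul_of_L2 {a b : ℕ → α → ℝ} {a' b' : α → ℝ} (ha : ∀ n, MemLp (a n) 2 ν)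
    (hb : ∀ n, MemLp (b n) 2 ν) (ha' : MemLp a' 2 ν) (hb' : MemLp b' 2 ν)
    (hla : Tendsto (fun n => eLpNorm (fun x => a n x - a' x) 2 ν) atTop (𝓝 0))
    (hlb : Tendsto (fun n => eLpNorm (fun x => b n x - b' x) 2 ν) atTop (𝓝 0)) :
    Tendsto (fun n => ∫ x, a n x * b n x ∂ν) atTop (𝓝 (∫ x, a' x * b' x ∂ν)) := by
  refine tendsto_integral_of_L1' (fun x => a' x * b' x)
    (ha'.aestronglyMeasurable.mul hb'.aestronglyMeasurable)
    (Eventually.of_forall fun n => (ha n).integrable_mul (hb n)) ?_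
  have key : ∀ n, eLpNorm ((fun x => a n x * b n x) - fun x => a' x * b' x) 1 ν ≤
      eLpNorm (fun x => a n x - a' x) 2 ν * eLpNorm (b n) 2 ν +
        eLpNorm a' 2 ν * eLpNorm (fun x => b n x - b' x) 2 ν := fun n => by
    have sa := ((ha n).sub ha').aestronglyMeasurable
    have sb := ((hb n).sub hb').aestronglyMeasurable
    have e : ((fun x => a n x * b n x) - fun x => a' x * b' x) =
        (fun x => a n x - a' x) • b n + a' • (fun x => b n x - b' x) := by
      ext x
      show a n x * b n x - a' x * b' x = (a n x - a' x) * b n x + a' x * (b n x - b' x)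
      ring
    rw [e]
    exact (eLpNorm_add_le (sa.smul (hb n).aestronglyMeasurable)
      (ha'.aestronglyMeasurable.smul sb) le_rfl).trans (add_le_add
        (eLpNorm_smul_le_mul_eLpNorm (p := 2) (q := 2) (hb n).aestronglyMeasurable sa)
        (eLpNorm_smul_le_mul_eLpNorm (p := 2) (q := 2) sb ha'.aestronglyMeasurable))
  refine tendsto_of_tendsto_of_tendsto_of_le_of_le tendsto_const_nhds ?_ (fun _ => zero_le) key
  have lb := tendsto_eLpNorm_of_sub (fun n => (hb n).aestronglyMeasurable)
    hb'.aestronglyMeasurable hlb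
  have t1 := ENNReal.Tendsto.mul hla (.inr hb'.eLpNorm_ne_top) lb (.inr ENNReal.zero_ne_top)
  have t2 := ENNReal.Tendsto.const_mul hlb (.inr ha'.eLpNorm_ne_top)
  simpa using t1.add t2

end L2Limits

/-! ### Approximation of functions with a Lagrangian trace -/

section Approximation

variable {L₁ L₂ : ℝ} [Fact (0 < L₁)] [Fact (0 < L₂)]

/-- `C¹` approximations of the zero extension of `f`, vanishing at the bottom, whose values on the
graph of `h` converge to the trace `g`. -/
structure IsTraceApprox (h : Torus L₁ L₂ → ℝ) (f : Space L₁ L₂ → ℝ)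
    (Df : Space L₁ L₂ → Fin 3 → ℝ) (g : Torus L₁ L₂ → ℝ) (G : ℕ → Space L₁ L₂ → ℝ) : Prop where
  ck : ∀ n, IsCkX 1 (G n)
  bot : ∀ n p, G n (p, -1) = 0
  lim : Tendsto (fun n => eLpNorm (fun q => G n q - (dom h).indicator f q) 2
    (volume.restrict (region (-1) h))) atTop (𝓝 0)
  lim_pd : ∀ i, Tendsto (fun n => eLpNorm (fun q => pdX i (G n) q -
    (dom h).indicator (fun q => Df q i) q) 2 (volume.restrict (region (-1) h))) atTop (𝓝 0)
  lim_trace : Tendsto (fun n => eLpNorm (fun p => G n (p, h p) - g p) 2) atTop (𝓝 0)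

/-- A vertical cutoff function equal to one above `z = -1/2`. -/
noncomputable def cutoffX (q : Space L₁ L₂) : ℝ := Real.smoothTransition (4 * q.2 + 3)

lemma isCkX_cutoffX : IsCkX 1 (cutoffX : Space L₁ L₂ → ℝ) := by
  rw [isCkX_iff]
  exact (Real.smoothTransition.contDiff (n := 1)).comp
    ((contDiff_const.mul (contDiff_snd.comp contDiff_snd)).add contDiff_const)

lemma cutoffX_eq_one {q : Space L₁ L₂} (hq : -1 / 2 ≤ q.2) : cutoffX q = 1 :=
  Real.smoothTransition.one_of_one_le (by linarith)

lemma cutoffX_bot (p : Torus L₁ L₂) : cutoffX (p, -1) = 0 :=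
  Real.smoothTransition.zero_of_nonpos (by norm_num)

lemma pdX_cutoffX_eq_zero (i : Fin 3) {q : Space L₁ L₂} (hq : 0 ≤ q.2) : pdX i cutoffX q = 0 := by
  have h : (fun s : ℝ => cutoffX (shiftX i s q)) =ᶠ[𝓝 0] fun _ => 1 := by
    have c : Continuous fun s : ℝ => (shiftX i s q).2 :=
      continuous_snd.comp ((continuous_shiftX i).comp (continuous_id.prodMk continuous_const))
    filter_upwards [c.continuousAt.eventually (lt_mem_nhds (a := -1 / 2)
      (show -1 / 2 < (shiftX i 0 q).2 by rw [HasPdX.shiftX_zero]; linarith))] with s hs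
    exact cutoffX_eq_one hs.le
  rw [pdX, h.deriv_eq, deriv_const]

lemma measurableSet_dom {h : Torus L₁ L₂ → ℝ} (hc : Continuous h) : MeasurableSet (dom h) :=
  (isOpen_region 0 hc).measurableSet

lemma memLp_indicator_dom {h : Torus L₁ L₂ → ℝ} (hc : Continuous h) {f : Space L₁ L₂ → ℝ}
    (hf : MemLp f 2 (volume.restrict (dom h))) (a : ℝ) :
    MemLp ((dom h).indicator f) 2 (volume.restrict (region a h)) :=
  ((memLp_indicator_iff_restrict (measurableSet_dom hc)).2 hf).restrict _

lemma IsCkX.mul {f g : Space L₁ L₂ → ℝ} (hf : IsCkX 1 f) (hg : IsCkX 1 g) :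
    IsCkX 1 fun q => f q * g q := by
  rw [isCkX_iff] at *
  exact hf.mul hg

/-- The approximations in the definition of the trace need not vanish at z = −1. Multiplying by a
vertical cutoff forces this without changing the limits, because the zero extension of f lives in z
> 0 and the graph lies in z ≥ 0. -/
lemma HasLagrangianTrace.exists_approx {h : Torus L₁ L₂ → ℝ} {f : Space L₁ L₂ → ℝ}
    {Df : Space L₁ L₂ → Fin 3 → ℝ} {g : Torus L₁ L₂ → ℝ} (H : HasLagrangianTrace h f Df g)
    (hc : Continuous h) (h0 : ∀ p, 0 ≤ h p) (hf : MemLp f 2 (volume.restrict (dom h)))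
    (hDf : ∀ i, MemLp (fun q => Df q i) 2 (volume.restrict (dom h))) :
    ∃ G, IsTraceApprox h f Df g G := by
  obtain ⟨G, ck, l, ld, lt⟩ := H
  have e : domExt h = region (-1) h := rfl
  rw [Measure.restrict_univ] at lt
  rw [e] at l ld
  have z1 : ∀ q ∉ dom h, (dom h).indicator f q = 0 := fun q hq => indicator_of_notMem hq _
  have ind : ∀ (f : Space L₁ L₂ → ℝ) (q : Space L₁ L₂),
      cutoffX q * (dom h).indicator f q = (dom h).indicator f q := fun f q => by
    by_cases hq : q ∈ dom h
    · rw [cutoffX_eq_one (by linarith [hq.1]), one_mul]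
    · rw [indicator_of_notMem hq, mul_zero]
  -- The derivative of the cutoff is supported where the zero extension vanishes, so the extra term
  -- of the product rule tends to zero in L².
  have ind' : ∀ (i : Fin 3) (q : Space L₁ L₂),
      pdX i cutoffX q * (dom h).indicator f q = 0 := fun i q => by
    by_cases hq : q ∈ dom h
    · rw [pdX_cutoffX_eq_zero i hq.1.le, zero_mul]
    · rw [indicator_of_notMem hq, mul_zero]
  have c01 : ∀ q : Space L₁ L₂, ‖cutoffX q‖ ≤ 1 := fun q => by
    rw [cutoffX, Real.norm_eq_abs, abs_of_nonneg (Real.smoothTransition.nonneg _)]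
    exact Real.smoothTransition.le_one _
  refine ⟨fun n q => cutoffX q * G n q, fun n => isCkX_cutoffX.mul (ck n),
    fun n p => by simp only [cutoffX_bot, zero_mul], ?_, fun i => ?_, ?_⟩
  · refine tendsto_of_tendsto_of_tendsto_of_le_of_le tendsto_const_nhds l (fun _ => zero_le)
      fun n => eLpNorm_mono fun q => ?_
    rw [← ind f q, ← mul_sub, norm_mul]
    rw [ind f q]
    exact mul_le_of_le_one_left (norm_nonneg _) (c01 q)
  · obtain ⟨H, hH⟩ := exists_bound hc
    obtain ⟨C, hC⟩ := exists_bound_slab ((isCkX_cutoffX (L₁ := L₁) (L₂ := L₂)).continuous_pdX i)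
      (-1) H
    have hm : ∀ n, AEStronglyMeasurable (fun q => G n q - (dom h).indicator f q)
        (volume.restrict (region (-1) h)) := fun n =>
      (ck n).continuous.aestronglyMeasurable.sub (memLp_indicator_dom hc hf _).aestronglyMeasurable
    have hm' : ∀ n, AEStronglyMeasurable (fun q => pdX i (G n) q -
        (dom h).indicator (fun q => Df q i) q) (volume.restrict (region (-1) h)) := fun n =>
      ((ck n).continuous_pdX i).aestronglyMeasurable.sub
        (memLp_indicator_dom hc (hDf i) _).aestronglyMeasurable
    have key : ∀ n, eLpNorm (fun q => pdX i (fun q => cutoffX q * G n q) q -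
        (dom h).indicator (fun q => Df q i) q) 2 (volume.restrict (region (-1) h)) ≤
        ENNReal.ofReal C * eLpNorm (fun q => G n q - (dom h).indicator f q) 2
          (volume.restrict (region (-1) h)) +
        eLpNorm (fun q => pdX i (G n) q - (dom h).indicator (fun q => Df q i) q) 2
          (volume.restrict (region (-1) h)) := fun n => by
      have e : (fun q => pdX i (fun q => cutoffX q * G n q) q -
          (dom h).indicator (fun q => Df q i) q) =
          (fun q => pdX i cutoffX q * (G n q - (dom h).indicator f q)) +
          fun q => cutoffX q * (pdX i (G n) q - (dom h).indicator (fun q => Df q i) q) := by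
        ext q
        rw [((isCkX_cutoffX.hasPdX i).mul ((ck n).hasPdX i)).pdX_eq]
        simp only [Pi.add_apply, mul_sub, ind, ind', sub_zero]
        ring
      rw [e]
      refine (eLpNorm_add_le ((isCkX_cutoffX.continuous_pdX i).aestronglyMeasurable.mul (hm n))
        (isCkX_cutoffX.continuous.aestronglyMeasurable.mul (hm' n)) one_le_two).trans
        (add_le_add ?_ (eLpNorm_mono fun q => ?_))
      · refine eLpNorm_le_mul_eLpNorm_of_ae_le_mul ((ae_restrict_iff'
          (isOpen_region _ hc).measurableSet).2 (Eventually.of_forall fun q hq => ?_)) _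
        rw [Pi.mul_apply, norm_mul]
        exact mul_le_mul_of_nonneg_right
          (hC q.1 q.2 ⟨hq.1.le, hq.2.le.trans ((le_abs_self _).trans (hH _))⟩) (norm_nonneg _)
      · rw [Pi.mul_apply, norm_mul]
        exact mul_le_of_le_one_left (norm_nonneg _) (c01 q)
    refine tendsto_of_tendsto_of_tendsto_of_le_of_le tendsto_const_nhds ?_ (fun _ => zero_le) key
    simpa using (ENNReal.Tendsto.const_mul l (.inr ENNReal.ofReal_ne_top)).add (ld i)
  · refine lt.congr fun n => ?_
    congr 1
    ext p
    rw [cutoffX_eq_one (q := (p, h p)) (by linarith [h0 p]), one_mul]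

end Approximation

/-! ### Korn's inequality below a graph -/

section Korn

variable {L₁ L₂ : ℝ} [Fact (0 < L₁)] [Fact (0 < L₂)]

lemma integral_region_indicator_dom {h : Torus L₁ L₂ → ℝ} (hc : Continuous h)
    (f : Space L₁ L₂ → ℝ) :
    ∫ q in region (-1) h, (dom h).indicator f q = ∫ q in dom h, f q := by
  rw [setIntegral_indicator (measurableSet_dom hc)]
  congr 2
  ext q
  exact ⟨fun hq => hq.2, fun hq => ⟨⟨by linarith [hq.1], hq.2⟩, hq⟩⟩

/-- A null Lagrangian has only boundary terms, and here all of them contain the trace of f, which is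
zero. The two approximations are removed one after the other, since the constant of the bracket
estimate depends on the second function. -/
lemma integral_bracket_eq_zero {h : Torus L₁ L₂ → ℝ} {Dh : Torus L₁ L₂ → Fin 2 → ℝ}
    {D2h : Torus L₁ L₂ → Fin 2 → Fin 2 → ℝ} (H2 : IsH2 h Dh D2h) (hc : Continuous h)
    (h0 : ∀ p, 0 ≤ h p) {f f' : Space L₁ L₂ → ℝ} {Df Df' : Space L₁ L₂ → Fin 3 → ℝ}
    {g' : Torus L₁ L₂ → ℝ} (H : HasLagrangianTrace h f Df fun _ => 0)
    (H' : HasLagrangianTrace h f' Df' g') (hf : MemLp f 2 (volume.restrict (dom h)))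
    (hDf : ∀ i, MemLp (fun q => Df q i) 2 (volume.restrict (dom h)))
    (hf' : MemLp f' 2 (volume.restrict (dom h)))
    (hDf' : ∀ i, MemLp (fun q => Df' q i) 2 (volume.restrict (dom h))) (i : Fin 2) (j : Fin 3) :
    ∫ q in dom h, (Df q i.castSucc * Df' q j - Df q j * Df' q i.castSucc) = 0 := by
  obtain ⟨F, hF⟩ := H.exists_approx hc h0 hf hDf
  obtain ⟨G, hG⟩ := H'.exists_approx hc h0 hf' hDf'
  have mF : ∀ n i, MemLp (pdX i (F n)) 2 (volume.restrict (region (-1) h)) := fun n i =>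
    memLp_region _ hc ((hF.ck n).continuous_pdX i)
  have mG : ∀ n i, MemLp (pdX i (G n)) 2 (volume.restrict (region (-1) h)) := fun n i =>
    memLp_region _ hc ((hG.ck n).continuous_pdX i)
  have mD := fun i => memLp_indicator_dom hc (hDf i) (-1)
  have mD' := fun i => memLp_indicator_dom hc (hDf' i) (-1)
  have zero : ∀ {a : Space L₁ L₂ → ℝ}, Tendsto (fun _ : ℕ => eLpNorm (fun q => a q - a q) 2
      (volume.restrict (region (-1) h))) atTop (𝓝 0) := by simp
  have tr : Tendsto (fun n => ∫ p, F n (p, h p) ^ 2) atTop (𝓝 0) := by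
    have := tendsto_integral_mul_of_L2 (a := fun n p => F n (p, h p)) (b := fun n p => F n (p, h p))
      (fun n => Torus.memLp ((hF.ck n).continuous.comp (continuous_graph hc)) 2)
      (fun n => Torus.memLp ((hF.ck n).continuous.comp (continuous_graph hc)) 2)
      (MemLp.zero' (p := 2)) (MemLp.zero' (p := 2)) hF.lim_trace hF.lim_trace
    simpa [← sq] using this
  -- First limit: the second function is the fixed C¹ function G m, and the traces of the
  -- approximations F n tend to zero in L².
  have s1 : ∀ m, ∫ q in region (-1) h,
      ((dom h).indicator (fun q => Df q i.castSucc) q * pdX j (G m) q -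
        (dom h).indicator (fun q => Df q j) q * pdX i.castSucc (G m) q) = 0 := fun m => by
    obtain ⟨C, hC⟩ := exists_abs_integral_bracket_le H2 hc h0 i j (hG.ck m)
    have l1 : Tendsto (fun n => ∫ q in region (-1) h,
        (pdX i.castSucc (F n) q * pdX j (G m) q - pdX j (F n) q * pdX i.castSucc (G m) q)) atTop
        (𝓝 0) := by
      refine squeeze_zero_norm (fun n => hC (F n) (hF.ck n) (hF.bot n)) ?_
      simpa using tr.sqrt.const_mul C
    refine tendsto_nhds_unique ?_ l1
    have t1 := tendsto_integral_mul_of_L2 (fun n => mF n i.castSucc) (fun _ => mG m j)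
      (mD i.castSucc) (mG m j) (hF.lim_pd _) zero
    have t2 := tendsto_integral_mul_of_L2 (fun n => mF n j) (fun _ => mG m i.castSucc)
      (mD j) (mG m i.castSucc) (hF.lim_pd _) zero
    have i1 : ∀ n, Integrable (fun q => pdX i.castSucc (F n) q * pdX j (G m) q)
      (volume.restrict (region (-1) h)) := fun n => (mF n _).integrable_mul (mG m _)
    have i2 : ∀ n, Integrable (fun q => pdX j (F n) q * pdX i.castSucc (G m) q)
      (volume.restrict (region (-1) h)) := fun n => (mF n _).integrable_mul (mG m _)
    have i3 : Integrable (fun q => (dom h).indicator (fun q => Df q i.castSucc) q * pdX j (G m) q)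
      (volume.restrict (region (-1) h)) := (mD _).integrable_mul (mG m _)
    have i4 : Integrable (fun q => (dom h).indicator (fun q => Df q j) q * pdX i.castSucc (G m) q)
      (volume.restrict (region (-1) h)) := (mD _).integrable_mul (mG m _)
    rw [integral_sub i3 i4]
    refine (t1.sub t2).congr fun n => ?_
    rw [integral_sub (i1 n) (i2 n)]
  have i1 : ∀ m, Integrable (fun q => (dom h).indicator (fun q => Df q i.castSucc) q *
    pdX j (G m) q) (volume.restrict (region (-1) h)) := fun m => (mD _).integrable_mul (mG m _)
  have i2 : ∀ m, Integrable (fun q => (dom h).indicator (fun q => Df q j) q *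
    pdX i.castSucc (G m) q) (volume.restrict (region (-1) h)) := fun m =>
      (mD _).integrable_mul (mG m _)
  have i3 : Integrable (fun q => (dom h).indicator (fun q => Df q i.castSucc) q *
    (dom h).indicator (fun q => Df' q j) q) (volume.restrict (region (-1) h)) :=
      (mD _).integrable_mul (mD' _)
  have i4 : Integrable (fun q => (dom h).indicator (fun q => Df q j) q *
    (dom h).indicator (fun q => Df' q i.castSucc) q) (volume.restrict (region (-1) h)) :=
      (mD _).integrable_mul (mD' _)
  -- Second limit: now only L² convergence of the gradients of G is needed.
  have t1 := tendsto_integral_mul_of_L2 (fun _ => mD i.castSucc) (fun n => mG n j)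
    (mD i.castSucc) (mD' j) zero (hG.lim_pd _)
  have t2 := tendsto_integral_mul_of_L2 (fun _ => mD j) (fun n => mG n i.castSucc)
    (mD j) (mD' i.castSucc) zero (hG.lim_pd _)
  have fin := (t1.sub t2)
  simp only [← integral_sub (i1 _) (i2 _), s1] at fin
  rw [← integral_sub i3 i4] at fin
  rw [← integral_region_indicator_dom hc]
  refine Eq.trans ?_ (tendsto_nhds_unique fin tendsto_const_nhds)
  congr 1
  ext q
  by_cases hq : q ∈ dom h
  · simp [hq]
  · simp [hq]

/-- The product A : Aᵀ equals (tr A)² minus twice the sum of the principal 2×2 minors. This isolates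
the null Lagrangians, and the coefficient of (tr A)² becomes μ − 2μ/3 + λ, which is positive in the
application. -/
lemma frob_stress (μ lam : ℝ) (A : Fin 3 → Fin 3 → ℝ) :
    frob (stress μ lam A) A = μ * (∑ i, ∑ j, A i j ^ 2) + (μ / 3 + lam) * (∑ k, A k k) ^ 2
      - 2 * μ * ((A 0 0 * A 1 1 - A 0 1 * A 1 0) + (A 0 0 * A 2 2 - A 0 2 * A 2 0)
        + (A 1 1 * A 2 2 - A 1 2 * A 2 1)) := by
  simp [frob, stress, Fin.sum_univ_three]
  ring

/-- A combination of squares in which pointwise nonnegativity for μ, λ ≥ 0 is visible, unlike in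
`frob_stress`. -/
lemma frob_stress_eq_sym (μ lam : ℝ) (A : Fin 3 → Fin 3 → ℝ) :
    frob (stress μ lam A) A = 2 * μ / 3 * ((A 0 0 - A 1 1) ^ 2 + (A 0 0 - A 2 2) ^ 2
        + (A 1 1 - A 2 2) ^ 2) + lam * (∑ k, A k k) ^ 2
      + μ * ((A 0 1 + A 1 0) ^ 2 + (A 0 2 + A 2 0) ^ 2 + (A 1 2 + A 2 1) ^ 2) := by
  simp [frob, stress, Fin.sum_univ_three]
  ring

/-- Korn's inequality below the graph of a plate of class `H²`, for velocities that move the graph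
vertically. -/
lemma korn {h : Torus L₁ L₂ → ℝ} {Dh : Torus L₁ L₂ → Fin 2 → ℝ}
    {D2h : Torus L₁ L₂ → Fin 2 → Fin 2 → ℝ} (H2 : IsH2 h Dh D2h) (hc : Continuous h)
    (h0 : ∀ p, 0 ≤ h p) {u : Space L₁ L₂ → Fin 3 → ℝ} {Du : Space L₁ L₂ → Fin 3 → Fin 3 → ℝ}
    {w : Torus L₁ L₂ → ℝ} (H : ∀ i : Fin 3, HasLagrangianTrace h (fun q => u q i)
      (fun q => Du q i) (fun p => if i = 2 then w p else 0))
    (hu : ∀ i, MemLp (fun q => u q i) 2 (volume.restrict (dom h)))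
    (hDu : ∀ i j, MemLp (fun q => Du q i j) 2 (volume.restrict (dom h)))
    {μ lam : ℝ} (hμ : 0 < μ) (hlam : 0 ≤ lam) :
    μ * ∫ q in dom h, (∑ i, ∑ j, Du q i j ^ 2) ≤
      ∫ q in dom h, frob (stress μ lam (Du q)) (Du q) := by
  -- Each of the three minors involves a horizontal component of the velocity, whose trace on the
  -- graph is zero; the vertical component never needs a vanishing trace.
  have z0 : HasLagrangianTrace h (fun q => u q 0) (fun q => Du q 0) fun _ => 0 := by simpa using H 0
  have z1 : HasLagrangianTrace h (fun q => u q 1) (fun q => Du q 1) fun _ => 0 := by simpa using H 1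
  have b01 := integral_bracket_eq_zero H2 hc h0 z0 (H 1) (hu 0) (hDu 0) (hu 1) (hDu 1) 0 1
  have b02 := integral_bracket_eq_zero H2 hc h0 z0 (H 2) (hu 0) (hDu 0) (hu 2) (hDu 2) 0 2
  have b12 := integral_bracket_eq_zero H2 hc h0 z1 (H 2) (hu 1) (hDu 1) (hu 2) (hDu 2) 1 2
  rw [show (0 : Fin 2).castSucc = (0 : Fin 3) from rfl] at b01 b02
  rw [show (1 : Fin 2).castSucc = (1 : Fin 3) from rfl] at b12
  have im : ∀ i j k l, IntegrableOn (fun q => Du q i j * Du q k l) (dom h) := fun i j k l =>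
    (hDu i j).integrable_mul (hDu k l)
  have is : ∀ i j, IntegrableOn (fun q => Du q i j ^ 2) (dom h) := fun i j =>
    (hDu i j).integrable_sq
  have iS : IntegrableOn (fun q => ∑ i, ∑ j, Du q i j ^ 2) (dom h) :=
    integrable_finsetSum _ fun i _ => integrable_finsetSum _ fun j _ => is i j
  have it : IntegrableOn (fun q => (∑ k, Du q k k) ^ 2) (dom h) :=
    (memLp_finsetSum _ fun k _ => hDu k k).integrable_sq
  have i01 : IntegrableOn (fun q => Du q 0 0 * Du q 1 1 - Du q 0 1 * Du q 1 0) (dom h) :=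
    (im _ _ _ _).sub (im _ _ _ _)
  have i02 : IntegrableOn (fun q => Du q 0 0 * Du q 2 2 - Du q 0 2 * Du q 2 0) (dom h) :=
    (im _ _ _ _).sub (im _ _ _ _)
  have i12 : IntegrableOn (fun q => Du q 1 1 * Du q 2 2 - Du q 1 2 * Du q 2 1) (dom h) :=
    (im _ _ _ _).sub (im _ _ _ _)
  simp only [frob_stress]
  have j1 : IntegrableOn (fun q => μ * ∑ i, ∑ j, Du q i j ^ 2) (dom h) := iS.const_mul _
  have j2 : IntegrableOn (fun q => (μ / 3 + lam) * (∑ k, Du q k k) ^ 2) (dom h) := it.const_mul _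
  have j3 : IntegrableOn (fun q => (Du q 0 0 * Du q 1 1 - Du q 0 1 * Du q 1 0) +
      (Du q 0 0 * Du q 2 2 - Du q 0 2 * Du q 2 0)) (dom h) := i01.add i02
  have j4 : IntegrableOn (fun q => (Du q 0 0 * Du q 1 1 - Du q 0 1 * Du q 1 0) +
      (Du q 0 0 * Du q 2 2 - Du q 0 2 * Du q 2 0) +
      (Du q 1 1 * Du q 2 2 - Du q 1 2 * Du q 2 1)) (dom h) := j3.add i12
  have j5 : IntegrableOn (fun q => μ * (∑ i, ∑ j, Du q i j ^ 2) +
    (μ / 3 + lam) * (∑ k, Du q k k) ^ 2) (dom h) := j1.add j2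
  rw [integral_sub j5 (j4.const_mul _), integral_add j1 j2, integral_const_mul, integral_const_mul,
    integral_const_mul, integral_add j3 i12, integral_add i01 i02, b01, b02, b12]
  have : 0 ≤ ∫ q in dom h, (∑ k, Du q k k) ^ 2 := integral_nonneg fun _ => sq_nonneg _
  have : 0 ≤ (μ / 3 + lam) * ∫ q in dom h, (∑ k, Du q k k) ^ 2 := by positivity
  linarith

end Korn

lemma eLpNorm_two_sq {α : Type*} [MeasurableSpace α] (f : α → ℝ) (ν : Measure α) :
    eLpNorm f 2 ν ^ 2 = ∫⁻ x, ‖f x‖ₑ ^ 2 ∂ν := by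
  have := eLpNorm_nnreal_pow_eq_lintegral (f := f) (μ := ν) (p := 2) two_ne_zero
  simpa using this

lemma enorm_sq_eq (x : ℝ) : ‖x‖ₑ ^ 2 = ENNReal.ofReal (x ^ 2) := by
  rw [← ofReal_norm, ← ENNReal.ofReal_pow (norm_nonneg _), Real.norm_eq_abs, sq_abs]

/-! ### Estimates on almost every vertical segment -/

section Vertical

variable {L₁ L₂ : ℝ}

/-- The `L²` norm of `f` on the vertical segment above `p`. -/
noncomputable def vert (h : Torus L₁ L₂ → ℝ) (f : Space L₁ L₂ → ℝ) (p : Torus L₁ L₂) : ENNReal :=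
  eLpNorm (fun z => f (p, z)) 2 (volume.restrict (Ioo 0 (h p)))

variable [Fact (0 < L₁)] [Fact (0 < L₂)]

lemma vert_sq (h : Torus L₁ L₂ → ℝ) (f : Space L₁ L₂ → ℝ) (p : Torus L₁ L₂) :
    vert h f p ^ 2 = ∫⁻ z in Ioo 0 (h p), ‖f (p, z)‖ₑ ^ 2 := eLpNorm_two_sq _ _

lemma eLpNorm_indicator_slice {a : ℝ} (ha : a ≤ 0) (h : Torus L₁ L₂ → ℝ) (f : Space L₁ L₂ → ℝ)
    (p : Torus L₁ L₂) : eLpNorm (fun z => (dom h).indicator f (p, z)) 2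
      (volume.restrict (Ioo a (h p))) = vert h f p := by
  have e : (fun z => (dom h).indicator f (p, z)) =
      (Ioo 0 (h p)).indicator fun z => f (p, z) := by
    ext z
    by_cases hz : z ∈ Ioo 0 (h p)
    · rw [indicator_of_mem hz, indicator_of_mem (show (p, z) ∈ dom h from hz)]
    · rw [indicator_of_notMem hz, indicator_of_notMem (show (p, z) ∉ dom h from hz)]
  rw [e, eLpNorm_indicator_eq_eLpNorm_restrict measurableSet_Ioo,
    Measure.restrict_restrict measurableSet_Ioo, vert]
  congr 2
  exact inter_eq_left.2 (Ioo_subset_Ioo_left ha)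

lemma aemeasurable_lintegral_slice (a : ℝ) {h : Torus L₁ L₂ → ℝ} (hc : Continuous h)
    {f : Space L₁ L₂ → ENNReal} (hf : AEMeasurable f (volume.restrict (region a h))) :
    AEMeasurable fun p => ∫⁻ z in Ioo a (h p), f (p, z) := by
  have m := (isOpen_region a hc).measurableSet
  have h1 : AEMeasurable (fun p => ∫⁻ z, (region a h).indicator f (p, z)) :=
    AEMeasurable.lintegral_prod_right' ((aemeasurable_indicator_iff m).2 hf)
  refine h1.congr (Eventually.of_forall fun p => ?_)
  simp only
  rw [← lintegral_indicator measurableSet_Ioo]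
  refine lintegral_congr fun z => ?_
  by_cases hz : z ∈ Ioo a (h p)
  · rw [indicator_of_mem hz, indicator_of_mem (show (p, z) ∈ region a h from hz)]
  · rw [indicator_of_notMem hz, indicator_of_notMem (show (p, z) ∉ region a h from hz)]

lemma lintegral_vert_sq {h : Torus L₁ L₂ → ℝ} (hc : Continuous h) {f : Space L₁ L₂ → ℝ}
    (hf : AEStronglyMeasurable f (volume.restrict (dom h))) :
    ∫⁻ p, vert h f p ^ 2 = ∫⁻ q in dom h, ‖f q‖ₑ ^ 2 := by
  simp only [vert_sq]
  exact (lintegral_region 0 hc (f := fun q => ‖f q‖ₑ ^ 2) (hf.enorm.pow_const 2)).symm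

lemma aemeasurable_vert {h : Torus L₁ L₂ → ℝ} (hc : Continuous h) {f : Space L₁ L₂ → ℝ}
    (hf : AEStronglyMeasurable f (volume.restrict (dom h))) : AEMeasurable (vert h f) := by
  have h1 := aemeasurable_lintegral_slice 0 hc (f := fun q => ‖f q‖ₑ ^ 2) (hf.enorm.pow_const 2)
  refine (h1.pow_const (1 / 2 : ℝ)).congr (Eventually.of_forall fun p => ?_)
  simp only
  rw [← vert_sq, ← ENNReal.rpow_natCast, ← ENNReal.rpow_mul]
  norm_num

lemma ae_vert_lt_top {h : Torus L₁ L₂ → ℝ} (hc : Continuous h) {f : Space L₁ L₂ → ℝ}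
    (hf : MemLp f 2 (volume.restrict (dom h))) : ∀ᵐ p, vert h f p < ⊤ := by
  have h1 : ∫⁻ p, vert h f p ^ 2 ≠ ⊤ := by
    rw [lintegral_vert_sq hc hf.aestronglyMeasurable, ← eLpNorm_two_sq]
    exact ENNReal.pow_ne_top hf.eLpNorm_ne_top
  filter_upwards [ae_lt_top' ((aemeasurable_vert hc hf.aestronglyMeasurable).pow_const 2) h1]
    with p hp
  exact (ENNReal.pow_lt_top_iff.1 hp).resolve_right two_ne_zero

lemma eLpNorm_slice_eq {f : Space L₁ L₂ → ℝ} (hf : Continuous f) (p : Torus L₁ L₂) {z : ℝ}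
    (hz : -1 ≤ z) : eLpNorm (fun z => f (p, z)) 2 (volume.restrict (Ioo (-1) z)) =
      ENNReal.ofReal (√(prim (fun q => f q ^ 2) (p, z))) := by
  have n0 : 0 ≤ prim (fun q => f q ^ 2) (p, z) := prim_nonneg (fun _ => sq_nonneg _) hz
  have e : eLpNorm (fun z => f (p, z)) 2 (volume.restrict (Ioo (-1) z)) ^ 2 =
      ENNReal.ofReal (√(prim (fun q => f q ^ 2) (p, z))) ^ 2 := by
    rw [eLpNorm_two_sq, ← ENNReal.ofReal_pow (Real.sqrt_nonneg _), Real.sq_sqrt n0]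
    simp only [enorm_sq_eq]
    rw [prim, intervalIntegral.integral_of_le hz, integral_Ioc_eq_integral_Ioo,
      ofReal_integral_eq_lintegral_ofReal _ (Eventually.of_forall fun _ => sq_nonneg _)]
    exact ((continuous_slice (hf.pow 2) p).continuousOn.integrableOn_compact
      (isCompact_Icc (a := -1) (b := z))).mono_set Ioo_subset_Icc_self
  exact (ENNReal.pow_right_strictMono two_ne_zero).injective e

/-- Along a subsequence, approximations converge on almost every vertical line. -/
lemma IsTraceApprox.exists_subseq {h : Torus L₁ L₂ → ℝ} {f : Space L₁ L₂ → ℝ}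
    {Df : Space L₁ L₂ → Fin 3 → ℝ} {g : Torus L₁ L₂ → ℝ} {G : ℕ → Space L₁ L₂ → ℝ}
    (H : IsTraceApprox h f Df g G) (hc : Continuous h)
    (hf : MemLp f 2 (volume.restrict (dom h)))
    (hDf : ∀ i, MemLp (fun q => Df q i) 2 (volume.restrict (dom h)))
    (hg : AEStronglyMeasurable g) :
    ∃ ns : ℕ → ℕ, StrictMono ns ∧ ∀ᵐ p,
      Tendsto (fun n => eLpNorm (fun z => G (ns n) (p, z) - (dom h).indicator f (p, z)) 2
        (volume.restrict (Ioo (-1) (h p)))) atTop (𝓝 0) ∧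
      Tendsto (fun n => eLpNorm (fun z => pdX 2 (G (ns n)) (p, z) -
        (dom h).indicator (fun q => Df q 2) (p, z)) 2
        (volume.restrict (Ioo (-1) (h p)))) atTop (𝓝 0) ∧
      Tendsto (fun n => G (ns n) (p, h p)) atTop (𝓝 (g p)) := by
  have m1 : ∀ n, AEMeasurable (fun q => ‖G n q - (dom h).indicator f q‖ₑ ^ 2)
      (volume.restrict (region (-1) h)) := fun n =>
    ((H.ck n).continuous.aestronglyMeasurable.sub
      (memLp_indicator_dom hc hf _).aestronglyMeasurable).enorm.pow_const 2
  have m2 : ∀ n, AEMeasurable (fun q => ‖pdX 2 (G n) q - (dom h).indicator (fun q => Df q 2) q‖ₑ ^ 2)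
      (volume.restrict (region (-1) h)) := fun n =>
    (((H.ck n).continuous_pdX 2).aestronglyMeasurable.sub
      (memLp_indicator_dom hc (hDf 2) _).aestronglyMeasurable).enorm.pow_const 2
  have m3 : ∀ n, AEMeasurable (fun p => ‖G n (p, h p) - g p‖ₑ ^ 2) := fun n =>
    (((H.ck n).continuous.comp (continuous_graph hc)).aestronglyMeasurable.sub hg).enorm.pow_const 2
  have sq0 : ∀ {a : ℕ → ENNReal}, Tendsto a atTop (𝓝 0) → Tendsto (fun n => a n ^ 2) atTop (𝓝 0) :=
    fun ha => by simpa using ENNReal.Tendsto.pow (n := 2) ha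
  have sqrt0 : ∀ {a : ℕ → ENNReal}, Tendsto (fun n => a n ^ 2) atTop (𝓝 0) →
      Tendsto a atTop (𝓝 0) := fun {a} ha => by
    have := (ENNReal.continuous_rpow_const (y := (1 / 2 : ℝ))).continuousAt.tendsto.comp ha
    simp only [Function.comp_def] at this
    rw [ENNReal.zero_rpow_of_pos (by norm_num)] at this
    refine this.congr fun n => ?_
    rw [← ENNReal.rpow_natCast, ← ENNReal.rpow_mul]
    norm_num
  -- The three errors are added up, so that a single subsequence handles the function, its vertical
  -- derivative and its trace.
  obtain ⟨ns, hns, h1⟩ := exists_subseq_ae_tendsto_zero (ν := (volume : Measure (Torus L₁ L₂)))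
    (f := fun n p => (∫⁻ z in Ioo (-1) (h p), ‖G n (p, z) - (dom h).indicator f (p, z)‖ₑ ^ 2) +
      (∫⁻ z in Ioo (-1) (h p), ‖pdX 2 (G n) (p, z) -
        (dom h).indicator (fun q => Df q 2) (p, z)‖ₑ ^ 2) + ‖G n (p, h p) - g p‖ₑ ^ 2)
    (fun n => ((aemeasurable_lintegral_slice _ hc (m1 n)).add
      (aemeasurable_lintegral_slice _ hc (m2 n))).add (m3 n)) (by
      have e : ∀ n, (∫⁻ p, ((∫⁻ z in Ioo (-1) (h p), ‖G n (p, z) - (dom h).indicator f (p, z)‖ₑ ^ 2) +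
        (∫⁻ z in Ioo (-1) (h p), ‖pdX 2 (G n) (p, z) -
          (dom h).indicator (fun q => Df q 2) (p, z)‖ₑ ^ 2) + ‖G n (p, h p) - g p‖ₑ ^ 2)) =
          eLpNorm (fun q => G n q - (dom h).indicator f q) 2 (volume.restrict (region (-1) h)) ^ 2 +
          eLpNorm (fun q => pdX 2 (G n) q - (dom h).indicator (fun q => Df q 2) q) 2
            (volume.restrict (region (-1) h)) ^ 2 +
          eLpNorm (fun p => G n (p, h p) - g p) 2 volume ^ 2 := fun n => by
        rw [lintegral_add_right' _ (m3 n), lintegral_add_right' _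
          (aemeasurable_lintegral_slice _ hc (m2 n)), ← lintegral_region _ hc (m1 n),
          ← lintegral_region _ hc (m2 n), eLpNorm_two_sq, eLpNorm_two_sq, eLpNorm_two_sq]
      simp only [e]
      simpa using ((sq0 H.lim).add (sq0 (H.lim_pd 2))).add (sq0 H.lim_trace))
  refine ⟨ns, hns, ?_⟩
  filter_upwards [h1] with p hp
  have sq : ∀ {a : ℕ → ENNReal}, (∀ n, a n ≤ (∫⁻ z in Ioo (-1) (h p),
        ‖G (ns n) (p, z) - (dom h).indicator f (p, z)‖ₑ ^ 2) +
      (∫⁻ z in Ioo (-1) (h p), ‖pdX 2 (G (ns n)) (p, z) -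
        (dom h).indicator (fun q => Df q 2) (p, z)‖ₑ ^ 2) + ‖G (ns n) (p, h p) - g p‖ₑ ^ 2) →
      Tendsto a atTop (𝓝 0) := fun ha =>
    tendsto_of_tendsto_of_tendsto_of_le_of_le tendsto_const_nhds hp (fun _ => zero_le) ha
  refine ⟨sqrt0 (sq fun n => ?_), sqrt0 (sq fun n => ?_), ?_⟩
  · rw [eLpNorm_two_sq]
    exact le_self_add.trans le_self_add
  · rw [eLpNorm_two_sq]
    exact le_add_self.trans le_self_add
  · have := sqrt0 (sq (a := fun n => ‖G (ns n) (p, h p) - g p‖ₑ ^ 2) fun n => le_add_self)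
    rw [tendsto_iff_edist_tendsto_0]
    simpa only [edist_eq_enorm_sub] using this

lemma AEStronglyMeasurable.slice_region {a : ℝ} {h : Torus L₁ L₂ → ℝ} (hc : Continuous h)
    {f : Space L₁ L₂ → ℝ} (hf : AEStronglyMeasurable f (volume.restrict (region a h))) :
    ∀ᵐ p, AEStronglyMeasurable (fun z => f (p, z)) (volume.restrict (Ioo a (h p))) := by
  have m := (isOpen_region a hc).measurableSet
  have h1 := ((aestronglyMeasurable_indicator_iff m).2 hf).prodMk_left
    (μ := (volume : Measure (Torus L₁ L₂))) (ν := (volume : Measure ℝ))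
  filter_upwards [h1] with p hp
  rw [← aestronglyMeasurable_indicator_iff measurableSet_Ioo]
  refine hp.congr (Eventually.of_forall fun z => ?_)
  show (region a h).indicator f (p, z) = _
  by_cases hz : z ∈ Ioo a (h p)
  · rw [indicator_of_mem hz, indicator_of_mem (show (p, z) ∈ region a h from hz)]
  · rw [indicator_of_notMem hz, indicator_of_notMem (show (p, z) ∉ region a h from hz)]

/-- Pointwise bounds on almost every vertical line for functions with a Lagrangian trace. -/
lemma HasLagrangianTrace.ae_vert_bounds {h : Torus L₁ L₂ → ℝ} {f : Space L₁ L₂ → ℝ}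
    {Df : Space L₁ L₂ → Fin 3 → ℝ} {g : Torus L₁ L₂ → ℝ} (H : HasLagrangianTrace h f Df g)
    (hc : Continuous h) (h0 : ∀ p, 0 ≤ h p) (hf : MemLp f 2 (volume.restrict (dom h)))
    (hDf : ∀ i, MemLp (fun q => Df q i) 2 (volume.restrict (dom h)))
    (hg : AEStronglyMeasurable g) :
    ∀ᵐ p, ‖g p‖ₑ ^ 2 ≤ 2 * (vert h f p * vert h (fun q => Df q 2) p) ∧
      ∀ᵐ z ∂volume.restrict (Ioo 0 (h p)),
        ‖f (p, z)‖ₑ ^ 2 ≤ 2 * (vert h f p * vert h (fun q => Df q 2) p) := by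
  obtain ⟨G, hG⟩ := H.exists_approx hc h0 hf hDf
  obtain ⟨ns, -, hns⟩ := hG.exists_subseq hc hf hDf hg
  filter_upwards [hns, ae_vert_lt_top hc hf, ae_vert_lt_top hc (hDf 2),
    AEStronglyMeasurable.slice_region hc (memLp_indicator_dom hc hf (-1)).aestronglyMeasurable,
    AEStronglyMeasurable.slice_region hc (memLp_indicator_dom hc (hDf 2) (-1)).aestronglyMeasurable]
    with p ⟨t1, t2, t3⟩ f1 f2 a1 a2
  have hp : (-1 : ℝ) ≤ h p := by linarith [h0 p]
  have cG := fun n => (hG.ck (ns n)).continuous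
  have cD := fun n => (hG.ck (ns n)).continuous_pdX 2
  have l1 := tendsto_eLpNorm_of_sub (fun n => (continuous_slice (cG n) p).aestronglyMeasurable) a1 t1
  have l2 := tendsto_eLpNorm_of_sub (fun n => (continuous_slice (cD n) p).aestronglyMeasurable) a2 t2
  rw [eLpNorm_indicator_slice (by norm_num)] at l1 l2
  have l3 := ENNReal.Tendsto.const_mul (a := 2)
    (ENNReal.Tendsto.mul l1 (.inr f2.ne) l2 (.inr f1.ne)) (.inr (by simp))
  -- For C¹ approximations the bound holds at every height including z = h(p), so it yields both the
  -- trace estimate and the interior one.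
  have key : ∀ n, ∀ z ∈ Icc (-1) (h p), ‖G (ns n) (p, z)‖ₑ ^ 2 ≤
      2 * (eLpNorm (fun z => G (ns n) (p, z)) 2 (volume.restrict (Ioo (-1) (h p))) *
        eLpNorm (fun z => pdX 2 (G (ns n)) (p, z)) 2 (volume.restrict (Ioo (-1) (h p)))) := by
    intro n z hz
    rw [eLpNorm_slice_eq (cG n) p hp, eLpNorm_slice_eq (cD n) p hp, enorm_sq_eq,
      ← ENNReal.ofReal_mul (Real.sqrt_nonneg _), ← ENNReal.ofReal_ofNat 2,
      ← ENNReal.ofReal_mul two_pos.le]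
    refine ENNReal.ofReal_le_ofReal ((sq_le_prim ((hG.ck (ns n)).hasPdX 2) (cG n) (cD n)
      (hG.bot _) (q := (p, z)) hz.1).trans ?_)
    have b1 := Real.sqrt_le_sqrt (prim_mono_right ((cG n).pow 2) (fun _ => sq_nonneg _) p hz.1 hz.2)
    have b2 := Real.sqrt_le_sqrt (prim_mono_right ((cD n).pow 2) (fun _ => sq_nonneg _) p hz.1 hz.2)
    exact mul_le_mul_of_nonneg_left (mul_le_mul b1 b2 (Real.sqrt_nonneg _) (Real.sqrt_nonneg _))
      two_pos.le
  refine ⟨le_of_tendsto_of_tendsto (ENNReal.Tendsto.pow t3.enorm) l3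
    (Eventually.of_forall fun n => key n (h p) ⟨hp, le_rfl⟩), ?_⟩
  -- Pointwise convergence in z needs a further subsequence, which may depend on p.
  have tm := tendstoInMeasure_of_tendsto_eLpNorm (p := 2) two_ne_zero
    (fun n => (continuous_slice (cG n) p).aestronglyMeasurable) a1 t1
  obtain ⟨ms, hms, hlim⟩ := tm.exists_seq_tendsto_ae
  have hlim0 : ∀ᵐ z ∂volume.restrict (Ioo 0 (h p)), Tendsto (fun n => G (ns (ms n)) (p, z)) atTop
      (𝓝 ((dom h).indicator f (p, z))) :=
    ae_mono (Measure.restrict_mono (Ioo_subset_Ioo_left (by norm_num)) le_rfl) hlim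
  filter_upwards [hlim0, ae_restrict_mem measurableSet_Ioo] with z hz hmem
  rw [indicator_of_mem (show (p, z) ∈ dom h from hmem)] at hz
  exact le_of_tendsto_of_tendsto (ENNReal.Tendsto.pow hz.enorm) (l3.comp hms.tendsto_atTop)
    (Eventually.of_forall fun n => key (ms n) z ⟨by linarith [hmem.1], hmem.2.le⟩)

/-- The Poincaré inequality on almost every vertical line. -/
lemma HasLagrangianTrace.ae_vert_le {h : Torus L₁ L₂ → ℝ} {f : Space L₁ L₂ → ℝ}
    {Df : Space L₁ L₂ → Fin 3 → ℝ} {g : Torus L₁ L₂ → ℝ} (H : HasLagrangianTrace h f Df g)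
    (hc : Continuous h) (h0 : ∀ p, 0 ≤ h p) (hf : MemLp f 2 (volume.restrict (dom h)))
    (hDf : ∀ i, MemLp (fun q => Df q i) 2 (volume.restrict (dom h)))
    (hg : AEStronglyMeasurable g) :
    ∀ᵐ p, vert h f p ≤ 2 * ENNReal.ofReal (h p) * vert h (fun q => Df q 2) p := by
  filter_upwards [H.ae_vert_bounds hc h0 hf hDf hg, ae_vert_lt_top hc hf] with p ⟨_, hp⟩ hfin
  rcases eq_or_ne (vert h f p) 0 with e | e
  · rw [e]; exact zero_le
  -- Integrate the pointwise bound over a segment of length h(p) and cancel one factor of the norm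
  -- of f.
  have h1 : vert h f p ^ 2 ≤
      2 * (vert h f p * vert h (fun q => Df q 2) p) * ENNReal.ofReal (h p) := by
    rw [vert_sq]
    refine (lintegral_mono_ae hp).trans_eq ?_
    rw [lintegral_const, Measure.restrict_apply_univ, Real.volume_Ioo, sub_zero]
  rw [sq, show 2 * (vert h f p * vert h (fun q => Df q 2) p) * ENNReal.ofReal (h p) =
    vert h f p * (2 * ENNReal.ofReal (h p) * vert h (fun q => Df q 2) p) by ring] at h1
  exact (ENNReal.mul_le_mul_iff_right e hfin.ne).1 h1

/-- Powers of the vertical `L²` mass are integrable. -/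
lemma HasLagrangianTrace.lintegral_vert_pow_le {h : Torus L₁ L₂ → ℝ} {f : Space L₁ L₂ → ℝ}
    {Df : Space L₁ L₂ → Fin 3 → ℝ} {g : Torus L₁ L₂ → ℝ} {Dh : Torus L₁ L₂ → Fin 2 → ℝ}
    {D2h : Torus L₁ L₂ → Fin 2 → Fin 2 → ℝ} (H : HasLagrangianTrace h f Df g)
    (H2 : IsH2 h Dh D2h) (hc : Continuous h) (h0 : ∀ p, 0 ≤ h p) {M : ℝ} (hM : ∀ p, h p ≤ M)
    (hf : MemLp f 2 (volume.restrict (dom h)))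
    (hDf : ∀ i, MemLp (fun q => Df q i) 2 (volume.restrict (dom h)))
    (hg : AEStronglyMeasurable g) {k : ℕ} (hk : 1 ≤ k) :
    ∫⁻ p, vert h f p ^ (4 * k) ≤ ENNReal.ofReal ((gnConst L₁ L₂ k * (((2 + M) ^ 2 + 1) *
      ∫ q in dom h, ∑ j, Df q j ^ 2)) ^ (2 * k) *
        plateConst L₁ L₂ k (∫ p, (∑ i, D2h p i i) ^ 2)) := by
  obtain ⟨G, hG⟩ := H.exists_approx hc h0 hf hDf
  obtain ⟨ns, hmono, hns⟩ := hG.exists_subseq hc hf hDf hg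
  have hp : ∀ p, (-1 : ℝ) ≤ h p := fun p => by linarith [h0 p]
  have cG := fun n => (hG.ck (ns n)).continuous
  set N : ℕ → Torus L₁ L₂ → ENNReal := fun n p =>
    ENNReal.ofReal (prim (fun q => G (ns n) q ^ 2) (p, h p) ^ (2 * k))
  have cN : ∀ n, Continuous fun p => prim (fun q => G (ns n) q ^ 2) (p, h p) ^ (2 * k) := fun n =>
    ((continuous_prim ((cG n).pow 2)).comp (continuous_graph hc)).pow _
  have N0 : ∀ n p, 0 ≤ prim (fun q => G (ns n) q ^ 2) (p, h p) := fun n p =>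
    prim_nonneg (fun _ => sq_nonneg _) (hp p)
  have eN : ∀ n p, N n p = eLpNorm (fun z => G (ns n) (p, z)) 2
      (volume.restrict (Ioo (-1) (h p))) ^ (4 * k) := fun n p => by
    rw [eLpNorm_slice_eq (cG n) p (hp p), ← ENNReal.ofReal_pow (Real.sqrt_nonneg _),
      show 4 * k = 2 * (2 * k) by ring, pow_mul _ 2, Real.sq_sqrt (N0 n p)]
  have lim : ∀ᵐ p, Tendsto (fun n => N n p) atTop (𝓝 (vert h f p ^ (4 * k))) := by
    filter_upwards [hns, AEStronglyMeasurable.slice_region hc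
      (memLp_indicator_dom hc hf (-1)).aestronglyMeasurable] with p ⟨t1, _, _⟩ a1
    have l1 := tendsto_eLpNorm_of_sub
      (fun n => (continuous_slice (cG n) p).aestronglyMeasurable) a1 t1
    rw [eLpNorm_indicator_slice (by norm_num)] at l1
    simp only [eN]
    exact ENNReal.Tendsto.pow l1
  -- Fatou's lemma applies to the powers on the left, whereas the Dirichlet integrals of the
  -- approximations on the right converge.
  have e1 : ∫⁻ p, vert h f p ^ (4 * k) = ∫⁻ p, liminf (fun n => N n p) atTop :=
    lintegral_congr_ae (lim.mono fun p hp => hp.liminf_eq.symm)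
  have cd := fun n i => (hG.ck (ns n)).continuous_pdX i
  have mD := fun i => memLp_indicator_dom hc (hDf i) (-1)
  have limD : Tendsto (fun n => ∫ p, prim (fun q => ∑ j, pdX j (G (ns n)) q ^ 2) (p, h p)) atTop
      (𝓝 (∫ q in dom h, ∑ j, Df q j ^ 2)) := by
    have l : ∀ j, Tendsto (fun n => ∫ q in region (-1) h,
        pdX j (G (ns n)) q * pdX j (G (ns n)) q) atTop (𝓝 (∫ q in region (-1) h,
          (dom h).indicator (fun q => Df q j) q * (dom h).indicator (fun q => Df q j) q)) := fun j =>
      (tendsto_integral_mul_of_L2 (fun n => memLp_region _ hc ((hG.ck n).continuous_pdX j))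
        (fun n => memLp_region _ hc ((hG.ck n).continuous_pdX j)) (mD j) (mD j) (hG.lim_pd j)
        (hG.lim_pd j)).comp hmono.tendsto_atTop
    have ls := tendsto_finsetSum Finset.univ fun j _ => l j
    have e2 : (∑ j, ∫ q in region (-1) h, (dom h).indicator (fun q => Df q j) q *
        (dom h).indicator (fun q => Df q j) q) = ∫ q in dom h, ∑ j, Df q j ^ 2 := by
      have i : ∀ j ∈ Finset.univ, Integrable (fun q => (dom h).indicator (fun q => Df q j) q *
          (dom h).indicator (fun q => Df q j) q) (volume.restrict (region (-1) h)) := fun j _ =>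
        (mD j).integrable_mul (mD j)
      rw [← integral_region_indicator_dom hc, ← integral_finsetSum _ i]
      congr 1; ext q
      by_cases hq : q ∈ dom h
      · simp [hq, sq]
      · simp [hq]
    rw [e2] at ls
    refine ls.congr fun n => ?_
    have i : ∀ j ∈ Finset.univ, Integrable (fun q => pdX j (G (ns n)) q * pdX j (G (ns n)) q)
        (volume.restrict (region (-1) h)) := fun j _ =>
      (memLp_region _ hc (cd n j)).integrable_mul (memLp_region _ hc (cd n j))
    rw [← integral_region_eq_prim (f := fun q => ∑ j, pdX j (G (ns n)) q ^ 2) hc h0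
      (continuous_finsetSum _ fun j _ => (cd n j).pow 2), ← integral_finsetSum _ i]
    congr 1; ext q
    exact Finset.sum_congr rfl fun j _ => (sq _).symm
  rw [e1]
  refine (lintegral_liminf_le fun n => (cN n).measurable.ennreal_ofReal).trans ?_
  have bd : ∀ n, ∫⁻ p, N n p ≤ ENNReal.ofReal ((gnConst L₁ L₂ k * (((2 + M) ^ 2 + 1) *
      ∫ p, prim (fun q => ∑ j, pdX j (G (ns n)) q ^ 2) (p, h p))) ^ (2 * k) *
        plateConst L₁ L₂ k (∫ p, (∑ i, D2h p i i) ^ 2)) := fun n => by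
    rw [← ofReal_integral_eq_lintegral_ofReal (Torus.integrable (cN n))
      (Eventually.of_forall fun p => pow_nonneg (N0 n p) _)]
    exact ENNReal.ofReal_le_ofReal
      (H2.integral_prim_sq_pow_le hc h0 hM (hG.ck (ns n)) (hG.bot _) hk)
  refine (liminf_le_liminf (Eventually.of_forall bd)).trans_eq ?_
  exact (ENNReal.tendsto_ofReal ((((limD.const_mul ((2 + M) ^ 2 + 1)).const_mul
    (gnConst L₁ L₂ k)).pow (2 * k)).mul_const _)).liminf_eq

end Vertical

/-- Hölder's inequality for several functions on a finite measure space, with a surplus of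
integrability. -/
lemma lintegral_prod_rpow_le {α : Type*} [MeasurableSpace α] {ν : Measure α} {n : ℕ}
    {f : Fin n → α → ENNReal} (hf : ∀ i, AEMeasurable (f i) ν) {p : Fin n → ℝ} (hp : ∀ i, 0 ≤ p i)
    (hs : ∑ i, p i ≤ 1) : ∫⁻ a, ∏ i, f i a ^ p i ∂ν ≤
      ν univ ^ (1 - ∑ i, p i) * ∏ i, (∫⁻ a, f i a ∂ν) ^ p i := by
  have := ENNReal.lintegral_mul_prod_norm_pow_le (μ := ν) Finset.univ (g := fun _ => 1) (f := f)
    aemeasurable_const (fun i _ => hf i) (1 - ∑ i, p i) (p := p) (by ring) (by linarith)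
    fun i _ => hp i
  simpa using this

/-! ### Flux estimates at a fixed time -/

section Slice

variable {L₁ L₂ : ℝ} [Fact (0 < L₁)] [Fact (0 < L₂)]

/-- The state of the fluid and the plate at a fixed time, with bounds on the energies. -/
structure IsPlateSlice (γ M S₀ R₀ W₀ : ℝ) (h : Torus L₁ L₂ → ℝ) (Dh : Torus L₁ L₂ → Fin 2 → ℝ)
    (D2h : Torus L₁ L₂ → Fin 2 → Fin 2 → ℝ) (u : Space L₁ L₂ → Fin 3 → ℝ)
    (Du : Space L₁ L₂ → Fin 3 → Fin 3 → ℝ) (ρ : Space L₁ L₂ → ℝ) (w : Torus L₁ L₂ → ℝ) :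
    Prop where
  isH2 : IsH2 h Dh D2h
  cont : Continuous h
  nonneg : ∀ p, 0 ≤ h p
  pos : ∀ᵐ p, 0 < h p
  le : ∀ p, h p ≤ M
  bending : ∫ p, (∑ i, D2h p i i) ^ 2 ≤ S₀
  trace : ∀ i : Fin 3, HasLagrangianTrace h (fun q => u q i) (fun q => Du q i)
    (fun p => if i = 2 then w p else 0)
  memLp_u : ∀ i, MemLp (fun q => u q i) 2 (volume.restrict (dom h))
  memLp_Du : ∀ i j, MemLp (fun q => Du q i j) 2 (volume.restrict (dom h))
  meas_ρ : AEStronglyMeasurable ρ (volume.restrict (dom h))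
  ρ_nonneg : ∀ᵐ q ∂volume.restrict (dom h), 0 ≤ ρ q
  pressure : ∫⁻ q in dom h, ‖ρ q‖ₑ ^ γ ≤ ENNReal.ofReal R₀
  meas_w : AEStronglyMeasurable w
  kinetic : ∫⁻ p, ‖w p‖ₑ ^ 2 ≤ ENNReal.ofReal W₀

/-- The Dirichlet energy of a velocity field. -/
noncomputable def dirichlet (h : Torus L₁ L₂ → ℝ) (Du : Space L₁ L₂ → Fin 3 → Fin 3 → ℝ) :
    ENNReal := ∫⁻ q in dom h, ∑ i, ∑ j, ‖Du q i j‖ₑ ^ 2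

/-- The quotient `(∂_j h)² / h`. -/
noncomputable def slopeQuot (h : Torus L₁ L₂ → ℝ) (Dh : Torus L₁ L₂ → Fin 2 → ℝ) (j : Fin 2)
    (p : Torus L₁ L₂) : ENNReal := ENNReal.ofReal (Dh p j ^ 2 / h p)

lemma lintegral_dom_fst {h : Torus L₁ L₂ → ℝ} (hc : Continuous h) {f : Torus L₁ L₂ → ENNReal}
    (hf : AEMeasurable f) :
    ∫⁻ q in dom h, f q.1 = ∫⁻ p, f p * ENNReal.ofReal (h p) := by
  have hm : AEMeasurable (fun q : Space L₁ L₂ => f q.1) := AEMeasurable.comp_fst hf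
  refine (lintegral_region 0 hc hm.restrict).trans (lintegral_congr fun p => ?_)
  show ∫⁻ _ in Ioo 0 (h p), f p = _
  rw [lintegral_const, Measure.restrict_apply_univ, Real.volume_Ioo, sub_zero]

variable {γ M S₀ R₀ W₀ : ℝ} {h : Torus L₁ L₂ → ℝ} {Dh : Torus L₁ L₂ → Fin 2 → ℝ}
  {D2h : Torus L₁ L₂ → Fin 2 → Fin 2 → ℝ} {u : Space L₁ L₂ → Fin 3 → ℝ}
  {Du : Space L₁ L₂ → Fin 3 → Fin 3 → ℝ} {ρ : Space L₁ L₂ → ℝ} {w : Torus L₁ L₂ → ℝ}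

namespace IsPlateSlice

variable (H : IsPlateSlice γ M S₀ R₀ W₀ h Dh D2h u Du ρ w)
include H

lemma meas_trace (i : Fin 3) : AEStronglyMeasurable fun p => if i = 2 then w p else 0 := by
  split_ifs
  · exact H.meas_w
  · exact aestronglyMeasurable_const

lemma aemeasurable_vert_u (i : Fin 3) : AEMeasurable (vert h fun q => u q i) :=
  aemeasurable_vert H.cont (H.memLp_u i).aestronglyMeasurable

lemma aemeasurable_vert_Du (i j : Fin 3) : AEMeasurable (vert h fun q => Du q i j) :=
  aemeasurable_vert H.cont (H.memLp_Du i j).aestronglyMeasurable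

lemma aemeasurable_Dh (j : Fin 2) : AEMeasurable fun p => Dh p j :=
  (H.isH2.2.1 j).aestronglyMeasurable.aemeasurable

lemma aemeasurable_slopeQuot (j : Fin 2) : AEMeasurable (slopeQuot h Dh j) :=
  (((H.aemeasurable_Dh j).pow_const 2).div H.cont.measurable.aemeasurable).ennreal_ofReal

lemma lintegral_Du_sq_le (i j : Fin 3) :
    ∫⁻ q in dom h, ‖Du q i j‖ₑ ^ 2 ≤ dirichlet h Du :=
  lintegral_mono fun q => (Finset.single_le_sum (f := fun j => ‖Du q i j‖ₑ ^ 2)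
    (fun _ _ => zero_le) (Finset.mem_univ j)).trans
      (Finset.single_le_sum (f := fun i => ∑ j, ‖Du q i j‖ₑ ^ 2)
        (fun _ _ => zero_le) (Finset.mem_univ i))

lemma lintegral_vert_Du_sq_le (i j : Fin 3) :
    ∫⁻ p, vert h (fun q => Du q i j) p ^ 2 ≤ dirichlet h Du :=
  (lintegral_vert_sq H.cont (H.memLp_Du i j).aestronglyMeasurable).trans_le
    (H.lintegral_Du_sq_le i j)

lemma lintegral_slopeQuot_sq_le (j : Fin 2) :
    ∫⁻ p, slopeQuot h Dh j p ^ 2 ≤ ENNReal.ofReal (9 * S₀) := by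
  have e : ∀ p, slopeQuot h Dh j p ^ 2 = ENNReal.ofReal (Dh p j ^ 4 / h p ^ 2) := fun p => by
    rw [slopeQuot, ← ENNReal.ofReal_pow (div_nonneg (sq_nonneg _) (H.nonneg p)), div_pow]
    ring_nf
  simp only [e]
  exact (H.isH2.lintegral_pow_four_div_le H.cont H.nonneg j).trans
    (ENNReal.ofReal_le_ofReal (mul_le_mul_of_nonneg_left H.bending (by norm_num)))

lemma lintegral_slopeQuot_le (j : Fin 2) : ∫⁻ p, slopeQuot h Dh j p ≤
    volume (univ : Set (Torus L₁ L₂)) + ENNReal.ofReal (9 * S₀) := by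
  calc ∫⁻ p, slopeQuot h Dh j p ≤ ∫⁻ p, (1 + slopeQuot h Dh j p ^ 2) := lintegral_mono fun p => by
        rcases le_total (slopeQuot h Dh j p) 1 with h1 | h1
        · exact h1.trans le_self_add
        · exact (le_self_pow₀ h1 two_ne_zero).trans le_add_self
    _ = volume (univ : Set (Torus L₁ L₂)) + ∫⁻ p, slopeQuot h Dh j p ^ 2 := by
        rw [lintegral_add_left measurable_const, lintegral_one]
    _ ≤ _ := by gcongr; exact H.lintegral_slopeQuot_sq_le j

lemma lintegral_vert_pow_le (i : Fin 3) {k : ℕ} (hk : 1 ≤ k) :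
    ∫⁻ p, vert h (fun q => u q i) p ^ (4 * k) ≤
      (ENNReal.ofReal (gnConst L₁ L₂ k * ((2 + M) ^ 2 + 1)) * dirichlet h Du) ^ (2 * k) *
        ENNReal.ofReal (plateConst L₁ L₂ k S₀) := by
  have g0 : 0 ≤ gnConst L₁ L₂ k := gnConst_nonneg Fact.out Fact.out k
  have i0 : 0 ≤ ∫ q in dom h, ∑ j, Du q i j ^ 2 :=
    integral_nonneg fun q => Finset.sum_nonneg fun _ _ => sq_nonneg _
  refine ((H.trace i).lintegral_vert_pow_le H.isH2 H.cont H.nonneg H.le (H.memLp_u i)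
    (H.memLp_Du i) (H.meas_trace i) hk).trans ?_
  have S0 : 0 ≤ ∫ p, (∑ i, D2h p i i) ^ 2 := integral_nonneg fun _ => sq_nonneg _
  rw [ENNReal.ofReal_mul ((even_two_mul k).pow_nonneg _), ENNReal.ofReal_pow (by positivity),
    ← mul_assoc, ENNReal.ofReal_mul (by positivity)]
  have e : ENNReal.ofReal (∫ q in dom h, ∑ j, Du q i j ^ 2) ≤ dirichlet h Du := by
    rw [ofReal_integral_eq_lintegral_ofReal
      (integrable_finsetSum _ fun j _ => (H.memLp_Du i j).integrable_sq)
      (Eventually.of_forall fun q => Finset.sum_nonneg fun _ _ => sq_nonneg _)]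
    refine lintegral_mono fun q => ?_
    rw [ENNReal.ofReal_sum_of_nonneg fun _ _ => sq_nonneg _]
    simp only [← enorm_sq_eq]
    exact Finset.single_le_sum (f := fun i => ∑ j, ‖Du q i j‖ₑ ^ 2)
        (fun _ _ => zero_le) (Finset.mem_univ i)
  have := plateConst_mono (L₁ := L₁) (L₂ := L₂) k S0 H.bending
  gcongr

/-- The outer exponent c/(4k) turns the L^{4k} bound into the power c/2 of the Dirichlet energy for
every k. Thus k may be large, and its Hölder exponent small, without changing the homogeneity. -/
lemma lintegral_vert_rpow_le (i : Fin 3) {k : ℕ} (hk : 1 ≤ k) {c : ℝ} (hc : 0 ≤ c) :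
    (∫⁻ p, vert h (fun q => u q i) p ^ (4 * k)) ^ (c / (4 * k)) ≤
      ENNReal.ofReal (gnConst L₁ L₂ k * ((2 + M) ^ 2 + 1)) ^ (c / 2) *
        ENNReal.ofReal (plateConst L₁ L₂ k S₀) ^ (c / (4 * k)) * dirichlet h Du ^ (c / 2) := by
  have k0 : (0 : ℝ) < k := by exact_mod_cast hk
  have n0 : 0 ≤ c / (4 * k) := by positivity
  refine (ENNReal.rpow_le_rpow (H.lintegral_vert_pow_le i hk) n0).trans_eq ?_
  rw [ENNReal.mul_rpow_of_nonneg _ _ n0, ← ENNReal.rpow_natCast, ← ENNReal.rpow_mul]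
  have e : ((2 * k : ℕ) : ℝ) * (c / (4 * k)) = c / 2 := by
    push_cast
    field_simp
    ring
  rw [e, ENNReal.mul_rpow_of_nonneg _ _ (by positivity)]
  ring

end IsPlateSlice

/-- The velocity of the plate is bounded in a power larger than two. -/
lemma exists_lintegral_velocity_le (L₁ L₂ : ℝ) [Fact (0 < L₁)] [Fact (0 < L₂)] {γ : ℝ} (hγ : 3 < γ)
    (M S₀ R₀ W₀ : ℝ) : ∃ C : ENNReal, C ≠ ⊤ ∧ ∀ {h : Torus L₁ L₂ → ℝ} {Dh D2h u Du ρ w},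
      IsPlateSlice γ M S₀ R₀ W₀ h Dh D2h u Du ρ w →
        ∫⁻ p, ‖w p‖ₑ ^ (2 + 2 / (γ - 1)) ≤ C * dirichlet h Du := by
  -- The Hölder exponents are a = 1/(γ−1) for w², 1/2 for D² and 1/(4k) for N^{4k}. They fit below 1
  -- for large k because γ > 3 means a < 1/2.
  obtain ⟨k, hk⟩ := exists_nat_gt (1 / (1 / 2 - 1 / (γ - 1)))
  set a : ℝ := 1 / (γ - 1)
  have a0 : 0 < a := by have : 0 < γ - 1 := by linarith
                        positivity
  have a2 : 0 < 1 / 2 - a := by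
    have : a < 1 / 2 := by
      rw [div_lt_div_iff₀ (by linarith) two_pos]; linarith
    linarith
  have k0 : (0 : ℝ) < k := lt_trans (by positivity) hk
  have hk1 : 1 ≤ k := by exact_mod_cast k0
  have hk4 : 1 / (4 * k : ℝ) ≤ 1 / 2 - a := by
    rw [div_lt_iff₀ a2] at hk
    rw [div_le_iff₀ (by positivity)]
    nlinarith
  set r : ℝ := 1 - ∑ i, (![a, 1 / 2, 1 / (4 * k)] : Fin 3 → ℝ) i
  have r0 : 0 ≤ r := by simp only [r, Fin.sum_univ_three]; simp; simp at hk4; linarith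
  refine ⟨2 * (volume (univ : Set (Torus L₁ L₂)) ^ r * (ENNReal.ofReal W₀ ^ a *
    (ENNReal.ofReal (gnConst L₁ L₂ k * ((2 + M) ^ 2 + 1)) ^ (1 / 2 : ℝ) *
        ENNReal.ofReal (plateConst L₁ L₂ k S₀) ^ (1 / (4 * k : ℝ))))), ?_,
    fun {h Dh D2h u Du ρ w} H => ?_⟩
  · refine ENNReal.mul_ne_top (by simp) (ENNReal.mul_ne_top ?_ (ENNReal.mul_ne_top ?_
      (ENNReal.mul_ne_top ?_ ?_)))
    · exact ENNReal.rpow_ne_top_of_nonneg r0 (measure_ne_top _ _)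
    · exact ENNReal.rpow_ne_top_of_nonneg a0.le ENNReal.ofReal_ne_top
    · exact ENNReal.rpow_ne_top_of_nonneg (by norm_num) ENNReal.ofReal_ne_top
    · exact ENNReal.rpow_ne_top_of_nonneg (by positivity) ENNReal.ofReal_ne_top
  have hv := (H.trace 2).ae_vert_bounds H.cont H.nonneg (H.memLp_u 2) (H.memLp_Du 2)
    (H.meas_trace 2)
  set N := vert h fun q => u q 2
  set D := vert h fun q => Du q 2 2
  have hol := lintegral_prod_rpow_le (ν := (volume : Measure (Torus L₁ L₂)))
    (f := ![fun p => ‖w p‖ₑ ^ 2, fun p => D p ^ 2, fun p => N p ^ (4 * k)])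
    (p := ![a, 1 / 2, 1 / (4 * k)]) (fun i => by
      fin_cases i
      · exact H.meas_w.enorm.pow_const 2
      · exact (H.aemeasurable_vert_Du 2 2).pow_const 2
      · exact (H.aemeasurable_vert_u 2).pow_const _) (fun i => by
      fin_cases i
      · exact a0.le
      · show (0 : ℝ) ≤ 1 / 2
        norm_num
      · show (0 : ℝ) ≤ 1 / (4 * k)
        positivity) (by linarith)
  simp only [Fin.prod_univ_three, Matrix.cons_val] at hol
  -- Since w is the trace of u₃, two powers of |w| are traded for 2 N D. The remaining 2a powers are
  -- left to the kinetic energy of the plate, which is bounded. N and D contribute half a power of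
  -- the Dirichlet energy each.
  have pt : ∀ᵐ p, ‖w p‖ₑ ^ (2 + 2 / (γ - 1)) ≤
      2 * ((‖w p‖ₑ ^ 2) ^ a * (D p ^ 2) ^ (1 / 2 : ℝ) * (N p ^ (4 * k)) ^ (1 / (4 * k : ℝ))) := by
    filter_upwards [hv] with p ⟨hp, _⟩
    rw [if_pos rfl] at hp
    have e1 : (D p ^ 2) ^ (1 / 2 : ℝ) = D p := by
      rw [← ENNReal.rpow_natCast, ← ENNReal.rpow_mul]; norm_num
    have e2 : (N p ^ (4 * k)) ^ (1 / (4 * k : ℝ)) = N p := by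
      rw [← ENNReal.rpow_natCast, ← ENNReal.rpow_mul]
      push_cast
      rw [mul_one_div_cancel (by positivity), ENNReal.rpow_one]
    have e3 : ‖w p‖ₑ ^ (2 + 2 / (γ - 1)) = (‖w p‖ₑ ^ 2) ^ a * ‖w p‖ₑ ^ 2 := by
      have ea : 2 / (γ - 1) = 2 * a := by
        simp only [a]
        ring
      rw [add_comm, ea, ENNReal.rpow_add_of_nonneg _ _ (by positivity) zero_le_two,
        ENNReal.rpow_two]
      congr 1
      rw [← ENNReal.rpow_natCast, ← ENNReal.rpow_mul]
      congr 1
    rw [e1, e2, e3]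
    calc (‖w p‖ₑ ^ 2) ^ a * ‖w p‖ₑ ^ 2 ≤ (‖w p‖ₑ ^ 2) ^ a * (2 * (N p * D p)) := by gcongr
      _ = _ := by ring
  refine (lintegral_mono_ae pt).trans ?_
  rw [lintegral_const_mul' _ _ (by simp)]
  have b1 := H.lintegral_vert_rpow_le 2 hk1 (c := 1) zero_le_one
  have b2 := ENNReal.rpow_le_rpow (H.lintegral_vert_Du_sq_le 2 2) (z := 1 / 2) (by norm_num)
  have b3 := ENNReal.rpow_le_rpow H.kinetic a0.le
  calc _ ≤ 2 * (volume (univ : Set (Torus L₁ L₂)) ^ r * ((∫⁻ p, ‖w p‖ₑ ^ 2) ^ a *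
        (∫⁻ p, D p ^ 2) ^ (1 / 2 : ℝ) * (∫⁻ p, N p ^ (4 * k)) ^ (1 / (4 * k : ℝ)))) := by
        gcongr
    _ ≤ 2 * (volume (univ : Set (Torus L₁ L₂)) ^ r * (ENNReal.ofReal W₀ ^ a *
        dirichlet h Du ^ (1 / 2 : ℝ) * (ENNReal.ofReal (gnConst L₁ L₂ k * ((2 + M) ^ 2 + 1)) ^
          (1 / 2 : ℝ) * ENNReal.ofReal (plateConst L₁ L₂ k S₀) ^ (1 / (4 * k : ℝ)) *
            dirichlet h Du ^ (1 / 2 : ℝ)))) := by gcongr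
    _ = 2 * (volume (univ : Set (Torus L₁ L₂)) ^ r * (ENNReal.ofReal W₀ ^ a *
    (ENNReal.ofReal (gnConst L₁ L₂ k * ((2 + M) ^ 2 + 1)) ^ (1 / 2 : ℝ) *
        ENNReal.ofReal (plateConst L₁ L₂ k S₀) ^ (1 / (4 * k : ℝ))))) *
          (dirichlet h Du ^ (1 / 2 : ℝ) * dirichlet h Du ^ (1 / 2 : ℝ)) := by ring
    _ = _ := by
        rw [← ENNReal.rpow_add_of_nonneg _ _ (by norm_num) (by norm_num)]
        norm_num

/-- The horizontal momentum flux against the slope of the plate. -/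
lemma exists_lintegral_flux_le (L₁ L₂ : ℝ) [Fact (0 < L₁)] [Fact (0 < L₂)] {γ : ℝ} (hγ : 3 < γ)
    (M S₀ R₀ W₀ : ℝ) : ∃ C : ENNReal, C ≠ ⊤ ∧ ∀ {h : Torus L₁ L₂ → ℝ} {Dh D2h u Du ρ w},
      IsPlateSlice γ M S₀ R₀ W₀ h Dh D2h u Du ρ w → ∀ (i : Fin 3) (j : Fin 2),
        ∫⁻ q in dom h, ‖ρ q‖ₑ * ‖u q i‖ₑ ^ 2 * slopeQuot h Dh j q.1 ≤ C * dirichlet h Du := by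
  -- With s = 1/γ the Hölder exponents are 1/2 for the squared slope quotient, s/2 for D², s for the
  -- vertical integral of ρ^γ and (2−s)/(4k) for N^{4k}. Without the last one the sum is 1/2 + 3s/2,
  -- which is below 1 exactly when γ > 3. The Dirichlet energy enters with total power s/2 + (2−s)/2
  -- = 1.
  obtain ⟨k, hk⟩ := exists_nat_gt (1 / (1 / 2 - 3 / (2 * γ)))
  set s : ℝ := 1 / γ
  have γ0 : 0 < γ := by linarith
  have s0 : 0 < s := by positivity
  have s3 : s < 1 / 3 := by
    rw [div_lt_div_iff₀ γ0 (by norm_num)]; linarith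
  have a2 : 0 < 1 / 2 - 3 / (2 * γ) := by
    have : 3 / (2 * γ) = 3 / 2 * s := by simp only [s]; ring
    rw [this]; linarith
  have k0 : (0 : ℝ) < k := lt_trans (by positivity) hk
  have hk1 : 1 ≤ k := by exact_mod_cast k0
  have hk4 : (2 - s) / (4 * k : ℝ) ≤ 1 / 2 - 3 / 2 * s := by
    rw [div_lt_iff₀ a2, show 3 / (2 * γ) = 3 / 2 * s by simp only [s]; ring] at hk
    rw [div_le_iff₀ (by positivity)]
    nlinarith
  set r : ℝ := 1 - ∑ i, (![1 / 2, s / 2, s, (2 - s) / (4 * k)] : Fin 4 → ℝ) i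
  have r0 : 0 ≤ r := by
    simp only [r, Fin.sum_univ_four, Matrix.cons_val]
    linarith
  refine ⟨2 ^ s * (volume (univ : Set (Torus L₁ L₂)) ^ r * (ENNReal.ofReal (9 * S₀) ^ (1 / 2 : ℝ) *
    ENNReal.ofReal R₀ ^ s * (ENNReal.ofReal (gnConst L₁ L₂ k * ((2 + M) ^ 2 + 1)) ^ ((2 - s) / 2) *
        ENNReal.ofReal (plateConst L₁ L₂ k S₀) ^ ((2 - s) / (4 * k : ℝ))))), ?_,
    fun {h Dh D2h u Du ρ w} H i j => ?_⟩
  · refine ENNReal.mul_ne_top (by simp) (ENNReal.mul_ne_top ?_ (ENNReal.mul_ne_top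
      (ENNReal.mul_ne_top ?_ ?_) (ENNReal.mul_ne_top ?_ ?_)))
    · exact ENNReal.rpow_ne_top_of_nonneg r0 (measure_ne_top _ _)
    · exact ENNReal.rpow_ne_top_of_nonneg (by norm_num) ENNReal.ofReal_ne_top
    · exact ENNReal.rpow_ne_top_of_nonneg s0.le ENNReal.ofReal_ne_top
    · exact ENNReal.rpow_ne_top_of_nonneg (by linarith) ENNReal.ofReal_ne_top
    · exact ENNReal.rpow_ne_top_of_nonneg (div_nonneg (by linarith) (by positivity))
        ENNReal.ofReal_ne_top
  have hv := (H.trace i).ae_vert_bounds H.cont H.nonneg (H.memLp_u i) (H.memLp_Du i)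
    (H.meas_trace i)
  set N := vert h fun q => u q i
  set D := vert h fun q => Du q i 2
  set Y := slopeQuot h Dh j
  set R : Torus L₁ L₂ → ENNReal := fun p => ∫⁻ z in Ioo 0 (h p), ‖ρ (p, z)‖ₑ ^ γ
  have mρ := H.meas_ρ
  have mR : AEMeasurable R := aemeasurable_lintegral_slice 0 H.cont (mρ.enorm.pow_const γ)
  have IR : ∫⁻ p, R p = ∫⁻ q in dom h, ‖ρ q‖ₑ ^ γ :=
    (lintegral_region 0 H.cont (mρ.enorm.pow_const γ)).symm
  have mY : AEMeasurable (fun q : Space L₁ L₂ => Y q.1) :=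
    AEMeasurable.comp_fst (H.aemeasurable_slopeQuot j)
  have mtot : AEMeasurable (fun q => ‖ρ q‖ₑ * ‖u q i‖ₑ ^ 2 * Y q.1) (volume.restrict (dom h)) :=
    (mρ.enorm.mul ((H.memLp_u i).aestronglyMeasurable.enorm.pow_const 2)).mul mY.restrict
  have hol := lintegral_prod_rpow_le (ν := (volume : Measure (Torus L₁ L₂)))
    (f := ![fun p => Y p ^ 2, fun p => D p ^ 2, R, fun p => N p ^ (4 * k)])
    (p := ![1 / 2, s / 2, s, (2 - s) / (4 * k)]) (fun l => by
      fin_cases l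
      · exact (H.aemeasurable_slopeQuot j).pow_const 2
      · exact (H.aemeasurable_vert_Du i 2).pow_const 2
      · exact mR
      · exact (H.aemeasurable_vert_u i).pow_const _) (fun l => by
      fin_cases l
      · show (0 : ℝ) ≤ 1 / 2
        norm_num
      · show (0 : ℝ) ≤ s / 2
        positivity
      · exact s0.le
      · show (0 : ℝ) ≤ (2 - s) / (4 * k)
        exact div_nonneg (by linarith) (by positivity)) (by linarith)
  simp only [Fin.prod_univ_four, Matrix.cons_val] at hol
  have pt : ∀ᵐ p, ∫⁻ z in Ioo 0 (h p), ‖ρ (p, z)‖ₑ * ‖u (p, z) i‖ₑ ^ 2 * Y p ≤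
      2 ^ s * ((Y p ^ 2) ^ (1 / 2 : ℝ) * (D p ^ 2) ^ (s / 2) * R p ^ s *
        (N p ^ (4 * k)) ^ ((2 - s) / (4 * k : ℝ))) := by
    filter_upwards [hv, AEStronglyMeasurable.slice_region H.cont (a := 0) mρ,
      AEStronglyMeasurable.slice_region H.cont (a := 0) (H.memLp_u i).aestronglyMeasurable]
      with p ⟨_, hp⟩ m1 m2
    have e1 : (D p ^ 2) ^ (s / 2) = D p ^ s := by
      rw [← ENNReal.rpow_natCast, ← ENNReal.rpow_mul]
      congr 1
      push_cast
      ring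
    have e2 : (N p ^ (4 * k)) ^ ((2 - s) / (4 * k : ℝ)) = N p ^ (2 - s) := by
      rw [← ENNReal.rpow_natCast, ← ENNReal.rpow_mul]
      congr 1
      push_cast
      field_simp
    have e3 : (Y p ^ 2) ^ (1 / 2 : ℝ) = Y p := by
      rw [← ENNReal.rpow_natCast, ← ENNReal.rpow_mul]; norm_num
    -- The fraction s of |u|² is bounded pointwise by 2 N D; the fraction 1 − s is paired with ρ by
    -- Hölder's inequality on the segment. No supremum of ρ is needed.
    have slice : ∫⁻ z in Ioo 0 (h p), ‖ρ (p, z)‖ₑ * ‖u (p, z) i‖ₑ ^ 2 ≤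
        (2 * (N p * D p)) ^ s * (R p ^ s * (N p ^ 2) ^ (1 - s)) := by
      have h1 : ∀ᵐ z ∂volume.restrict (Ioo 0 (h p)), ‖ρ (p, z)‖ₑ * ‖u (p, z) i‖ₑ ^ 2 ≤
          (2 * (N p * D p)) ^ s * ((‖ρ (p, z)‖ₑ ^ γ) ^ s * (‖u (p, z) i‖ₑ ^ 2) ^ (1 - s)) := by
        filter_upwards [hp] with z hz
        have t1 : (‖ρ (p, z)‖ₑ ^ γ) ^ s = ‖ρ (p, z)‖ₑ := by
          rw [← ENNReal.rpow_mul, mul_one_div_cancel γ0.ne', ENNReal.rpow_one]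
        have t2 : ‖u (p, z) i‖ₑ ^ 2 =
            (‖u (p, z) i‖ₑ ^ 2) ^ s * (‖u (p, z) i‖ₑ ^ 2) ^ (1 - s) := by
          rw [← ENNReal.rpow_add_of_nonneg _ _ s0.le (by linarith)]
          norm_num
        rw [t1]
        calc ‖ρ (p, z)‖ₑ * ‖u (p, z) i‖ₑ ^ 2 =
            ‖ρ (p, z)‖ₑ * ((‖u (p, z) i‖ₑ ^ 2) ^ s * (‖u (p, z) i‖ₑ ^ 2) ^ (1 - s)) := by
              rw [← t2]
          _ ≤ ‖ρ (p, z)‖ₑ * ((2 * (N p * D p)) ^ s * (‖u (p, z) i‖ₑ ^ 2) ^ (1 - s)) := by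
              have := ENNReal.rpow_le_rpow hz s0.le
              gcongr
          _ = _ := by ring
      have m3 : AEMeasurable (fun z => (‖ρ (p, z)‖ₑ ^ γ) ^ s * (‖u (p, z) i‖ₑ ^ 2) ^ (1 - s))
          (volume.restrict (Ioo 0 (h p))) :=
        ((m1.enorm.pow_const γ).pow_const s).mul ((m2.enorm.pow_const 2).pow_const _)
      refine (lintegral_mono_ae h1).trans ?_
      rw [lintegral_const_mul'' _ m3]
      gcongr
      refine (ENNReal.lintegral_mul_norm_pow_le (m1.enorm.pow_const γ) (m2.enorm.pow_const 2)
        s0.le (by linarith) (by ring)).trans_eq ?_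
      rw [vert_sq]
    have mm : AEMeasurable (fun z => ‖ρ (p, z)‖ₑ * ‖u (p, z) i‖ₑ ^ 2)
        (volume.restrict (Ioo 0 (h p))) := m1.enorm.mul (m2.enorm.pow_const 2)
    rw [lintegral_mul_const'' _ mm, e1, e2, e3]
    calc _ ≤ (2 * (N p * D p)) ^ s * (R p ^ s * (N p ^ 2) ^ (1 - s)) * Y p := by gcongr
      _ = 2 ^ s * (Y p * D p ^ s * R p ^ s * (N p ^ s * (N p ^ 2) ^ (1 - s))) := by
          rw [ENNReal.mul_rpow_of_nonneg _ _ s0.le, ENNReal.mul_rpow_of_nonneg _ _ s0.le]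
          ring
      _ = _ := by
          congr 2
          rw [← ENNReal.rpow_natCast, ← ENNReal.rpow_mul,
            ← ENNReal.rpow_add_of_nonneg _ _ s0.le (by push_cast; linarith)]
          congr 1
          push_cast
          ring
  refine (lintegral_region 0 H.cont mtot).trans_le ((lintegral_mono_ae pt).trans ?_)
  rw [lintegral_const_mul' _ _ (by simp)]
  have b1 := H.lintegral_vert_rpow_le i hk1 (c := 2 - s) (by linarith)
  have b2 := ENNReal.rpow_le_rpow (H.lintegral_vert_Du_sq_le i 2) (z := s / 2) (by positivity)
  have b3 := ENNReal.rpow_le_rpow (IR.trans_le H.pressure) s0.le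
  have b4 := ENNReal.rpow_le_rpow (H.lintegral_slopeQuot_sq_le j) (z := 1 / 2) (by norm_num)
  calc _ ≤ 2 ^ s * (volume (univ : Set (Torus L₁ L₂)) ^ r * ((∫⁻ p, Y p ^ 2) ^ (1 / 2 : ℝ) *
        (∫⁻ p, D p ^ 2) ^ (s / 2) * (∫⁻ p, R p) ^ s *
          (∫⁻ p, N p ^ (4 * k)) ^ ((2 - s) / (4 * k : ℝ)))) := by
        gcongr
    _ ≤ 2 ^ s * (volume (univ : Set (Torus L₁ L₂)) ^ r * (ENNReal.ofReal (9 * S₀) ^ (1 / 2 : ℝ) *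
        dirichlet h Du ^ (s / 2) * ENNReal.ofReal R₀ ^ s *
        (ENNReal.ofReal (gnConst L₁ L₂ k * ((2 + M) ^ 2 + 1)) ^ ((2 - s) / 2) *
        ENNReal.ofReal (plateConst L₁ L₂ k S₀) ^ ((2 - s) / (4 * k : ℝ)) *
            dirichlet h Du ^ ((2 - s) / 2)))) := by gcongr
    _ = 2 ^ s * (volume (univ : Set (Torus L₁ L₂)) ^ r * (ENNReal.ofReal (9 * S₀) ^ (1 / 2 : ℝ) *
    ENNReal.ofReal R₀ ^ s * (ENNReal.ofReal (gnConst L₁ L₂ k * ((2 + M) ^ 2 + 1)) ^ ((2 - s) / 2) *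
        ENNReal.ofReal (plateConst L₁ L₂ k S₀) ^ ((2 - s) / (4 * k : ℝ))))) *
          (dirichlet h Du ^ (s / 2) * dirichlet h Du ^ ((2 - s) / 2)) := by ring
    _ = _ := by
        rw [← ENNReal.rpow_add_of_nonneg _ _ (by positivity) (by linarith),
          show s / 2 + (2 - s) / 2 = 1 by ring, ENNReal.rpow_one]

/-- The horizontal velocity against the slope of the plate. -/
lemma IsPlateSlice.lintegral_velocity_slope_le
    (H : IsPlateSlice γ M S₀ R₀ W₀ h Dh D2h u Du ρ w) (i : Fin 3) (j : Fin 2) :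
    ∫⁻ q in dom h, ‖u q i * (Dh q.1 j / h q.1 ^ 2)‖ₑ ≤
      dirichlet h Du + (volume (univ : Set (Torus L₁ L₂)) + ENNReal.ofReal (9 * S₀)) := by
  have mw : AEMeasurable fun p => Dh p j / h p ^ 2 :=
    (H.aemeasurable_Dh j).div (H.cont.measurable.aemeasurable.pow_const 2)
  have mw' : AEMeasurable fun q : Space L₁ L₂ => Dh q.1 j / h q.1 ^ 2 := AEMeasurable.comp_fst mw
  have mu := (H.memLp_u i).aestronglyMeasurable
  -- Cauchy–Schwarz on the segment and Poincaré's inequality give ∫ |u_i| dz ≤ 2 h^{3/2} D. Divided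
  -- by h², this leaves 2 D |∂_j h|/√h ≤ D² + (∂_j h)²/h.
  have pt : ∀ᵐ p, ∫⁻ z in Ioo 0 (h p), ‖u (p, z) i * (Dh p j / h p ^ 2)‖ₑ ≤
      vert h (fun q => Du q i 2) p ^ 2 + slopeQuot h Dh j p := by
    filter_upwards [(H.trace i).ae_vert_le H.cont H.nonneg (H.memLp_u i) (H.memLp_Du i)
      (H.meas_trace i), H.pos, ae_vert_lt_top H.cont (H.memLp_Du i 2),
      AEStronglyMeasurable.slice_region H.cont (a := 0) mu] with p hp h0 hfin m1
    have c1 : ∫⁻ z in Ioo 0 (h p), ‖u (p, z) i‖ₑ ≤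
        vert h (fun q => u q i) p * ENNReal.ofReal (√(h p)) := by
      have := ENNReal.lintegral_mul_norm_pow_le (m1.enorm.pow_const 2)
        (aemeasurable_const (b := (1 : ENNReal))) (p := 1 / 2) (q := 1 / 2) (by norm_num)
        (by norm_num) (by norm_num)
      rw [← vert_sq h fun q => u q i, lintegral_const, Measure.restrict_apply_univ,
        Real.volume_Ioo, sub_zero, one_mul] at this
      have e : ∀ x : ENNReal, (x ^ 2) ^ (1 / 2 : ℝ) = x := fun x => by
        rw [← ENNReal.rpow_natCast, ← ENNReal.rpow_mul]; norm_num
      simp only [e, ENNReal.one_rpow, mul_one] at this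
      rwa [ENNReal.ofReal_rpow_of_nonneg h0.le (by norm_num), ← Real.sqrt_eq_rpow] at this
    simp only [enorm_mul]
    rw [lintegral_mul_const'' _ m1.enorm]
    obtain ⟨x, hx, hx0⟩ : ∃ x : ℝ, vert h (fun q => Du q i 2) p = ENNReal.ofReal x ∧ 0 ≤ x :=
      ⟨_, (ENNReal.ofReal_toReal hfin.ne).symm, ENNReal.toReal_nonneg⟩
    rw [hx] at hp ⊢
    refine (mul_le_mul_left (c1.trans (mul_le_mul_left hp _)) _).trans ?_
    rw [← ENNReal.ofReal_ofNat 2, ← ENNReal.ofReal_mul two_pos.le,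
      ← ENNReal.ofReal_mul (by positivity), ← ENNReal.ofReal_mul (by positivity),
      ← ofReal_norm, ← ENNReal.ofReal_mul (by positivity), ← ENNReal.ofReal_pow hx0, slopeQuot,
      ← ENNReal.ofReal_add (by positivity) (by positivity)]
    refine ENNReal.ofReal_le_ofReal ?_
    obtain ⟨y, hy0, hy⟩ : ∃ y : ℝ, 0 < y ∧ h p = y ^ 2 :=
      ⟨√(h p), Real.sqrt_pos.2 h0, (Real.sq_sqrt h0.le).symm⟩
    rw [hy, Real.sqrt_sq hy0.le, Real.norm_eq_abs, abs_div, abs_of_pos (by positivity :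
      0 < (y ^ 2) ^ 2), ← sq_abs (Dh p j)]
    have e1 : 2 * y ^ 2 * x * y * (|Dh p j| / (y ^ 2) ^ 2) = 2 * x * (|Dh p j| / y) := by
      field_simp
    have e2 : |Dh p j| ^ 2 / y ^ 2 = (|Dh p j| / y) ^ 2 := by rw [div_pow]
    rw [e1, e2]
    nlinarith [sq_nonneg (x - |Dh p j| / y)]
  have mtot : AEMeasurable (fun q => ‖u q i * (Dh q.1 j / h q.1 ^ 2)‖ₑ)
      (volume.restrict (dom h)) := (mu.aemeasurable.mul mw'.restrict).enorm
  refine (lintegral_region 0 H.cont mtot).trans_le ((lintegral_mono_ae pt).trans ?_)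
  rw [lintegral_add_right' _ (H.aemeasurable_slopeQuot j)]
  exact add_le_add (H.lintegral_vert_Du_sq_le i 2) (H.lintegral_slopeQuot_le j)

end Slice

/-- Young's inequality with the exponents γ and γ/(γ−1); twice the latter is 2 + 2/(γ−1). The factor
1/γ is at most 1/3, which leaves room for absorption. -/
lemma mul_sq_le_rpow_add {γ : ℝ} (hγ : 3 < γ) {r : ℝ} (hr : 0 ≤ r) (w : ℝ) :
    r * w ^ 2 ≤ 1 / 3 * r ^ γ + |w| ^ (2 + 2 / (γ - 1)) := by
  have hc := Real.HolderConjugate.conjExponent (p := γ) (by linarith)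
  have y := Real.young_inequality_of_nonneg hr (sq_nonneg w) hc
  have e : (w ^ 2) ^ γ.conjExponent = |w| ^ (2 + 2 / (γ - 1)) := by
    rw [← sq_abs, ← Real.rpow_natCast, ← Real.rpow_mul (abs_nonneg w), Real.conjExponent]
    congr 1
    have : γ - 1 ≠ 0 := by linarith
    push_cast
    field_simp
    ring
  rw [e] at y
  have n1 : 0 ≤ r ^ γ := Real.rpow_nonneg hr _
  have n2 : 0 ≤ |w| ^ (2 + 2 / (γ - 1)) := Real.rpow_nonneg (abs_nonneg w) _
  have b1 : r ^ γ / γ ≤ 1 / 3 * r ^ γ := by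
    rw [div_le_iff₀ (by linarith)]; nlinarith
  have b2 : |w| ^ (2 + 2 / (γ - 1)) / γ.conjExponent ≤ |w| ^ (2 + 2 / (γ - 1)) :=
    div_le_self n2 hc.symm.lt.le
  linarith

/-- Weighted Young inequality. It is used for three fluxes, so the weight 1/4 makes them consume 3/4
of the kinetic term of the contact inequality. -/
lemma abs_mul_le_quarter {r u v x : ℝ} (hr : 0 ≤ r) (hx0 : 0 ≤ x) (hx : x ≤ 1) :
    |r * u * v * x| ≤ 1 / 4 * (r * u ^ 2) + r * v ^ 2 := by
  have e : |r * u * v * x| = r * (|u| * |v|) * x := by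
    rw [abs_mul, abs_mul, abs_mul, abs_of_nonneg hr, abs_of_nonneg hx0]; ring
  have h1 : r * (|u| * |v|) * x ≤ r * (|u| * |v|) := mul_le_of_le_one_right (by positivity) hx
  have h2 : |u| * |v| ≤ 1 / 4 * u ^ 2 + v ^ 2 := by
    rw [← sq_abs u, ← sq_abs v]
    nlinarith [sq_nonneg (1 / 2 * |u| - |v|)]
  have h3 := mul_le_mul_of_nonneg_left h2 hr
  rw [e]
  linarith

/-! ### All fluxes of the contact inequality at a fixed time -/

section SliceBounds

variable {L₁ L₂ : ℝ} [Fact (0 < L₁)] [Fact (0 < L₂)] {γ M S₀ R₀ W₀ : ℝ} {h : Torus L₁ L₂ → ℝ}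
  {Dh : Torus L₁ L₂ → Fin 2 → ℝ} {D2h : Torus L₁ L₂ → Fin 2 → Fin 2 → ℝ}
  {u : Space L₁ L₂ → Fin 3 → ℝ} {Du : Space L₁ L₂ → Fin 3 → Fin 3 → ℝ} {ρ : Space L₁ L₂ → ℝ}
  {w : Torus L₁ L₂ → ℝ}

namespace IsPlateSlice

variable (H : IsPlateSlice γ M S₀ R₀ W₀ h Dh D2h u Du ρ w)
include H

lemma ae_dom : ∀ᵐ q ∂volume.restrict (dom h), (0 < q.2 ∧ q.2 < h q.1) ∧ 0 ≤ ρ q := by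
  filter_upwards [ae_restrict_mem (measurableSet_dom H.cont), H.ρ_nonneg] with q hq hρ
  exact ⟨hq, hρ⟩

lemma measurable_h : Measurable fun q : Space L₁ L₂ => h q.1 :=
  (H.cont.comp continuous_fst).measurable

lemma aemeasurable_kinetic : AEMeasurable (fun q => ρ q * u q 2 ^ 2 / h q.1)
    (volume.restrict (dom h)) :=
  (H.meas_ρ.aemeasurable.mul ((H.memLp_u 2).aestronglyMeasurable.aemeasurable.pow_const 2)).div
    H.measurable_h.aemeasurable

lemma aemeasurable_pressure : AEMeasurable (fun q => ρ q ^ γ / h q.1)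
    (volume.restrict (dom h)) :=
  (H.meas_ρ.aemeasurable.pow_const γ).div H.measurable_h.aemeasurable

/-- As z/h ≤ 1, two Young inequalities split the flux into ρu₃²/4h, ρ^γ/3h and |w|^{2+2/(γ−1)}/h.
The last does not depend on z, and integrating it over a segment of length h removes the factor 1/h.
-/
lemma lintegral_time_le (hγ : 3 < γ) :
    ∫⁻ q in dom h, ‖ρ q * u q 2 * q.2 * w q.1 / h q.1 ^ 2‖ₑ ≤
      ENNReal.ofReal (1 / 4) * (∫⁻ q in dom h, ‖ρ q * u q 2 ^ 2 / h q.1‖ₑ) +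
        ENNReal.ofReal (1 / 3) * (∫⁻ q in dom h, ‖ρ q ^ γ / h q.1‖ₑ) +
          ∫⁻ p, ‖w p‖ₑ ^ (2 + 2 / (γ - 1)) := by
  set f : Torus L₁ L₂ → ENNReal := fun p =>
    ‖w p‖ₑ ^ (2 + 2 / (γ - 1)) * ENNReal.ofReal (1 / h p)
  have mf : AEMeasurable f := (H.meas_w.enorm.pow_const _).mul
    (measurable_const.div H.cont.measurable).ennreal_ofReal.aemeasurable
  have pt : ∀ᵐ q ∂volume.restrict (dom h), ‖ρ q * u q 2 * q.2 * w q.1 / h q.1 ^ 2‖ₑ ≤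
      ENNReal.ofReal (1 / 4) * ‖ρ q * u q 2 ^ 2 / h q.1‖ₑ +
        ENNReal.ofReal (1 / 3) * ‖ρ q ^ γ / h q.1‖ₑ + f q.1 := by
    filter_upwards [H.ae_dom] with q ⟨⟨h1, h2⟩, hρ⟩
    have hp : 0 < h q.1 := h1.trans h2
    have e0 : 0 ≤ 2 + 2 / (γ - 1) := by
      have : 0 < γ - 1 := by linarith
      positivity
    have hf : f q.1 = ENNReal.ofReal (|w q.1| ^ (2 + 2 / (γ - 1)) * (1 / h q.1)) := by
      simp only [f]
      rw [← ofReal_norm, Real.norm_eq_abs, ENNReal.ofReal_rpow_of_nonneg (abs_nonneg _) e0,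
        ENNReal.ofReal_mul (Real.rpow_nonneg (abs_nonneg _) _)]
    rw [hf, ← ofReal_norm, ← ofReal_norm, ← ofReal_norm, ← ENNReal.ofReal_mul (by norm_num),
      ← ENNReal.ofReal_mul (by norm_num), ← ENNReal.ofReal_add (by positivity) (by positivity),
      ← ENNReal.ofReal_add (by positivity) (by positivity)]
    refine ENNReal.ofReal_le_ofReal ?_
    have n1 : 0 ≤ ρ q ^ γ := Real.rpow_nonneg hρ _
    rw [Real.norm_eq_abs, Real.norm_of_nonneg (by positivity), Real.norm_of_nonneg (by positivity)]
    have a1 := abs_mul_le_quarter (u := u q 2) (v := w q.1) hρ (div_nonneg h1.le hp.le)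
      ((div_le_one hp).2 h2.le)
    have a2 := mul_sq_le_rpow_add hγ hρ (w q.1)
    have e : ρ q * u q 2 * q.2 * w q.1 / h q.1 ^ 2 =
        ρ q * u q 2 * w q.1 * (q.2 / h q.1) * (1 / h q.1) := by field_simp
    rw [e, abs_mul, abs_of_pos (one_div_pos.2 hp)]
    have a3 := mul_le_mul_of_nonneg_right (a1.trans (add_le_add_right a2 _))
      (one_div_pos.2 hp).le
    refine a3.trans (le_of_eq ?_)
    ring
  have mA := H.aemeasurable_kinetic.enorm.const_mul (ENNReal.ofReal (1 / 4))
  have mP := H.aemeasurable_pressure.enorm.const_mul (ENNReal.ofReal (1 / 3))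
  have mS : AEMeasurable (fun q => ENNReal.ofReal (1 / 4) * ‖ρ q * u q 2 ^ 2 / h q.1‖ₑ +
    ENNReal.ofReal (1 / 3) * ‖ρ q ^ γ / h q.1‖ₑ) (volume.restrict (dom h)) := mA.add mP
  refine (lintegral_mono_ae pt).trans ?_
  rw [lintegral_add_left' mS, lintegral_add_left' mA,
    lintegral_const_mul'' _ H.aemeasurable_kinetic.enorm,
    lintegral_const_mul'' _ H.aemeasurable_pressure.enorm, lintegral_dom_fst H.cont mf]
  gcongr with p
  simp only [f]
  rw [mul_assoc, ← ENNReal.ofReal_mul (one_div_nonneg.2 (H.nonneg p))]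
  refine mul_le_of_le_one_right zero_le (ENNReal.ofReal_le_one.2 ?_)
  rw [one_div_mul_eq_div]
  exact div_self_le_one _

/-- Young's inequality puts the slope on the horizontal velocity: the second part is ρ u_i² (∂_j
h)²/h, which `exists_lintegral_flux_le` controls. -/
lemma lintegral_horizontal_le (i : Fin 3) (j : Fin 2) :
    ∫⁻ q in dom h, ‖ρ q * u q i * u q 2 * (q.2 * Dh q.1 j / h q.1 ^ 2)‖ₑ ≤
      ENNReal.ofReal (1 / 4) * (∫⁻ q in dom h, ‖ρ q * u q 2 ^ 2 / h q.1‖ₑ) +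
        ∫⁻ q in dom h, ‖ρ q‖ₑ * ‖u q i‖ₑ ^ 2 * slopeQuot h Dh j q.1 := by
  have pt : ∀ᵐ q ∂volume.restrict (dom h),
      ‖ρ q * u q i * u q 2 * (q.2 * Dh q.1 j / h q.1 ^ 2)‖ₑ ≤
      ENNReal.ofReal (1 / 4) * ‖ρ q * u q 2 ^ 2 / h q.1‖ₑ +
        ‖ρ q‖ₑ * ‖u q i‖ₑ ^ 2 * slopeQuot h Dh j q.1 := by
    filter_upwards [H.ae_dom] with q ⟨⟨h1, h2⟩, hρ⟩
    have hp : 0 < h q.1 := h1.trans h2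
    rw [enorm_sq_eq, slopeQuot, ← ofReal_norm, ← ofReal_norm, ← ofReal_norm,
      ← ENNReal.ofReal_mul (by norm_num), ← ENNReal.ofReal_mul (by positivity),
      ← ENNReal.ofReal_mul (by positivity), ← ENNReal.ofReal_add (by positivity) (by positivity)]
    refine ENNReal.ofReal_le_ofReal ?_
    rw [Real.norm_eq_abs, Real.norm_of_nonneg (by positivity), Real.norm_of_nonneg hρ]
    have a1 := abs_mul_le_quarter (u := u q 2) (v := u q i * Dh q.1 j) hρ (div_nonneg h1.le hp.le)
      ((div_le_one hp).2 h2.le)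
    have e : ρ q * u q i * u q 2 * (q.2 * Dh q.1 j / h q.1 ^ 2) =
        ρ q * u q 2 * (u q i * Dh q.1 j) * (q.2 / h q.1) * (1 / h q.1) := by field_simp
    rw [e, abs_mul, abs_of_pos (one_div_pos.2 hp)]
    refine (mul_le_mul_of_nonneg_right a1 (one_div_pos.2 hp).le).trans (le_of_eq ?_)
    ring
  refine (lintegral_mono_ae pt).trans ?_
  rw [lintegral_add_left' (H.aemeasurable_kinetic.enorm.const_mul _),
    lintegral_const_mul'' _ H.aemeasurable_kinetic.enorm]

/-- After z/h ≤ 1 and Young's inequality there remains (∂_j h/h)², whose integral over a segment of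
length h is the slope quotient. -/
lemma lintegral_viscous_le (a b c d : Fin 3) (j : Fin 2) :
    ∫⁻ q in dom h, ‖(Du q a b + Du q c d) * (q.2 * Dh q.1 j / h q.1 ^ 2)‖ₑ ≤
      dirichlet h Du + dirichlet h Du +
        (volume (univ : Set (Torus L₁ L₂)) + ENNReal.ofReal (9 * S₀)) := by
  set f : Torus L₁ L₂ → ENNReal := fun p => slopeQuot h Dh j p * ENNReal.ofReal (1 / h p)
  have mf : AEMeasurable f := (H.aemeasurable_slopeQuot j).mul
    (measurable_const.div H.cont.measurable).ennreal_ofReal.aemeasurable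
  have pt : ∀ᵐ q ∂volume.restrict (dom h),
      ‖(Du q a b + Du q c d) * (q.2 * Dh q.1 j / h q.1 ^ 2)‖ₑ ≤
        ‖Du q a b‖ₑ ^ 2 + ‖Du q c d‖ₑ ^ 2 + f q.1 := by
    filter_upwards [H.ae_dom] with q ⟨⟨h1, h2⟩, hρ⟩
    have hp : 0 < h q.1 := h1.trans h2
    simp only [f]
    rw [enorm_sq_eq, enorm_sq_eq, slopeQuot, ← ofReal_norm, ← ENNReal.ofReal_mul (by positivity),
      ← ENNReal.ofReal_add (by positivity) (by positivity),
      ← ENNReal.ofReal_add (by positivity) (by positivity)]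
    refine ENNReal.ofReal_le_ofReal ?_
    rw [Real.norm_eq_abs]
    have e : (Du q a b + Du q c d) * (q.2 * Dh q.1 j / h q.1 ^ 2) =
      (Du q a b + Du q c d) * (Dh q.1 j / h q.1) * (q.2 / h q.1) := by field_simp
    have e2 : Dh q.1 j ^ 2 / h q.1 * (1 / h q.1) = (Dh q.1 j / h q.1) ^ 2 := by field_simp
    have a0 : q.2 / h q.1 ≤ 1 := (div_le_one hp).2 h2.le
    have a1 : 0 ≤ q.2 / h q.1 := div_nonneg h1.le hp.le
    rw [e, e2, abs_mul, abs_of_nonneg a1]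
    refine (mul_le_of_le_one_right (abs_nonneg _) a0).trans ?_
    rw [abs_le]
    constructor <;> nlinarith [sq_nonneg (Du q a b + Du q c d - Dh q.1 j / h q.1),
      sq_nonneg (Du q a b + Du q c d + Dh q.1 j / h q.1), sq_nonneg (Du q a b - Du q c d)]
  have m1 := (H.memLp_Du a b).aestronglyMeasurable.enorm.pow_const 2
  have m2 := (H.memLp_Du c d).aestronglyMeasurable.enorm.pow_const 2
  have mS : AEMeasurable (fun q => ‖Du q a b‖ₑ ^ 2 + ‖Du q c d‖ₑ ^ 2)
    (volume.restrict (dom h)) := m1.add m2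
  refine (lintegral_mono_ae pt).trans ?_
  rw [lintegral_add_left' mS, lintegral_add_left' m1, lintegral_dom_fst H.cont mf]
  refine add_le_add (add_le_add (H.lintegral_Du_sq_le a b) (H.lintegral_Du_sq_le c d))
    ((lintegral_mono fun p => ?_).trans (H.lintegral_slopeQuot_le j))
  simp only [f]
  rw [mul_assoc, ← ENNReal.ofReal_mul (one_div_nonneg.2 (H.nonneg p))]
  refine mul_le_of_le_one_right zero_le (ENNReal.ofReal_le_one.2 ?_)
  rw [one_div_mul_eq_div]
  exact div_self_le_one _

lemma lintegral_divergence_le :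
    ∫⁻ q in dom h, ‖u q 0 * (Dh q.1 0 / h q.1 ^ 2) + u q 1 * (Dh q.1 1 / h q.1 ^ 2)‖ₑ ≤
      dirichlet h Du + dirichlet h Du + ((volume (univ : Set (Torus L₁ L₂)) +
        ENNReal.ofReal (9 * S₀)) + (volume (univ : Set (Torus L₁ L₂)) + ENNReal.ofReal (9 * S₀))) := by
  have mw : AEMeasurable fun p => Dh p 0 / h p ^ 2 :=
    (H.aemeasurable_Dh 0).div (H.cont.measurable.aemeasurable.pow_const 2)
  have mw' : AEMeasurable fun q : Space L₁ L₂ => Dh q.1 0 / h q.1 ^ 2 := AEMeasurable.comp_fst mw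
  have m1 : AEMeasurable (fun q => ‖u q 0 * (Dh q.1 0 / h q.1 ^ 2)‖ₑ) (volume.restrict (dom h)) :=
    ((H.memLp_u 0).aestronglyMeasurable.aemeasurable.mul mw'.restrict).enorm
  calc _ ≤ ∫⁻ q in dom h, (‖u q 0 * (Dh q.1 0 / h q.1 ^ 2)‖ₑ + ‖u q 1 * (Dh q.1 1 / h q.1 ^ 2)‖ₑ) :=
        lintegral_mono fun q => enorm_add_le _ _
    _ ≤ _ := by
        rw [lintegral_add_left' m1]
        refine (add_le_add (H.lintegral_velocity_slope_le 0 0)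
          (H.lintegral_velocity_slope_le 1 1)).trans_eq ?_
        ring

end IsPlateSlice

/-- Bounds of all fluxes in the contact inequality at a fixed time. -/
lemma exists_lintegral_fluxes_le (L₁ L₂ : ℝ) [Fact (0 < L₁)] [Fact (0 < L₂)] {γ : ℝ} (hγ : 3 < γ)
    (M S₀ R₀ W₀ : ℝ) : ∃ C : ENNReal, C ≠ ⊤ ∧ ∀ {h : Torus L₁ L₂ → ℝ} {Dh D2h u Du ρ w},
      IsPlateSlice γ M S₀ R₀ W₀ h Dh D2h u Du ρ w →
      ∫⁻ q in dom h, ‖ρ q * u q 2 * q.2 * w q.1 / h q.1 ^ 2‖ₑ ≤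
        ENNReal.ofReal (1 / 4) * (∫⁻ q in dom h, ‖ρ q * u q 2 ^ 2 / h q.1‖ₑ) +
        ENNReal.ofReal (1 / 3) * (∫⁻ q in dom h, ‖ρ q ^ γ / h q.1‖ₑ) + C * (1 + dirichlet h Du) ∧
      (∀ (i : Fin 3) (j : Fin 2),
        ∫⁻ q in dom h, ‖ρ q * u q i * u q 2 * (q.2 * Dh q.1 j / h q.1 ^ 2)‖ₑ ≤
          ENNReal.ofReal (1 / 4) * (∫⁻ q in dom h, ‖ρ q * u q 2 ^ 2 / h q.1‖ₑ) +
            C * (1 + dirichlet h Du)) ∧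
      (∀ (a b c d : Fin 3) (j : Fin 2),
        ∫⁻ q in dom h, ‖(Du q a b + Du q c d) * (q.2 * Dh q.1 j / h q.1 ^ 2)‖ₑ ≤
          C * (1 + dirichlet h Du)) ∧
      ∫⁻ q in dom h, ‖u q 0 * (Dh q.1 0 / h q.1 ^ 2) + u q 1 * (Dh q.1 1 / h q.1 ^ 2)‖ₑ ≤
        C * (1 + dirichlet h Du) := by
  obtain ⟨C₁, h₁, H₁⟩ := exists_lintegral_velocity_le L₁ L₂ hγ M S₀ R₀ W₀
  obtain ⟨C₂, h₂, H₂⟩ := exists_lintegral_flux_le L₁ L₂ hγ M S₀ R₀ W₀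
  set V : ENNReal := volume (univ : Set (Torus L₁ L₂)) + ENNReal.ofReal (9 * S₀)
  have hV : V ≠ ⊤ := ENNReal.add_ne_top.2 ⟨measure_ne_top _ _, ENNReal.ofReal_ne_top⟩
  have le1 : ∀ {C C' : ENNReal} (E : ENNReal), C ≤ C' → C * E ≤ C' * (1 + E) := fun E hC =>
    mul_le_mul' hC le_add_self
  have le2 : ∀ {a a' C' : ENNReal} (E : ENNReal), a + a' ≤ C' → a' + a * E ≤ C' * (1 + E) :=
    fun {a a' C'} E hC => by
      calc a' + a * E ≤ C' * 1 + C' * E := by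
            gcongr
            · rw [mul_one]; exact le_add_self.trans hC
            · exact le_self_add.trans hC
        _ = C' * (1 + E) := by ring
  -- One constant for all fluxes: C₁ from the plate velocity, C₂ from the horizontal momentum flux,
  -- 2 from the doubled Dirichlet energy, and V for each slope term, of which the divergence has
  -- two.
  refine ⟨C₁ + C₂ + 2 + (V + V), by simp [ENNReal.add_eq_top, h₁, h₂, hV],
    fun {h Dh D2h u Du ρ w} H => ⟨?_, fun i j => ?_, fun a b c d j => ?_, ?_⟩⟩
  · refine (H.lintegral_time_le hγ).trans (add_le_add le_rfl ((H₁ H).trans (le1 _ ?_)))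
    exact le_self_add.trans (le_self_add.trans le_self_add)
  · refine (H.lintegral_horizontal_le i j).trans (add_le_add le_rfl ((H₂ H i j).trans (le1 _ ?_)))
    exact le_add_self.trans (le_self_add.trans le_self_add)
  · refine (H.lintegral_viscous_le a b c d j).trans ?_
    rw [← two_mul, add_comm]
    refine le2 _ ?_
    exact add_le_add le_add_self le_add_self
  · refine H.lintegral_divergence_le.trans ?_
    rw [← two_mul (dirichlet h Du), add_comm]
    refine le2 _ ?_
    exact add_le_add le_add_self le_rfl

end SliceBounds

/-! ### Continuous functions with a weak time derivative -/

section WeakTimeDerivative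

lemma contDiff_smoothTransition : ContDiff ℝ ∞ Real.smoothTransition :=
  Real.smoothTransition.contDiff

lemma continuous_deriv_smoothTransition : Continuous (deriv Real.smoothTransition) :=
  contDiff_smoothTransition.continuous_deriv (by simp)

lemma hasDerivAt_smoothTransition (x : ℝ) :
    HasDerivAt Real.smoothTransition (deriv Real.smoothTransition x) x :=
  (contDiff_smoothTransition.differentiable (by simp) x).hasDerivAt

lemma deriv_smoothTransition_eq_zero {x : ℝ} (hx : x ∉ Icc (0 : ℝ) 1) :
    deriv Real.smoothTransition x = 0 := by
  rw [mem_Icc, not_and_or, not_le, not_le] at hx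
  rcases hx with hx | hx
  · have : Real.smoothTransition =ᶠ[𝓝 x] fun _ => 0 := by
      filter_upwards [gt_mem_nhds hx] with y hy
      exact Real.smoothTransition.zero_of_nonpos hy.le
    rw [this.deriv_eq, deriv_const]
  · have : Real.smoothTransition =ᶠ[𝓝 x] fun _ => 1 := by
      filter_upwards [lt_mem_nhds hx] with y hy
      exact Real.smoothTransition.one_of_one_le hy.le
    rw [this.deriv_eq, deriv_const]

lemma hasCompactSupport_deriv_smoothTransition :
    HasCompactSupport (deriv Real.smoothTransition) :=
  HasCompactSupport.intro isCompact_Icc fun _ hx => deriv_smoothTransition_eq_zero hx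

lemma integral_deriv_smoothTransition : ∫ x, deriv Real.smoothTransition x = 1 := by
  have h0 : Tendsto Real.smoothTransition atBot (𝓝 0) :=
    tendsto_const_nhds.congr' (by
      filter_upwards [eventually_le_atBot 0] with x hx
      exact (Real.smoothTransition.zero_of_nonpos hx).symm)
  have h1 : Tendsto Real.smoothTransition atTop (𝓝 1) :=
    tendsto_const_nhds.congr' (by
      filter_upwards [eventually_ge_atTop 1] with x hx
      exact (Real.smoothTransition.one_of_one_le hx).symm)
  rw [integral_of_hasDerivAt_of_tendsto hasDerivAt_smoothTransition
    (continuous_deriv_smoothTransition.integrable_of_hasCompactSupport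
      hasCompactSupport_deriv_smoothTransition) h0 h1, sub_zero]

/-- Substitution σ = N (s − c): the derivative of a steep ramp is a kernel of unit mass rescaled to
width 1/N. -/
lemma integral_mul_ramp {a : ℝ → ℝ} {N : ℝ} (hN : 0 < N) (c : ℝ) :
    ∫ s, a s * (N * deriv Real.smoothTransition (N * (s - c))) =
      ∫ σ, a (c + σ / N) * deriv Real.smoothTransition σ := by
  set g : ℝ → ℝ := fun σ => a (c + σ / N) * deriv Real.smoothTransition σ
  have e : ∀ s, a s * (N * deriv Real.smoothTransition (N * (s - c))) = N * g (N * (s - c)) :=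
    fun s => by
      simp only [g]
      rw [mul_div_cancel_left₀ _ hN.ne', add_sub_cancel]
      ring
  simp only [e]
  rw [integral_const_mul, integral_sub_right_eq_self (fun s => g (N * s)) c,
    Measure.integral_comp_mul_left, abs_of_pos (inv_pos.2 hN), smul_eq_mul, ← mul_assoc,
    mul_inv_cancel₀ hN.ne', one_mul]

/-- The rescaled kernels concentrate at the limit of their base points, and a is continuous. Moving
base points are allowed because the ramp near time 0 starts at 1/N. -/
lemma tendsto_integral_ramp {a : ℝ → ℝ} (ha : Continuous a) {C : ℝ} (hC : ∀ s, |a s| ≤ C)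
    {N : ℕ → ℝ} (hN : Tendsto N atTop atTop) {c : ℕ → ℝ} {c' : ℝ} (hc : Tendsto c atTop (𝓝 c')) :
    Tendsto (fun n => ∫ σ, a (c n + σ / N n) * deriv Real.smoothTransition σ) atTop
      (𝓝 (a c')) := by
  have int := continuous_deriv_smoothTransition.integrable_of_hasCompactSupport
      hasCompactSupport_deriv_smoothTransition (μ := volume)
  have := tendsto_integral_of_dominated_convergence (μ := volume)
    (F := fun n σ => a (c n + σ / N n) * deriv Real.smoothTransition σ)
    (f := fun σ => a c' * deriv Real.smoothTransition σ)
    (fun σ => C * ‖deriv Real.smoothTransition σ‖)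
    (fun n => ((ha.comp (continuous_const.add (continuous_id.div_const _))).mul
      continuous_deriv_smoothTransition).aestronglyMeasurable) (int.norm.const_mul C)
    (fun n => Eventually.of_forall fun σ => by
      rw [norm_mul]
      exact mul_le_mul_of_nonneg_right (hC _) (norm_nonneg _))
    (Eventually.of_forall fun σ => by
      refine Tendsto.mul_const _ ((ha.tendsto c').comp ?_)
      have := hc.add (hN.const_div_atTop σ)
      rwa [add_zero] at this)
  rwa [integral_const_mul, integral_deriv_smoothTransition, mul_one] at this

/-- A continuous function with an integrable weak derivative is the primitive of the latter. -/
lemma eq_add_integral_of_weak_deriv {T : ℝ} {a b : ℝ → ℝ} (ha : ContinuousOn a (Icc 0 T))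
    (hb : IntegrableOn b (Ioo 0 T))
    (h : ∀ θ : ℝ → ℝ, ContDiff ℝ ∞ θ → HasCompactSupport θ → tsupport θ ⊆ Ioo 0 T →
      ∫ s in Ioo 0 T, a s * deriv θ s = -∫ s in Ioo 0 T, b s * θ s) {t : ℝ} (ht : t ∈ Ioo 0 T) :
    a t = a 0 + ∫ s in Ioo 0 t, b s := by
  have hT : 0 ≤ T := ht.1.le.trans ht.2.le
  -- The constant extension beyond [0, T] lets the ramp integrals run over the whole line.
  set a' : ℝ → ℝ := IccExtend hT ((Icc 0 T).domRestrict a)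
  have ca : Continuous a' := (continuousOn_iff_continuous_domRestrict.1 ha).Icc_extend'
  have ea : ∀ s ∈ Icc 0 T, a' s = a s := fun s hs => IccExtend_of_mem _ _ hs
  obtain ⟨C, hC⟩ := isCompact_Icc.exists_bound_of_continuousOn ha
  have hC' : ∀ s, |a' s| ≤ C := fun s => hC _ (projIcc 0 T hT s).2
  set st := Real.smoothTransition
  -- The summand 2/(T − t) ensures 2/N < T − t, so that the test functions below are supported in
  -- (0, T) for every n.
  set N : ℕ → ℝ := fun n => n + 1 + 2 / (T - t)
  have hTt : 0 < T - t := sub_pos.2 ht.2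
  have N0 : ∀ n, 0 < N n := fun n => by positivity
  have N1 : ∀ n, 2 < N n * (T - t) := fun n => by
    have : N n * (T - t) = (n + 1) * (T - t) + 2 := by
      simp only [N]; field_simp
    rw [this]
    have : 0 < ((n : ℝ) + 1) * (T - t) := by positivity
    linarith
  have Nlim : Tendsto N atTop atTop :=
    tendsto_atTop_add_const_right _ _ (tendsto_atTop_add_const_right _ _ tendsto_natCast_atTop_atTop)
  -- A smooth approximation of the indicator of (0, t]: one ramp rises on [1/N, 2/N], the other
  -- falls on [t, t + 1/N].
  set θ : ℕ → ℝ → ℝ := fun n s => st (N n * (s - 1 / N n)) - st (N n * (s - t))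
  have hd : ∀ n s, HasDerivAt (θ n) (N n * deriv st (N n * (s - 1 / N n)) -
      N n * deriv st (N n * (s - t))) s := fun n s => by
    have d : ∀ c, HasDerivAt (fun s => st (N n * (s - c))) (N n * deriv st (N n * (s - c))) s :=
      fun c => by
        have := HasDerivAt.comp s (hasDerivAt_smoothTransition (N n * (s - c)))
          (((hasDerivAt_id s).sub_const c).const_mul (N n))
        rw [mul_one, mul_comm] at this
        exact this
    exact (d _).sub (d _)
  have smooth : ∀ n, ContDiff ℝ ∞ (θ n) := fun n =>
    (contDiff_smoothTransition.comp (contDiff_const.mul (contDiff_id.sub contDiff_const))).sub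
      (contDiff_smoothTransition.comp (contDiff_const.mul (contDiff_id.sub contDiff_const)))
  have e1 : ∀ n s, N n * (s - 1 / N n) = N n * s - 1 := fun n s => by
    have := (N0 n).ne'
    field_simp
  have supp : ∀ n, Function.support (θ n) ⊆ Icc (min (1 / N n) t) (max (2 / N n) (t + 1 / N n)) :=
    fun n s hs => by
      by_contra hcon
      refine hs ?_
      rw [mem_Icc, not_and_or, not_le, not_le] at hcon
      simp only [θ, e1]
      rcases hcon with hcon | hcon
      · have h1 := (lt_min_iff.1 hcon).1
        have h2 := (lt_min_iff.1 hcon).2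
        rw [lt_div_iff₀ (N0 n)] at h1
        rw [show st (N n * s - 1) = 0 from Real.smoothTransition.zero_of_nonpos (by linarith),
          show st (N n * (s - t)) = 0 from Real.smoothTransition.zero_of_nonpos
            (mul_nonpos_of_nonneg_of_nonpos (N0 n).le (by linarith)), sub_zero]
      · have h1 := (max_lt_iff.1 hcon).1
        have h2 := (max_lt_iff.1 hcon).2
        rw [div_lt_iff₀ (N0 n)] at h1
        have h3 : 1 / N n < s - t := by linarith
        rw [div_lt_iff₀ (N0 n)] at h3
        rw [show st (N n * s - 1) = 1 from Real.smoothTransition.one_of_one_le (by linarith),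
          show st (N n * (s - t)) = 1 from Real.smoothTransition.one_of_one_le (by linarith),
          sub_self]
  have sub : ∀ n, Icc (min (1 / N n) t) (max (2 / N n) (t + 1 / N n)) ⊆ Ioo 0 T := fun n s hs => by
    have h1 : 0 < min (1 / N n) t := lt_min (one_div_pos.2 (N0 n)) ht.1
    have h2 : 2 / N n < T - t := by rw [div_lt_iff₀ (N0 n)]; linarith [N1 n]
    have h3 : 1 / N n < T - t := by rw [div_lt_iff₀ (N0 n)]; linarith [N1 n]
    have h4 : max (2 / N n) (t + 1 / N n) < T := max_lt (by linarith [ht.1]) (by linarith)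
    exact ⟨h1.trans_le hs.1, hs.2.trans_lt h4⟩
  have tsupp : ∀ n, tsupport (θ n) ⊆ Ioo 0 T := fun n =>
    (closure_minimal (supp n) isClosed_Icc).trans (sub n)
  have comp : ∀ n, HasCompactSupport (θ n) := fun n =>
    HasCompactSupport.of_support_subset_isCompact isCompact_Icc (supp n)
  have ramp_int : ∀ n c, Integrable fun s => a' s * (N n * deriv st (N n * (s - c))) := fun n c => by
    refine Continuous.integrable_of_hasCompactSupport (ca.mul (continuous_const.mul
      (continuous_deriv_smoothTransition.comp (continuous_const.mul
        (continuous_id.sub continuous_const))))) ?_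
    refine HasCompactSupport.intro (K := Icc c (c + 1 / N n)) isCompact_Icc fun s hs => ?_
    rw [show deriv st (N n * (s - c)) = 0 from deriv_smoothTransition_eq_zero fun hx => hs ⟨?_, ?_⟩]
    · ring
    · have h1 := nonneg_of_mul_nonneg_right hx.1 (N0 n)
      linarith
    · have h2 : s - c ≤ 1 / N n := by rw [le_div_iff₀ (N0 n)]; linarith [hx.2]
      linarith
  have lhs : ∀ n, ∫ s in Ioo 0 T, a s * deriv (θ n) s =
      (∫ σ, a' (1 / N n + σ / N n) * deriv st σ) - ∫ σ, a' (t + σ / N n) * deriv st σ := fun n => by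
    rw [← integral_mul_ramp (N0 n), ← integral_mul_ramp (N0 n),
      ← integral_sub (ramp_int n _) (ramp_int n _)]
    refine Eq.trans ?_ (setIntegral_eq_integral_of_forall_compl_eq_zero (s := Ioo 0 T)
      fun s hs => ?_)
    · refine setIntegral_congr_fun measurableSet_Ioo fun s hs => ?_
      rw [(hd n s).deriv, ea s (Ioo_subset_Icc_self hs)]
      ring
    · have : deriv (θ n) s = 0 := by
        by_contra hne
        exact hs (tsupp n (support_deriv_subset hne))
      rw [(hd n s).deriv] at this
      rw [← mul_sub, this, mul_zero]
  have lim1 := (tendsto_integral_ramp ca hC' Nlim (Nlim.const_div_atTop 1)).sub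
    (tendsto_integral_ramp ca hC' Nlim (tendsto_const_nhds (x := t)))
  have lim2 : Tendsto (fun n => ∫ s in Ioo 0 T, b s * θ n s) atTop
      (𝓝 (∫ s in Ioo 0 T, (Iic t).indicator b s)) := by
    refine tendsto_integral_of_dominated_convergence (fun s => ‖b s‖)
      (fun n => hb.aestronglyMeasurable.mul (smooth n).continuous.aestronglyMeasurable) hb.norm
      (fun n => Eventually.of_forall fun s => ?_)
      ((ae_restrict_iff' measurableSet_Ioo).2 (Eventually.of_forall fun s hs => ?_))
    · rw [norm_mul]
      refine mul_le_of_le_one_right (norm_nonneg _) ?_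
      rw [Real.norm_eq_abs, abs_le]
      have := Real.smoothTransition.nonneg (N n * (s - 1 / N n))
      have := Real.smoothTransition.le_one (N n * (s - 1 / N n))
      have := Real.smoothTransition.nonneg (N n * (s - t))
      have := Real.smoothTransition.le_one (N n * (s - t))
      constructor <;> simp only [θ, st] <;> linarith
    · have l : ∀ c, 0 < c → Tendsto (fun n => N n * c) atTop atTop := fun c hc =>
        Nlim.atTop_mul_const hc
      have s1 : ∀ᶠ n in atTop, st (N n * (s - 1 / N n)) = 1 := by
        filter_upwards [(l s hs.1).eventually_ge_atTop 2] with n hn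
        rw [e1]
        exact Real.smoothTransition.one_of_one_le (by linarith)
      refine tendsto_const_nhds.congr' ?_
      rcases le_or_gt s t with hst | hst
      · filter_upwards [s1] with n hn
        simp only [θ]
        rw [indicator_of_mem (show s ∈ Iic t from hst), hn,
          show st (N n * (s - t)) = 0 from Real.smoothTransition.zero_of_nonpos
            (mul_nonpos_of_nonneg_of_nonpos (N0 n).le (by linarith))]
        ring
      · filter_upwards [s1, (l (s - t) (sub_pos.2 hst)).eventually_ge_atTop 1] with n hn hn'
        simp only [θ]
        rw [indicator_of_notMem (show s ∉ Iic t from not_le.2 hst), hn,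
          show st (N n * (s - t)) = 1 from Real.smoothTransition.one_of_one_le hn']
        ring
  have key := tendsto_nhds_unique (lim1.congr fun n =>
    ((lhs n).symm.trans (h (θ n) (smooth n) (comp n) (tsupp n)))) lim2.neg
  rw [ea 0 ⟨le_rfl, hT⟩, ea t (Ioo_subset_Icc_self ht), setIntegral_indicator measurableSet_Iic,
    show Ioo 0 T ∩ Iic t = Ioc 0 t from Set.ext fun s =>
      ⟨fun hs => ⟨hs.1.1, hs.2⟩, fun hs => ⟨⟨hs.1, hs.2.trans_lt ht.2⟩, hs.2⟩⟩,
    integral_Ioc_eq_integral_Ioo] at key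
  linarith

end WeakTimeDerivative

/-! ### Moving cylinders and the work of a stationary force -/

section Cylinder

variable {L₁ L₂ : ℝ} [Fact (0 < L₁)] [Fact (0 < L₂)] {T : ℝ} {η : ℝ → Torus L₁ L₂ → ℝ}

lemma continuous_of_continuousOn_time (hη : ContinuousOn (Function.uncurry η) (Icc 0 T ×ˢ univ))
    {s : ℝ} (hs : s ∈ Icc 0 T) : Continuous (η s) :=
  (hη.comp_continuous (continuous_const.prodMk continuous_id)
    fun p => ⟨hs, mem_univ p⟩ : Continuous fun p => Function.uncurry η (s, p))

lemma measurableSet_cyl (hη : ContinuousOn (Function.uncurry η) (Icc 0 T ×ˢ univ)) {t : ℝ}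
    (ht : t ≤ T) : MeasurableSet (cyl t η) := by
  have e : cyl t η = (Ioo 0 t ×ˢ univ) ∩
      (fun a : ℝ × Space L₁ L₂ => (a.2.2, η a.1 a.2.1 - a.2.2)) ⁻¹' (Ioi 0 ×ˢ Ioi 0) := by
    ext a
    simp [cyl, dom]
  rw [e]
  refine (ContinuousOn.isOpen_inter_preimage ?_ (isOpen_Ioo.prod isOpen_univ)
    (isOpen_Ioi.prod isOpen_Ioi)).measurableSet
  refine (continuous_snd.comp continuous_snd).continuousOn.prodMk (ContinuousOn.sub ?_
    (continuous_snd.comp continuous_snd).continuousOn)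
  exact hη.comp (f := fun a : ℝ × Space L₁ L₂ => (a.1, a.2.1))
    (continuous_fst.prodMk (continuous_fst.comp continuous_snd)).continuousOn
    fun a ha => ⟨⟨ha.1.1.le, ha.1.2.le.trans ht⟩, mem_univ _⟩

lemma indicator_cyl {β : Type*} [Zero β] {t s : ℝ} (f : ℝ × Space L₁ L₂ → β) (q : Space L₁ L₂) :
    (cyl t η).indicator f (s, q) =
      (Ioo 0 t).indicator (fun s => (dom (η s)).indicator (fun q => f (s, q)) q) s := by
  by_cases h1 : s ∈ Ioo 0 t
  · by_cases h2 : q ∈ dom (η s)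
    · rw [indicator_of_mem h1, indicator_of_mem h2,
        indicator_of_mem (show (s, q) ∈ cyl t η from ⟨h1, h2⟩)]
    · rw [indicator_of_mem h1, indicator_of_notMem h2,
        indicator_of_notMem (show (s, q) ∉ cyl t η from fun h => h2 h.2)]
  · rw [indicator_of_notMem h1, indicator_of_notMem (show (s, q) ∉ cyl t η from fun h => h1 h.1)]

section

variable (hη : ContinuousOn (Function.uncurry η) (Icc 0 T ×ˢ univ)) {t : ℝ} (ht : t ≤ T)
include hη ht

lemma measurableSet_dom_time {s : ℝ} (hs : s ∈ Ioo 0 t) : MeasurableSet (dom (η s)) :=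
  measurableSet_dom (continuous_of_continuousOn_time hη ⟨hs.1.le, hs.2.le.trans ht⟩)

lemma lintegral_indicator_cyl (f : ℝ × Space L₁ L₂ → ENNReal) :
    ∫⁻ s, ∫⁻ q, (cyl t η).indicator f (s, q) = ∫⁻ s in Ioo 0 t, ∫⁻ q in dom (η s), f (s, q) := by
  rw [← lintegral_indicator measurableSet_Ioo]
  refine lintegral_congr fun s => ?_
  simp only [indicator_cyl]
  by_cases h1 : s ∈ Ioo 0 t
  · simp only [indicator_of_mem h1]
    rw [lintegral_indicator (measurableSet_dom_time hη ht h1)]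
  · simp only [indicator_of_notMem h1, lintegral_zero]

lemma lintegral_cyl {f : ℝ × Space L₁ L₂ → ENNReal} (hf : AEMeasurable f (volume.restrict (cyl t η))) :
    ∫⁻ a in cyl t η, f a = ∫⁻ s in Ioo 0 t, ∫⁻ q in dom (η s), f (s, q) := by
  have m := measurableSet_cyl hη ht
  rw [← lintegral_indicator m, ← lintegral_indicator_cyl hη ht]
  exact lintegral_prod _ ((aemeasurable_indicator_iff m).2 hf)

/-- This direction of Tonelli's theorem needs no measurability. It therefore applies to the fluxes
without checking their joint measurability. -/
lemma lintegral_cyl_le (f : ℝ × Space L₁ L₂ → ENNReal) :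
    ∫⁻ a in cyl t η, f a ≤ ∫⁻ s in Ioo 0 t, ∫⁻ q in dom (η s), f (s, q) := by
  rw [← lintegral_indicator (measurableSet_cyl hη ht), ← lintegral_indicator_cyl hη ht]
  exact lintegral_prod_le _

lemma integral_cyl {f : ℝ × Space L₁ L₂ → ℝ} (hf : IntegrableOn f (cyl t η)) :
    IntegrableOn (fun s => ∫ q in dom (η s), f (s, q)) (Ioo 0 t) ∧
    ∫ a in cyl t η, f a = ∫ s in Ioo 0 t, ∫ q in dom (η s), f (s, q) := by
  have m := measurableSet_cyl hη ht
  have hi := (integrable_indicator_iff m).2 hf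
  have e : (fun s => ∫ q, (cyl t η).indicator f (s, q)) =
      (Ioo 0 t).indicator fun s => ∫ q in dom (η s), f (s, q) := by
    ext s
    simp only [indicator_cyl]
    by_cases h1 : s ∈ Ioo 0 t
    · simp only [indicator_of_mem h1]
      rw [integral_indicator (measurableSet_dom_time hη ht h1)]
    · simp only [indicator_of_notMem h1, integral_zero]
  constructor
  · rw [← integrable_indicator_iff measurableSet_Ioo, ← e]
    exact hi.integral_prod_left
  · rw [← integral_indicator m, ← integral_indicator measurableSet_Ioo, ← e]
    exact integral_prod _ hi

lemma ae_ae_dom_of_ae_cyl {P : ℝ × Space L₁ L₂ → Prop} (h : ∀ᵐ a ∂volume.restrict (cyl t η), P a) :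
    ∀ᵐ s ∂volume.restrict (Ioo 0 t), ∀ᵐ q ∂volume.restrict (dom (η s)), P (s, q) := by
  rw [ae_restrict_iff' (measurableSet_cyl hη ht)] at h
  have h1 := Measure.ae_ae_of_ae_prod (μ := (volume : Measure ℝ))
    (ν := (volume : Measure (Space L₁ L₂))) h
  rw [ae_restrict_iff' measurableSet_Ioo]
  filter_upwards [h1] with s h2 hs
  rw [ae_restrict_iff' (measurableSet_dom_time hη ht hs)]
  filter_upwards [h2] with q hq hq'
  exact hq ⟨hs, hq'⟩

lemma ae_aestronglyMeasurable_dom {f : ℝ × Space L₁ L₂ → ℝ}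
    (hf : AEStronglyMeasurable f (volume.restrict (cyl t η))) :
    ∀ᵐ s ∂volume.restrict (Ioo 0 t),
      AEStronglyMeasurable (fun q => f (s, q)) (volume.restrict (dom (η s))) := by
  have m := measurableSet_cyl hη ht
  have h1 := ((aestronglyMeasurable_indicator_iff m).2 hf).prodMk_left
    (μ := (volume : Measure ℝ)) (ν := (volume : Measure (Space L₁ L₂)))
  rw [ae_restrict_iff' measurableSet_Ioo]
  filter_upwards [h1] with s h2 hs
  rw [← aestronglyMeasurable_indicator_iff (measurableSet_dom_time hη ht hs)]
  refine h2.congr (Eventually.of_forall fun q => ?_)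
  show (cyl t η).indicator f (s, q) = _
  rw [indicator_cyl, indicator_of_mem hs]

lemma ae_memLp_dom {f : ℝ × Space L₁ L₂ → ℝ} (hf : MemLp f 2 (volume.restrict (cyl t η))) :
    ∀ᵐ s ∂volume.restrict (Ioo 0 t),
      MemLp (fun q => f (s, q)) 2 (volume.restrict (dom (η s))) := by
  have m := measurableSet_cyl hη ht
  have m2 : AEMeasurable (fun a => ‖f a‖ₑ ^ 2) (volume.restrict (cyl t η)) :=
    hf.aestronglyMeasurable.enorm.pow_const 2
  have h1 : ∫⁻ s in Ioo 0 t, ∫⁻ q in dom (η s), ‖f (s, q)‖ₑ ^ 2 ≠ ⊤ := by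
    rw [← lintegral_cyl hη ht m2, ← eLpNorm_two_sq]
    exact ENNReal.pow_ne_top hf.eLpNorm_ne_top
  rw [← lintegral_indicator_cyl hη ht (fun a => ‖f a‖ₑ ^ 2)] at h1
  have h2 := ae_lt_top' (AEMeasurable.lintegral_prod_right' (μ := (volume : Measure ℝ))
    (ν := (volume : Measure (Space L₁ L₂))) ((aemeasurable_indicator_iff m).2 m2)) h1
  filter_upwards [ae_aestronglyMeasurable_dom hη ht hf.aestronglyMeasurable,
    ae_restrict_of_ae h2, ae_restrict_mem measurableSet_Ioo] with s h3 h4 hs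
  refine ⟨h3, ?_⟩
  simp only [indicator_cyl, indicator_of_mem hs] at h4
  rw [lintegral_indicator (measurableSet_dom_time hη ht hs), ← eLpNorm_two_sq] at h4
  exact (ENNReal.pow_lt_top_iff.1 h4).resolve_right two_ne_zero

end

lemma restrict_cylT (t : ℝ) : (volume : Measure (ℝ × Torus L₁ L₂)).restrict (cylT t) =
    (volume.restrict (Ioo 0 t)).prod volume := by
  conv_rhs => rw [← Measure.restrict_univ (μ := (volume : Measure (Torus L₁ L₂)))]
  exact (Measure.prod_restrict _ _).symm

lemma MemLinftyT.ae_memLp {f : ℝ → Torus L₁ L₂ → ℝ} (hf : MemLinftyT T 2 f) :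
    ∀ᵐ s ∂volume.restrict (Ioo 0 T), MemLp (f s) 2 := by
  obtain ⟨hm, C, hC⟩ := hf
  rw [restrict_cylT] at hm
  filter_upwards [hm.prodMk_left, hC] with s h1 h2
  exact ⟨h1, h2.trans_lt ENNReal.coe_lt_top⟩

lemma MemLinftyT.integrable {f : ℝ → Torus L₁ L₂ → ℝ} (hf : MemLinftyT T 2 f) :
    Integrable (Function.uncurry f) ((volume.restrict (Ioo 0 T)).prod volume) := by
  obtain ⟨hm, C, hC⟩ := hf
  rw [restrict_cylT] at hm
  refine ⟨hm, ?_⟩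
  rw [HasFiniteIntegral, lintegral_prod _ hm.enorm]
  have b : ∀ᵐ s ∂volume.restrict (Ioo 0 T), ∫⁻ p, ‖Function.uncurry f (s, p)‖ₑ ≤
      volume (univ : Set (Torus L₁ L₂)) + C ^ 2 := by
    filter_upwards [hC] with s hs
    calc ∫⁻ p, ‖f s p‖ₑ ≤ ∫⁻ p, (1 + ‖f s p‖ₑ ^ 2) := lintegral_mono fun p => by
          rcases le_total ‖f s p‖ₑ 1 with h1 | h1
          · exact h1.trans le_self_add
          · exact (le_self_pow₀ h1 two_ne_zero).trans le_add_self
      _ = volume (univ : Set (Torus L₁ L₂)) + eLpNorm (f s) 2 volume ^ 2 := by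
          rw [lintegral_add_left measurable_const, lintegral_one, eLpNorm_two_sq]
      _ ≤ _ := by gcongr
  refine (lintegral_mono_ae b).trans_lt ?_
  rw [lintegral_const]
  exact ENNReal.mul_lt_top (ENNReal.add_lt_top.2 ⟨measure_lt_top _ _, by finiteness⟩)
    (by rw [Measure.restrict_apply_univ]; exact measure_Ioo_lt_top)

lemma isTestT_mul {θ : ℝ → ℝ} (hθ : ContDiff ℝ ∞ θ) (hc : HasCompactSupport θ) {I : Set ℝ}
    (hs : tsupport θ ⊆ I) {F : Torus L₁ L₂ → ℝ} (hF : IsCkT ∞ F) :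
    IsTestT I fun s p => θ s * F p := by
  have sub : Function.support (Function.uncurry fun s (p : Torus L₁ L₂) => θ s * F p) ⊆
      tsupport θ ×ˢ univ := fun a ha =>
    ⟨subset_tsupport θ (left_ne_zero_of_mul ha), mem_univ _⟩
  refine ⟨?_, HasCompactSupport.of_support_subset_isCompact (hc.prod isCompact_univ) sub,
    (closure_minimal sub ((isClosed_tsupport θ).prod isClosed_univ)).trans
      (prod_mono_left hs)⟩
  exact (hθ.comp contDiff_fst).mul ((isCkT_iff.1 hF).comp contDiff_snd)

/-- The work of a stationary force on the plate. -/
lemma integral_force_mul_velocity (hη : ContinuousOn (Function.uncurry η) (Icc 0 T ×ˢ univ))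
    {dη : ℝ → Torus L₁ L₂ → ℝ} (hL : MemLinftyT T 2 η) (hd : MemLinftyT T 2 dη)
    (hw : ∀ ψ : ℝ → Torus L₁ L₂ → ℝ, IsTestT (Ioo 0 T) ψ →
      ∫ a in cylT T, η a.1 a.2 * deriv (fun s => ψ s a.2) a.1 =
        -∫ a in cylT T, dη a.1 a.2 * ψ a.1 a.2)
    {F : Torus L₁ L₂ → ℝ} (hF : IsCkT ∞ F) {t : ℝ} (ht : t ∈ Ioo 0 T) :
    ∫ a in cylT t, F a.2 * dη a.1 a.2 = (∫ p, F p * η t p) - ∫ p, F p * η 0 p := by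
  have cF := hF.continuous
  obtain ⟨M, hM⟩ := exists_bound cF
  have mF : AEStronglyMeasurable (fun a : ℝ × Torus L₁ L₂ => F a.2)
      ((volume.restrict (Ioo 0 T)).prod volume) := (cF.comp continuous_snd).aestronglyMeasurable
  have iη : Integrable (fun a : ℝ × Torus L₁ L₂ => F a.2 * η a.1 a.2)
      ((volume.restrict (Ioo 0 T)).prod volume) :=
    hL.integrable.bdd_mul mF (Eventually.of_forall fun a => hM a.2)
  have id : Integrable (fun a : ℝ × Torus L₁ L₂ => F a.2 * dη a.1 a.2)
      ((volume.restrict (Ioo 0 T)).prod volume) :=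
    hd.integrable.bdd_mul mF (Eventually.of_forall fun a => hM a.2)
  -- Testing with θ(s) F(p) shows that the scalar function s ↦ ∫ F η(s) has the weak derivative ∫ F
  -- ∂_t η. The smoothness of F makes the product an admissible test function.
  have key := eq_add_integral_of_weak_deriv (T := T) (a := fun s => ∫ p, F p * η s p)
    (b := fun s => ∫ p, F p * dη s p) ?_ id.integral_prod_left (fun θ hθ hc hs => ?_) ht
  · have e : ∫ a in cylT t, F a.2 * dη a.1 a.2 = ∫ s in Ioo 0 t, ∫ p, F p * dη s p := by
      rw [restrict_cylT]
      refine integral_prod _ ?_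
      rw [← restrict_cylT] at id ⊢
      exact id.mono_measure (Measure.restrict_mono
        (prod_mono_left (Ioo_subset_Ioo_right ht.2.le)) le_rfl)
    rw [e]
    linarith
  · obtain ⟨C, hC⟩ := (isCompact_Icc.prod isCompact_univ).exists_bound_of_continuousOn hη
    refine continuousOn_of_dominated (bound := fun _ => M * C) (fun s hs =>
      (cF.mul (continuous_of_continuousOn_time hη hs)).aestronglyMeasurable) (fun s hs =>
      Eventually.of_forall fun p => ?_) (integrable_const _) (Eventually.of_forall fun p => ?_)
    · rw [norm_mul]
      exact mul_le_mul (hM p) (hC (s, p) ⟨hs, mem_univ _⟩) (norm_nonneg _)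
        ((abs_nonneg _).trans (hM p))
    · exact continuousOn_const.mul (hη.comp (f := fun s => (s, p))
        (continuous_id.prodMk continuous_const).continuousOn fun s hs => ⟨hs, mem_univ _⟩)
  · have h1 := hw _ (isTestT_mul hθ hc hs hF)
    have dθ : ∀ (s : ℝ) (c : ℝ), deriv (fun s => θ s * c) s = deriv θ s * c := fun s c =>
      deriv_mul_const_field c
    simp only [dθ, restrict_cylT] at h1
    have cθ' : Continuous (deriv θ) := hθ.continuous_deriv (by simp)
    obtain ⟨A, hA⟩ := hc.exists_bound_of_continuous hθ.continuous
    obtain ⟨A', hA'⟩ := hc.deriv.exists_bound_of_continuous cθ'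
    have i1 : Integrable (fun a : ℝ × Torus L₁ L₂ => η a.1 a.2 * (deriv θ a.1 * F a.2))
        ((volume.restrict (Ioo 0 T)).prod volume) := by
      refine (iη.bdd_mul (cθ'.comp continuous_fst).aestronglyMeasurable
        (Eventually.of_forall fun a => hA' a.1)).congr (Eventually.of_forall fun a => ?_)
      simp only [Function.comp_apply]
      ring
    have i2 : Integrable (fun a : ℝ × Torus L₁ L₂ => dη a.1 a.2 * (θ a.1 * F a.2))
        ((volume.restrict (Ioo 0 T)).prod volume) := by
      refine (id.bdd_mul (hθ.continuous.comp continuous_fst).aestronglyMeasurable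
        (Eventually.of_forall fun a => hA a.1)).congr (Eventually.of_forall fun a => ?_)
      simp only [Function.comp_apply]
      ring
    rw [integral_prod _ i1, integral_prod _ i2] at h1
    have e1 : ∀ s, (∫ p, F p * η s p) * deriv θ s = ∫ p, η s p * (deriv θ s * F p) := fun s => by
      rw [← integral_mul_const]
      congr 1; ext p; ring
    have e2 : ∀ s, (∫ p, F p * dη s p) * θ s = ∫ p, dη s p * (θ s * F p) := fun s => by
      rw [← integral_mul_const]
      congr 1; ext p; ring
    simp only [e1, e2]
    exact h1

end Cylinder

lemma frob_stress_nonneg {μ lam : ℝ} (hμ : 0 ≤ μ) (hlam : 0 ≤ lam) (A : Fin 3 → Fin 3 → ℝ) :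
    0 ≤ frob (stress μ lam A) A := by
  rw [frob_stress_eq_sym]; positivity

lemma integrable_frob_stress {α : Type*} [MeasurableSpace α] {ν : Measure α}
    {A : α → Fin 3 → Fin 3 → ℝ} (hA : ∀ i j, MemLp (fun a => A a i j) 2 ν) (μ lam : ℝ) :
    Integrable (fun a => frob (stress μ lam (A a)) (A a)) ν := by
  simp only [frob_stress_eq_sym]
  have s : ∀ i j k l, Integrable (fun a => (A a i j - A a k l) ^ 2) ν := fun i j k l =>
    MemLp.integrable_sq (f := fun a => A a i j - A a k l) ((hA i j).sub (hA k l))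
  have p : ∀ i j k l, Integrable (fun a => (A a i j + A a k l) ^ 2) ν := fun i j k l =>
    MemLp.integrable_sq (f := fun a => A a i j + A a k l) ((hA i j).add (hA k l))
  have t : Integrable (fun a => (∑ k, A a k k) ^ 2) ν :=
    MemLp.integrable_sq (f := fun a => ∑ k, A a k k) (memLp_finsetSum _ fun k _ => hA k k)
  exact ((((s _ _ _ _).add (s _ _ _ _)).add (s _ _ _ _)).const_mul _).add (t.const_mul _) |>.add
    ((((p _ _ _ _).add (p _ _ _ _)).add (p _ _ _ _)).const_mul _)

/-! ### Energy bounds independent of the strength of the force -/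

section Energy

variable {L₁ L₂ : ℝ} [Fact (0 < L₁)] [Fact (0 < L₂)]

/-- The bending energy does not depend on the choice of the weak derivatives. -/
lemma IsH2.integral_sq_laplacian_eq {h : Torus L₁ L₂ → ℝ} {Dh Dh' : Torus L₁ L₂ → Fin 2 → ℝ}
    {D2h D2h' : Torus L₁ L₂ → Fin 2 → Fin 2 → ℝ} (H : IsH2 h Dh D2h) (H' : IsH2 h Dh' D2h') :
    ∫ p, (∑ i, D2h p i i) ^ 2 = ∫ p, (∑ i, D2h' p i i) ^ 2 := by
  obtain ⟨-, m1, m2, w1, w2⟩ := H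
  obtain ⟨-, m1', m2', w1', w2'⟩ := H'
  have e1 : ∀ i, (fun p => Dh p i) =ᵐ[volume] fun p => Dh' p i := fun i =>
    (w1 i).ae_eq (w1' i) (m1 i) (m1' i)
  have e2 : ∀ i, (fun p => D2h p i i) =ᵐ[volume] fun p => D2h' p i i := fun i => by
    refine HasWeakPdT.ae_eq (fun ψ hψ => ?_) (w2' i i) (m2 i i) (m2' i i)
    rw [← w2 i i ψ hψ]
    refine integral_congr_ae ?_
    filter_upwards [e1 i] with p hp
    rw [hp]
  refine integral_congr_ae ?_
  filter_upwards [e2 0, e2 1] with p h0 h1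
  simp only [Fin.sum_univ_two, h0, h1]

/-- The regularity of a weak solution at almost every time. -/
structure IsRegularSlice (γ : ℝ) (h : Torus L₁ L₂ → ℝ) (Dh : Torus L₁ L₂ → Fin 2 → ℝ)
    (D2h : Torus L₁ L₂ → Fin 2 → Fin 2 → ℝ) (u : Space L₁ L₂ → Fin 3 → ℝ)
    (Du : Space L₁ L₂ → Fin 3 → Fin 3 → ℝ) (ρ : Space L₁ L₂ → ℝ) (w : Torus L₁ L₂ → ℝ) :
    Prop where
  isH2 : IsH2 h Dh D2h
  cont : Continuous h
  nonneg : ∀ p, 0 ≤ h p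
  pos : ∀ᵐ p, 0 < h p
  trace : ∀ i : Fin 3, HasLagrangianTrace h (fun q => u q i) (fun q => Du q i)
    (fun p => if i = 2 then w p else 0)
  memLp_u : ∀ i, MemLp (fun q => u q i) 2 (volume.restrict (dom h))
  memLp_Du : ∀ i j, MemLp (fun q => Du q i j) 2 (volume.restrict (dom h))
  meas_ρ : AEStronglyMeasurable ρ (volume.restrict (dom h))
  ρ_nonneg : ∀ᵐ q ∂volume.restrict (dom h), 0 ≤ ρ q
  integrable_pressure : IntegrableOn (fun q => ρ q ^ γ) (dom h)
  integrable_kinetic : IntegrableOn (fun q => ρ q * normSq (u q)) (dom h)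
  memLp_w : MemLp w 2

lemma normSq_nonneg (v : Fin 3 → ℝ) : 0 ≤ normSq v := Finset.sum_nonneg fun _ _ => sq_nonneg _

/-- A point with h < 0 would have a neighbourhood of positive measure on which h < 0. -/
lemma forall_nonneg_of_ae_pos {h : Torus L₁ L₂ → ℝ} (hc : Continuous h) (hp : ∀ᵐ p, 0 < h p)
    (p : Torus L₁ L₂) : 0 ≤ h p := by
  by_contra! hlt
  have := (isOpen_Iio.preimage hc).measure_pos (volume : Measure (Torus L₁ L₂)) ⟨p, hlt⟩
  refine this.ne' (measure_mono_null (fun q hq => ?_) (ae_iff.1 hp))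
  exact not_lt.2 (le_of_lt hq)

namespace IsRegularSlice

variable {γ : ℝ} {h : Torus L₁ L₂ → ℝ} {Dh : Torus L₁ L₂ → Fin 2 → ℝ}
  {D2h : Torus L₁ L₂ → Fin 2 → Fin 2 → ℝ} {u : Space L₁ L₂ → Fin 3 → ℝ}
  {Du : Space L₁ L₂ → Fin 3 → Fin 3 → ℝ} {ρ : Space L₁ L₂ → ℝ} {w : Torus L₁ L₂ → ℝ}

/-- Every energy and the dissipation D are nonnegative, so each of them alone is controlled by the
total. -/
lemma energy_le (R : IsRegularSlice γ h Dh D2h u Du ρ w) (hγ : 1 < γ) {D E : ℝ} (hD : 0 ≤ D)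
    (hle : (∫ q in dom h, (1 / 2 * ρ q * normSq (u q) + ρ q ^ γ / (γ - 1)))
      + (∫ p, (1 / 2 * w p ^ 2 + 1 / 2 * (∑ i, D2h p i i) ^ 2)) + D ≤ E) :
    ∫ q in dom h, ρ q * normSq (u q) ≤ 2 * E ∧ ∫ q in dom h, ρ q ^ γ ≤ (γ - 1) * E ∧
      ∫ p, w p ^ 2 ≤ 2 * E ∧ ∫ p, (∑ i, D2h p i i) ^ 2 ≤ 2 * E ∧ D ≤ E := by
  have g0 : 0 < γ - 1 := by linarith
  have i1 : IntegrableOn (fun q => 1 / 2 * ρ q * normSq (u q)) (dom h) :=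
    (R.integrable_kinetic.const_mul (1 / 2)).congr
      (Eventually.of_forall fun q => (mul_assoc _ _ _).symm)
  have i2 : Integrable fun p => (∑ i, D2h p i i) ^ 2 :=
    MemLp.integrable_sq (f := fun p => ∑ i, D2h p i i)
      (memLp_finsetSum _ fun i _ => R.isH2.2.2.1 i i)
  rw [integral_add i1 (R.integrable_pressure.div_const _),
    integral_add (R.memLp_w.integrable_sq.const_mul _) (i2.const_mul _), integral_div,
    integral_const_mul, integral_const_mul] at hle
  simp only [mul_assoc] at hle
  rw [integral_const_mul] at hle
  have n1 : 0 ≤ ∫ q in dom h, ρ q * normSq (u q) := integral_nonneg_of_ae <| by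
    filter_upwards [R.ρ_nonneg] with q hq
    exact mul_nonneg hq (normSq_nonneg _)
  have n2 : 0 ≤ ∫ q in dom h, ρ q ^ γ := integral_nonneg_of_ae <| by
    filter_upwards [R.ρ_nonneg] with q hq
    exact Real.rpow_nonneg hq _
  have n2' := div_nonneg n2 g0.le
  have n3 : 0 ≤ ∫ p, w p ^ 2 := integral_nonneg fun _ => sq_nonneg _
  have n4 : 0 ≤ ∫ p, (∑ i, D2h p i i) ^ 2 := integral_nonneg fun _ => sq_nonneg _
  refine ⟨by linarith, ?_, by linarith, by linarith, by linarith⟩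
  rw [← div_le_iff₀' g0]
  linarith

/-- The zero of h at p₀ is what bounds its height: the bending energy alone does not see constants.
-/
lemma isPlateSlice (R : IsRegularSlice γ h Dh D2h u Du ρ w) (hγ : 1 < γ) {p₀ : Torus L₁ L₂}
    (h0 : h p₀ = 0) {M S₀ R₀ W₀ : ℝ} (hM : 2 * √(max L₁ L₂ * (holderConst L₁ L₂ * S₀)) ≤ M)
    (hS : ∫ p, (∑ i, D2h p i i) ^ 2 ≤ S₀) (hR : ∫ q in dom h, ρ q ^ γ ≤ R₀)
    (hW : ∫ p, w p ^ 2 ≤ W₀) : IsPlateSlice γ M S₀ R₀ W₀ h Dh D2h u Du ρ w where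
  isH2 := R.isH2
  cont := R.cont
  nonneg := R.nonneg
  pos := R.pos
  le p := by
    have hL₁ : 0 < L₁ := Fact.out
    have hH := holderConst_pos (L₁ := L₁) (L₂ := L₂)
    refine (R.isH2.le_add_sqrt_max R.cont R.nonneg p₀ p).trans (le_trans ?_ hM)
    rw [h0, zero_add]
    have : 0 ≤ max L₁ L₂ := hL₁.le.trans (le_max_left _ _)
    gcongr
  bending := hS
  trace := R.trace
  memLp_u := R.memLp_u
  memLp_Du := R.memLp_Du
  meas_ρ := R.meas_ρ
  ρ_nonneg := R.ρ_nonneg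
  pressure := by
    refine le_trans (le_of_eq ?_) (ENNReal.ofReal_le_ofReal hR)
    rw [ofReal_integral_eq_lintegral_ofReal R.integrable_pressure]
    · refine lintegral_congr_ae ?_
      filter_upwards [R.ρ_nonneg] with q hq
      rw [← ofReal_norm, Real.norm_of_nonneg hq, ENNReal.ofReal_rpow_of_nonneg hq (by linarith)]
    · filter_upwards [R.ρ_nonneg] with q hq
      exact Real.rpow_nonneg hq _
  meas_w := R.memLp_w.aestronglyMeasurable
  kinetic := by
    refine le_trans (le_of_eq ?_) (ENNReal.ofReal_le_ofReal hW)
    rw [ofReal_integral_eq_lintegral_ofReal R.memLp_w.integrable_sq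
      (Eventually.of_forall fun _ => sq_nonneg _)]
    simp only [enorm_sq_eq]

/-- The work of a force concentrated near a point of contact. -/
lemma integral_force_le (R : IsRegularSlice γ h Dh D2h u Du ρ w) {p₀ : Torus L₁ L₂}
    (h0 : h p₀ = 0) {F : Torus L₁ L₂ → ℝ} (hF : Continuous F) (F0 : ∀ p, 0 ≤ F p) {ε : ℝ}
    (hε₁ : ε ≤ L₁) (hε₂ : ε ≤ L₂)
    (hs : ∀ p, F p ≠ 0 → ∃ a : ℝ × ℝ, |a.1| < ε ∧ |a.2| < ε ∧ p = p₀ + projT a) :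
    ∫ p, F p * h p ≤
      (∫ p, F p) * (2 * √(ε * (holderConst L₁ L₂ * ∫ p, (∑ i, D2h p i i) ^ 2))) := by
  rw [← integral_mul_const]
  refine integral_mono (Torus.integrable (hF.mul R.cont)) ((Torus.integrable hF).mul_const _)
    fun p => ?_
  by_cases hp : F p = 0
  · simp [hp]
  · obtain ⟨a, h1, h2, rfl⟩ := hs p hp
    have := R.isH2.le_add_sqrt R.cont R.nonneg p₀ h1.le h2.le (h1.le.trans hε₁) (h2.le.trans hε₂)
    rw [h0, zero_add] at this
    exact mul_le_mul_of_nonneg_left this (F0 _)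

end IsRegularSlice

/-- The energy of the initial data. -/
noncomputable def initialEnergy (γ : ℝ) (d : InitialData L₁ L₂)
    (D2η₀ : Torus L₁ L₂ → Fin 2 → Fin 2 → ℝ) : ℝ :=
  (∫ q in dom d.η₀, (1 / (2 * d.ρ₀ q) * normSq (d.q₀ q) + d.ρ₀ q ^ γ / (γ - 1)))
    + (∫ p, (1 / 2 * d.v₀ p ^ 2 + 1 / 2 * (∑ i, D2η₀ p i i) ^ 2))

/-- A weak solution carries its own weak derivatives of η₀, but the force has to be fixed before the
solution. The energy bound must therefore not depend on the representatives. -/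
lemma initialEnergy_congr {γ : ℝ} {d : InitialData L₁ L₂} (hv : MemLp d.v₀ 2)
    {Dh Dh' : Torus L₁ L₂ → Fin 2 → ℝ} {D2h D2h' : Torus L₁ L₂ → Fin 2 → Fin 2 → ℝ}
    (H : IsH2 d.η₀ Dh D2h) (H' : IsH2 d.η₀ Dh' D2h') :
    initialEnergy γ d D2h = initialEnergy γ d D2h' := by
  have i2 : ∀ {Dh D2h}, IsH2 d.η₀ Dh D2h → Integrable fun p => (∑ i, D2h p i i) ^ 2 := fun {_ D2h} H =>
    MemLp.integrable_sq (f := fun p => ∑ i, D2h p i i) (memLp_finsetSum _ fun i _ => H.2.2.1 i i)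
  rw [initialEnergy, initialEnergy, integral_add (hv.integrable_sq.const_mul _)
    ((i2 H).const_mul _), integral_add (hv.integrable_sq.const_mul _) ((i2 H').const_mul _),
    integral_const_mul _ fun p => (∑ i, D2h p i i) ^ 2,
    integral_const_mul _ fun p => (∑ i, D2h' p i i) ^ 2, H.integral_sq_laplacian_eq H']

namespace IsWeakSolutionWith

variable {γ μ lam T : ℝ} {d : InitialData L₁ L₂} {F : ℝ → Torus L₁ L₂ → ℝ}
    {ρ : ℝ → Space L₁ L₂ → ℝ} {u : ℝ → Space L₁ L₂ → Fin 3 → ℝ} {η : ℝ → Torus L₁ L₂ → ℝ}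
    {Du : ℝ → Space L₁ L₂ → Fin 3 → Fin 3 → ℝ} {dη : ℝ → Torus L₁ L₂ → ℝ}
    {Dη : ℝ → Torus L₁ L₂ → Fin 2 → ℝ} {D2η : ℝ → Torus L₁ L₂ → Fin 2 → Fin 2 → ℝ}
    {Dη₀ : Torus L₁ L₂ → Fin 2 → ℝ} {D2η₀ : Torus L₁ L₂ → Fin 2 → Fin 2 → ℝ}

lemma ae_isRegularSlice (S : IsWeakSolutionWith γ μ lam T d F ρ u η Du dη Dη D2η Dη₀ D2η₀)
    (hγ : 0 < γ) :
    ∀ᵐ t ∂volume.restrict (Ioo 0 T),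
      IsRegularSlice γ (η t) (Dη t) (D2η t) (u t) (Du t) (ρ t) (dη t) := by
  have hη := S.η_continuous
  obtain ⟨mρ, Cρ, hρ⟩ := S.ρ_Lγ
  obtain ⟨mk, Ck, hk⟩ := S.kinetic
  have a1 := eventually_all.2 fun i => ae_memLp_dom hη le_rfl (S.u_L2 i)
  have a2 := eventually_all.2 fun i => eventually_all.2 fun j =>
    ae_memLp_dom hη le_rfl (S.Du_L2 i j)
  filter_upwards [S.η_H2, S.coupling, a1, a2, ae_aestronglyMeasurable_dom hη le_rfl mρ,
    ae_aestronglyMeasurable_dom hη le_rfl mk, hρ, hk, ae_ae_dom_of_ae_cyl hη le_rfl S.ρ_nonneg,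
    S.dη_L2.ae_memLp, ae_restrict_mem measurableSet_Ioo]
    with t h1 h2 h3 h4 h5 h6 h7 h8 h9 h10 ht
  have ht' := Ioo_subset_Icc_self ht
  have c := continuous_of_continuousOn_time hη ht'
  have p := S.η_pos t ht'
  refine ⟨h1, c, forall_nonneg_of_ae_pos c p, p, h2, h3, h4, h5, h9, ?_, ?_, h10⟩
  · have m : MemLp (ρ t) (ENNReal.ofReal γ) (volume.restrict (dom (η t))) :=
      ⟨h5, h7.trans_lt ENNReal.coe_lt_top⟩
    refine (m.integrable_norm_rpow (by simpa using hγ) ENNReal.ofReal_ne_top).congr ?_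
    filter_upwards [h9] with q hq
    rw [ENNReal.toReal_ofReal hγ.le, Real.norm_of_nonneg hq]
  · exact memLp_one_iff_integrable.1 ⟨h6, h8.trans_lt ENNReal.coe_lt_top⟩

section

variable {F : Torus L₁ L₂ → ℝ} {p₀ : Torus L₁ L₂} {ε : ℝ}

/-- Energy bounds which do not depend on the strength of a concentrated force, as long as the plate
touches the bottom at the point of concentration. -/
lemma ae_isPlateSlice
    (S : IsWeakSolutionWith γ μ lam T d (fun _ => F) ρ u η Du dη Dη D2η Dη₀ D2η₀)
    (hγ : 1 < γ) (hμ : 0 ≤ μ) (hlam : 0 ≤ lam) (hT : 0 < T) (hF : IsCkT ∞ F) (F0 : ∀ p, 0 ≤ F p)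
    (hε : 0 ≤ ε) (hε₁ : ε ≤ L₁) (hε₂ : ε ≤ L₂)
    (hs : ∀ p, F p ≠ 0 → ∃ a : ℝ × ℝ, |a.1| < ε ∧ |a.2| < ε ∧ p = p₀ + projT a)
    (hK : 4 * (∫ p, F p) ^ 2 * (ε * holderConst L₁ L₂) ≤ 1)
    (h0 : ∀ t ∈ Ioo 0 T, η t p₀ = 0) {E : ℝ} (hE : E = 2 * (initialEnergy γ d D2η₀ + 1)) :
    ∀ᵐ t ∂volume.restrict (Ioo 0 T),
      IsPlateSlice γ (2 * √(max L₁ L₂ * (holderConst L₁ L₂ * (2 * E)))) (2 * E) ((γ - 1) * E) (2 * E)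
        (η t) (Dη t) (D2η t) (u t) (Du t) (ρ t) (dη t) ∧
      ∫ q in dom (η t), ρ t q * normSq (u t q) ≤ 2 * E ∧
      ∫ q in dom (η t), ρ t q ^ γ ≤ (γ - 1) * E ∧ ∫ p, dη t p ^ 2 ≤ 2 * E ∧
      ∫ a in cyl t η, frob (stress μ lam (Du a.1 a.2)) (Du a.1 a.2) ≤ E := by
  filter_upwards [S.energy, S.ae_isRegularSlice (by linarith), ae_restrict_mem measurableSet_Ioo]
    with t he R ht
  have work := integral_force_mul_velocity S.η_continuous S.η_L2 S.dη_L2 S.dη_weak hF ht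
  -- The initial term of the work enters with a minus sign and is dropped.
  have n0 : 0 ≤ ∫ p, F p * η 0 p := integral_nonneg fun p => mul_nonneg (F0 p)
    (forall_nonneg_of_ae_pos (continuous_of_continuousOn_time S.η_continuous ⟨le_rfl, hT.le⟩)
      (S.η_pos 0 ⟨le_rfl, hT.le⟩) p)
  have D0 : 0 ≤ ∫ a in cyl t η, frob (stress μ lam (Du a.1 a.2)) (Du a.1 a.2) :=
    integral_nonneg fun a => frob_stress_nonneg hμ hlam _
  have he' : (∫ q in dom (η t), (1 / 2 * ρ t q * normSq (u t q) + ρ t q ^ γ / (γ - 1)))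
      + (∫ p, (1 / 2 * dη t p ^ 2 + 1 / 2 * (∑ i, D2η t p i i) ^ 2))
      + (∫ a in cyl t η, frob (stress μ lam (Du a.1 a.2)) (Du a.1 a.2)) ≤
      initialEnergy γ d D2η₀ + ∫ p, F p * η t p := by
    refine he.trans ?_
    rw [work, initialEnergy]
    linarith
  -- A first use of the energy inequality, with the work still on the right side, to bound the
  -- bending energy X by 2 (E₀ + ∫ F η(t)), where E₀ is the initial energy.
  obtain ⟨-, -, -, b, -⟩ := R.energy_le hγ D0 he'
  have wk := R.integral_force_le (h0 t ht) hF.continuous F0 hε₁ hε₂ hs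
  set X := ∫ p, (∑ i, D2η t p i i) ^ 2
  set K := ∫ p, F p
  have X0 : 0 ≤ X := integral_nonneg fun _ => sq_nonneg _
  have H0 := holderConst_pos (L₁ := L₁) (L₂ := L₂)
  -- Young's inequality with 4 K² ε · `holderConst` ≤ 1. Together with the bound of X this gives ∫ F
  -- η(t) ≤ (E₀ + ∫ F η(t))/2 + 1, so the total energy is at most 2 (E₀ + 1) = E, and K has
  -- disappeared.
  have am : K * (2 * √(ε * (holderConst L₁ L₂ * X))) ≤ X / 4 + 1 := by
    rw [← mul_assoc ε, Real.sqrt_mul' _ X0]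
    have h1 := Real.sq_sqrt (show 0 ≤ ε * holderConst L₁ L₂ by positivity)
    have h2 := Real.sq_sqrt X0
    have h3 := sq_nonneg (√X / 2 - 2 * K * √(ε * holderConst L₁ L₂))
    have e : (√X / 2 - 2 * K * √(ε * holderConst L₁ L₂)) ^ 2 = √X ^ 2 / 4 +
      4 * K ^ 2 * √(ε * holderConst L₁ L₂) ^ 2 - K * (2 * (√(ε * holderConst L₁ L₂) * √X)) := by
      ring
    rw [e, h1, h2] at h3
    linarith
  obtain ⟨b1, b2, b3, b4, b5⟩ := R.energy_le hγ D0 (he'.trans (show _ ≤ E by linarith))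
  exact ⟨R.isPlateSlice hγ (h0 t ht) le_rfl b4 b2 b3, b1, b2, b3, b5⟩

end

/-- Korn's inequality at almost every time, integrated in time; it converts the dissipation bound
into a bound of the full gradient. -/
lemma lintegral_dirichlet_le (S : IsWeakSolutionWith γ μ lam T d F ρ u η Du dη Dη D2η Dη₀ D2η₀)
    (hγ : 0 < γ) (hμ : 0 < μ) (hlam : 0 ≤ lam) {t E : ℝ} (ht : t ≤ T)
    (hE : ∫ a in cyl t η, frob (stress μ lam (Du a.1 a.2)) (Du a.1 a.2) ≤ E) :
    ∫⁻ s in Ioo 0 t, dirichlet (η s) (Du s) ≤ ENNReal.ofReal (E / μ) := by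
  have sub : cyl t η ⊆ cyl T η := fun a ha => ⟨⟨ha.1.1, ha.1.2.trans_le ht⟩, ha.2⟩
  obtain ⟨i, e⟩ := integral_cyl S.η_continuous ht (f := fun a : ℝ × Space L₁ L₂ =>
    frob (stress μ lam (Du a.1 a.2)) (Du a.1 a.2)) (integrable_frob_stress (fun i j =>
      (S.Du_L2 i j).mono_measure (Measure.restrict_mono sub le_rfl)) μ lam)
  have b : ∀ᵐ s ∂volume.restrict (Ioo 0 t), dirichlet (η s) (Du s) ≤ ENNReal.ofReal
      ((∫ q in dom (η s), frob (stress μ lam (Du s q)) (Du s q)) / μ) := by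
    filter_upwards [ae_restrict_of_ae_restrict_of_subset (Ioo_subset_Ioo_right ht)
      (S.ae_isRegularSlice hγ)] with s R
    have k := korn R.isH2 R.cont R.nonneg R.trace R.memLp_u R.memLp_Du hμ hlam
    refine le_trans (le_of_eq ?_) (ENNReal.ofReal_le_ofReal ((le_div_iff₀' hμ).2 k))
    rw [ofReal_integral_eq_lintegral_ofReal (integrable_finsetSum _ fun i _ =>
      integrable_finsetSum _ fun j _ => (R.memLp_Du i j).integrable_sq)
      (Eventually.of_forall fun q => Finset.sum_nonneg fun _ _ => Finset.sum_nonneg fun _ _ =>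
        sq_nonneg _), dirichlet]
    refine lintegral_congr fun q => ?_
    rw [ENNReal.ofReal_sum_of_nonneg fun _ _ => Finset.sum_nonneg fun _ _ => sq_nonneg _]
    refine Finset.sum_congr rfl fun i _ => ?_
    rw [ENNReal.ofReal_sum_of_nonneg fun _ _ => sq_nonneg _]
    simp only [enorm_sq_eq]
  refine (lintegral_mono_ae b).trans ?_
  rw [← ofReal_integral_eq_lintegral_ofReal (i.div_const μ) (Eventually.of_forall fun s =>
    div_nonneg (integral_nonneg fun q => frob_stress_nonneg hμ.le hlam _) hμ.le), integral_div, ← e]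
  exact ENNReal.ofReal_le_ofReal (by gcongr)

end IsWeakSolutionWith

end Energy

/-! ### The contact inequality bounds the strength of the force -/

section Contact

variable {L₁ L₂ : ℝ} [Fact (0 < L₁)] [Fact (0 < L₂)] {T : ℝ} {η : ℝ → Torus L₁ L₂ → ℝ}

section

variable (hη : ContinuousOn (Function.uncurry η) (Icc 0 T ×ˢ univ)) {t : ℝ} (ht : t ≤ T)
include hη ht

lemma aemeasurable_lintegral_dom {f : ℝ × Space L₁ L₂ → ENNReal}
    (hf : AEMeasurable f (volume.restrict (cyl t η))) :
    AEMeasurable (fun s => ∫⁻ q in dom (η s), f (s, q)) (volume.restrict (Ioo 0 t)) := by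
  have m := measurableSet_cyl hη ht
  have h1 := AEMeasurable.lintegral_prod_right' (μ := (volume : Measure ℝ))
    (ν := (volume : Measure (Space L₁ L₂))) ((aemeasurable_indicator_iff m).2 hf)
  refine h1.restrict.congr ?_
  filter_upwards [ae_restrict_mem measurableSet_Ioo] with s hs
  simp only [indicator_cyl, indicator_of_mem hs]
  exact lintegral_indicator (measurableSet_dom_time hη ht hs) _

lemma lintegral_enorm_dom {g : ℝ × Space L₁ L₂ → ℝ} (hg : IntegrableOn g (cyl t η))
    (g0 : ∀ᵐ a ∂volume.restrict (cyl t η), 0 ≤ g a) :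
    ∫⁻ s in Ioo 0 t, ∫⁻ q in dom (η s), ‖g (s, q)‖ₑ = ENNReal.ofReal (∫ a in cyl t η, g a) := by
  rw [← lintegral_cyl hη ht hg.aestronglyMeasurable.enorm, ofReal_integral_eq_lintegral_ofReal hg g0]
  refine lintegral_congr_ae ?_
  filter_upwards [g0] with a ha
  rw [← ofReal_norm, Real.norm_of_nonneg ha]

/-- Integration in time of a bound on a flux. -/
lemma abs_integral_cyl_le {f g k : ℝ × Space L₁ L₂ → ℝ} (hg : IntegrableOn g (cyl t η))
    (g0 : ∀ᵐ a ∂volume.restrict (cyl t η), 0 ≤ g a) (hk : IntegrableOn k (cyl t η))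
    (k0 : ∀ᵐ a ∂volume.restrict (cyl t η), 0 ≤ k a) {D : ℝ → ENNReal} {C δ : ENNReal} {α β : ℝ}
    (hα : 0 ≤ α) (hβ : 0 ≤ β) (hD : ∫⁻ s in Ioo 0 t, D s ≤ δ)
    (hC : C * (ENNReal.ofReal T + δ) ≠ ⊤)
    (hb : ∀ᵐ s ∂volume.restrict (Ioo 0 t), ∫⁻ q in dom (η s), ‖f (s, q)‖ₑ ≤
      ENNReal.ofReal α * (∫⁻ q in dom (η s), ‖g (s, q)‖ₑ) +
        ENNReal.ofReal β * (∫⁻ q in dom (η s), ‖k (s, q)‖ₑ) + C * (1 + D s)) :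
    |∫ a in cyl t η, f a| ≤ α * (∫ a in cyl t η, g a) + β * (∫ a in cyl t η, k a) +
      (C * (ENNReal.ofReal T + δ)).toReal := by
  have mg := (aemeasurable_lintegral_dom hη ht hg.aestronglyMeasurable.enorm).const_mul
    (ENNReal.ofReal α)
  have mk := (aemeasurable_lintegral_dom hη ht hk.aestronglyMeasurable.enorm).const_mul
    (ENNReal.ofReal β)
  have mgk : AEMeasurable (fun s => ENNReal.ofReal α * (∫⁻ q in dom (η s), ‖g (s, q)‖ₑ) +
        ENNReal.ofReal β * (∫⁻ q in dom (η s), ‖k (s, q)‖ₑ)) (volume.restrict (Ioo 0 t)) :=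
    mg.add mk
  have n1 : 0 ≤ ∫ a in cyl t η, g a := integral_nonneg_of_ae g0
  have n2 : 0 ≤ ∫ a in cyl t η, k a := integral_nonneg_of_ae k0
  have key : ‖∫ a in cyl t η, f a‖ₑ ≤ ENNReal.ofReal (α * (∫ a in cyl t η, g a) +
      β * (∫ a in cyl t η, k a) + (C * (ENNReal.ofReal T + δ)).toReal) := by
    calc _ ≤ ∫⁻ s in Ioo 0 t, ∫⁻ q in dom (η s), ‖f (s, q)‖ₑ :=
          (enorm_integral_le_lintegral_enorm _).trans (lintegral_cyl_le hη ht _)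
      _ ≤ _ := lintegral_mono_ae hb
      _ ≤ ENNReal.ofReal (α * (∫ a in cyl t η, g a)) + ENNReal.ofReal (β * (∫ a in cyl t η, k a)) +
          C * (ENNReal.ofReal T + δ) := by
        rw [lintegral_add_left' mgk, lintegral_add_left' mg,
          lintegral_const_mul' _ _ ENNReal.ofReal_ne_top,
          lintegral_const_mul' _ _ ENNReal.ofReal_ne_top, lintegral_enorm_dom hη ht hg g0,
          lintegral_enorm_dom hη ht hk k0, ENNReal.ofReal_mul hα, ENNReal.ofReal_mul hβ]
        refine add_le_add le_rfl ?_
        -- An infinite C is compatible with the finite product only if T ≤ 0, and then the time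
        -- interval is empty.
        rcases eq_or_ne C ⊤ with rfl | hC'
        · rcases eq_or_ne (ENNReal.ofReal T + δ) 0 with h0 | h0
          · have hT : T ≤ 0 := ENNReal.ofReal_eq_zero.1 (add_eq_zero.1 h0).1
            rw [Ioo_eq_empty (by linarith)]
            simp
          · exact absurd (ENNReal.top_mul h0) hC
        · rw [lintegral_const_mul' _ _ hC', lintegral_add_left measurable_const, lintegral_one,
            Measure.restrict_apply_univ, Real.volume_Ioo, sub_zero]
          gcongr
      _ = _ := by
        have m1 := mul_nonneg hα n1
        have m2 := mul_nonneg hβ n2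
        rw [ENNReal.ofReal_add (by positivity) ENNReal.toReal_nonneg, ENNReal.ofReal_add m1 m2,
          ENNReal.ofReal_toReal hC]
  rw [← ofReal_norm, Real.norm_eq_abs] at key
  refine (ENNReal.ofReal_le_ofReal_iff ?_).1 key
  have := mul_nonneg hα n1
  have := mul_nonneg hβ n2
  have : 0 ≤ (C * (ENNReal.ofReal T + δ)).toReal := ENNReal.toReal_nonneg
  positivity

end

lemma volume_dom_le {h : Torus L₁ L₂ → ℝ} (hc : Continuous h) {M : ℝ} (hM : ∀ p, h p ≤ M) :
    volume (dom h) ≤ ENNReal.ofReal M * volume (univ : Set (Torus L₁ L₂)) := by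
  have := lintegral_dom_fst hc (f := fun _ => 1) aemeasurable_const
  simp only [one_mul, lintegral_one, Measure.restrict_apply_univ] at this
  rw [this]
  refine (lintegral_mono fun p => ENNReal.ofReal_le_ofReal (hM p)).trans_eq ?_
  rw [lintegral_const]

namespace IsRegularSlice

variable {γ : ℝ} {h : Torus L₁ L₂ → ℝ} {Dh : Torus L₁ L₂ → Fin 2 → ℝ}
  {D2h : Torus L₁ L₂ → Fin 2 → Fin 2 → ℝ} {u : Space L₁ L₂ → Fin 3 → ℝ}
  {Du : Space L₁ L₂ → Fin 3 → Fin 3 → ℝ} {ρ : Space L₁ L₂ → ℝ} {w : Torus L₁ L₂ → ℝ}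

/-- As 0 < z/h < 1, the integrand is at most ρ|u₃| ≤ ρ (1 + |u|²) ≤ 1 + ρ^γ + ρ|u|². -/
lemma integral_momentum_le (R : IsRegularSlice γ h Dh D2h u Du ρ w) (hγ : 1 ≤ γ) {M : ℝ}
    (hM : ∀ p, h p ≤ M) :
    ∫ q in dom h, ρ q * u q 2 * (q.2 / h q.1) ≤
      M * (volume : Measure (Torus L₁ L₂)).real univ + (∫ q in dom h, ρ q ^ γ) +
        ∫ q in dom h, ρ q * normSq (u q) := by
  have M0 : 0 ≤ M := (R.nonneg 0).trans (hM 0)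
  have v := volume_dom_le R.cont hM
  have vt : ENNReal.ofReal M * volume (univ : Set (Torus L₁ L₂)) ≠ ⊤ :=
    ENNReal.mul_ne_top ENNReal.ofReal_ne_top (measure_ne_top _ _)
  have i0 : IntegrableOn (fun _ : Space L₁ L₂ => (1 : ℝ)) (dom h) :=
    integrableOn_const (ne_top_of_le_ne_top vt v)
  have e0 : ∫ q in dom h, (1 : ℝ) ≤ M * (volume : Measure (Torus L₁ L₂)).real univ := by
    rw [setIntegral_const, smul_eq_mul, mul_one]
    refine (ENNReal.toReal_mono vt v).trans_eq ?_
    rw [ENNReal.toReal_mul, ENNReal.toReal_ofReal M0]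
    rfl
  have i1 : IntegrableOn (fun q => 1 + ρ q ^ γ) (dom h) := i0.add R.integrable_pressure
  have i2 : IntegrableOn (fun q => 1 + ρ q ^ γ + ρ q * normSq (u q)) (dom h) :=
    i1.add R.integrable_kinetic
  have e2 : ∫ q in dom h, (1 + ρ q ^ γ + ρ q * normSq (u q)) = (∫ q in dom h, (1 : ℝ)) +
      (∫ q in dom h, ρ q ^ γ) + ∫ q in dom h, ρ q * normSq (u q) := by
    rw [integral_add i1 R.integrable_kinetic, integral_add i0 R.integrable_pressure]
  have b : ∀ᵐ q ∂volume.restrict (dom h), ‖ρ q * u q 2 * (q.2 / h q.1)‖ ≤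
      1 + ρ q ^ γ + ρ q * normSq (u q) := by
    filter_upwards [R.ρ_nonneg, ae_restrict_mem (measurableSet_dom R.cont)] with q hρ hq
    have hh : 0 < h q.1 := hq.1.trans hq.2
    have h1 : |q.2 / h q.1| ≤ 1 := by
      rw [abs_of_nonneg (div_nonneg hq.1.le hh.le), div_le_one hh]
      exact hq.2.le
    have h2 : u q 2 ^ 2 ≤ normSq (u q) :=
      Finset.single_le_sum (f := fun i => u q i ^ 2) (fun _ _ => sq_nonneg _) (Finset.mem_univ 2)
    have h3 : |u q 2| ≤ 1 + normSq (u q) := by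
      rw [← sq_abs] at h2
      nlinarith [sq_nonneg (|u q 2| - 1)]
    have h4 : ρ q ≤ 1 + ρ q ^ γ := by
      rcases le_total (ρ q) 1 with h5 | h5
      · exact h5.trans (le_add_of_nonneg_right (Real.rpow_nonneg hρ _))
      · exact (Real.self_le_rpow_of_one_le h5 hγ).trans (le_add_of_nonneg_left zero_le_one)
    rw [Real.norm_eq_abs, abs_mul, abs_mul, abs_of_nonneg hρ]
    calc ρ q * |u q 2| * |q.2 / h q.1| ≤ ρ q * (1 + normSq (u q)) * 1 := by
          have : 0 ≤ 1 + normSq (u q) := (abs_nonneg _).trans h3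
          gcongr
      _ ≤ _ := by linarith
  exact (le_abs_self _).trans ((norm_integral_le_of_norm_le i2 b).trans (e2.trans_le (by linarith)))

lemma integral_velocity_le (R : IsRegularSlice γ h Dh D2h u Du ρ w) :
    ∫ p, w p ≤ (volume : Measure (Torus L₁ L₂)).real univ + ∫ p, w p ^ 2 := by
  have e : ∫ p, (1 + w p ^ 2) = (volume : Measure (Torus L₁ L₂)).real univ + ∫ p, w p ^ 2 := by
    rw [integral_add (integrable_const _) R.memLp_w.integrable_sq]
    simp
  rw [← e]
  refine integral_mono (R.memLp_w.integrable one_le_two)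
    ((integrable_const _).add R.memLp_w.integrable_sq) fun p => ?_
  show w p ≤ 1 + w p ^ 2
  nlinarith [sq_nonneg (w p - 1)]

end IsRegularSlice

/-- The strength of a concentrated force is bounded as long as the plate touches the bottom at the
point of concentration. -/
lemma exists_force_bound (L₁ L₂ : ℝ) [Fact (0 < L₁)] [Fact (0 < L₂)] {γ μ lam : ℝ} (hγ : 3 < γ)
    (hμ : 0 < μ) (hlam : 0 ≤ lam) {T : ℝ} (hT : 0 < T) (d : InitialData L₁ L₂) (E : ℝ) :
    ∃ B : ℝ, ∀ {p₀ : Torus L₁ L₂} {F : Torus L₁ L₂ → ℝ} {ε : ℝ} {ρ u η Du dη Dη D2η Dη₀ D2η₀},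
      IsWeakSolutionWith γ μ lam T d (fun _ => F) ρ u η Du dη Dη D2η Dη₀ D2η₀ →
      E = 2 * (initialEnergy γ d D2η₀ + 1) → IsCkT ∞ F → (∀ p, 0 ≤ F p) →
      0 ≤ ε → ε ≤ L₁ → ε ≤ L₂ →
      (∀ p, F p ≠ 0 → ∃ a : ℝ × ℝ, |a.1| < ε ∧ |a.2| < ε ∧ p = p₀ + projT a) →
      4 * (∫ p, F p) ^ 2 * (ε * holderConst L₁ L₂) ≤ 1 →
      (∀ t ∈ Ioo 0 T, η t p₀ = 0) → ∫ p, F p ≤ B := by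
  set M := 2 * √(max L₁ L₂ * (holderConst L₁ L₂ * (2 * E)))
  set V := (volume : Measure (Torus L₁ L₂)).real univ
  obtain ⟨C, hC, HC⟩ := exists_lintegral_fluxes_le L₁ L₂ hγ M (2 * E) ((γ - 1) * E) (2 * E)
  set δ := ENNReal.ofReal (E / μ)
  have hCδ : C * (ENNReal.ofReal T + δ) ≠ ⊤ :=
    ENNReal.mul_ne_top hC (ENNReal.add_ne_top.2 ⟨ENNReal.ofReal_ne_top, ENNReal.ofReal_ne_top⟩)
  set C' := (C * (ENNReal.ofReal T + δ)).toReal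
  set c := 4 * μ / 3 + lam
  have c0 : 0 ≤ c := by positivity
  -- The coefficient of C' counts three inertial fluxes, two viscous ones with factor μ and the
  -- divergence flux. The other terms are the bound of ∫ log η(t), the initial logarithm, and the
  -- momentum and plate velocity at times t and 0.
  set A := (3 + 2 * μ + |lam - 2 * μ / 3|) * C' + c * (M * V) - c * (∫ p, Real.log (d.η₀ p)) +
    (M * V + (γ - 1) * E + 2 * E) - (∫ q in dom d.η₀, d.q₀ q 2 * (q.2 / d.η₀ q.1)) +
    (V + 2 * E) - ∫ p, d.v₀ p
  refine ⟨A * (2 / T) ⊔ 0, fun {p₀ F ε ρ u η Du dη Dη D2η Dη₀ D2η₀} S hE hF F0 hε hε₁ hε₂ hs hK h0 =>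
    ?_⟩
  have slices := S.ae_isPlateSlice (by linarith) hμ.le hlam hT hF F0 hε hε₁ hε₂ hs hK h0 hE
  -- All inequalities hold for almost every time, so there is a common admissible time beyond T/2.
  -- There the impulse is at least (T/2) ∫ F.
  have nb : NeBot (ae (volume.restrict (Ioo (T / 2) T))) := by
    rw [ae_neBot, Ne, Measure.restrict_eq_zero, Real.volume_Ioo]
    simpa using hT
  have sub : Ioo (T / 2) T ⊆ Ioo 0 T := Ioo_subset_Ioo_left (by linarith)
  obtain ⟨t, ⟨⟨⟨ct, P, kin, Rp, Rw, fr⟩, R⟩, ht⟩⟩ := ((ae_restrict_of_ae_restrict_of_subset sub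
    ((S.contact.and slices).and (S.ae_isRegularSlice (by linarith)))).and
    (ae_restrict_mem measurableSet_Ioo)).exists
  have ht0 : 0 < t := by linarith [ht.1]
  have htT : t ≤ T := ht.2.le
  have hη := S.η_continuous
  have sl : ∀ᵐ s ∂volume.restrict (Ioo 0 t), IsPlateSlice γ M (2 * E) ((γ - 1) * E) (2 * E)
      (η s) (Dη s) (D2η s) (u s) (Du s) (ρ s) (dη s) :=
    (ae_restrict_of_ae_restrict_of_subset (Ioo_subset_Ioo_right htT) slices).mono fun s h => h.1
  have hD := S.lintegral_dirichlet_le (by linarith) hμ hlam htT fr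
  have subc : cyl t η ⊆ cyl T η := fun a ha => ⟨⟨ha.1.1, ha.1.2.trans_le htT⟩, ha.2⟩
  have ip := S.pressure_over_η.mono_set subc
  have ik := S.kinetic_over_η.mono_set subc
  have ρ0 := ae_restrict_of_ae_restrict_of_subset subc S.ρ_nonneg
  have mc := measurableSet_cyl hη htT
  have p0 : ∀ᵐ a ∂volume.restrict (cyl t η), 0 ≤ ρ a.1 a.2 ^ γ / η a.1 a.2.1 := by
    filter_upwards [ρ0, ae_restrict_mem mc] with a h1 h2
    exact div_nonneg (Real.rpow_nonneg h1 _) (h2.2.1.trans h2.2.2).le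
  have k0 : ∀ᵐ a ∂volume.restrict (cyl t η), 0 ≤ ρ a.1 a.2 * u a.1 a.2 2 ^ 2 / η a.1 a.2.1 := by
    filter_upwards [ρ0, ae_restrict_mem mc] with a h1 h2
    exact div_nonneg (mul_nonneg h1 (sq_nonneg _)) (h2.2.1.trans h2.2.2).le
  have f1 := abs_integral_cyl_le hη htT (f := fun a =>
    ρ a.1 a.2 * u a.1 a.2 2 * a.2.2 * dη a.1 a.2.1 / η a.1 a.2.1 ^ 2) ik k0 ip p0
    (α := 1 / 4) (β := 1 / 3) (by norm_num) (by norm_num) (δ := δ) hD hCδ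
    (sl.mono fun s P => (HC P).1)
  have f2 : ∀ (i : Fin 3) (j : Fin 2), |∫ a in cyl t η, ρ a.1 a.2 * u a.1 a.2 i * u a.1 a.2 2 *
      (a.2.2 * Dη a.1 a.2.1 j / η a.1 a.2.1 ^ 2)| ≤
      1 / 4 * (∫ a in cyl t η, ρ a.1 a.2 * u a.1 a.2 2 ^ 2 / η a.1 a.2.1) + C' := fun i j => by
    have := abs_integral_cyl_le hη htT (f := fun a => ρ a.1 a.2 * u a.1 a.2 i * u a.1 a.2 2 *
      (a.2.2 * Dη a.1 a.2.1 j / η a.1 a.2.1 ^ 2)) ik k0 ip p0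
      (α := 1 / 4) (β := 0) (by norm_num) le_rfl (δ := δ) hD hCδ
      (sl.mono fun s P => by simpa using (HC P).2.1 i j)
    simpa only [ENNReal.ofReal_zero, zero_mul, add_zero, zero_add] using this
  have f3 : ∀ (a b c d : Fin 3) (j : Fin 2), |∫ x in cyl t η, (Du x.1 x.2 a b + Du x.1 x.2 c d) *
      (x.2.2 * Dη x.1 x.2.1 j / η x.1 x.2.1 ^ 2)| ≤ C' := fun a b c d j => by
    have := abs_integral_cyl_le hη htT (f := fun x => (Du x.1 x.2 a b + Du x.1 x.2 c d) *
      (x.2.2 * Dη x.1 x.2.1 j / η x.1 x.2.1 ^ 2)) ik k0 ip p0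
      (α := 0) (β := 0) le_rfl le_rfl (δ := δ) hD hCδ
      (sl.mono fun s P => by simpa using (HC P).2.2.1 a b c d j)
    simpa only [ENNReal.ofReal_zero, zero_mul, add_zero, zero_add] using this
  have f4 : |∫ a in cyl t η, (u a.1 a.2 0 * (Dη a.1 a.2.1 0 / η a.1 a.2.1 ^ 2)
      + u a.1 a.2 1 * (Dη a.1 a.2.1 1 / η a.1 a.2.1 ^ 2))| ≤ C' := by
    have := abs_integral_cyl_le hη htT (f := fun a =>
      u a.1 a.2 0 * (Dη a.1 a.2.1 0 / η a.1 a.2.1 ^ 2)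
      + u a.1 a.2 1 * (Dη a.1 a.2.1 1 / η a.1 a.2.1 ^ 2)) ik k0 ip p0
      (α := 0) (β := 0) le_rfl le_rfl (δ := δ) hD hCδ
      (sl.mono fun s P => by simpa using (HC P).2.2.2)
    simpa only [ENNReal.ofReal_zero, zero_mul, add_zero, zero_add] using this
  have f4' : (lam - 2 * μ / 3) * (∫ a in cyl t η, (u a.1 a.2 0 * (Dη a.1 a.2.1 0 / η a.1 a.2.1 ^ 2)
      + u a.1 a.2 1 * (Dη a.1 a.2.1 1 / η a.1 a.2.1 ^ 2))) ≤ |lam - 2 * μ / 3| * C' :=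
    (le_abs_self _).trans ((abs_mul _ _).trans_le (mul_le_mul_of_nonneg_left f4 (abs_nonneg _)))
  have f30 := mul_le_mul_of_nonneg_left (neg_le_of_abs_le (f3 0 2 2 0 0)) hμ.le
  have f31 := mul_le_mul_of_nonneg_left (neg_le_of_abs_le (f3 1 2 2 1 1)) hμ.le
  have f20 := le_of_abs_le (f2 0 0)
  have f21 := le_of_abs_le (f2 1 1)
  have f1' : _ ≤ _ + _ + C' := le_of_abs_le f1
  have mom : ∫ q in dom (η t), ρ t q * u t q 2 * (q.2 / η t q.1) ≤
      M * V + (γ - 1) * E + 2 * E := by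
    have : ∫ q in dom (η t), ρ t q * u t q 2 * (q.2 / η t q.1) ≤ M * V + _ + _ :=
      R.integral_momentum_le (by linarith) P.le
    linarith
  have vel : ∫ p, dη t p ≤ V + 2 * E := by
    have : ∫ p, dη t p ≤ V + _ := R.integral_velocity_le
    linarith
  -- Only an upper bound of the logarithm is needed, and log η ≤ η ≤ M provides it; its lower bound
  -- would degenerate at contact.
  have lg : c * (∫ p, Real.log (η t p)) ≤ c * (M * V) := by
    refine mul_le_mul_of_nonneg_left ?_ c0
    refine (integral_mono (S.log_η t ⟨ht0.le, htT⟩) (integrable_const M) fun p => ?_).trans_eq ?_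
    · exact (Real.log_le_self (P.nonneg p)).trans (P.le p)
    · rw [integral_const, smul_eq_mul, mul_comm]
  have fc : ∫ a in cylT t, F a.2 = t * ∫ p, F p := by
    rw [restrict_cylT, integral_fun_snd, measureReal_restrict_apply_univ, Real.volume_real_Ioo,
      sub_zero, max_eq_left ht0.le, smul_eq_mul]
  have pn : 0 ≤ ∫ a in cyl t η, ρ a.1 a.2 ^ γ / η a.1 a.2.1 := integral_nonneg_of_ae p0
  have kn : 0 ≤ ∫ a in cyl t η, ρ a.1 a.2 * u a.1 a.2 2 ^ 2 / η a.1 a.2.1 :=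
    integral_nonneg_of_ae k0
  simp only [fc] at ct
  -- Absorption: the right side uses 3 · 1/4 of the kinetic term and 1/3 of the pressure term, both
  -- of which are nonnegative and appear on the left with coefficient 1.
  have main : t * (∫ p, F p) ≤ A := by
    have lg' := lg
    simp only [A, c] at lg' ⊢
    linarith
  have F1 : 0 ≤ ∫ p, F p := integral_nonneg F0
  refine le_max_of_le_left ?_
  have : T / 2 * (∫ p, F p) ≤ A := (mul_le_mul_of_nonneg_right ht.1.le F1).trans main
  calc ∫ p, F p = T / 2 * (∫ p, F p) * (2 / T) := by field_simp
    _ ≤ _ := by gcongr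

end Contact

end FluidPlate

/-! ### Choice of the force -/

theorem theorem3 (L₁ L₂ : ℝ) [Fact (0 < L₁)] [Fact (0 < L₂)]
    (γ μ lam : ℝ) (hγ : 3 < γ) (hμ : 0 < μ) (hlam : 0 ≤ lam)
    (d : FluidPlate.InitialData L₁ L₂) (hd : d.Admissible γ)
    (p₀ : FluidPlate.Torus L₁ L₂) (hp₀ : d.η₀ p₀ = 0)
    (T : ℝ) (hT : 0 < T) (r : ℝ) (hr : 0 < r) :
    ∃ F : FluidPlate.Torus L₁ L₂ → ℝ,
      MeasureTheory.Integrable F ∧ (∃ M : ℝ, ∀ p, F p ≤ M) ∧ (∀ p, 0 ≤ F p) ∧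
      Function.support F ⊆ Metric.ball p₀ r ∧
      ∀ (ρ : ℝ → FluidPlate.Space L₁ L₂ → ℝ) (u : ℝ → FluidPlate.Space L₁ L₂ → Fin 3 → ℝ)
        (η : ℝ → FluidPlate.Torus L₁ L₂ → ℝ),
        FluidPlate.IsWeakSolution γ μ lam T d (fun _ => F) ρ u η →
        ∃ t ∈ Set.Ioo 0 T, 0 < η t p₀ := by
  open FluidPlate in
  have hL₁ : 0 < L₁ := Fact.out
  have hL₂ : 0 < L₂ := Fact.out
  obtain ⟨Dh, D2h, hH2⟩ := hd.η₀_H2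
  obtain ⟨B, hB⟩ := exists_force_bound L₁ L₂ hγ hμ hlam hT d (2 * (initialEnergy γ d D2h + 1))
  -- The mass of the force, chosen above the bound B, which does not depend on the force.
  set K := |B| + 1
  have K0 : 0 < K := by positivity
  have H0 := holderConst_pos (L₁ := L₁) (L₂ := L₂)
  -- The width meets three demands: the support stays in the ball, the work is absorbed by the
  -- bending energy (4 K² ε · `holderConst` ≤ 1), and the square is no wider than the Hölder
  -- estimate allows.
  set ε := min (min r (1 / (4 * K ^ 2 * holderConst L₁ L₂))) (min L₁ L₂)
  have ε0 : 0 < ε := by positivity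
  have ε1 : ε ≤ 1 / (4 * K ^ 2 * holderConst L₁ L₂) := (min_le_left _ _).trans (min_le_right _ _)
  obtain ⟨k, hk⟩ := exists_isMollifier (L₁ := L₁) (L₂ := L₂) ε0
  have smooth : IsCkT ∞ fun p => K * k (p₀ - p) :=
    contDiff_const.mul (hk.smooth.comp_sub_left p₀)
  have F0 : ∀ p, 0 ≤ K * k (p₀ - p) := fun p => mul_nonneg K0.le (hk.nonneg _)
  have mass : ∫ p, K * k (p₀ - p) = K := by
    rw [integral_const_mul, integral_sub_left, hk.integral_eq, mul_one]
  have supp : ∀ p, K * k (p₀ - p) ≠ 0 →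
      ∃ a : ℝ × ℝ, |a.1| < ε ∧ |a.2| < ε ∧ p = p₀ + projT a := fun p hp => by
    obtain ⟨a, h1, h2, h3⟩ := hk.supp _ (right_ne_zero_of_mul hp)
    refine ⟨-a, by simpa using h1, by simpa using h2, ?_⟩
    have : projT (-a) = -(projT a : Torus L₁ L₂) := by simp [projT]
    rw [this, ← h3]
    abel
  refine ⟨fun p => K * k (p₀ - p), Torus.integrable smooth.continuous, ?_, F0, fun p hp => ?_,
    fun ρ u η ⟨Du, dη, Dη, D2η, Dη₀, D2η₀, S⟩ => ?_⟩
  · obtain ⟨C, hC⟩ := exists_bound smooth.continuous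
    exact ⟨C, fun p => (le_abs_self _).trans (hC p)⟩
  · obtain ⟨a, h1, h2, rfl⟩ := supp p hp
    rw [Metric.mem_ball, dist_eq_norm, add_sub_cancel_left]
    exact (norm_projT_lt h1 h2).trans_le ((min_le_left _ _).trans (min_le_left _ _))
  -- The negation gives η(t, p₀) ≤ 0 on (0, T). With nonnegativity this is permanent contact, and
  -- then K ≤ B, which is absurd.
  · by_contra! hcon
    have := hB S (by rw [initialEnergy_congr hd.v₀_L2 hH2 S.η₀_H2]) smooth F0 ε0.le
      ((min_le_right _ _).trans (min_le_left _ _)) ((min_le_right _ _).trans (min_le_right _ _))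
      supp (by
        rw [mass, ← mul_assoc, mul_right_comm]
        exact (le_div_iff₀' (by positivity)).1 ε1)
      fun t ht => le_antisymm (hcon t ht) (forall_nonneg_of_ae_pos
        (continuous_of_continuousOn_time S.η_continuous (Ioo_subset_Icc_self ht))
        (S.η_pos t (Ioo_subset_Icc_self ht)) p₀)
    rw [mass] at this
    linarith [le_abs_self B]
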